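/- Let $\mathbb I=\mathbb R/\mathbb Z$, $T>0$, $d>0$, $\alpha\in(0,1]$, and write $|\cdot|_0$ for the $L^2(\mathbb I)$ norm and $|u|_1=|u_\rho|_0$; $(\cdot)^\perp$ is counter-clockwise rotation by $\pi/2$. **Assumptions.** Let $f\in C^1(\mathbb R)$, $g\in C^1(\mathbb R\times\mathbb R)$, and suppose that for every $L>0$ there is $C_L\ge 0$ with $|g(v_1,z)-g(v_2,z)|\le C_L|v_1-v_2|$ for all $v_1,v_2\in\mathbb R$ and $|z|\le L$. Let $\vec x:\mathbb I\times[0,T]\to\mathbb R^2$ and $w:\mathbb I\times[0,T]\to\mathbb R$ be continuous with $$\vec x\in W^{1,\infty}(0,T;[H^2(\mathbb I)]^2)\cap H^2(0,T;[H^1(\mathbb I)]^2)\cap W^{2,\infty}(0,T;[L^2(\mathbb I)]^2),$$ $$w\in C([0,T];H^2(\mathbb I))\cap W^{1,\infty}(0,T;H^1(\mathbb I))\cap H^2(0,T;L^2(\mathbb I)),$$ and $0<m\le|\vec x_\rho|\le M$ on $\mathbb I\times[0,T]$ for some constants $m,M$. Put $\vec\tau=\vec x_\rho/|\vec x_\rho|$,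 $\vec\nu=\vec\tau^\perp$, $v=\vec x_t\cdot\vec\nu$ and $\kappa=|\vec x_\rho|^{-1}\vec\tau_\rho\cdot\vec\nu$. Suppose that for all $t\in(0,T]$ and almost all $\rho\in\mathbb I$ $$\alpha\,\vec x_t+(1-\alpha)(\vec x_t\cdot\vec\nu)\,\vec\nu=\frac{\vec x_{\rho\rho}}{|\vec x_\rho|^2}+f(w)\,\vec\nu,$$ $$w_t-(\vec x_t\cdot\vec\tau)\frac{w_\rho}{|\vec x_\rho|}-\frac{d}{|\vec x_\rho|}\Bigl(\frac{w_\rho}{|\vec x_\rho|}\Bigr)_\rho-\kappa\,v\,w=g(v,w).$$ **Scheme.** Decompose $\mathbb I$ into intervals $\sigma_j=(\rho_{j-1},\rho_j)$, $j=1,\dots,J$, with $\rho_J=\rho_0+1$, $h_j=\rho_j-\rho_{j-1}$ and $h=\max_jh_j$. Let $V^h$ be the space of continuous functions on $\mathbb I$ that are affine on each $\sigma_j$, $I^h:C(\mathbb I)\to V^h$ Lagrange interpolation at the nodes (applied componentwise to vectors), $I^h_j$ its restriction to $\overline{\sigma_j}$, $(\cdot,\cdot)$ the $L^2(\mathbb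 I)$ inner product, and $(\eta_1,\eta_2)^h=\sum_j\int_{\sigma_j}I^h_j(\eta_1\cdot\eta_2)\,d\rho$ for functions that are continuous on each $\overline{\sigma_j}$. Let $0=t_0<\dots<t_N=T$, $\Delta t_n=t_n-t_{n-1}$, $\Delta t=\max_n\Delta t_n$ and $D_ta^n=(a^n-a^{n-1})/\Delta t_n$. For $\vec X^n\in[V^h]^2$ put $\vec{\mathcal T}^n=\vec X^n_\rho/|\vec X^n_\rho|$ and $\vec{\mathcal V}^n=(\vec{\mathcal T}^n)^\perp$ on each $\sigma_j$. The discrete problem starts from $\vec X^0=I^h\vec x(\cdot,0)$, $W^0=I^hw(\cdot,0)$ and asks, for $n=1,\dots,N$, for $\vec X^n\in[V^h]^2$ such that for all $\vec\xi\in[V^h]^2$ $$\bigl(|\vec X^{n-1}_\rho|^2[\alpha D_t\vec X^n+(1-\alpha)(D_t\vec X^n\cdot\vec{\mathcal V}^{n-1})\vec{\mathcal V}^{n-1}],\vec\xi\bigr)^h+(\vec X^n_\rho,\vec\xi_\rho)=\bigl(|\vec X^{n-1}_\rho|^2f(W^{n-1})\vec{\mathcal V}^{n-1},\vec\xi\bigr)^h,$$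 and then, with $V^n=D_t\vec X^n\cdot\vec{\mathcal V}^n$ and $\Psi^n=D_t\vec X^n\cdot\vec{\mathcal T}^n$, for $W^n\in V^h$ such that for all $\eta\in V^h$ $$D_t\bigl[(|\vec X^n_\rho|W^n,\eta)^h\bigr]+d\Bigl(\frac{W^n_\rho}{|\vec X^n_\rho|},\eta_\rho\Bigr)+(\Psi^nW^n,\eta_\rho)^h=\bigl(|\vec X^n_\rho|\,g(V^n,W^{n-1}),\eta\bigr)^h.$$ **Theorem.** For all constants $C_1,C_2$ there are $h^\star>0$ and $C$, independent of the partitions, such that for all partitions with $h\le C_1h_j$ for all $j$, $h\le h^\star$ and $\Delta t\le C_2h$ the following holds. The discrete problem has a unique solution $(\vec X^n,W^n)$, $n=0,\dots,N$; each of its linear systems is uniquely solvable, with $\vec X^n_\rho\ne0$ on every $\sigma_j$ for all $n=0,\dots,N$; and, with $\vec x^n=\vec x(\cdot,t_n)$, $w^n=w(\cdot,t_n)$, $\vec x^n_t=\vec x_t(\cdot,t_n)$, $$\sup_{n=0,\dots,N}\bigl[|\vec x^n-\vec X^n|_1^2+|w^n-W^n|_0^2\bigr]+\sum_{n=1}^N\Delta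 t_n\bigl[|\vec x^n_t-D_t\vec X^n|_0^2+|w^n-W^n|_1^2\bigr]\le C\,h^2.$$ -/

import Mathlib

open MeasureTheory Set
open scoped ContDiff ENNReal RealInnerProductSpace

noncomputable section

namespace CurveRD

/-- The Euclidean plane. -/
abbrev Plane : Type := EuclideanSpace ℝ (Fin 2)

/-- Counter-clockwise rotation by `π / 2`. -/
def perp (p : Plane) : Plane := !₂[-(p 1), p 0]

/-! ### Sobolev spaces on the periodic unit interval

Functions on the periodic unit interval are `1`-periodic functions of `ρ : ℝ`; integrals are taken
over one period. -/

/-- Lebesgue measure on one period. -/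
abbrev periodMeasure : Measure ℝ := volume.restrict (Ioc 0 1)

/-- `L²` of the periodic unit interval, with values in `E`. -/
abbrev L2Per (E : Type*) [NormedAddCommGroup E] : Type _ := Lp E 2 periodMeasure

section Sobolev

variable {E : Type*} [NormedAddCommGroup E] [NormedSpace ℝ E]

/-- `v` is the weak derivative of `u` on the periodic unit interval. -/
def IsPerWeakDeriv (u v : L2Per E) : Prop :=
  ∀ φ : ℝ → ℝ, ContDiff ℝ ∞ φ → Function.Periodic φ 1 →
    ∫ ρ, deriv φ ρ • u ρ ∂periodMeasure = -∫ ρ, φ ρ • v ρ ∂periodMeasure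

lemma integrable_smul_L2Per {φ : ℝ → ℝ} (hφ : Continuous φ) (u : L2Per E) :
    Integrable (fun ρ => φ ρ • u ρ) periodMeasure := by
  obtain ⟨C, hC⟩ := (isCompact_Icc (a := (0 : ℝ)) (b := 1)).exists_bound_of_continuousOn
    hφ.continuousOn
  refine Integrable.bdd_smul ((Lp.memLp u).integrable (by norm_num)) C
    hφ.aestronglyMeasurable ?_
  filter_upwards [ae_restrict_mem measurableSet_Ioc] with ρ hρ
  exact hC ρ (Ioc_subset_Icc_self hρ)

/-- Integration of an `L²` function against a continuous weight. -/
def weightedIntegral (φ : ℝ → ℝ) (hφ : Continuous φ) : L2Per E →ₗ[ℝ] E where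
  toFun u := ∫ ρ, φ ρ • u ρ ∂periodMeasure
  map_add' u v := by
    rw [← integral_add (integrable_smul_L2Per hφ u) (integrable_smul_L2Per hφ v)]
    refine integral_congr_ae ?_
    filter_upwards [Lp.coeFn_add u v] with ρ hρ
    rw [hρ, Pi.add_apply, smul_add]
  map_smul' c u := by
    rw [RingHom.id_apply, ← integral_smul]
    refine integral_congr_ae ?_
    filter_upwards [Lp.coeFn_smul c u] with ρ hρ
    rw [hρ, Pi.smul_apply, smul_comm]

lemma continuous_weightedIntegral (φ : ℝ → ℝ) (hφ : Continuous φ) :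
    Continuous (weightedIntegral (E := E) φ hφ) := by
  obtain ⟨C, hC⟩ := (isCompact_Icc (a := (0 : ℝ)) (b := 1)).exists_bound_of_continuousOn
    hφ.continuousOn
  have hC0 : 0 ≤ C := (norm_nonneg _).trans (hC 0 (by simp))
  refine AddMonoidHomClass.continuous_of_bound (weightedIntegral (E := E) φ hφ) C fun u => ?_
  have hu : Integrable (fun ρ => u ρ) periodMeasure := (Lp.memLp u).integrable (by norm_num)
  calc ‖∫ ρ, φ ρ • u ρ ∂periodMeasure‖
      ≤ ∫ ρ, C * ‖u ρ‖ ∂periodMeasure := by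
        refine norm_integral_le_of_norm_le (hu.norm.const_mul C) ?_
        filter_upwards [ae_restrict_mem measurableSet_Ioc] with ρ hρ
        rw [norm_smul]
        exact mul_le_mul_of_nonneg_right (hC ρ (Ioc_subset_Icc_self hρ)) (norm_nonneg _)
    _ = C * ∫ ρ, ‖u ρ‖ ∂periodMeasure := integral_const_mul _ _
    _ ≤ C * ‖u‖ := by
        refine mul_le_mul_of_nonneg_left ?_ hC0
        rw [integral_norm_eq_lintegral_enorm hu.aestronglyMeasurable, Lp.norm_def,
          ← eLpNorm_one_eq_lintegral_enorm]
        refine ENNReal.toReal_mono (Lp.eLpNorm_ne_top u) ?_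
        have : IsProbabilityMeasure periodMeasure := ⟨by simp⟩
        exact eLpNorm_le_eLpNorm_of_exponent_le (by norm_num) (Lp.aestronglyMeasurable u)

variable (E) in
/-- The Sobolev space `H^l` of the periodic unit interval, with values in `E`. An element is the
tuple `(u, u', …, u^(l))` of its weak derivatives, and its norm is the root of the sum of the squares
of their `L²` norms. -/
def HPer (l : ℕ) : Submodule ℝ (PiLp 2 fun _ : Fin (l + 1) => L2Per E) where
  carrier := {U | ∀ i : Fin l, IsPerWeakDeriv (U i.castSucc) (U i.succ)}
  add_mem' {U V} hU hV i φ hφ hp := by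
    have h1 := (weightedIntegral (E := E) _ (hφ.continuous_deriv (by simp))).map_add
      (U i.castSucc) (V i.castSucc)
    have h2 := (weightedIntegral (E := E) _ hφ.continuous).map_add (U i.succ) (V i.succ)
    have h3 := hU i φ hφ hp
    have h4 := hV i φ hφ hp
    simp only [weightedIntegral, LinearMap.coe_mk, AddHom.coe_mk] at h1 h2
    simp only [PiLp.add_apply]
    rw [h1, h2, h3, h4, neg_add]
  zero_mem' i φ hφ hp := by
    have h1 := (weightedIntegral (E := E) _ (hφ.continuous_deriv (by simp))).map_zero
    have h2 := (weightedIntegral (E := E) _ hφ.continuous).map_zero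
    simp only [weightedIntegral, LinearMap.coe_mk, AddHom.coe_mk] at h1 h2
    simp only [PiLp.zero_apply]
    rw [h1, h2, neg_zero]
  smul_mem' c U hU i φ hφ hp := by
    have h1 := (weightedIntegral (E := E) _ (hφ.continuous_deriv (by simp))).map_smul c
      (U i.castSucc)
    have h2 := (weightedIntegral (E := E) _ hφ.continuous).map_smul c (U i.succ)
    have h3 := hU i φ hφ hp
    simp only [weightedIntegral, LinearMap.coe_mk, AddHom.coe_mk] at h1 h2
    simp only [PiLp.smul_apply]
    rw [h1, h2, h3, smul_neg]

lemma isClosed_HPer (l : ℕ) :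
    IsClosed (HPer E l : Set (PiLp 2 fun _ : Fin (l + 1) => L2Per E)) := by
  have : (HPer E l : Set (PiLp 2 fun _ : Fin (l + 1) => L2Per E)) =
      ⋂ (i : Fin l) (φ : ℝ → ℝ) (hφ : ContDiff ℝ ∞ φ) (_ : Function.Periodic φ 1),
        {U | weightedIntegral (E := E) _ (hφ.continuous_deriv (by simp)) (U i.castSucc) =
          -weightedIntegral (E := E) _ hφ.continuous (U i.succ)} := by
    ext U
    simp only [mem_iInter, mem_ofPred_eq]
    rfl
  rw [this]
  refine isClosed_iInter fun i => isClosed_iInter fun φ => isClosed_iInter fun hφ =>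
    isClosed_iInter fun _ => isClosed_eq ?_ ?_
  · exact (continuous_weightedIntegral _ _).comp (PiLp.continuous_apply 2 _ i.castSucc)
  · exact ((continuous_weightedIntegral φ hφ.continuous).comp
      (PiLp.continuous_apply 2 (fun _ : Fin (l + 1) => L2Per E) i.succ)).neg

instance instCompleteSpaceHPer [CompleteSpace E] (l : ℕ) : CompleteSpace (HPer E l) :=
  (isClosed_HPer l).completeSpace_coe

/-- The function `u : ℝ → E` is a representative of the element `U` of `H^l`. -/
def Represents {l : ℕ} (U : HPer E l) (u : ℝ → E) : Prop :=
  (U : PiLp 2 fun _ : Fin (l + 1) => L2Per E) 0 =ᵐ[periodMeasure] u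

end Sobolev

section Bochner

variable {B : Type*} [NormedAddCommGroup B] [NormedSpace ℝ B]

/-- `v` is the weak derivative of the `B`-valued function `u` on `(0, T)`. -/
def IsWeakTimeDeriv (T : ℝ) (u v : ℝ → B) : Prop :=
  ∀ φ : ℝ → ℝ, ContDiff ℝ ∞ φ → HasCompactSupport φ → tsupport φ ⊆ Ioo 0 T →
    ∫ t in Ioo 0 T, deriv φ t • u t = -∫ t in Ioo 0 T, φ t • v t

/-- `u ∈ W^{k,p}(0, T; B)`. -/
def MemWTime (T : ℝ) (p : ℝ≥0∞) : ℕ → (ℝ → B) → Prop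
  | 0, u => MemLp u p (volume.restrict (Ioo 0 T))
  | k + 1, u => MemLp u p (volume.restrict (Ioo 0 T)) ∧
      ∃ v : ℝ → B, IsWeakTimeDeriv T u v ∧ MemWTime T p k v

end Bochner

section SpaceTime

variable {E : Type*} [NormedAddCommGroup E] [NormedSpace ℝ E]

/-- `u ∈ W^{k,p}(0, T; H^l)` for a function `u t ρ` of time and space. -/
def MemWH (T : ℝ) (k : ℕ) (p : ℝ≥0∞) (l : ℕ) (u : ℝ → ℝ → E) : Prop :=
  ∃ U : ℝ → HPer E l,
    (∀ᵐ t ∂(volume.restrict (Ioo 0 T)), Represents (U t) (u t)) ∧ MemWTime T p k U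

/-- `u ∈ C([0, T]; H^l)` for a function `u t ρ` of time and space. -/
def MemCH (T : ℝ) (l : ℕ) (u : ℝ → ℝ → E) : Prop :=
  ∃ U : ℝ → HPer E l,
    (∀ t ∈ Icc 0 T, Represents (U t) (u t)) ∧ ContinuousOn U (Icc 0 T)

/-- The time derivative of `u t ρ` on `[0, T]`, one-sided at the end points. -/
def timeDeriv (T : ℝ) (u : ℝ → ℝ → E) (t ρ : ℝ) : E :=
  derivWithin (fun s => u s ρ) (Icc 0 T) t

/-- The square of the `L²` norm over one period. -/
def normSq (u : ℝ → E) : ℝ := ∫ ρ in (0 : ℝ)..1, ‖u ρ‖ ^ 2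

/-- The square of the `H¹` seminorm over one period. -/
def seminormSq (u : ℝ → E) : ℝ := ∫ ρ in (0 : ℝ)..1, ‖deriv u ρ‖ ^ 2

end SpaceTime

/-! ### Geometry of a parametrised closed curve and the evolution equations -/

/-- Unit tangent. -/
def tangent (y : ℝ → Plane) (ρ : ℝ) : Plane := ‖deriv y ρ‖⁻¹ • deriv y ρ

/-- Unit normal. -/
def normal (y : ℝ → Plane) (ρ : ℝ) : Plane := perp (tangent y ρ)

/-- Curvature: the component along the normal of the arclength derivative of the tangent. -/
def curvature (y : ℝ → Plane) (ρ : ℝ) : ℝ :=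
  ⟪‖deriv y ρ‖⁻¹ • deriv (tangent y) ρ, normal y ρ⟫

/-- Normal velocity on `[0, T]`. -/
def normalVel (T : ℝ) (x : ℝ → ℝ → Plane) (t ρ : ℝ) : ℝ :=
  ⟪timeDeriv T x t ρ, normal (x t) ρ⟫

/-- Tangential velocity on `[0, T]`. -/
def tangentialVel (T : ℝ) (x : ℝ → ℝ → Plane) (t ρ : ℝ) : ℝ :=
  ⟪timeDeriv T x t ρ, tangent (x t) ρ⟫

/-- `α x_t + (1 - α) (x_t · ν) ν = x_ρρ / |x_ρ|² + f(w) ν`, for all `t ∈ (0, T]` and almost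
all `ρ`. -/
def SolvesCurveEq (T α : ℝ) (f : ℝ → ℝ) (x : ℝ → ℝ → Plane) (w : ℝ → ℝ → ℝ) : Prop :=
  ∀ t ∈ Ioc 0 T, ∀ᵐ ρ : ℝ,
    α • timeDeriv T x t ρ + ((1 - α) * normalVel T x t ρ) • normal (x t) ρ =
      (‖deriv (x t) ρ‖ ^ 2)⁻¹ • deriv (deriv (x t)) ρ + f (w t ρ) • normal (x t) ρ

/-- `w_t - (x_t · τ) w_ρ / |x_ρ| - (d / |x_ρ|) (w_ρ / |x_ρ|)_ρ - κ v w = g(v, w)`, for all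
`t ∈ (0, T]` and almost all `ρ`. -/
def SolvesScalarEq (T d : ℝ) (g : ℝ → ℝ → ℝ) (x : ℝ → ℝ → Plane) (w : ℝ → ℝ → ℝ) : Prop :=
  ∀ t ∈ Ioc 0 T, ∀ᵐ ρ : ℝ,
    timeDeriv T w t ρ - tangentialVel T x t ρ * (1 / ‖deriv (x t) ρ‖) * deriv (w t) ρ
        - d / ‖deriv (x t) ρ‖ * deriv (fun r => deriv (w t) r / ‖deriv (x t) r‖) ρ
        - curvature (x t) ρ * normalVel T x t ρ * w t ρ =
      g (normalVel T x t ρ) (w t ρ)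

/-! ### Partitions and finite elements -/

/-- A partition `a = node 0 < node 1 < ⋯ < node count = b`. -/
structure Partition (a b : ℝ) where
  count : ℕ
  node : Fin (count + 1) → ℝ
  strictMono : StrictMono node
  first : node 0 = a
  last : node (Fin.last count) = b

namespace Partition

variable {a b : ℝ} (P : Partition a b)

/-- Left end point of the `j`-th subinterval. -/
def left (j : Fin P.count) : ℝ := P.node j.castSucc

/-- Right end point of the `j`-th subinterval. -/
def right (j : Fin P.count) : ℝ := P.node j.succ

/-- Length of the `j`-th subinterval. -/
def step (j : Fin P.count) : ℝ := P.right j - P.left j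

/-- The largest length of a subinterval. -/
def maxStep : ℝ := ⨆ j, P.step j

variable {E : Type*} [NormedAddCommGroup E] [NormedSpace ℝ E]

/-- The constant value, on the `j`-th subinterval, of the derivative of a function that is affine
there. -/
def grad (χ : ℝ → E) (j : Fin P.count) : E := (P.step j)⁻¹ • (χ (P.right j) - χ (P.left j))

/-- The affine interpolant of `η` at the end points of the `j`-th subinterval. -/
def localInterp (j : Fin P.count) (η : ℝ → E) (ρ : ℝ) : E :=
  η (P.left j) + (ρ - P.left j) • P.grad η j

/-- The integral of a piecewise continuous function. Such a function is given by the family `η` of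
its continuous extensions to the closed subintervals. -/
def integral (η : Fin P.count → ℝ → ℝ) : ℝ :=
  ∑ j, ∫ ρ in P.left j..P.right j, η j ρ

/-- The mass-lumped integral: `η` is replaced by its affine interpolant on each subinterval. With a
product of two piecewise continuous functions as the integrand this is the discrete inner product. -/
def lumped (η : Fin P.count → ℝ → ℝ) : ℝ :=
  ∑ j, ∫ ρ in P.left j..P.right j, P.localInterp j (η j) ρ

end Partition

section FiniteElements

variable {ρ₀ : ℝ} (P : Partition ρ₀ (ρ₀ + 1))
variable {E : Type*} [NormedAddCommGroup E] [NormedSpace ℝ E]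

/-- `χ` is a continuous piecewise affine function on the periodic unit interval, decomposed by the
partition `P` of one period. -/
def IsFE (χ : ℝ → E) : Prop :=
  Continuous χ ∧ Function.Periodic χ 1 ∧
    ∀ j, ∃ a b : E, ∀ ρ ∈ Ioo (P.left j) (P.right j), χ ρ = a + ρ • b

/-- `χ` is the Lagrange interpolant of `η`. -/
def IsInterp (η χ : ℝ → E) : Prop :=
  IsFE P χ ∧ ∀ i, χ (P.node i) = η (P.node i)

/-- The difference quotient `(u - uOld) / Δt`. -/
def diffQuot (Δt : ℝ) (uOld u : ℝ → E) (ρ : ℝ) : E := Δt⁻¹ • (u ρ - uOld ρ)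

/-- Discrete unit tangent on the `j`-th element. -/
def discTangent (X : ℝ → Plane) (j : Fin P.count) : Plane := ‖P.grad X j‖⁻¹ • P.grad X j

/-- Discrete unit normal on the `j`-th element. -/
def discNormal (X : ℝ → Plane) (j : Fin P.count) : Plane := perp (discTangent P X j)

/-- The linear system for the new curve `X`, given the old curve `XOld` and the old scalar
`WOld`. -/
def CurveStep (α : ℝ) (f : ℝ → ℝ) (Δt : ℝ) (XOld : ℝ → Plane) (WOld : ℝ → ℝ)
    (X : ℝ → Plane) : Prop :=
  ∀ ξ : ℝ → Plane, IsFE P ξ →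
    P.lumped (fun j ρ =>
        ⟪‖P.grad XOld j‖ ^ 2 • (α • diffQuot Δt XOld X ρ
          + ((1 - α) * ⟪diffQuot Δt XOld X ρ, discNormal P XOld j⟫) • discNormal P XOld j), ξ ρ⟫)
      + P.integral (fun j _ => ⟪P.grad X j, P.grad ξ j⟫)
    = P.lumped (fun j ρ => ⟪(‖P.grad XOld j‖ ^ 2 * f (WOld ρ)) • discNormal P XOld j, ξ ρ⟫)

/-- The linear system for the new scalar `W`, given the old and the new curve `XOld`, `X` and the
old scalar `WOld`. -/
def ScalarStep (d : ℝ) (g : ℝ → ℝ → ℝ) (Δt : ℝ) (XOld X : ℝ → Plane) (WOld W : ℝ → ℝ) : Prop :=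
  ∀ η : ℝ → ℝ, IsFE P η →
    (P.lumped (fun j ρ => ‖P.grad X j‖ * W ρ * η ρ)
        - P.lumped (fun j ρ => ‖P.grad XOld j‖ * WOld ρ * η ρ)) / Δt
      + d * P.integral (fun j _ => P.grad W j / ‖P.grad X j‖ * P.grad η j)
      + P.lumped (fun j ρ => ⟪diffQuot Δt XOld X ρ, discTangent P X j⟫ * W ρ * P.grad η j)
    = P.lumped (fun j ρ =>
        ‖P.grad X j‖ * g ⟪diffQuot Δt XOld X ρ, discNormal P X j⟫ (WOld ρ) * η ρ)

/-- `(X n, W n)`, `n = 0, …, N`, solve the fully discrete problem on the spatial partition `P` and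
the time partition `S`, with the interpolants of `x₀` and `w₀` as initial data. -/
structure IsDiscreteSolution {T : ℝ} (S : Partition 0 T) (α d : ℝ) (f : ℝ → ℝ) (g : ℝ → ℝ → ℝ)
    (x₀ : ℝ → Plane) (w₀ : ℝ → ℝ)
    (X : Fin (S.count + 1) → ℝ → Plane) (W : Fin (S.count + 1) → ℝ → ℝ) : Prop where
  fe_X : ∀ n, IsFE P (X n)
  fe_W : ∀ n, IsFE P (W n)
  init_X : IsInterp P x₀ (X 0)
  init_W : IsInterp P w₀ (W 0)
  curve : ∀ n : Fin S.count,
    CurveStep P α f (S.step n) (X n.castSucc) (W n.castSucc) (X n.succ)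
  scalar : ∀ n : Fin S.count,
    ScalarStep P d g (S.step n) (X n.castSucc) (X n.succ) (W n.castSucc) (W n.succ)

end FiniteElements

end CurveRD

end

open MeasureTheory Set
open scoped ContDiff ENNReal RealInnerProductSpace

set_option linter.unusedSectionVars false

noncomputable section

/-! The theorem is an energy estimate for the nodal errors e = x - X and z = w - W, propagated from
one time step to the next under a smallness hypothesis that the estimate itself restores.

Regularity. The Sobolev-Bochner assumptions are converted into pointwise statements with one
constant K and one monotone function G (`Reg`, `exists_reg`). G is a running time integral of the
squared norms of x_tt and w_tt. Hence (t - s)(G t - G s) bounds the squared error of a difference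
quotient over [s, t], and these errors can be summed over the time grid by telescoping, although
x_tt and w_tt need not be bounded in the norms used. The curve equation bounds x_ρρ and the scalar
equation bounds w_ρρ, so x_ρ and w_ρ are Lipschitz in ρ and the spatial consistency errors are of
first order.

Curve (`exists_curve_estimate`). The error equation is tested with D_t e. Since α > 0 the mobility
matrix is positive definite, which controls |D_t e|². The implicit stiffness term yields the
increment of |e_ρ|² and, in addition, the numerical dissipation Δt² |D_t e_ρ|².

Scalar (`exists_scalar_estimate`). The scheme is tested with z. The difficulty is that the mass
matrix moves with the curve: the rate of change of |X_ρ| contains the tangential part of D_t e_ρ,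
and the curve estimate bounds D_t e but not its derivative. Summation by parts on the closed polygon
(`Partition.sum_by_parts`) moves the difference onto ζ = w z - z²/2, with w at the old time level,
and onto the jumps of the discrete tangent. By the curve scheme at a node (`CurveStep.jump`) these
jumps are of size h (1 + |D_t X|) (`exists_tangent_jump`). The second order remainder in the length
element costs Δt |D_t e_ρ|², which is what the numerical dissipation pays for. Terms quadratic in
D_t e carry a factor 1 + Z², where Z bounds the nodal values of z.

Closing the argument. The energy is Λ |e_ρ|² plus the lumped integral of |X_ρ| z², with Λ so large
that the velocity terms of the scalar estimate are absorbed by the dissipation of the curve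
estimate. If this energy is at most δ h, the inverse inequalities of the quasi-uniform mesh keep
|X_ρ| between 1/(2K) and 2K, make both linear systems uniquely solvable, and give |z| ≤ 1 by a
bootstrap (`exists_one_step`). The discrete Gronwall argument then bounds the energy by B h², which
is at most δ h for small h, so the hypothesis holds at the next step as well
(`exists_discrete_solution`). First order interpolation and difference quotient errors turn the
nodal estimates into the stated norms. -/

namespace CurveRD

/-! ### Functions with an integrable weak derivative are primitives. -/

section DuBoisReymond

variable {B : Type*} [NormedAddCommGroup B] [NormedSpace ℝ B] [CompleteSpace B]

/-- A compact subset of an open interval lies in a closed subinterval. -/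
lemma exists_Icc_of_isCompact_subset_Ioo {a b : ℝ} (hab : a < b) {s : Set ℝ} (hs : IsCompact s)
    (hsub : s ⊆ Ioo a b) : ∃ c e, a < c ∧ c ≤ e ∧ e < b ∧ s ⊆ Icc c e := by
  rcases s.eq_empty_or_nonempty with rfl | hne
  · exact ⟨(a + b) / 2, (a + b) / 2, by linarith, le_rfl, by linarith, empty_subset _⟩
  · obtain ⟨c, hc⟩ := hs.exists_isLeast hne
    obtain ⟨e, he⟩ := hs.exists_isGreatest hne
    exact ⟨c, e, (hsub hc.1).1, hc.2 he.1, (hsub he.1).2, fun y hy => ⟨hc.2 hy, he.2 hy⟩⟩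

/-- A smooth function with compact support in an interval and zero mean is the derivative of such a
function. -/
lemma exists_primitive_of_integral_eq_zero {T : ℝ} (hT : 0 < T) {χ : ℝ → ℝ} (hχ : ContDiff ℝ ∞ χ)
    (hc : HasCompactSupport χ) (hs : tsupport χ ⊆ Ioo 0 T) (h0 : ∫ t, χ t = 0) :
    ∃ φ : ℝ → ℝ, ContDiff ℝ ∞ φ ∧ HasCompactSupport φ ∧ tsupport φ ⊆ Ioo 0 T ∧ deriv φ = χ := by
  obtain ⟨c, e, hac, hce, heb, hsub⟩ := exists_Icc_of_isCompact_subset_Ioo hT hc hs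
  have hzero : ∀ t, t ∉ Icc c e → χ t = 0 := fun t ht => by
    by_contra h
    exact ht (hsub (subset_tsupport _ h))
  let φ : ℝ → ℝ := fun t => ∫ s in (0 : ℝ)..t, χ s
  have hder : ∀ t, HasDerivAt φ (χ t) t := fun t =>
    intervalIntegral.integral_hasDerivAt_right (hχ.continuous.intervalIntegrable _ _)
      (hχ.continuous.stronglyMeasurableAtFilter _ _) hχ.continuous.continuousAt
  have hd : deriv φ = χ := funext fun t => (hder t).deriv
  have hφ : ContDiff ℝ ∞ φ := by
    rw [contDiff_infty_iff_deriv, hd]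
    exact ⟨fun t => (hder t).differentiableAt, hχ⟩
  -- To the left of the support there is nothing to integrate; to the right the primitive equals the
  -- total integral, which is zero.
  have hvan : ∀ t, t ∉ Icc c e → φ t = 0 := by
    intro t ht
    rw [mem_Icc, not_and_or, not_le, not_le] at ht
    rcases ht with ht | ht
    · refine intervalIntegral.integral_zero_ae (.of_forall fun s hs => hzero s fun h => ?_)
      have h1 := hs.2
      have := h.1
      rcases le_max_iff.1 h1 with h2 | h2 <;> linarith
    · have : φ t = ∫ s, χ s := by
        refine intervalIntegral.integral_eq_integral_of_support_subset fun s hs => ?_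
        have : s ∈ Icc c e := by
          by_contra h
          exact hs (hzero s h)
        exact ⟨by linarith [this.1], by linarith [this.2]⟩
      rw [this, h0]
  have htsupp : tsupport φ ⊆ Icc c e := by
    refine closure_minimal (fun t ht => ?_) isClosed_Icc
    by_contra h
    exact ht (hvan t h)
  exact ⟨φ, hφ, isCompact_Icc.of_isClosed_subset (isClosed_tsupport _) htsupp,
    htsupp.trans fun t ht => ⟨by linarith [ht.1], by linarith [ht.2]⟩, hd⟩

lemma setIntegral_smul_eq_integral {B : Type*} [NormedAddCommGroup B] [NormedSpace ℝ B] {T : ℝ}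
    {φ : ℝ → ℝ} (hs : tsupport φ ⊆ Ioo 0 T)
    (u : ℝ → B) : ∫ t in Ioo 0 T, φ t • u t = ∫ t, φ t • u t := by
  refine setIntegral_eq_integral_of_forall_compl_eq_zero fun t ht => ?_
  rw [image_eq_zero_of_notMem_tsupport (fun h => ht (hs h)), zero_smul]

/-- Integration by parts against the primitive of an integrable function. -/
lemma integral_deriv_smul_primitive {T : ℝ} {v : ℝ → B}
    (hv : IntegrableOn v (Ioo 0 T)) {φ : ℝ → ℝ} (hφ : ContDiff ℝ ∞ φ)
    (hs : tsupport φ ⊆ Ioo 0 T) :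
    ∫ t in Ioo 0 T, deriv φ t • ∫ s in (0 : ℝ)..t, v s = -∫ t in Ioo 0 T, φ t • v t := by
  have hφ' : Continuous (deriv φ) := hφ.continuous_deriv (by simp)
  have hφi : IntegrableOn (deriv φ) (Ioo 0 T) :=
    (hφ'.integrableOn_Icc (a := 0) (b := T)).mono_set Ioo_subset_Icc_self
  -- Fubini on the triangle 0 < s < t < T, encoded by an indicator inside the square so that both
  -- iterated integrals run over `Ioo 0 T`.
  have hint : Integrable (Function.uncurry fun t s => (Ioo 0 t).indicator (fun s => deriv φ t • v s) s)
      ((volume.restrict (Ioo 0 T)).prod (volume.restrict (Ioo 0 T))) := by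
    have h1 := hφi.smul_prod hv
    have hm : MeasurableSet {p : ℝ × ℝ | p.2 ∈ Ioo 0 p.1} := by
      have : {p : ℝ × ℝ | p.2 ∈ Ioo 0 p.1} = {p | 0 < p.2} ∩ {p | p.2 < p.1} := rfl
      rw [this]
      exact (measurableSet_lt measurable_const measurable_snd).inter
        (measurableSet_lt measurable_snd measurable_fst)
    refine (h1.indicator hm).congr (.of_forall fun p => ?_)
    simp only [Function.uncurry, indicator, mem_ofPred_eq]
  have hsw := integral_integral_swap hint
  have hl : ∀ t ∈ Ioo 0 T, deriv φ t • ∫ s in (0 : ℝ)..t, v s =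
      ∫ s in Ioo 0 T, (Ioo 0 t).indicator (fun s => deriv φ t • v s) s := by
    intro t ht
    rw [setIntegral_indicator measurableSet_Ioo,
      inter_eq_right.2 (Ioo_subset_Ioo_right ht.2.le), integral_smul,
      intervalIntegral.integral_of_le ht.1.le, integral_Ioc_eq_integral_Ioo]
  have hr : ∀ s ∈ Ioo 0 T, ∫ t in Ioo 0 T, (Ioo 0 t).indicator (fun s => deriv φ t • v s) s =
      -(φ s • v s) := by
    intro s hs'
    have : ∀ t ∈ Ioo 0 T, (Ioo 0 t).indicator (fun s => deriv φ t • v s) s =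
        (Ioi s).indicator (fun t => deriv φ t • v s) t := by
      intro t _
      simp only [indicator, mem_Ioo, mem_Ioi, hs'.1, true_and]
    rw [setIntegral_congr_fun measurableSet_Ioo this, setIntegral_indicator measurableSet_Ioi]
    have h2 : Ioo 0 T ∩ Ioi s = Ioo s T := by
      ext t
      simp only [mem_inter_iff, mem_Ioo, mem_Ioi]
      exact ⟨fun h => ⟨h.2, h.1.2⟩, fun h => ⟨⟨hs'.1.trans h.1, h.2⟩, h.1⟩⟩
    have hT0 : φ T = 0 := image_eq_zero_of_notMem_tsupport fun h => (hs h).2.false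
    rw [h2, integral_smul_const, ← integral_Ioc_eq_integral_Ioo,
      ← intervalIntegral.integral_of_le hs'.2.le,
      intervalIntegral.integral_deriv_eq_sub
        (fun t _ => (hφ.differentiable (by simp)).differentiableAt)
        (hφ'.intervalIntegrable _ _), hT0, zero_sub, neg_smul]
  rw [setIntegral_congr_fun measurableSet_Ioo hl, hsw, setIntegral_congr_fun measurableSet_Ioo hr,
    integral_neg]

/-- A function with an integrable weak derivative is a primitive of it. -/
theorem IsWeakTimeDeriv.exists_eq_add_integral {T : ℝ} (hT : 0 < T) {u v : ℝ → B}
    (hu : IntegrableOn u (Ioo 0 T)) (hv : IntegrableOn v (Ioo 0 T)) (h : IsWeakTimeDeriv T u v) :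
    ∃ c : B, ∀ᵐ t ∂(volume.restrict (Ioo 0 T)), u t = c + ∫ s in (0 : ℝ)..t, v s := by
  set y : ℝ → B := fun t => u t - ∫ s in (0 : ℝ)..t, v s with hy
  have hvi : IntervalIntegrable v volume 0 T := by
    rw [intervalIntegrable_iff_integrableOn_Ioo_of_le hT.le]
    exact hv
  have hprim : IntegrableOn (fun t => ∫ s in (0 : ℝ)..t, v s) (Ioo 0 T) := by
    have := intervalIntegral.continuousOn_primitive_interval (f := v) (μ := volume) (a := 0) (b := T)
      (by rw [uIcc_of_le hT.le]; exact (integrableOn_Icc_iff_integrableOn_Ioo (by simp) (by simp)).2 hv)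
    rw [uIcc_of_le hT.le] at this
    exact (this.integrableOn_Icc).mono_set Ioo_subset_Icc_self
  have hyi : IntegrableOn y (Ioo 0 T) := hu.sub hprim
  have hmul : ∀ {φ : ℝ → ℝ} {z : ℝ → B}, Continuous φ → HasCompactSupport φ →
      IntegrableOn z (Ioo 0 T) → IntegrableOn (fun t => φ t • z t) (Ioo 0 T) := by
    intro φ z hφ hc hz
    obtain ⟨C, hC⟩ := hc.exists_bound_of_continuous hφ
    exact Integrable.bdd_smul hz C hφ.aestronglyMeasurable (.of_forall hC)
  -- The difference of `u` and the primitive of `v` has weak derivative zero; it remains to see that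
  -- such a function is constant.
  have hyz : ∀ φ : ℝ → ℝ, ContDiff ℝ ∞ φ → HasCompactSupport φ → tsupport φ ⊆ Ioo 0 T →
      ∫ t in Ioo 0 T, deriv φ t • y t = 0 := by
    intro φ hφ hc hs
    have h1 := h φ hφ hc hs
    have h2 := integral_deriv_smul_primitive hv hφ hs
    have hcd := hφ.continuous_deriv (n := ∞) (by simp)
    simp only [hy, smul_sub]
    rw [integral_sub (hmul hcd hc.deriv hu) (hmul hcd hc.deriv hprim), h1, h2, sub_self]
  -- a bump function of unit mass
  obtain ⟨φ₀, hφ₀, hc₀, hs₀, hm₀⟩ : ∃ φ : ℝ → ℝ, ContDiff ℝ ∞ φ ∧ HasCompactSupport φ ∧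
      tsupport φ ⊆ Ioo 0 T ∧ ∫ t, φ t = 1 := by
    let b : ContDiffBump (T / 2) := ⟨T / 8, T / 4, by linarith, by linarith⟩
    refine ⟨b.normed volume, b.contDiff_normed, b.hasCompactSupport_normed, ?_, b.integral_normed⟩
    rw [b.tsupport_normed_eq, Real.closedBall_eq_Icc]
    intro t ht
    have h1 := ht.1
    have h2 := ht.2
    simp only [b] at h1 h2
    exact ⟨by linarith, by linarith⟩
  refine ⟨∫ t in Ioo 0 T, φ₀ t • y t, ?_⟩
  set c := ∫ t in Ioo 0 T, φ₀ t • y t with hcdef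
  have hconst : IntegrableOn (fun _ : ℝ => c) (Ioo 0 T) := integrableOn_const (by simp) (by simp)
  have key := isOpen_Ioo.ae_eq_zero_of_integral_contDiff_smul_eq_zero (μ := volume)
    (f := fun t => y t - c) (U := Ioo 0 T) (hyi.sub hconst).locallyIntegrableOn ?_
  · rw [ae_restrict_iff' measurableSet_Ioo]
    filter_upwards [key] with t ht hmem
    have := ht hmem
    simp only [hy] at this
    rw [sub_eq_zero] at this
    rw [← this, sub_add_cancel]
  · intro ψ hψ hcψ hsψ
    rw [← setIntegral_smul_eq_integral hsψ]
    -- A general test function minus its mass times `φ₀` has zero mean, hence is the derivative of a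
    -- test function and is annihilated by `y`. So integrating `ψ` against `y` gives its mass times
    -- `c`, and `y - c` is orthogonal to all test functions.
    set a := ∫ t, ψ t with ha
    have hχ : ContDiff ℝ ∞ (fun t => ψ t - a * φ₀ t) := hψ.sub (contDiff_const.mul hφ₀)
    have hcχ : HasCompactSupport (fun t => ψ t - a * φ₀ t) := hcψ.sub hc₀.mul_left
    have hsχ : tsupport (fun t => ψ t - a * φ₀ t) ⊆ Ioo 0 T := by
      refine (tsupport_sub ψ (fun t => a * φ₀ t)).trans (union_subset hsψ ?_)
      exact (closure_mono (Function.support_mul_subset_right _ _)).trans hs₀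
    have hiψ : Integrable ψ := hψ.continuous.integrable_of_hasCompactSupport hcψ
    have hi₀ : Integrable φ₀ := hφ₀.continuous.integrable_of_hasCompactSupport hc₀
    obtain ⟨φ, hφ, hcφ, hsφ, hd⟩ := exists_primitive_of_integral_eq_zero hT hχ hcχ hsχ (by
      rw [integral_sub hiψ (hi₀.const_mul a), integral_const_mul, hm₀, mul_one, sub_self])
    have h3 := hyz φ hφ hcφ hsφ
    rw [hd] at h3
    simp only [sub_smul, mul_smul] at h3
    rw [integral_sub (hmul hψ.continuous hcψ hyi)
      (show Integrable (fun t => a • φ₀ t • y t) (volume.restrict (Ioo 0 T)) from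
        (hmul hφ₀.continuous hc₀ hyi).smul a),
      integral_smul, ← hcdef, sub_eq_zero] at h3
    simp only [smul_sub]
    rw [integral_sub (hmul hψ.continuous hcψ hyi) (hmul hψ.continuous hcψ hconst), h3,
      integral_smul_const, ha, sub_eq_zero]
    congr 1
    have := setIntegral_smul_eq_integral hsψ (fun _ : ℝ => (1 : ℝ))
    simp only [smul_eq_mul, mul_one] at this
    exact this.symm

end DuBoisReymond

/-! ### Continuous representatives of periodic Sobolev functions. -/

section PeriodicSobolev

variable {E : Type*} [NormedAddCommGroup E] [NormedSpace ℝ E]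

/-- The periodic extension of a smooth function with compact support in the open unit interval. -/
lemma contDiff_comp_fract {φ : ℝ → ℝ} (hφ : ContDiff ℝ ∞ φ) (hc : HasCompactSupport φ)
    (hs : tsupport φ ⊆ Ioo 0 1) : ContDiff ℝ ∞ (fun ρ => φ (Int.fract ρ)) := by
  obtain ⟨c, e, h0c, hce, he1, hsub⟩ := exists_Icc_of_isCompact_subset_Ioo one_pos hc hs
  have hzero : ∀ t, t ∉ Icc c e → φ t = 0 := fun t ht => by
    by_contra h
    exact ht (hsub (subset_tsupport _ h))
  rw [contDiff_iff_contDiffAt]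
  intro ρ₀
  have hev : (fun ρ => φ (Int.fract ρ)) =ᶠ[nhds ρ₀] fun ρ => φ (ρ - ⌊ρ₀⌋) := by
    -- On this neighbourhood the floor can drop by at most one. Where it does, the fractional part
    -- lies above `e`, beyond the support, and the unshifted argument is negative, so both sides
    -- vanish.
    have hopen : IsOpen {ρ : ℝ | -(1 - e) < ρ - ⌊ρ₀⌋ ∧ ρ - ⌊ρ₀⌋ < 1} :=
      (isOpen_lt continuous_const (continuous_id.sub continuous_const)).inter
        (isOpen_lt (continuous_id.sub continuous_const) continuous_const)
    have hmem : ρ₀ ∈ {ρ : ℝ | -(1 - e) < ρ - ⌊ρ₀⌋ ∧ ρ - ⌊ρ₀⌋ < 1} := by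
      constructor
      · linarith [Int.floor_le ρ₀]
      · linarith [Int.lt_floor_add_one ρ₀]
    filter_upwards [hopen.mem_nhds hmem] with ρ hρ
    by_cases h : 0 ≤ ρ - ⌊ρ₀⌋
    · have : ⌊ρ⌋ = ⌊ρ₀⌋ := by
        rw [Int.floor_eq_iff]
        exact ⟨by linarith, by linarith [hρ.2]⟩
      rw [Int.fract, this]
    · push Not at h
      have : ⌊ρ⌋ = ⌊ρ₀⌋ - 1 := by
        rw [Int.floor_eq_iff]
        push_cast
        exact ⟨by linarith [hρ.1], by linarith⟩
      rw [Int.fract, this, hzero (ρ - ⌊ρ₀⌋) (fun hh => by linarith [hh.1]), hzero]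
      intro hh
      have := hh.2
      push_cast at this
      linarith [hρ.1]
  exact ContDiffAt.congr_of_eventuallyEq (hφ.comp (contDiff_id.sub contDiff_const)).contDiffAt hev

lemma deriv_comp_fract {φ : ℝ → ℝ} {ρ : ℝ} (hρ : ρ ∈ Ioo (0 : ℝ) 1) :
    deriv (fun ρ => φ (Int.fract ρ)) ρ = deriv φ ρ := by
  refine Filter.EventuallyEq.deriv_eq ?_
  filter_upwards [isOpen_Ioo.mem_nhds hρ] with r hr
  rw [Int.fract_eq_self.2 ⟨hr.1.le, hr.2⟩]

/-- A test function supported inside the unit interval extends periodically through `Int.fract`, so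
the periodic notion of weak derivative contains the one on an interval and the du Bois-Reymond lemma
applies with T = 1. -/
lemma IsPerWeakDeriv.isWeakTimeDeriv {u v : L2Per E} (h : IsPerWeakDeriv u v) :
    IsWeakTimeDeriv 1 (u : ℝ → E) v := by
  intro φ hφ hc hs
  have h1 := h _ (contDiff_comp_fract hφ hc hs)
    (fun ρ => by simp only [Int.fract_add_one])
  rw [integral_Ioc_eq_integral_Ioo, integral_Ioc_eq_integral_Ioo] at h1
  have h2 : ∫ t in Ioo (0 : ℝ) 1, deriv (fun ρ => φ (Int.fract ρ)) t • u t =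
      ∫ t in Ioo (0 : ℝ) 1, deriv φ t • u t :=
    setIntegral_congr_fun measurableSet_Ioo fun t ht => by simp only [deriv_comp_fract ht]
  have h3 : ∫ t in Ioo (0 : ℝ) 1, φ (Int.fract t) • v t = ∫ t in Ioo (0 : ℝ) 1, φ t • v t :=
    setIntegral_congr_fun measurableSet_Ioo fun t ht => by
      simp only [Int.fract_eq_self.2 ⟨ht.1.le, ht.2⟩]
  rw [← h2, ← h3]
  exact h1

/-- Constants are admissible periodic test functions. This is the information lost on the open
interval, and it is what makes the primitive of the derivative periodic. -/
lemma IsPerWeakDeriv.integral_eq_zero {u v : L2Per E} (h : IsPerWeakDeriv u v) :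
    ∫ ρ, v ρ ∂periodMeasure = 0 := by
  have := h (fun _ => 1) contDiff_const (fun _ => rfl)
  simpa using this

/-- `u` is a periodic primitive of the periodic, square integrable function `u'`. -/
structure H1Pair (u u' : ℝ → E) : Prop where
  per : Function.Periodic u 1
  per' : Function.Periodic u' 1
  memLp : MemLp u' 2 periodMeasure
  ftc : ∀ a b, u b - u a = ∫ s in a..b, u' s

lemma intervalIntegrable_of_periodic {v : ℝ → E} (hp : Function.Periodic v 1)
    (hv : Integrable v periodMeasure) (a b : ℝ) : IntervalIntegrable v volume a b := by
  refine hp.intervalIntegrable₀ one_ne_zero ?_ a b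
  rw [intervalIntegrable_iff_integrableOn_Ioc_of_le zero_le_one]
  exact hv

/-- The Cauchy-Schwarz inequality for the integral of a function over an interval. -/
lemma sq_norm_integral_le {v : ℝ → E} {a b : ℝ} (hab : a ≤ b)
    (hv : IntervalIntegrable v volume a b)
    (hv2 : IntervalIntegrable (fun s => ‖v s‖ ^ 2) volume a b) :
    ‖∫ s in a..b, v s‖ ^ 2 ≤ (b - a) * ∫ s in a..b, ‖v s‖ ^ 2 := by
  have h1 := intervalIntegral.norm_integral_le_integral_norm (f := v) (μ := volume) hab
  set I := ∫ s in a..b, ‖v s‖ with hI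
  rcases hab.eq_or_lt with rfl | hlt
  · simp
  have hI0 : 0 ≤ I := intervalIntegral.integral_nonneg hab fun _ _ => norm_nonneg _
  have hba : 0 < b - a := sub_pos.2 hlt
  -- The variance of the norm about its mean is nonnegative.
  have h2 : 0 ≤ ∫ s in a..b, (‖v s‖ - I / (b - a)) ^ 2 :=
    intervalIntegral.integral_nonneg hab fun _ _ => sq_nonneg _
  have h3 : ∫ s in a..b, (‖v s‖ - I / (b - a)) ^ 2 =
      (∫ s in a..b, ‖v s‖ ^ 2) - 2 * (I / (b - a)) * I + (b - a) * (I / (b - a)) ^ 2 := by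
    have : ∀ s, (‖v s‖ - I / (b - a)) ^ 2 =
        ‖v s‖ ^ 2 - 2 * (I / (b - a)) * ‖v s‖ + (I / (b - a)) ^ 2 := fun s => by ring
    simp only [this]
    rw [intervalIntegral.integral_add (hv2.sub (hv.norm.const_mul _)) (by simp),
      intervalIntegral.integral_sub hv2 (hv.norm.const_mul _),
      intervalIntegral.integral_const_mul, intervalIntegral.integral_const, smul_eq_mul, ← hI]
  have h4 : 2 * (I / (b - a)) * I - (b - a) * (I / (b - a)) ^ 2 = I ^ 2 / (b - a) := by
    field_simp
    ring
  have h5 : I ^ 2 / (b - a) ≤ ∫ s in a..b, ‖v s‖ ^ 2 := by linarith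
  rw [div_le_iff₀ hba] at h5
  calc ‖∫ s in a..b, v s‖ ^ 2 ≤ I ^ 2 := pow_le_pow_left₀ (norm_nonneg _) h1 2
    _ ≤ _ := by linarith

namespace H1Pair

variable {u u' v v' : ℝ → E}

lemma integrable (h : H1Pair u u') (a b : ℝ) : IntervalIntegrable u' volume a b :=
  intervalIntegrable_of_periodic h.per' (h.memLp.integrable (by norm_num)) a b

lemma per_sq (h : H1Pair u u') : Function.Periodic (fun s => ‖u' s‖ ^ 2) 1 := fun s => by
  simp only [h.per' s]

lemma integrable_sq (h : H1Pair u u') (a b : ℝ) :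
    IntervalIntegrable (fun s => ‖u' s‖ ^ 2) volume a b :=
  intervalIntegrable_of_periodic h.per_sq h.memLp.norm.integrable_sq a b

lemma continuous (h : H1Pair u u') : Continuous u := by
  have : u = fun ρ => u 0 + ∫ s in (0 : ℝ)..ρ, u' s := funext fun ρ => by
    rw [← h.ftc, add_sub_cancel]
  rw [this]
  exact continuous_const.add (intervalIntegral.continuous_primitive h.integrable 0)

lemma sq_norm_sub_le (h : H1Pair u u') {a b : ℝ} (hab : a ≤ b) :
    ‖u b - u a‖ ^ 2 ≤ (b - a) * ∫ s in a..b, ‖u' s‖ ^ 2 := by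
  rw [h.ftc]
  exact sq_norm_integral_le hab (h.integrable a b) (h.integrable_sq a b)

lemma integral_sq_mono (h : H1Pair u u') {a b c : ℝ} (hab : a ≤ b) (hbc : b ≤ c) :
    ∫ s in a..b, ‖u' s‖ ^ 2 ≤ ∫ s in a..c, ‖u' s‖ ^ 2 :=
  intervalIntegral.integral_mono_interval le_rfl hab hbc (.of_forall fun _ => sq_nonneg _)
    (h.integrable_sq a c)

/-- The elementary Sobolev inequality, with a free length scale. -/
lemma sq_norm_le (h : H1Pair u u') {δ : ℝ} (hδ : 0 < δ) (hδ1 : δ ≤ 1) (ρ : ℝ) :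
    ‖u ρ‖ ^ 2 ≤ 2 / δ * (∫ s in (0 : ℝ)..1, ‖u s‖ ^ 2) +
      2 * δ * ∫ s in (0 : ℝ)..1, ‖u' s‖ ^ 2 := by
  have hcu : Continuous fun s => ‖u s‖ ^ 2 := (h.continuous.norm).pow 2
  have hperu : Function.Periodic (fun s => ‖u s‖ ^ 2) 1 := fun s => by simp only [h.per s]
  have hI : ∫ s in ρ..ρ + δ, ‖u s‖ ^ 2 ≤ ∫ s in (0 : ℝ)..1, ‖u s‖ ^ 2 := by
    have := hperu.intervalIntegral_add_eq 0 ρ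
    rw [zero_add] at this
    rw [this]
    exact intervalIntegral.integral_mono_interval le_rfl (by linarith) (by linarith)
      (.of_forall fun _ => sq_nonneg _) (hcu.intervalIntegrable _ _)
  have hI' : ∫ s in ρ..ρ + δ, ‖u' s‖ ^ 2 ≤ ∫ s in (0 : ℝ)..1, ‖u' s‖ ^ 2 := by
    have := h.per_sq.intervalIntegral_add_eq 0 ρ
    rw [zero_add] at this
    rw [this]
    exact h.integral_sq_mono (by linarith) (by linarith)
  -- Compare `u ρ` with `u s` for s in a window of length δ and average over the window. A small δ
  -- makes the contribution of the derivative small, which later serves as an interpolation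
  -- inequality.
  have hpt : ∀ s ∈ Icc ρ (ρ + δ), ‖u ρ‖ ^ 2 ≤
      2 * ‖u s‖ ^ 2 + 2 * δ * ∫ s in (0 : ℝ)..1, ‖u' s‖ ^ 2 := by
    intro s hs
    have h1 := h.sq_norm_sub_le hs.1
    have h2 := h.integral_sq_mono hs.1 hs.2
    have h3 : 0 ≤ ∫ r in ρ..s, ‖u' r‖ ^ 2 :=
      intervalIntegral.integral_nonneg hs.1 fun _ _ => sq_nonneg _
    have h4 : ‖u s - u ρ‖ ^ 2 ≤ δ * ∫ s in (0 : ℝ)..1, ‖u' s‖ ^ 2 :=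
      h1.trans (mul_le_mul (by linarith [hs.2]) (h2.trans hI') h3 hδ.le)
    have h5 : ‖u ρ‖ ≤ ‖u s‖ + ‖u s - u ρ‖ := by
      have := norm_sub_norm_le (u ρ) (u s)
      rw [norm_sub_rev] at this
      linarith
    have h6 : ‖u ρ‖ ^ 2 ≤ (‖u s‖ + ‖u s - u ρ‖) ^ 2 := pow_le_pow_left₀ (norm_nonneg _) h5 2
    nlinarith [sq_nonneg (‖u s‖ - ‖u s - u ρ‖)]
  have hint : ∫ _ in ρ..ρ + δ, ‖u ρ‖ ^ 2 ≤
      ∫ s in ρ..ρ + δ, (2 * ‖u s‖ ^ 2 + 2 * δ * ∫ s in (0 : ℝ)..1, ‖u' s‖ ^ 2) := by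
    refine intervalIntegral.integral_mono_on (by linarith) (by simp) ?_ hpt
    exact ((continuous_const.mul hcu).add continuous_const).intervalIntegrable _ _
  rw [intervalIntegral.integral_add
      (show IntervalIntegrable (fun s => 2 * ‖u s‖ ^ 2) volume ρ (ρ + δ) from
        (continuous_const.mul hcu).intervalIntegrable _ _) (by simp),
    intervalIntegral.integral_const_mul, intervalIntegral.integral_const,
    intervalIntegral.integral_const, smul_eq_mul, smul_eq_mul, add_sub_cancel_left] at hint
  have h7 : ‖u ρ‖ ^ 2 = (δ * ‖u ρ‖ ^ 2) / δ := by field_simp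
  rw [h7, div_le_iff₀ hδ]
  calc δ * ‖u ρ‖ ^ 2 ≤ _ := hint
    _ ≤ 2 * (∫ s in (0 : ℝ)..1, ‖u s‖ ^ 2) +
        δ * (2 * δ * ∫ s in (0 : ℝ)..1, ‖u' s‖ ^ 2) := by linarith
    _ = _ := by field_simp

end H1Pair

/-- Periodic functions that agree almost everywhere on one period agree almost everywhere. -/
lemma ae_eq_of_periodic {F : Type*} {f g : ℝ → F} (hf : Function.Periodic f 1)
    (hg : Function.Periodic g 1) (h : f =ᵐ[periodMeasure] g) : f =ᵐ[volume] g := by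
  have hfd := isAddFundamentalDomain_Ioc (T := (1 : ℝ)) one_pos 0
  rw [Filter.EventuallyEq, ae_iff]
  -- The exceptional set is invariant under integer translations, so it is null once its part in the
  -- fundamental domain `Ioc 0 1` is.
  refine hfd.measure_zero_of_invariant _ (fun n => ?_) ?_
  · obtain ⟨n, k, rfl⟩ := n
    ext ρ
    rw [Set.mem_vadd_set_iff_neg_vadd_mem]
    have h1 := hf.sub_zsmul_eq (x := ρ) k
    have h2 := hg.sub_zsmul_eq (x := ρ) k
    simp only [mem_ofPred_eq]
    have : (-(⟨(fun m : ℤ => m • (1 : ℝ)) k, ⟨k, rfl⟩⟩ : AddSubgroup.zmultiples (1 : ℝ)) +ᵥ ρ) =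
        ρ - k • (1 : ℝ) := by
      change -(k • (1 : ℝ)) + ρ = _
      ring
    rw [this, h1, h2]
  · rw [zero_add]
    rw [Filter.EventuallyEq, ae_restrict_iff' measurableSet_Ioc, ae_iff] at h
    convert h using 2
    ext ρ
    simp only [mem_inter_iff, mem_ofPred_eq, Classical.not_imp]
    tauto

/-- Continuous periodic functions that agree almost everywhere on one period are equal. -/
lemma eq_of_periodic_of_ae_eq {f g : ℝ → E} (hf : Function.Periodic f 1)
    (hg : Function.Periodic g 1) (hfc : Continuous f) (hgc : Continuous g)
    (h : f =ᵐ[periodMeasure] g) : f = g :=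
  Measure.eq_of_ae_eq (ae_eq_of_periodic hf hg h) hfc hgc

lemma H1Pair.congr {u u' v : ℝ → E} (h : H1Pair u u') (hv : Function.Periodic v 1)
    (he : u' =ᵐ[periodMeasure] v) : H1Pair u v where
  per := h.per
  per' := hv
  memLp := h.memLp.ae_eq he
  ftc a b := by
    rw [h.ftc]
    refine intervalIntegral.integral_congr_ae ?_
    filter_upwards [ae_eq_of_periodic h.per' hv he] with ρ hρ _ using hρ

/-- On one period `a` is a constant plus a primitive of `b`. Extending `b` periodically, its zero
mean over a period makes the primitive periodic too. -/
lemma exists_h1Pair [CompleteSpace E] {a b : L2Per E} (h : IsPerWeakDeriv a b) :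
    ∃ u u' : ℝ → E, H1Pair u u' ∧ a =ᵐ[periodMeasure] u ∧ b =ᵐ[periodMeasure] u' := by
  have hia : IntegrableOn a (Ioo 0 1) := by
    have : Integrable a periodMeasure := (Lp.memLp a).integrable (by norm_num)
    exact IntegrableOn.mono_set this Ioo_subset_Ioc_self
  have hb : Integrable b periodMeasure := (Lp.memLp b).integrable (by norm_num)
  have hib : IntegrableOn b (Ioo 0 1) := IntegrableOn.mono_set hb Ioo_subset_Ioc_self
  obtain ⟨c, hc⟩ := h.isWeakTimeDeriv.exists_eq_add_integral one_pos hia hib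
  -- The half-open period is closed on the right, as in `periodMeasure`, so the extension agrees
  -- with the chosen representative of `b` at every point of the period.
  let u' : ℝ → E := fun ρ => b (toIocMod one_pos 0 ρ)
  have hu'b : ∀ ρ ∈ Ioc (0 : ℝ) 1, u' ρ = b ρ := fun ρ hρ => by
    have : toIocMod one_pos 0 ρ = ρ := by
      rw [toIocMod_eq_self]
      simpa using hρ
    simp only [u', this]
  have hbu : b =ᵐ[periodMeasure] u' := by
    filter_upwards [ae_restrict_mem measurableSet_Ioc] with ρ hρ using (hu'b ρ hρ).symm
  have hper' : Function.Periodic u' 1 := fun ρ => by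
    simp only [u', toIocMod_add_right]
  have hmem : MemLp u' 2 periodMeasure := (Lp.memLp b).ae_eq hbu
  have hii := intervalIntegrable_of_periodic hper' (hmem.integrable (by norm_num))
  have hzero : ∀ ρ, ∫ s in ρ..ρ + 1, u' s = 0 := fun ρ => by
    rw [hper'.intervalIntegral_add_eq ρ 0, zero_add, intervalIntegral.integral_of_le zero_le_one,
      ← h.integral_eq_zero]
    exact integral_congr_ae hbu.symm
  refine ⟨fun ρ => c + ∫ s in (0 : ℝ)..ρ, u' s, u', ⟨fun ρ => ?_, hper', hmem, fun r s => ?_⟩,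
    ?_, hbu⟩
  · rw [← intervalIntegral.integral_add_adjacent_intervals (hii 0 ρ) (hii ρ (ρ + 1)), hzero,
      add_zero]
  · rw [add_sub_add_left_eq_sub, intervalIntegral.integral_interval_sub_left (hii 0 s) (hii 0 r)]
  · have : ∀ᵐ t ∂periodMeasure, a t = c + ∫ s in (0 : ℝ)..t, b s := by
      have h := hc
      rwa [restrict_Ioo_eq_restrict_Ioc] at h
    filter_upwards [this, ae_restrict_mem measurableSet_Ioc] with ρ hρ hmem
    rw [hρ]
    congr 1
    refine intervalIntegral.integral_congr_ae (.of_forall fun s hs => ?_)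
    rw [uIoc_of_le hmem.1.le] at hs
    exact (hu'b s ⟨hs.1, hs.2.trans hmem.2⟩).symm

lemma integral_norm_sq_eq (U : L2Per E) {u : ℝ → E} (h : U =ᵐ[periodMeasure] u) :
    ∫ s in (0 : ℝ)..1, ‖u s‖ ^ 2 = ‖U‖ ^ 2 := by
  have h1 : ∫ s in (0 : ℝ)..1, ‖u s‖ ^ 2 = ∫ s, ‖U s‖ ^ 2 ∂periodMeasure := by
    rw [intervalIntegral.integral_of_le zero_le_one]
    refine integral_congr_ae ?_
    filter_upwards [h] with ρ hρ
    rw [hρ]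
  have h0 : 0 ≤ ∫ s, ‖U s‖ ^ 2 ∂periodMeasure := integral_nonneg fun _ => sq_nonneg _
  have h2 := (Lp.memLp U).eLpNorm_eq_integral_rpow_norm (by norm_num) (by norm_num)
  have h3 : ∀ s, ‖U s‖ ^ (2 : ℝ≥0∞).toReal = ‖U s‖ ^ 2 := fun s => by simp
  simp only [h3] at h2
  rw [h1, Lp.norm_def, h2, ENNReal.toReal_ofReal (Real.rpow_nonneg h0 _), ← Real.rpow_natCast,
    ← Real.rpow_mul h0]
  norm_num

/-! ### Continuous representatives -/

section Rep

variable [CompleteSpace E] {l : ℕ}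

lemma HPer.isPerWeakDeriv_zero (U : HPer E (l + 1)) :
    IsPerWeakDeriv ((U : PiLp 2 fun _ : Fin (l + 1 + 1) => L2Per E) 0)
      ((U : PiLp 2 fun _ : Fin (l + 1 + 1) => L2Per E) 1) := by
  have := U.2 0
  rwa [Fin.castSucc_zero, Fin.succ_zero_eq_one] at this

/-- The continuous representative of an element of `H^l`, `l ≥ 1`. -/
def rep (U : HPer E (l + 1)) : ℝ → E := (exists_h1Pair (HPer.isPerWeakDeriv_zero U)).choose

lemma rep_spec (U : HPer E (l + 1)) : ∃ u', H1Pair (rep U) u' ∧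
    (U : PiLp 2 fun _ : Fin (l + 1 + 1) => L2Per E) 0 =ᵐ[periodMeasure] rep U ∧
    (U : PiLp 2 fun _ : Fin (l + 1 + 1) => L2Per E) 1 =ᵐ[periodMeasure] u' :=
  (exists_h1Pair (HPer.isPerWeakDeriv_zero U)).choose_spec

lemma rep_periodic (U : HPer E (l + 1)) : Function.Periodic (rep U) 1 := by
  obtain ⟨u', h, -⟩ := rep_spec U
  exact h.per

lemma continuous_rep (U : HPer E (l + 1)) : Continuous (rep U) := by
  obtain ⟨u', h, -⟩ := rep_spec U
  exact h.continuous

lemma represents_rep (U : HPer E (l + 1)) : Represents U (rep U) := by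
  obtain ⟨u', -, h, -⟩ := rep_spec U
  exact h

/-- A class contains at most one continuous periodic function. Hence `rep` is linear, and facts
about classes transfer to the functions `x t` and `w t` themselves. -/
lemma Represents.eq_rep {U : HPer E (l + 1)} {u : ℝ → E} (h : Represents U u)
    (hp : Function.Periodic u 1) (hc : Continuous u) : u = rep U :=
  eq_of_periodic_of_ae_eq hp (rep_periodic U) hc (continuous_rep U) (h.symm.trans (represents_rep U))

lemma Represents.add {l : ℕ} {U V : HPer E l} {u v : ℝ → E} (hu : Represents U u)
    (hv : Represents V v) : Represents (U + V) (u + v) := by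
  have h := Lp.coeFn_add ((U : PiLp 2 fun _ : Fin (l + 1) => L2Per E) 0)
    ((V : PiLp 2 fun _ : Fin (l + 1) => L2Per E) 0)
  exact h.trans (Filter.EventuallyEq.add hu hv)

lemma Represents.smul {l : ℕ} {U : HPer E l} {u : ℝ → E} (c : ℝ) (hu : Represents U u) :
    Represents (c • U) (c • u) := by
  have h := Lp.coeFn_smul c ((U : PiLp 2 fun _ : Fin (l + 1) => L2Per E) 0)
  exact h.trans (Filter.EventuallyEq.const_smul hu c)

lemma Represents.sub {l : ℕ} {U V : HPer E l} {u v : ℝ → E} (hu : Represents U u)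
    (hv : Represents V v) : Represents (U - V) (u - v) := by
  have := hu.add (hv.smul (-1))
  simpa [sub_eq_add_neg] using this

lemma rep_add (U V : HPer E (l + 1)) : rep (U + V) = rep U + rep V :=
  (((represents_rep U).add (represents_rep V)).eq_rep
    ((rep_periodic U).add (rep_periodic V)) ((continuous_rep U).add (continuous_rep V))).symm

lemma rep_smul (c : ℝ) (U : HPer E (l + 1)) : rep (c • U) = c • rep U :=
  (((represents_rep U).smul c).eq_rep ((rep_periodic U).smul c)
    ((continuous_rep U).const_smul c)).symm

lemma norm_component_sq_le {l : ℕ} (U : HPer E l) (i : Fin (l + 1)) :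
    ‖(U : PiLp 2 fun _ : Fin (l + 1) => L2Per E) i‖ ^ 2 ≤ ‖U‖ ^ 2 := by
  rw [Submodule.coe_norm]
  exact pow_le_pow_left₀ (norm_nonneg _) (PiLp.norm_apply_le _ i) 2

/-- The Sobolev inequality with length scale one bounds the square by 2 + 2 times the squared norm.
-/
lemma norm_rep_le (U : HPer E (l + 1)) (ρ : ℝ) : ‖rep U ρ‖ ≤ 2 * ‖U‖ := by
  obtain ⟨u', h, h0, h1⟩ := rep_spec U
  have := h.sq_norm_le one_pos le_rfl ρ
  rw [integral_norm_sq_eq _ h0, integral_norm_sq_eq _ h1] at this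
  refine abs_le_of_sq_le_sq' ?_ (by positivity) |>.2
  nlinarith [norm_component_sq_le U 0, norm_component_sq_le U 1]

/-- Point evaluation on `H^l`, `l ≥ 1`. -/
def evalAt (ρ : ℝ) : HPer E (l + 1) →L[ℝ] E :=
  LinearMap.mkContinuous
    { toFun := fun U => rep U ρ
      map_add' := fun U V => by rw [rep_add, Pi.add_apply]
      map_smul' := fun c U => by rw [rep_smul, Pi.smul_apply, RingHom.id_apply] } 2
    fun U => norm_rep_le U ρ

lemma evalAt_apply (ρ : ℝ) (U : HPer E (l + 1)) : evalAt ρ U = rep U ρ := rfl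

lemma Represents.exists_h1Pair {U : HPer E (l + 1)} {u : ℝ → E} (h : Represents U u)
    (hp : Function.Periodic u 1) (hc : Continuous u) :
    ∃ u', H1Pair u u' ∧ ∫ s in (0 : ℝ)..1, ‖u s‖ ^ 2 ≤ ‖U‖ ^ 2 ∧
      ∫ s in (0 : ℝ)..1, ‖u' s‖ ^ 2 ≤ ‖U‖ ^ 2 := by
  obtain ⟨u', h1, h2, h3⟩ := rep_spec U
  rw [h.eq_rep hp hc]
  exact ⟨u', h1, (integral_norm_sq_eq _ h2).trans_le (norm_component_sq_le U _),
    (integral_norm_sq_eq _ h3).trans_le (norm_component_sq_le U _)⟩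

/-- The continuous representative of an element of `H²` is continuously differentiable, and its
derivative is a primitive of its second weak derivative. -/
lemma Represents.h2 {U : HPer E 2} {u : ℝ → E} (h : Represents U u)
    (hp : Function.Periodic u 1) (hc : Continuous u) :
    (∀ ρ, HasDerivAt u (deriv u ρ) ρ) ∧ (∀ ρ, ‖deriv u ρ‖ ≤ 2 * ‖U‖) ∧
    H1Pair u (deriv u) ∧
    ∃ u'', H1Pair (deriv u) u'' ∧ ∫ s in (0 : ℝ)..1, ‖u'' s‖ ^ 2 ≤ ‖U‖ ^ 2 := by
  obtain ⟨u', h1, h2, h3⟩ := rep_spec U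
  rw [h.eq_rep hp hc]
  have hw := U.2 1
  -- The first weak derivative has itself a continuous representative `v`. So `rep U` is a primitive
  -- of a continuous function and is differentiable everywhere, not just almost everywhere.
  obtain ⟨v, v', k1, k2, k3⟩ := CurveRD.exists_h1Pair hw
  have huv : u' =ᵐ[periodMeasure] v := h3.symm.trans k2
  have h1' := h1.congr k1.per huv
  have hd : ∀ ρ, HasDerivAt (rep U) (v ρ) ρ := by
    have : rep U = fun ρ => rep U 0 + ∫ s in (0 : ℝ)..ρ, v s := funext fun ρ => by
      rw [← h1'.ftc, add_sub_cancel]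
    rw [this]
    intro ρ
    exact (intervalIntegral.integral_hasDerivAt_right (k1.continuous.intervalIntegrable _ _)
      (k1.continuous.stronglyMeasurableAtFilter _ _) k1.continuous.continuousAt).const_add _
  have hdv : deriv (rep U) = v := funext fun ρ => (hd ρ).deriv
  rw [hdv]
  refine ⟨hd, fun ρ => ?_, h1', v', k1, ?_⟩
  · have := k1.sq_norm_le one_pos le_rfl ρ
    rw [integral_norm_sq_eq _ k2, integral_norm_sq_eq _ k3] at this
    refine abs_le_of_sq_le_sq' ?_ (by positivity) |>.2
    have e1 := norm_component_sq_le U (Fin.castSucc 1)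
    have e2 := norm_component_sq_le U (Fin.succ 1)
    nlinarith
  · exact (integral_norm_sq_eq _ k3).trans_le (norm_component_sq_le U _)

/-- A periodic primitive is differentiable almost everywhere. -/
lemma H1Pair.ae_hasDerivAt {u u' : ℝ → E} (h : H1Pair u u') :
    ∀ᵐ ρ, HasDerivAt u (u' ρ) ρ := by
  have hl : LocallyIntegrable u' := by
    refine (locallyIntegrable_iff).2 fun k hk => ?_
    obtain ⟨R, hR⟩ := hk.isBounded.subset_closedBall 0
    rw [Real.closedBall_eq_Icc] at hR
    refine IntegrableOn.mono_set ?_ hR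
    rcases le_or_gt (0 - R) (0 + R) with h0 | h0
    · rw [integrableOn_Icc_iff_integrableOn_Ioc, ← intervalIntegrable_iff_integrableOn_Ioc_of_le h0]
      exact h.integrable _ _
    · rw [Icc_eq_empty (not_le.2 h0)]
      exact integrableOn_empty
  filter_upwards [LocallyIntegrable.ae_hasDerivAt_integral hl] with ρ hρ
  have : u = fun ρ => u 0 + ∫ s in (0 : ℝ)..ρ, u' s := funext fun ρ => by
    rw [← h.ftc, add_sub_cancel]
  rw [this]
  exact (hρ 0).const_add _

/-- A periodic primitive of an essentially bounded function is Lipschitz. -/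
lemma H1Pair.norm_sub_le {u u' : ℝ → E} (h : H1Pair u u') {C : ℝ}
    (hC : ∀ᵐ ρ, ‖u' ρ‖ ≤ C) (a b : ℝ) : ‖u b - u a‖ ≤ C * |b - a| := by
  rw [h.ftc]
  exact intervalIntegral.norm_integral_le_of_norm_le_const_ae
    (by filter_upwards [hC] with ρ hρ _ using hρ)

end Rep

end PeriodicSobolev

/-! ### Weak time derivatives in a Banach space. -/

section BochnerTime

variable {B : Type*} [NormedAddCommGroup B] [NormedSpace ℝ B] [CompleteSpace B]

lemma MemWTime.memLp {T : ℝ} {p : ℝ≥0∞} {k : ℕ} {u : ℝ → B} (h : MemWTime T p k u) :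
    MemLp u p (volume.restrict (Ioo 0 T)) := by
  cases k with
  | zero => exact h
  | succ k => exact h.1

/-- A function with a weak derivative agrees almost everywhere with a primitive, on all of `ℝ`, of a
globally integrable function. -/
lemma MemWTime.exists_primitive {T : ℝ} (hT : 0 < T) {p : ℝ≥0∞} (hp : 1 ≤ p) {k : ℕ} {u : ℝ → B}
    (h : MemWTime T p (k + 1) u) :
    ∃ (v v₁ : ℝ → B) (c : B), MemWTime T p k v ∧ v₁ = (Ioo 0 T).indicator v ∧ Integrable v₁ ∧
      ∀ᵐ t ∂(volume.restrict (Ioo 0 T)), u t = c + ∫ s in (0 : ℝ)..t, v₁ s := by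
  obtain ⟨hu, v, hw, hv⟩ := h
  have hvi : IntegrableOn v (Ioo 0 T) := hv.memLp.integrable hp
  obtain ⟨c, hc⟩ := hw.exists_eq_add_integral hT (hu.integrable hp) hvi
  refine ⟨v, _, c, hv, rfl, hvi.integrable_indicator measurableSet_Ioo, ?_⟩
  filter_upwards [hc, ae_restrict_mem measurableSet_Ioo] with t ht hmem
  rw [ht]
  congr 1
  refine intervalIntegral.integral_congr_ae (.of_forall fun s hs => ?_)
  rw [uIoc_of_le hmem.1.le] at hs
  rw [indicator_of_mem]
  exact ⟨hs.1, hs.2.trans_lt hmem.2⟩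

/-- The function is almost everywhere a primitive of an essentially bounded one. Cutting the
derivative off outside `Ioo 0 T` makes the primitive Lipschitz on the whole line. -/
lemma MemWTime.exists_lipschitz {T : ℝ} (hT : 0 < T) {u : ℝ → B} (h : MemWTime T ⊤ 1 u) :
    ∃ (U : ℝ → B) (K : ℝ), 0 ≤ K ∧ u =ᵐ[volume.restrict (Ioo 0 T)] U ∧
      ∀ s t, ‖U t - U s‖ ≤ K * |t - s| := by
  obtain ⟨v, v₁, c, hv, hv₁, hi, hae⟩ := h.exists_primitive hT le_top
  set K := (eLpNormEssSup v (volume.restrict (Ioo 0 T))).toReal with hK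
  have hbound : ∀ᵐ t, ‖v₁ t‖ ≤ K := by
    have h1 := ae_le_eLpNormEssSup (f := v) (μ := volume.restrict (Ioo 0 T))
    rw [ae_restrict_iff' measurableSet_Ioo] at h1
    have hfin : eLpNormEssSup v (volume.restrict (Ioo 0 T)) ≠ ⊤ := by
      have := hv.memLp.2.ne
      rwa [eLpNorm_exponent_top] at this
    filter_upwards [h1] with t ht
    rw [hv₁]
    by_cases hm : t ∈ Ioo 0 T
    · rw [indicator_of_mem hm, ← toReal_enorm]
      exact ENNReal.toReal_mono hfin (ht hm)
    · rw [indicator_of_notMem hm, norm_zero]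
      exact ENNReal.toReal_nonneg
  refine ⟨fun t => c + ∫ s in (0 : ℝ)..t, v₁ s, K, ENNReal.toReal_nonneg, hae, fun s t => ?_⟩
  rw [add_sub_add_left_eq_sub, intervalIntegral.integral_interval_sub_left
    hi.intervalIntegrable hi.intervalIntegrable]
  exact intervalIntegral.norm_integral_le_of_norm_le_const_ae
    (by filter_upwards [hbound] with r hr _ using hr)

/-- Integrating twice gives a C¹ representative U with derivative V. The difference quotient is the
mean of V over [s, t], and Cauchy-Schwarz bounds the oscillation of V there by the integral of the
squared second derivative. G is the running value of that integral, so the right-hand sides can be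
summed over a time grid. -/
lemma MemWTime.exists_C1 {T : ℝ} (hT : 0 < T) {u : ℝ → B} (h : MemWTime T 2 2 u) :
    ∃ (U V : ℝ → B) (G : ℝ → ℝ), Monotone G ∧ u =ᵐ[volume.restrict (Ioo 0 T)] U ∧
      (∀ t, HasDerivAt U (V t) t) ∧
      ∀ s t, s < t → ‖V t - (t - s)⁻¹ • (U t - U s)‖ ^ 2 ≤ (t - s) * (G t - G s) := by
  obtain ⟨v, v₁, c, hv, hv₁, hi, hae⟩ := h.exists_primitive hT (by norm_num)
  obtain ⟨v', v₁', c', hv', hv₁', hi', hae'⟩ := hv.exists_primitive hT (by norm_num)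
  set V : ℝ → B := fun t => c' + ∫ s in (0 : ℝ)..t, v₁' s with hV
  have hVc : Continuous V :=
    continuous_const.add (intervalIntegral.continuous_primitive (fun _ _ => hi'.intervalIntegrable) 0)
  have hsq : Integrable fun t => ‖v₁' t‖ ^ 2 := by
    have h1 : MemLp v₁' 2 volume := by
      rw [hv₁', memLp_indicator_iff_restrict measurableSet_Ioo]
      exact hv'.memLp
    exact h1.norm.integrable_sq
  have hG : ∀ s t, (∫ r in (0 : ℝ)..t, ‖v₁' r‖ ^ 2) - ∫ r in (0 : ℝ)..s, ‖v₁' r‖ ^ 2 =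
      ∫ r in s..t, ‖v₁' r‖ ^ 2 := fun s t =>
    intervalIntegral.integral_interval_sub_left hsq.intervalIntegrable hsq.intervalIntegrable
  have hmono : Monotone fun t => ∫ r in (0 : ℝ)..t, ‖v₁' r‖ ^ 2 := fun s t hst => by
    rw [← sub_nonneg, hG]
    exact intervalIntegral.integral_nonneg hst fun _ _ => sq_nonneg _
  refine ⟨fun t => c + ∫ s in (0 : ℝ)..t, V s, V, fun t => ∫ r in (0 : ℝ)..t, ‖v₁' r‖ ^ 2,
    hmono, ?_, fun t => ?_, fun s t hst => ?_⟩
  · filter_upwards [hae, ae_restrict_mem measurableSet_Ioo] with t ht hmem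
    rw [ht]
    congr 1
    rw [ae_restrict_iff' measurableSet_Ioo] at hae'
    refine intervalIntegral.integral_congr_ae ?_
    filter_upwards [hae'] with s hs hst
    rw [uIoc_of_le hmem.1.le] at hst
    have hs' : s ∈ Ioo 0 T := ⟨hst.1, hst.2.trans_lt hmem.2⟩
    rw [hv₁, indicator_of_mem hs', hs hs']
  · exact (intervalIntegral.integral_hasDerivAt_right (hVc.intervalIntegrable _ _)
      (hVc.stronglyMeasurableAtFilter _ _) hVc.continuousAt).const_add _
  · rw [add_sub_add_left_eq_sub, intervalIntegral.integral_interval_sub_left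
      (hVc.intervalIntegrable _ _) (hVc.intervalIntegrable _ _), hG]
    have hts : 0 < t - s := sub_pos.2 hst
    set D := (t - s) * ∫ r in s..t, ‖v₁' r‖ ^ 2 with hD
    have hD0 : 0 ≤ D := mul_nonneg hts.le
      (intervalIntegral.integral_nonneg hst.le fun _ _ => sq_nonneg _)
    have hpt : ∀ r ∈ uIoc s t, ‖V t - V r‖ ≤ √D := by
      intro r hr
      rw [uIoc_of_le hst.le] at hr
      refine Real.le_sqrt_of_sq_le ?_
      have e1 : V t - V r = ∫ q in r..t, v₁' q := by
        simp only [hV]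
        rw [add_sub_add_left_eq_sub, intervalIntegral.integral_interval_sub_left
          hi'.intervalIntegrable hi'.intervalIntegrable]
      rw [e1]
      refine (sq_norm_integral_le hr.2 hi'.intervalIntegrable hsq.intervalIntegrable).trans ?_
      refine mul_le_mul (by linarith [hr.1]) ?_ ?_ hts.le
      · rw [← hG r t, ← hG s t]
        have := hmono hr.1.le
        simp only at this
        linarith
      · exact intervalIntegral.integral_nonneg hr.2 fun _ _ => sq_nonneg _
    have e2 : V t - (t - s)⁻¹ • ∫ r in s..t, V r = (t - s)⁻¹ • ∫ r in s..t, (V t - V r) := by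
      rw [intervalIntegral.integral_sub (by simp) (hVc.intervalIntegrable _ _),
        intervalIntegral.integral_const, smul_sub, smul_smul, inv_mul_cancel₀ hts.ne', one_smul]
    have e3 := intervalIntegral.norm_integral_le_of_norm_le_const hpt
    rw [abs_of_pos hts] at e3
    rw [e2, norm_smul, norm_inv, Real.norm_of_nonneg hts.le]
    calc ((t - s)⁻¹ * ‖∫ r in s..t, (V t - V r)‖) ^ 2 ≤ (√D) ^ 2 := by
          refine pow_le_pow_left₀ (by positivity) ?_ 2
          rw [inv_mul_le_iff₀ hts]
          linarith
      _ = D := Real.sq_sqrt hD0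

end BochnerTime

/-! ### Pointwise time derivatives from Bochner regularity. -/

section SpaceTimeRegularity

variable {E : Type*} [NormedAddCommGroup E] [NormedSpace ℝ E] [CompleteSpace E]

lemma continuous_slice {T : ℝ} {u : ℝ → ℝ → E}
    (hc : ContinuousOn (fun q : ℝ × ℝ => u q.1 q.2) (Icc 0 T ×ˢ univ)) {t : ℝ} (ht : t ∈ Icc 0 T) :
    Continuous (u t) := by
  rw [← continuousOn_univ]
  exact hc.comp (f := fun ρ => (t, ρ)) (by fun_prop) (fun ρ _ => ⟨ht, mem_univ _⟩)

lemma continuousOn_slice {T : ℝ} {u : ℝ → ℝ → E}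
    (hc : ContinuousOn (fun q : ℝ × ℝ => u q.1 q.2) (Icc 0 T ×ˢ univ)) (ρ : ℝ) :
    ContinuousOn (fun t => u t ρ) (Icc 0 T) :=
  hc.comp (f := fun t => (t, ρ)) (by fun_prop) (fun t ht => ⟨ht, mem_univ _⟩)

lemma eqOn_Icc_of_ae_Ioo {F : Type*} [TopologicalSpace F] [T2Space F] {T : ℝ} (hT : 0 < T)
    {f g : ℝ → F} (h : f =ᵐ[volume.restrict (Ioo 0 T)] g) (hf : ContinuousOn f (Icc 0 T))
    (hg : ContinuousOn g (Icc 0 T)) : EqOn f g (Icc 0 T) := by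
  refine Measure.eqOn_Icc_of_ae_eq (μ := volume) hT.ne ?_ hf hg
  rwa [← restrict_Ioo_eq_restrict_Icc]

/-- Point evaluation is continuous on H^l for l ≥ 1. For each ρ both sides are therefore continuous
in time, and equality for almost every time becomes equality for every time. -/
lemma represents_of_ae {T : ℝ} (hT : 0 < T) {l : ℕ} {u : ℝ → ℝ → E}
    (hp : ∀ t, Function.Periodic (u t) 1)
    (hc : ContinuousOn (fun q : ℝ × ℝ => u q.1 q.2) (Icc 0 T ×ˢ univ))
    {U₀ U : ℝ → HPer E (l + 1)}
    (h₀ : ∀ᵐ t ∂(volume.restrict (Ioo 0 T)), Represents (U₀ t) (u t))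
    (hae : U₀ =ᵐ[volume.restrict (Ioo 0 T)] U) (hU : Continuous U) :
    ∀ t ∈ Icc 0 T, Represents (U t) (u t) := by
  have key : ∀ ρ, EqOn (fun t => evalAt ρ (U t)) (fun t => u t ρ) (Icc 0 T) := by
    intro ρ
    refine eqOn_Icc_of_ae_Ioo hT ?_ (by fun_prop) (continuousOn_slice hc ρ)
    filter_upwards [h₀, hae, ae_restrict_mem measurableSet_Ioo] with t h1 h2 h3
    rw [evalAt_apply, ← h2,
      ← h1.eq_rep (hp t) (continuous_slice hc (Ioo_subset_Icc_self h3))]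
  intro t ht
  have : u t = rep (U t) := funext fun ρ => (key ρ ht).symm
  rw [this]
  exact represents_rep _

lemma continuous_of_norm_sub_le {B : Type*} [NormedAddCommGroup B] {U : ℝ → B} {K : ℝ}
    (hK : 0 ≤ K) (h : ∀ s t, ‖U t - U s‖ ≤ K * |t - s|) : Continuous U :=
  (LipschitzWith.of_dist_le_mul (K := ⟨K, hK⟩) fun s t => by
    rw [dist_eq_norm, Real.dist_eq]
    exact h t s).continuous

lemma MemWH.exists_lipschitz {T : ℝ} (hT : 0 < T) {l : ℕ} {u : ℝ → ℝ → E}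
    (hp : ∀ t, Function.Periodic (u t) 1)
    (hc : ContinuousOn (fun q : ℝ × ℝ => u q.1 q.2) (Icc 0 T ×ˢ univ))
    (h : MemWH T 1 ⊤ (l + 1) u) :
    ∃ (U : ℝ → HPer E (l + 1)) (K : ℝ), 0 ≤ K ∧ (∀ t ∈ Icc 0 T, Represents (U t) (u t)) ∧
      ∀ s t, ‖U t - U s‖ ≤ K * |t - s| := by
  obtain ⟨U₀, h₀, hm⟩ := h
  obtain ⟨U, K, hK, hae, hL⟩ := hm.exists_lipschitz hT
  exact ⟨U, K, hK, represents_of_ae hT hp hc h₀ hae (continuous_of_norm_sub_le hK hL), hL⟩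

/-- The pointwise time derivative of a function in `H²(0, T; H¹)`. -/
lemma MemWH.timeDeriv_estimate {T : ℝ} (hT : 0 < T) {l : ℕ} {u : ℝ → ℝ → E}
    (hp : ∀ t, Function.Periodic (u t) 1)
    (hc : ContinuousOn (fun q : ℝ × ℝ => u q.1 q.2) (Icc 0 T ×ˢ univ))
    (h : MemWH T 2 2 (l + 1) u) :
    ∃ G : ℝ → ℝ, Monotone G ∧
      (∀ t ∈ Icc 0 T, ∀ ρ, HasDerivWithinAt (fun s => u s ρ) (timeDeriv T u t ρ) (Icc 0 T) t) ∧
      ∀ s ∈ Icc 0 T, ∀ t ∈ Icc 0 T, s < t → ∀ ρ,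
        ‖timeDeriv T u t ρ - (t - s)⁻¹ • (u t ρ - u s ρ)‖ ^ 2 ≤ (t - s) * (G t - G s) := by
  obtain ⟨U₀, h₀, hm⟩ := h
  obtain ⟨U, V, G, hG, hae, hd, hest⟩ := hm.exists_C1 hT
  have hrep := represents_of_ae hT hp hc h₀ hae
    (continuous_iff_continuousAt.2 fun t => (hd t).continuousAt)
  have hev : ∀ t ∈ Icc 0 T, ∀ ρ, u t ρ = evalAt ρ (U t) := fun t ht ρ => by
    rw [evalAt_apply, ← (hrep t ht).eq_rep (hp t) (continuous_slice hc ht)]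
  have hder : ∀ t ∈ Icc 0 T, ∀ ρ,
      HasDerivWithinAt (fun s => u s ρ) (evalAt ρ (V t)) (Icc 0 T) t := fun t ht ρ => by
    have h1 : HasDerivAt (fun s => evalAt ρ (U s)) (evalAt ρ (V t)) t :=
      (evalAt ρ).hasFDerivAt.comp_hasDerivAt t (hd t)
    exact h1.hasDerivWithinAt.congr (fun s hs => hev s hs ρ) (hev t ht ρ)
  have htd : ∀ t ∈ Icc 0 T, ∀ ρ, timeDeriv T u t ρ = evalAt ρ (V t) := fun t ht ρ =>
    (hder t ht ρ).derivWithin ((uniqueDiffOn_Icc hT) t ht)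
  -- The factor 4 is the square of the embedding constant in `norm_rep_le`.
  refine ⟨fun t => 4 * G t, fun s t hst => mul_le_mul_of_nonneg_left (hG hst) (by norm_num),
    fun t ht ρ => (htd t ht ρ) ▸ hder t ht ρ, fun s hs t ht hst ρ => ?_⟩
  rw [htd t ht, hev t ht, hev s hs, ← map_sub, ← map_smul, ← map_sub, evalAt_apply]
  have h1 := norm_rep_le (V t - (t - s)⁻¹ • (U t - U s)) ρ
  have h2 := hest s t hst
  have h3 := pow_le_pow_left₀ (norm_nonneg _) h1 2
  nlinarith

/-- The component of order zero of an element of a Sobolev space. -/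
def componentZero (l : ℕ) : HPer E l →L[ℝ] L2Per E :=
  (PiLp.proj 2 (fun _ : Fin (l + 1) => L2Per E) (0 : Fin (l + 1)) :
    (PiLp 2 fun _ : Fin (l + 1) => L2Per E) →L[ℝ] L2Per E) ∘L (HPer E l).subtypeL

lemma represents_iff {l : ℕ} (U : HPer E l) (u : ℝ → E) :
    Represents U u ↔ componentZero l U =ᵐ[periodMeasure] u := Iff.rfl

lemma integral_sq_le_of_represents {l : ℕ} {U : HPer E l} {u : ℝ → E} (h : Represents U u) :
    ∫ s in (0 : ℝ)..1, ‖u s‖ ^ 2 ≤ ‖U‖ ^ 2 :=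
  (integral_norm_sq_eq _ h).trans_le (norm_component_sq_le U 0)

/-- The pointwise time derivative of a function in `W^{1,∞}(0, T; H¹) ∩ H²(0, T; L²)`. -/
lemma MemWH.timeDeriv_estimate_L2 {T : ℝ} (hT : 0 < T) {u : ℝ → ℝ → E}
    (hp : ∀ t, Function.Periodic (u t) 1)
    (hc : ContinuousOn (fun q : ℝ × ℝ => u q.1 q.2) (Icc 0 T ×ˢ univ))
    {U₁ : ℝ → HPer E 1} {K : ℝ} (hK : 0 ≤ K) (hrep₁ : ∀ t ∈ Icc 0 T, Represents (U₁ t) (u t))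
    (hL : ∀ s t, ‖U₁ t - U₁ s‖ ≤ K * |t - s|) (h : MemWH T 2 2 0 u) :
    ∃ G : ℝ → ℝ, Monotone G ∧ ∀ t ∈ Icc 0 T,
      (∀ ρ, HasDerivWithinAt (fun s => u s ρ) (timeDeriv T u t ρ) (Icc 0 T) t) ∧
      Continuous (timeDeriv T u t) ∧
      ∀ s ∈ Icc 0 T, s < t →
        ∫ ρ in (0 : ℝ)..1, ‖timeDeriv T u t ρ - (t - s)⁻¹ • (u t ρ - u s ρ)‖ ^ 2 ≤
          (t - s) * (G t - G s) := by
  obtain ⟨U₀, h₀, hm⟩ := h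
  obtain ⟨U, V, G, hG, hae, hd, hest⟩ := hm.exists_C1 hT
  have hUc : Continuous U := continuous_iff_continuousAt.2 fun t => (hd t).continuousAt
  have hU₁c : Continuous U₁ := continuous_of_norm_sub_le hK hL
  have hrep : ∀ t ∈ Icc 0 T, Represents (U t) (u t) := by
    -- Point evaluation is not available on L². The two continuous curves of classes are compared in
    -- L² instead, and the representation is inherited from `U₁`.
    have : EqOn (fun t => componentZero 0 (U t)) (fun t => componentZero 1 (U₁ t)) (Icc 0 T) := by
      refine eqOn_Icc_of_ae_Ioo hT ?_ (by fun_prop) (by fun_prop)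
      filter_upwards [h₀, hae, ae_restrict_mem measurableSet_Ioo] with t h1 h2 h3
      rw [← h2]
      refine Lp.ext ?_
      exact ((represents_iff _ _).1 h1).trans
        ((represents_iff _ _).1 (hrep₁ t (Ioo_subset_Icc_self h3))).symm
    intro t ht
    have h1 := this ht
    rw [represents_iff]
    simp only at h1
    rw [h1]
    exact (represents_iff _ _).1 (hrep₁ t ht)
  refine ⟨G, hG, fun t ht => ?_⟩
  -- difference quotients
  set D : ℝ → ℝ → E := fun s => (s - t)⁻¹ • (u s - u t) with hD
  set d : ℝ → HPer E 0 := fun s => (s - t)⁻¹ • (U s - U t) with hddef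
  set d₁ : ℝ → HPer E 1 := fun s => (s - t)⁻¹ • (U₁ s - U₁ t) with hd₁def
  have hDper : ∀ s, Function.Periodic (D s) 1 := fun s => ((hp s).sub (hp t)).smul _
  have hDc : ∀ s ∈ Icc 0 T, Continuous (D s) := fun s hs =>
    ((continuous_slice hc hs).sub (continuous_slice hc ht)).const_smul _
  have hdr : ∀ s ∈ Icc 0 T, Represents (d s) (D s) := fun s hs =>
    ((hrep s hs).sub (hrep t ht)).smul _
  have hd₁r : ∀ s ∈ Icc 0 T, Represents (d₁ s) (D s) := fun s hs =>
    ((hrep₁ s hs).sub (hrep₁ t ht)).smul _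
  have hd₁n : ∀ s, ‖d₁ s‖ ≤ K := by
    intro s
    simp only [hd₁def]
    rw [norm_smul, norm_inv, Real.norm_eq_abs]
    rcases eq_or_ne s t with rfl | hne
    · simpa using hK
    · rw [inv_mul_le_iff₀ (abs_pos.2 (sub_ne_zero.2 hne)), mul_comm]
      exact hL t s
  -- The difference quotients converge in L² and stay bounded in H¹. The Sobolev inequality with a
  -- free length scale interpolates between the two.
  have hpair : ∀ s ∈ Icc 0 T, ∀ s' ∈ Icc 0 T, ∀ δ : ℝ, 0 < δ → δ ≤ 1 → ∀ ρ,
      ‖D s ρ - D s' ρ‖ ^ 2 ≤ 2 / δ * ‖d s - d s'‖ ^ 2 + 2 * δ * (2 * K) ^ 2 := by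
    intro s hs s' hs' δ hδ hδ1 ρ
    obtain ⟨v, h1, -, h2⟩ := ((hd₁r s hs).sub (hd₁r s' hs')).exists_h1Pair
      ((hDper s).sub (hDper s')) ((hDc s hs).sub (hDc s' hs'))
    have h3 := h1.sq_norm_le hδ hδ1 ρ
    have h4 := integral_sq_le_of_represents ((hdr s hs).sub (hdr s' hs'))
    have h5 : ‖d₁ s - d₁ s'‖ ^ 2 ≤ (2 * K) ^ 2 :=
      pow_le_pow_left₀ (norm_nonneg _) (by linarith [norm_sub_le (d₁ s) (d₁ s'), hd₁n s, hd₁n s']) 2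
    refine h3.trans (add_le_add ?_ ?_)
    · exact mul_le_mul_of_nonneg_left h4 (by positivity)
    · exact mul_le_mul_of_nonneg_left (h2.trans h5) (by positivity)
  set F := nhdsWithin t (Icc 0 T \ {t}) with hF
  have hFne : F.NeBot := by
    rw [hF, ← accPt_principal_iff_nhdsWithin, ← uniqueDiffWithinAt_iff_accPt]
    exact uniqueDiffOn_Icc hT t ht
  have hFmem : ∀ᶠ s in F, s ∈ Icc 0 T := by
    filter_upwards [self_mem_nhdsWithin] with s hs using hs.1
  have hdlim : Filter.Tendsto d F (nhds (V t)) := by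
    have := hasDerivAt_iff_tendsto_slope.1 (hd t)
    have h2 := this.mono_left (nhdsWithin_mono t (show Icc 0 T \ {t} ⊆ {t}ᶜ from fun s hs => hs.2))
    refine h2.congr fun s => ?_
    rw [slope_def_module]
  -- First δ makes the H¹ contribution small, then closeness in L² takes care of the term with 1/δ.
  -- This yields pointwise limits, that is, a classical time derivative at every ρ.
  have hcauchy : ∀ ρ, ∃ y, Filter.Tendsto (fun s => D s ρ) F (nhds y) := by
    intro ρ
    rw [← cauchy_map_iff_exists_tendsto, Metric.cauchy_iff]
    refine ⟨hFne.map _, fun ε hε => ?_⟩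
    obtain ⟨δ, hδ, hδ1, hδ2⟩ : ∃ δ : ℝ, 0 < δ ∧ δ ≤ 1 ∧ 2 * δ * (2 * K) ^ 2 < ε ^ 2 / 2 := by
      refine ⟨min 1 (ε ^ 2 / (4 * ((2 * K) ^ 2 + 1))), by positivity, min_le_left _ _, ?_⟩
      have h1 : min 1 (ε ^ 2 / (4 * ((2 * K) ^ 2 + 1))) * (4 * ((2 * K) ^ 2 + 1)) ≤ ε ^ 2 := by
        rw [← le_div_iff₀ (by positivity)]
        exact min_le_right _ _
      have h2 : 0 < min 1 (ε ^ 2 / (4 * ((2 * K) ^ 2 + 1))) := by positivity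
      nlinarith
    set η := ε * √δ / 4 with hη
    have hη0 : 0 < η := by positivity
    have hball : ∀ᶠ s in F, ‖d s - V t‖ < η := by
      have := Metric.tendsto_nhds.1 hdlim η hη0
      simpa only [dist_eq_norm] using this
    refine ⟨(fun s => D s ρ) '' {s | s ∈ Icc 0 T ∧ ‖d s - V t‖ < η},
      Filter.image_mem_map (hFmem.and hball), ?_⟩
    rintro _ ⟨s, ⟨hs, hs1⟩, rfl⟩ _ ⟨s', ⟨hs', hs1'⟩, rfl⟩
    rw [dist_eq_norm]
    have h1 := hpair s hs s' hs' δ hδ hδ1 ρ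
    have h2 : ‖d s - d s'‖ ≤ 2 * η := by
      have := norm_sub_le (d s - V t) (d s' - V t)
      rw [sub_sub_sub_cancel_right] at this
      linarith
    have h3 : ‖d s - d s'‖ ^ 2 ≤ ε ^ 2 * δ / 4 := by
      refine (pow_le_pow_left₀ (norm_nonneg _) h2 2).trans_eq ?_
      rw [hη, mul_pow, div_pow, mul_pow, Real.sq_sqrt hδ.le]
      ring
    have h4 : 2 / δ * ‖d s - d s'‖ ^ 2 ≤ ε ^ 2 / 2 := by
      calc 2 / δ * ‖d s - d s'‖ ^ 2 ≤ 2 / δ * (ε ^ 2 * δ / 4) :=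
            mul_le_mul_of_nonneg_left h3 (by positivity)
        _ = ε ^ 2 / 2 := by
            field_simp
            norm_num
    exact lt_of_pow_lt_pow_left₀ 2 hε.le (by linarith)
  choose y hy using hcauchy
  have hder : ∀ ρ, HasDerivWithinAt (fun s => u s ρ) (y ρ) (Icc 0 T) t := fun ρ => by
    rw [hasDerivWithinAt_iff_tendsto_slope]
    refine (hy ρ).congr fun s => ?_
    rw [slope_def_module]
    rfl
  have htd : timeDeriv T u t = y := funext fun ρ =>
    (hder ρ).derivWithin ((uniqueDiffOn_Icc hT) t ht)
  -- The H¹ bound on the difference quotients gives a Hölder bound of exponent 1/2 that survives the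
  -- limit; the factor b - a + 1 dominates the number of periods needed to cover [a, b].
  have hhol : ∀ a b, a ≤ b → ‖y b - y a‖ ^ 2 ≤ (b - a) * (K ^ 2 * (b - a + 1)) := by
    intro a b hab
    refine le_of_tendsto ((((hy b).sub (hy a)).norm).pow 2) ?_
    filter_upwards [hFmem] with s hs
    obtain ⟨v, h1, -, h2⟩ := (hd₁r s hs).exists_h1Pair (hDper s) (hDc s hs)
    refine (h1.sq_norm_sub_le hab).trans (mul_le_mul_of_nonneg_left ?_ (by linarith))
    have hK2 : ‖d₁ s‖ ^ 2 ≤ K ^ 2 := pow_le_pow_left₀ (norm_nonneg _) (hd₁n s) 2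
    have h3 : ∫ r in a..b, ‖v r‖ ^ 2 ≤ ∫ r in a..a + (⌈b - a⌉₊ : ℕ) • (1 : ℝ), ‖v r‖ ^ 2 := by
      refine h1.integral_sq_mono hab ?_
      have := Nat.le_ceil (b - a)
      simp only [nsmul_eq_mul, mul_one]
      linarith
    have h4 : ∫ r in a..a + (⌈b - a⌉₊ : ℕ) • (1 : ℝ), ‖v r‖ ^ 2 =
        (⌈b - a⌉₊ : ℕ) • ∫ r in a..a + 1, ‖v r‖ ^ 2 := by
      have := h1.per_sq.intervalIntegral_add_zsmul_eq (⌈b - a⌉₊ : ℤ) a h1.integrable_sq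
      simpa using this
    have h5 : ∫ r in a..a + 1, ‖v r‖ ^ 2 ≤ K ^ 2 := by
      rw [h1.per_sq.intervalIntegral_add_eq a 0, zero_add]
      exact h2.trans hK2
    have h6 := Nat.ceil_lt_add_one (sub_nonneg.2 hab)
    rw [h4] at h3
    refine h3.trans ?_
    rw [nsmul_eq_mul, mul_comm (K ^ 2)]
    exact mul_le_mul h6.le h5 (intervalIntegral.integral_nonneg (by linarith)
      fun _ _ => sq_nonneg _) (by linarith)
  have hyc : Continuous y := by
    have hb : ∀ a b, ‖y b - y a‖ ^ 2 ≤ |b - a| * (K ^ 2 * (|b - a| + 1)) := by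
      intro a b
      rcases le_total a b with h | h
      · rw [abs_of_nonneg (sub_nonneg.2 h)]
        exact hhol a b h
      · rw [norm_sub_rev, abs_sub_comm, abs_of_nonneg (sub_nonneg.2 h)]
        exact hhol b a h
    rw [continuous_iff_continuousAt]
    intro a
    rw [ContinuousAt, tendsto_iff_norm_sub_tendsto_zero]
    have h1 : Filter.Tendsto (fun b => √(|b - a| * (K ^ 2 * (|b - a| + 1)))) (nhds a)
        (nhds 0) := by
      have : Continuous fun b => √(|b - a| * (K ^ 2 * (|b - a| + 1))) := by fun_prop
      have h2 := this.tendsto a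
      simpa using h2
    exact squeeze_zero (fun _ => norm_nonneg _) (fun b => Real.le_sqrt_of_sq_le (hb a b)) h1
  -- The L² limit and the pointwise limit agree, because a subsequence of an L² convergent sequence
  -- converges almost everywhere.
  have hyV : componentZero 0 (V t) =ᵐ[periodMeasure] y := by
    obtain ⟨q, hq⟩ := hF ▸ Filter.exists_seq_tendsto F
    have h1 : Filter.Tendsto (fun k => componentZero 0 (d (q k))) Filter.atTop
        (nhds (componentZero 0 (V t))) :=
      ((componentZero 0).continuous.tendsto _).comp (hdlim.comp hq)
    obtain ⟨ns, hns, hlim⟩ := (tendstoInMeasure_of_tendsto_Lp h1).exists_seq_tendsto_ae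
    have h2 : ∀ᵐ ρ ∂periodMeasure, ∀ k, q k ∈ Icc 0 T →
        (componentZero 0 (d (q k)) : ℝ → E) ρ = D (q k) ρ := by
      rw [ae_all_iff]
      intro k
      by_cases hk : q k ∈ Icc 0 T
      · filter_upwards [(represents_iff _ _).1 (hdr _ hk)] with ρ hρ _ using hρ
      · exact .of_forall fun _ h => absurd h hk
    filter_upwards [hlim, h2] with ρ h3 h4
    refine tendsto_nhds_unique h3 ?_
    have h5 : Filter.Tendsto (fun k => D (q (ns k)) ρ) Filter.atTop (nhds (y ρ)) :=
      (hy ρ).comp (hq.comp hns.tendsto_atTop)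
    refine h5.congr' ?_
    filter_upwards [(hq.comp hns.tendsto_atTop).eventually hFmem] with k hk
    exact (h4 _ hk).symm
  rw [htd]
  refine ⟨hder, hyc, fun s hs hst => ?_⟩
  have hVy : Represents (V t) y := hyV
  have h1 := integral_sq_le_of_represents
    (hVy.sub (((hrep t ht).sub (hrep s hs)).smul ((t - s)⁻¹)))
  exact h1.trans (hest s t hst)

end SpaceTimeRegularity

/-! ### The plane, unit vectors and the force of the curve equation. -/

section Geometry

/-- A `C¹` map is Lipschitz and bounded on balls. -/
lemma exists_lipschitz_bound {E F : Type*} [NormedAddCommGroup E] [NormedSpace ℝ E]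
    [FiniteDimensional ℝ E] [NormedAddCommGroup F] [NormedSpace ℝ F] {H : E → F}
    (hH : ContDiff ℝ 1 H) (R : ℝ) :
    ∃ C : ℝ, 0 ≤ C ∧ (∀ y, ‖y‖ ≤ R → ‖H y‖ ≤ C) ∧
      ∀ y z, ‖y‖ ≤ R → ‖z‖ ≤ R → ‖H y - H z‖ ≤ C * ‖y - z‖ := by
  have hK : IsCompact (Metric.closedBall (0 : E) R) := isCompact_closedBall 0 R
  obtain ⟨K, hL⟩ := (hH.locallyLipschitz.locallyLipschitzOn
    (s := Metric.closedBall (0 : E) R)).exists_lipschitzOnWith_of_compact hK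
  obtain ⟨B, hB⟩ := hK.exists_bound_of_continuousOn hH.continuous.continuousOn
  refine ⟨max K B, le_max_of_le_left K.2, fun y hy => ?_, fun y z hy hz => ?_⟩
  · exact (hB y (by simpa using hy)).trans (le_max_right _ _)
  · have := hL.dist_le_mul y (by simpa using hy) z (by simpa using hz)
    rw [dist_eq_norm, dist_eq_norm] at this
    exact this.trans (mul_le_mul_of_nonneg_right (le_max_left _ _) (norm_nonneg _))

lemma inner_eq (p q : Plane) : ⟪p, q⟫ = p 0 * q 0 + p 1 * q 1 := by
  simp [PiLp.inner_apply, Fin.sum_univ_two, mul_comm]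

lemma perp_zero_apply (p : Plane) : perp p 0 = -(p 1) := rfl

lemma perp_one_apply (p : Plane) : perp p 1 = p 0 := rfl

lemma plane_ext {p q : Plane} (h0 : p 0 = q 0) (h1 : p 1 = q 1) : p = q := by
  ext i
  fin_cases i
  exacts [h0, h1]

/-- Rotation by `π / 2` as a continuous linear map. -/
def perpCLM : Plane →L[ℝ] Plane :=
  LinearMap.toContinuousLinearMap
    { toFun := perp
      map_add' := fun p q => by
        apply plane_ext
        · simp only [perp_zero_apply, PiLp.add_apply]; ring
        · simp only [perp_one_apply, PiLp.add_apply]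
      map_smul' := fun c p => by
        apply plane_ext
        · simp only [perp_zero_apply, PiLp.smul_apply, RingHom.id_apply, smul_eq_mul]; ring
        · simp only [perp_one_apply, PiLp.smul_apply, RingHom.id_apply] }

lemma perpCLM_apply (p : Plane) : perpCLM p = perp p := rfl

lemma perp_smul (c : ℝ) (p : Plane) : perp (c • p) = c • perp p := by
  simp only [← perpCLM_apply, map_smul]

lemma perp_sub (p q : Plane) : perp (p - q) = perp p - perp q := by
  simp only [← perpCLM_apply, map_sub]

lemma norm_perp (p : Plane) : ‖perp p‖ = ‖p‖ := by
  have : ‖perp p‖ ^ 2 = ‖p‖ ^ 2 := by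
    rw [← real_inner_self_eq_norm_sq, ← real_inner_self_eq_norm_sq, inner_eq, inner_eq,
      perp_zero_apply, perp_one_apply]
    ring
  exact (pow_left_inj₀ (norm_nonneg _) (norm_nonneg _) two_ne_zero).1 this

/-- Decomposition of an inner product along an orthogonal frame. -/
lemma inner_mul_norm_sq (p a b : Plane) :
    ⟪a, p⟫ * ⟪b, p⟫ + ⟪a, perp p⟫ * ⟪b, perp p⟫ = ‖p‖ ^ 2 * ⟪a, b⟫ := by
  rw [← real_inner_self_eq_norm_sq]
  simp only [inner_eq, perp_zero_apply, perp_one_apply]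
  ring

lemma norm_unit {a : Plane} (ha : a ≠ 0) : ‖‖a‖⁻¹ • a‖ = 1 := by
  rw [norm_smul, norm_inv, norm_norm, inv_mul_cancel₀ (norm_ne_zero_iff.2 ha)]

/-- Write the difference as (a - b)/‖b‖ plus a multiple of a that only sees the difference of the
lengths. The constant involves ‖b‖ alone, so a lower bound is needed for only one of the two
vectors. -/
lemma norm_unit_sub_le {a b : Plane} (ha : a ≠ 0) (hb : b ≠ 0) :
    ‖‖a‖⁻¹ • a - ‖b‖⁻¹ • b‖ ≤ 2 * ‖b‖⁻¹ * ‖a - b‖ := by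
  have ha' := norm_pos_iff.2 ha
  have hb' := norm_pos_iff.2 hb
  have h1 : ‖a‖⁻¹ • a - ‖b‖⁻¹ • b = ‖b‖⁻¹ • (a - b) + (‖a‖⁻¹ - ‖b‖⁻¹) • a := by
    rw [smul_sub, sub_smul]
    abel
  have h2 : ‖(‖a‖⁻¹ - ‖b‖⁻¹) • a‖ ≤ ‖b‖⁻¹ * ‖a - b‖ := by
    rw [norm_smul, Real.norm_eq_abs]
    have : (‖a‖⁻¹ - ‖b‖⁻¹) = ‖a‖⁻¹ * ‖b‖⁻¹ * (‖b‖ - ‖a‖) := by field_simp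
    rw [this, abs_mul, abs_of_pos (by positivity)]
    have h3 := abs_norm_sub_norm_le b a
    rw [norm_sub_rev] at h3
    calc ‖a‖⁻¹ * ‖b‖⁻¹ * |‖b‖ - ‖a‖| * ‖a‖ = ‖b‖⁻¹ * |‖b‖ - ‖a‖| := by field_simp
      _ ≤ _ := by gcongr
  rw [h1]
  refine (norm_add_le _ _).trans ?_
  rw [norm_smul, norm_inv, norm_norm]
  linarith

/-- The right-hand side `x_ρρ` of the curve equation: the mobility matrix applied to the velocity
`D`, minus the forcing, for the tangent vector `a` and the value `s` of the scalar. -/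
def curveForce (α : ℝ) (f : ℝ → ℝ) (a D : Plane) (s : ℝ) : Plane :=
  ‖a‖ ^ 2 • (α • D + ((1 - α) * ⟪D, perp (‖a‖⁻¹ • a)⟫) • perp (‖a‖⁻¹ • a))
    - (‖a‖ ^ 2 * f s) • perp (‖a‖⁻¹ • a)

/-- The factor ‖a‖² cancels the normalisation of the tangent, so the expression has no singularity
at a = 0. -/
lemma curveForce_eq (α : ℝ) (f : ℝ → ℝ) (a D : Plane) (s : ℝ) :
    curveForce α f a D s = (α * ‖a‖ ^ 2) • D + ((1 - α) * ⟪D, perp a⟫) • perp a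
      - (‖a‖ * f s) • perp a := by
  rcases eq_or_ne a 0 with rfl | ha
  · have h0 : perp 0 = 0 := by rw [← perpCLM_apply, map_zero]
    simp [curveForce, h0]
  have ha' := norm_pos_iff.2 ha
  simp only [curveForce, perp_smul, inner_smul_right, smul_add, smul_smul]
  congr 2
  · rw [mul_comm]
  · field_simp
  · field_simp

/-- The only nonsmooth ingredient of `curveForce_eq` is ‖a‖. Treated as an independent fourth
variable it leaves a C¹ map `H`, and the norm is itself 1-Lipschitz. -/
lemma exists_curveForce_bound (α : ℝ) {f : ℝ → ℝ} (hf : ContDiff ℝ 1 f) (R : ℝ) :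
    ∃ C : ℝ, 0 ≤ C ∧
      (∀ a D s, ‖a‖ ≤ R → ‖D‖ ≤ R → |s| ≤ R → ‖curveForce α f a D s‖ ≤ C) ∧
      ∀ a D s a' D' s', ‖a‖ ≤ R → ‖D‖ ≤ R → |s| ≤ R → ‖a'‖ ≤ R → ‖D'‖ ≤ R → |s'| ≤ R →
        ‖curveForce α f a D s - curveForce α f a' D' s'‖ ≤
          C * (‖a - a'‖ + ‖D - D'‖ + |s - s'|) := by
  let H : Plane × Plane × ℝ × ℝ → Plane := fun y =>
    (α * ‖y.1‖ ^ 2) • y.2.1 + ((1 - α) * ⟪y.2.1, perpCLM y.1⟫) • perpCLM y.1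
      - (y.2.2.2 * f y.2.2.1) • perpCLM y.1
  have hH : ContDiff ℝ 1 H := by
    have h1 : ContDiff ℝ 1 fun y : Plane × Plane × ℝ × ℝ => y.1 := contDiff_fst
    have h2 : ContDiff ℝ 1 fun y : Plane × Plane × ℝ × ℝ => y.2.1 := contDiff_fst.comp contDiff_snd
    have h3 : ContDiff ℝ 1 fun y : Plane × Plane × ℝ × ℝ => y.2.2.1 :=
      contDiff_fst.comp (contDiff_snd.comp contDiff_snd)
    have h4 : ContDiff ℝ 1 fun y : Plane × Plane × ℝ × ℝ => y.2.2.2 :=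
      contDiff_snd.comp (contDiff_snd.comp contDiff_snd)
    have h5 : ContDiff ℝ 1 fun y : Plane × Plane × ℝ × ℝ => perpCLM y.1 :=
      perpCLM.contDiff.comp h1
    exact (((contDiff_const.mul (h1.norm_sq ℝ)).smul h2).add
      ((contDiff_const.mul (h2.inner ℝ h5)).smul h5)).sub ((h4.mul (hf.comp h3)).smul h5)
  obtain ⟨C, hC, hb, hL⟩ := exists_lipschitz_bound hH R
  have hn : ∀ (a D : Plane) (s : ℝ), ‖a‖ ≤ R → ‖D‖ ≤ R → |s| ≤ R →
      ‖((a, D, s, ‖a‖) : Plane × Plane × ℝ × ℝ)‖ ≤ R := by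
    intro a D s h1 h2 h3
    simp only [Prod.norm_def, Real.norm_eq_abs, abs_norm, max_le_iff]
    exact ⟨h1, h2, h3, h1⟩
  have he : ∀ a D s, curveForce α f a D s = H (a, D, s, ‖a‖) := fun a D s => by
    rw [curveForce_eq]
    rfl
  refine ⟨C, hC, fun a D s h1 h2 h3 => ?_, fun a D s a' D' s' h1 h2 h3 h1' h2' h3' => ?_⟩
  · rw [he]
    exact hb _ (hn a D s h1 h2 h3)
  · rw [he, he]
    refine (hL _ _ (hn a D s h1 h2 h3) (hn a' D' s' h1' h2' h3')).trans
      (mul_le_mul_of_nonneg_left ?_ hC)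
    simp only [Prod.mk_sub_mk, Prod.norm_def, Real.norm_eq_abs, max_le_iff]
    have e1 := norm_nonneg (a - a')
    have e2 := norm_nonneg (D - D')
    have e3 := abs_nonneg (s - s')
    have e4 := abs_norm_sub_norm_le a a'
    exact ⟨by linarith, by linarith, by linarith, by linarith⟩

/-- The derivative of a Lipschitz function of time is bounded by its Lipschitz constant. -/
lemma norm_le_of_hasDerivWithinAt {F : Type*} [NormedAddCommGroup F] [NormedSpace ℝ F] {T : ℝ}
    (hT : 0 < T) {φ : ℝ → F} {φ' : F} {t : ℝ} (ht : t ∈ Icc 0 T)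
    (h : HasDerivWithinAt φ φ' (Icc 0 T) t) {C : ℝ}
    (hC : ∀ s ∈ Icc 0 T, ‖φ s - φ t‖ ≤ C * |s - t|) : ‖φ'‖ ≤ C := by
  have hne : (nhdsWithin t (Icc 0 T \ {t})).NeBot := by
    rw [← accPt_principal_iff_nhdsWithin, ← uniqueDiffWithinAt_iff_accPt]
    exact uniqueDiffOn_Icc hT t ht
  refine le_of_tendsto (hasDerivWithinAt_iff_tendsto_slope.1 h).norm ?_
  filter_upwards [self_mem_nhdsWithin] with s hs
  rw [slope_def_module, norm_smul, norm_inv, Real.norm_eq_abs,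
    inv_mul_le_iff₀ (abs_pos.2 (sub_ne_zero.2 hs.2)), mul_comm]
  exact hC s hs.1

lemma absolutelyContinuous_of_norm_sub_le {F : Type*} [NormedAddCommGroup F] {u : ℝ → F} {C : ℝ}
    (h : ∀ a b, ‖u b - u a‖ ≤ C * |b - a|) (a b : ℝ) :
    AbsolutelyContinuousOnInterval u a b := by
  have hC : 0 ≤ C := by
    have := (norm_nonneg _).trans (h 0 1)
    simpa using this
  refine (LipschitzOnWith.of_dist_le_mul (K := ⟨C, hC⟩) fun s _ t _ => ?_).absolutelyContinuousOnInterval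
  rw [dist_eq_norm, Real.dist_eq]
  exact h t s

lemma absolutelyContinuous_inner {u v : ℝ → Plane} {C C' : ℝ}
    (hu : ∀ a b, ‖u b - u a‖ ≤ C * |b - a|) (hv : ∀ a b, ‖v b - v a‖ ≤ C' * |b - a|) (a b : ℝ) :
    AbsolutelyContinuousOnInterval (fun ρ => ⟪u ρ, v ρ⟫) a b := by
  have hcoord : ∀ {u : ℝ → Plane} {C : ℝ} (_ : ∀ a b, ‖u b - u a‖ ≤ C * |b - a|) (i : Fin 2),
      AbsolutelyContinuousOnInterval (fun ρ => u ρ i) a b := fun {u C} hu i =>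
    absolutelyContinuous_of_norm_sub_le
      (fun a b => (PiLp.norm_apply_le (u b - u a) i).trans (hu a b)) a b
  simp only [inner_eq]
  exact ((hcoord hu 0).fun_mul (hcoord hv 0)).fun_add ((hcoord hu 1).fun_mul (hcoord hv 1))

/-- The differential equations hold only for almost every ρ, so integration by parts has to go
through absolute continuity. -/
lemma integral_eq_sub_of_ae_hasDerivAt {φ φ' : ℝ → ℝ} {a b : ℝ}
    (hac : AbsolutelyContinuousOnInterval φ a b) (h : ∀ᵐ ρ, HasDerivAt φ (φ' ρ) ρ) :
    ∫ ρ in a..b, φ' ρ = φ b - φ a := by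
  rw [← hac.integral_deriv_eq_sub]
  refine intervalIntegral.integral_congr_ae ?_
  filter_upwards [h] with ρ hρ _ using hρ.deriv.symm

lemma intervalIntegrable_of_ae_hasDerivAt {φ φ' : ℝ → ℝ} {a b : ℝ}
    (hac : AbsolutelyContinuousOnInterval φ a b) (h : ∀ᵐ ρ, HasDerivAt φ (φ' ρ) ρ) :
    IntervalIntegrable φ' volume a b := by
  refine hac.intervalIntegrable_deriv.congr_ae ?_
  refine ae_restrict_of_ae ?_
  filter_upwards [h] with ρ hρ using hρ.deriv

end Geometry

/-! ### The equations in the form that is discretised. -/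

section Equations

/-- Solving the curve equation for the second space derivative identifies it with `curveForce`. Its
arguments are bounded, so x_ρ turns out to be Lipschitz, which the H² regularity alone does not
give. -/
lemma ae_hasDerivAt_curve {T α : ℝ} {f : ℝ → ℝ} {x : ℝ → ℝ → Plane} {w : ℝ → ℝ → ℝ}
    (hx_eq : SolvesCurveEq T α f x w) {t : ℝ} (ht : t ∈ Ioc 0 T)
    (hne : ∀ ρ, deriv (x t) ρ ≠ 0) {x₂ : ℝ → Plane}
    (hd : ∀ᵐ ρ, HasDerivAt (deriv (x t)) (x₂ ρ) ρ) :
    ∀ᵐ ρ, HasDerivAt (deriv (x t))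
      (curveForce α f (deriv (x t) ρ) (timeDeriv T x t ρ) (w t ρ)) ρ := by
  filter_upwards [hd, hx_eq t ht] with ρ h1 h2
  rw [h1.deriv] at h2
  have hp : (‖deriv (x t) ρ‖ ^ 2) ≠ 0 := pow_ne_zero 2 (norm_ne_zero_iff.2 (hne ρ))
  have h3 : x₂ ρ = curveForce α f (deriv (x t) ρ) (timeDeriv T x t ρ) (w t ρ) := by
    have h4 : (‖deriv (x t) ρ‖ ^ 2)⁻¹ • x₂ ρ =
        α • timeDeriv T x t ρ + ((1 - α) * normalVel T x t ρ) • normal (x t) ρ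
          - f (w t ρ) • normal (x t) ρ := by
      rw [h2, add_sub_cancel_right]
    have h5 := congrArg (fun y => ‖deriv (x t) ρ‖ ^ 2 • y) h4
    simp only [smul_smul, mul_inv_cancel₀ hp, one_smul] at h5
    rw [h5, smul_sub, smul_smul]
    rfl
  rw [← h3]
  exact h1

/-- The scalar equation, in the form that is integrated by parts. -/
lemma ae_scalar_identity {T d : ℝ} {g : ℝ → ℝ → ℝ} {x : ℝ → ℝ → Plane} {w : ℝ → ℝ → ℝ}
    (hw_eq : SolvesScalarEq T d g x w) {t : ℝ} (ht : t ∈ Ioc 0 T)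
    (hne : ∀ ρ, deriv (x t) ρ ≠ 0) {x₂ : ℝ → Plane} {w₂ : ℝ → ℝ}
    (hx₂ : ∀ᵐ ρ, HasDerivAt (deriv (x t)) (x₂ ρ) ρ)
    (hw₂ : ∀ᵐ ρ, HasDerivAt (deriv (w t)) (w₂ ρ) ρ) :
    ∀ᵐ ρ, HasDerivAt (tangent (x t)) (deriv (tangent (x t)) ρ) ρ ∧
      HasDerivAt (fun r => deriv (w t) r / ‖deriv (x t) r‖)
        (deriv (fun r => deriv (w t) r / ‖deriv (x t) r‖) ρ) ρ ∧
      ‖deriv (x t) ρ‖ * timeDeriv T w t ρ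
          - ‖deriv (x t) ρ‖ * g (normalVel T x t ρ) (w t ρ) =
        ⟪timeDeriv T x t ρ, deriv (tangent (x t)) ρ⟫ * w t ρ
          + ⟪timeDeriv T x t ρ, tangent (x t) ρ⟫ * deriv (w t) ρ
          + d * deriv (fun r => deriv (w t) r / ‖deriv (x t) r‖) ρ := by
  filter_upwards [hx₂, hw₂, hw_eq t ht] with ρ h1 h2 h3
  have hn : DifferentiableAt ℝ (fun r => ‖deriv (x t) r‖) ρ := h1.differentiableAt.norm ℝ (hne ρ)
  have hn0 : ‖deriv (x t) ρ‖ ≠ 0 := norm_ne_zero_iff.2 (hne ρ)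
  have hτ : DifferentiableAt ℝ (tangent (x t)) ρ := (hn.inv hn0).smul h1.differentiableAt
  have hθ : DifferentiableAt ℝ (fun r => deriv (w t) r / ‖deriv (x t) r‖) ρ :=
    h2.differentiableAt.div hn hn0
  refine ⟨hτ.hasDerivAt, hθ.hasDerivAt, ?_⟩
  set θ' := deriv (fun r => deriv (w t) r / ‖deriv (x t) r‖) ρ with hθ'
  set τ' := deriv (tangent (x t)) ρ with hτ'
  -- The derivative of a unit vector field is orthogonal to it. So the inner product of x_t with τ_ρ
  -- is the product of the two normal components, that is, κ v times the length element.
  have horth : ⟪τ', tangent (x t) ρ⟫ = 0 := by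
    have e1 := hτ.hasDerivAt.inner ℝ hτ.hasDerivAt
    have e2 : (fun r => ⟪tangent (x t) r, tangent (x t) r⟫) = fun _ => (1 : ℝ) := by
      funext r
      rw [real_inner_self_eq_norm_sq, tangent, norm_unit (hne r), one_pow]
    rw [e2] at e1
    have e3 := e1.unique (hasDerivAt_const ρ (1 : ℝ))
    rw [real_inner_comm] at e3
    linarith
  have hdec := inner_mul_norm_sq (tangent (x t) ρ) τ' (timeDeriv T x t ρ)
  have hunit : ‖tangent (x t) ρ‖ = 1 := norm_unit (hne ρ)
  rw [horth, hunit, zero_mul, zero_add, one_pow, one_mul] at hdec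
  simp only [curvature, tangentialVel, real_inner_smul_left] at h3
  rw [← hτ'] at h3
  rw [real_inner_comm τ' (timeDeriv T x t ρ), ← hdec, ← h3]
  simp only [normalVel, normal]
  field_simp
  ring

end Equations

/-- Quantitative regularity of a solution `(x, w)`, with a single constant `K`, together with the
weak forms of the two equations on intervals. -/
structure Reg (T α d : ℝ) (f : ℝ → ℝ) (g : ℝ → ℝ → ℝ) (x : ℝ → ℝ → Plane) (w : ℝ → ℝ → ℝ)
    (K : ℝ) (G : ℝ → ℝ) : Prop where
  one_le : 1 ≤ K
  mono : Monotone G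
  G_le : G T - G 0 ≤ K
  x_per : ∀ t, Function.Periodic (x t) 1
  w_per : ∀ t, Function.Periodic (w t) 1
  x_deriv : ∀ t ∈ Icc 0 T, ∀ ρ, HasDerivAt (x t) (deriv (x t) ρ) ρ
  le_xρ : ∀ t ∈ Icc 0 T, ∀ ρ, K⁻¹ ≤ ‖deriv (x t) ρ‖
  xρ_le : ∀ t ∈ Icc 0 T, ∀ ρ, ‖deriv (x t) ρ‖ ≤ K
  xρ_lip : ∀ t ∈ Icc 0 T, ∀ a b, ‖deriv (x t) b - deriv (x t) a‖ ≤ K * |b - a|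
  x_time : ∀ s ∈ Icc 0 T, ∀ t ∈ Icc 0 T, ∀ ρ, ‖x t ρ - x s ρ‖ ≤ K * |t - s|
  xρ_time : ∀ s ∈ Icc 0 T, ∀ t ∈ Icc 0 T, ∀ ρ, ‖deriv (x t) ρ - deriv (x s) ρ‖ ≤ K * |t - s|
  xρ_osc : ∀ s ∈ Icc 0 T, ∀ t ∈ Icc 0 T, ∃ Y : ℝ → ℝ, Monotone Y ∧
    (∀ ρ, Y (ρ + 1) - Y ρ ≤ K * (t - s) ^ 2) ∧ ∀ a b, a ≤ b →
      ‖(deriv (x t) b - deriv (x s) b) - (deriv (x t) a - deriv (x s) a)‖ ^ 2 ≤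
        (b - a) * (Y b - Y a)
  xt_le : ∀ t ∈ Icc 0 T, ∀ ρ, ‖timeDeriv T x t ρ‖ ≤ K
  xt_lip : ∀ t ∈ Icc 0 T, ∀ a b, ‖timeDeriv T x t b - timeDeriv T x t a‖ ≤ K * |b - a|
  xt_est : ∀ s ∈ Icc 0 T, ∀ t ∈ Icc 0 T, s < t → ∀ ρ,
    ‖timeDeriv T x t ρ - (t - s)⁻¹ • (x t ρ - x s ρ)‖ ^ 2 ≤ (t - s) * (G t - G s)
  w_deriv : ∀ t ∈ Icc 0 T, ∀ ρ, HasDerivAt (w t) (deriv (w t) ρ) ρ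
  w_le : ∀ t ∈ Icc 0 T, ∀ ρ, |w t ρ| ≤ K
  wρ_le : ∀ t ∈ Icc 0 T, ∀ ρ, |deriv (w t) ρ| ≤ K
  wρ_lip : ∀ t ∈ Ioc 0 T, ∀ a b, |deriv (w t) b - deriv (w t) a| ≤ K * |b - a|
  w_time : ∀ s ∈ Icc 0 T, ∀ t ∈ Icc 0 T, ∀ ρ, |w t ρ - w s ρ| ≤ K * |t - s|
  w_osc : ∀ s ∈ Icc 0 T, ∀ t ∈ Icc 0 T, ∃ Y : ℝ → ℝ, Monotone Y ∧
    (∀ ρ, Y (ρ + 1) - Y ρ ≤ K * (t - s) ^ 2) ∧ ∀ a b, a ≤ b →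
      ((w t b - w s b) - (w t a - w s a)) ^ 2 ≤ (b - a) * (Y b - Y a)
  curve_weak : ∀ t ∈ Ioc 0 T, ∀ a b, ∀ p q : Plane,
    ∫ ρ in a..b, ⟪curveForce α f (deriv (x t) ρ) (timeDeriv T x t ρ) (w t ρ), p + (ρ - a) • q⟫ =
      ⟪deriv (x t) b, p + (b - a) • q⟫ - ⟪deriv (x t) a, p⟫ - ⟪x t b - x t a, q⟫
  scalar_weak : ∀ t ∈ Ioc 0 T, ∀ s ∈ Icc 0 T, s < t → ∃ Z : ℝ → ℝ, Monotone Z ∧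
    (∀ ρ, Z (ρ + 1) - Z ρ ≤ K * ((t - s) * (G t - G s))) ∧ ∀ a b, a ≤ b → ∀ p q : ℝ,
      |(∫ ρ in a..b,
          (‖deriv (x t) ρ‖ * ((t - s)⁻¹ * (w t ρ - w s ρ))
            + ⟪(t - s)⁻¹ • (deriv (x t) ρ - deriv (x s) ρ), tangent (x t) ρ⟫ * w t ρ
            - ‖deriv (x t) ρ‖ * g (normalVel T x t ρ) (w t ρ)) * (p + (ρ - a) * q)
          + (⟪(t - s)⁻¹ • (x t ρ - x s ρ), tangent (x t) ρ⟫ * w t ρ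
            + d * (deriv (w t) ρ / ‖deriv (x t) ρ‖)) * q)
        - ((⟪(t - s)⁻¹ • (x t b - x s b), tangent (x t) b⟫ * w t b
            + d * (deriv (w t) b / ‖deriv (x t) b‖)) * (p + (b - a) * q)
          - (⟪(t - s)⁻¹ • (x t a - x s a), tangent (x t) a⟫ * w t a
            + d * (deriv (w t) a / ‖deriv (x t) a‖)) * p)| ≤
        (Z b - Z a) + K * ((b - a) * (p ^ 2 + (p + (b - a) * q) ^ 2))

/-! ### Weak form of the scalar equation with difference quotients. -/

section ScalarWeakForm

variable {T d : ℝ} {g : ℝ → ℝ → ℝ} {x : ℝ → ℝ → Plane} {w : ℝ → ℝ → ℝ}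

/-- By convexity the square at an intermediate point is at most a convex combination of the squares
at the end points. -/
lemma sq_affine_le {a b ρ : ℝ} (hρ : ρ ∈ Icc a b) (p q : ℝ) :
    (p + (ρ - a) * q) ^ 2 ≤ p ^ 2 + (p + (b - a) * q) ^ 2 := by
  rcases hρ.1.eq_or_lt with rfl | h
  · simp only [sub_self, zero_mul, add_zero]
    linarith [sq_nonneg (p + (b - a) * q)]
  have h0 : 0 < b - a := by linarith [hρ.2]
  obtain ⟨l, hl0, hl1, hla⟩ : ∃ l : ℝ, 0 ≤ l ∧ l ≤ 1 ∧ ρ - a = l * (b - a) :=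
    ⟨(ρ - a) / (b - a), div_nonneg (by linarith) h0.le, (div_le_one h0).2 (by linarith [hρ.2]),
      by field_simp⟩
  rw [hla]
  have h1 : 0 ≤ l * (1 - l) * ((b - a) * q) ^ 2 := by
    have := sub_nonneg.2 hl1
    positivity
  have h2 : 0 ≤ l * p ^ 2 := by positivity
  have h3 : 0 ≤ (1 - l) * (p + (b - a) * q) ^ 2 := mul_nonneg (sub_nonneg.2 hl1) (sq_nonneg _)
  nlinarith

lemma add_mul_le_sq {X Y N : ℝ} : (X + Y) * N ≤ X ^ 2 + Y ^ 2 + N ^ 2 := by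
  nlinarith [sq_nonneg (X - N), sq_nonneg (Y - N), sq_nonneg X, sq_nonneg Y]

lemma norm_tangent_sub_le {y : ℝ → Plane} {m C : ℝ} (hm : 0 < m)
    (hlow : ∀ ρ, m ≤ ‖deriv y ρ‖) (hlip : ∀ a b, ‖deriv y b - deriv y a‖ ≤ C * |b - a|)
    (a b : ℝ) : ‖tangent y b - tangent y a‖ ≤ 2 * m⁻¹ * C * |b - a| := by
  have hne : ∀ ρ, deriv y ρ ≠ 0 := fun ρ => norm_pos_iff.1 (hm.trans_le (hlow ρ))
  refine (norm_unit_sub_le (hne b) (hne a)).trans ?_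
  have h1 : ‖deriv y a‖⁻¹ ≤ m⁻¹ := inv_anti₀ hm (hlow a)
  calc 2 * ‖deriv y a‖⁻¹ * ‖deriv y b - deriv y a‖
      ≤ 2 * m⁻¹ * (C * |b - a|) := by
        have := norm_nonneg (deriv y b - deriv y a)
        gcongr
        exact hlip a b
    _ = _ := by ring

lemma norm_le_of_hasDerivAt_of_lip {F : Type*} [NormedAddCommGroup F] [NormedSpace ℝ F]
    {u : ℝ → F} {C : ℝ} (hu : ∀ a b, ‖u b - u a‖ ≤ C * |b - a|) {u' : F} {ρ : ℝ}
    (h : HasDerivAt u u' ρ) : ‖u'‖ ≤ C := by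
  have hC : 0 ≤ C := by
    have := (norm_nonneg _).trans (hu 0 1)
    simpa using this
  exact h.le_of_lip' hC (.of_forall fun r => hu ρ r)

/-- The second derivative of `w` is bounded, by the scalar equation. -/
lemma ae_second_deriv_bound (hw_eq : SolvesScalarEq T d g x w) (hd : 0 < d) {t : ℝ}
    (ht : t ∈ Ioc 0 T) {m M Cx Ct Cw Cwt Cg : ℝ} (hm : 0 < m) (hCx : 0 ≤ Cx)
    (hlow : ∀ ρ, m ≤ ‖deriv (x t) ρ‖) (hup : ∀ ρ, ‖deriv (x t) ρ‖ ≤ M)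
    (hlip : ∀ a b, ‖deriv (x t) b - deriv (x t) a‖ ≤ Cx * |b - a|)
    (hxt : ∀ ρ, ‖timeDeriv T x t ρ‖ ≤ Ct) (hw : ∀ ρ, |w t ρ| ≤ Cw)
    (hwρ : ∀ ρ, |deriv (w t) ρ| ≤ Cw) (hwt : ∀ ρ, |timeDeriv T w t ρ| ≤ Cwt)
    (hg : ∀ v z, |v| ≤ Ct → |z| ≤ Cw → |g v z| ≤ Cg)
    {x₂ : ℝ → Plane} {w₂ : ℝ → ℝ} (hx₂ : ∀ᵐ ρ, HasDerivAt (deriv (x t)) (x₂ ρ) ρ)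
    (hw₂ : ∀ᵐ ρ, HasDerivAt (deriv (w t)) (w₂ ρ) ρ) :
    ∀ᵐ ρ, ‖w₂ ρ‖ ≤ d⁻¹ * (M * Cwt + M * Cg + Ct * (2 * m⁻¹ * Cx) * Cw + Ct * Cw) * M
      + Cw * m⁻¹ * Cx := by
  have hne : ∀ ρ, deriv (x t) ρ ≠ 0 := fun ρ => norm_pos_iff.1 (hm.trans_le (hlow ρ))
  filter_upwards [hx₂, hw₂, ae_scalar_identity hw_eq ht hne hx₂ hw₂] with ρ h1 h2 h3
  obtain ⟨h4, h5, h6⟩ := h3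
  set n := ‖deriv (x t) ρ‖ with hn
  set θ' := deriv (fun r => deriv (w t) r / ‖deriv (x t) r‖) ρ with hθ'
  have hn0 : 0 < n := hm.trans_le (hlow ρ)
  have hM : 0 ≤ M := hn0.le.trans (hup ρ)
  have hCt : 0 ≤ Ct := (norm_nonneg _).trans (hxt ρ)
  have hCw : 0 ≤ Cw := (abs_nonneg _).trans (hw ρ)
  have hτ' : ‖deriv (tangent (x t)) ρ‖ ≤ 2 * m⁻¹ * Cx :=
    norm_le_of_hasDerivAt_of_lip (norm_tangent_sub_le hm hlow hlip) h4
  have hunit : ‖tangent (x t) ρ‖ = 1 := norm_unit (hne ρ)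
  have hnv : |normalVel T x t ρ| ≤ Ct := by
    refine (abs_real_inner_le_norm _ _).trans ?_
    rw [normal, norm_perp, hunit, mul_one]
    exact hxt ρ
  have b1 : |⟪timeDeriv T x t ρ, deriv (tangent (x t)) ρ⟫ * w t ρ| ≤
      Ct * (2 * m⁻¹ * Cx) * Cw := by
    rw [abs_mul]
    exact mul_le_mul ((abs_real_inner_le_norm _ _).trans
      (mul_le_mul (hxt ρ) hτ' (norm_nonneg _) hCt)) (hw ρ) (abs_nonneg _) (by positivity)
  have b2 : |⟪timeDeriv T x t ρ, tangent (x t) ρ⟫ * deriv (w t) ρ| ≤ Ct * Cw := by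
    rw [abs_mul]
    refine mul_le_mul ((abs_real_inner_le_norm _ _).trans ?_) (hwρ ρ) (abs_nonneg _) hCt
    rw [hunit, mul_one]
    exact hxt ρ
  have b3 : |n * timeDeriv T w t ρ| ≤ M * Cwt := by
    rw [abs_mul, abs_of_pos hn0]
    exact mul_le_mul (hup ρ) (hwt ρ) (abs_nonneg _) hM
  have b4 : |n * g (normalVel T x t ρ) (w t ρ)| ≤ M * Cg := by
    rw [abs_mul, abs_of_pos hn0]
    exact mul_le_mul (hup ρ) (hg _ _ hnv (hw ρ)) (abs_nonneg _) hM
  -- The scalar equation is solved for its diffusion term; everything else in it is bounded.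
  have b5 : |d * θ'| ≤ M * Cwt + M * Cg + Ct * (2 * m⁻¹ * Cx) * Cw + Ct * Cw := by
    have : d * θ' = n * timeDeriv T w t ρ - n * g (normalVel T x t ρ) (w t ρ)
        - ⟪timeDeriv T x t ρ, deriv (tangent (x t)) ρ⟫ * w t ρ
        - ⟪timeDeriv T x t ρ, tangent (x t) ρ⟫ * deriv (w t) ρ := by linarith
    rw [this]
    rw [abs_le] at b1 b2 b3 b4 ⊢
    constructor <;> linarith [b1.1, b1.2, b2.1, b2.2, b3.1, b3.2, b4.1, b4.2]
  have b6 : |θ'| ≤ d⁻¹ * (M * Cwt + M * Cg + Ct * (2 * m⁻¹ * Cx) * Cw + Ct * Cw) := by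
    rw [abs_mul, abs_of_pos hd] at b5
    rw [inv_mul_eq_div, le_div_iff₀ hd]
    linarith
  have hnd : HasDerivAt (fun r => ‖deriv (x t) r‖) (deriv (fun r => ‖deriv (x t) r‖) ρ) ρ :=
    (h1.differentiableAt.norm ℝ (hne ρ)).hasDerivAt
  set n' := deriv (fun r => ‖deriv (x t) r‖) ρ with hn'
  have b7 : |n'| ≤ Cx := norm_le_of_hasDerivAt_of_lip (u := fun r => ‖deriv (x t) r‖)
    (fun a b => by
      rw [Real.norm_eq_abs]
      exact (abs_norm_sub_norm_le _ _).trans (hlip a b)) hnd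
  -- The bound on w_ρρ follows from the product rule for w_ρ = (w_ρ / |x_ρ|) |x_ρ|.
  have hprod := h5.mul hnd
  have heq : ((fun r => deriv (w t) r / ‖deriv (x t) r‖) * fun r => ‖deriv (x t) r‖) =
      deriv (w t) := by
    funext r
    simp only [Pi.mul_apply]
    rw [div_mul_cancel₀ _ (norm_ne_zero_iff.2 (hne r))]
  rw [heq] at hprod
  rw [h2.unique hprod, ← hn, Real.norm_eq_abs]
  refine (abs_add_le _ _).trans (add_le_add ?_ ?_)
  · rw [abs_mul, abs_of_pos hn0]
    exact mul_le_mul b6 (hup ρ) hn0.le ((abs_nonneg _).trans b6)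
  · rw [abs_mul, abs_div, abs_of_pos hn0, div_eq_mul_inv]
    exact mul_le_mul (mul_le_mul (hwρ ρ) (inv_anti₀ hm (hlow ρ)) (by positivity) hCw) b7
      (abs_nonneg _) (by positivity)

/-- The weak form of the scalar equation on an interval, with difference quotients instead of time
derivatives. -/
lemma scalar_weak_form (hw_eq : SolvesScalarEq T d g x w) {s t : ℝ} (ht : t ∈ Ioc 0 T)
    (hst : s < t) {m M Cx Cw Cw' r e : ℝ} (hm : 0 < m) (hCx : 0 ≤ Cx)
    (hw_per : ∀ t, Function.Periodic (w t) 1)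
    (hxt_deriv : ∀ ρ, HasDerivAt (x t) (deriv (x t) ρ) ρ)
    (hxs_deriv : ∀ ρ, HasDerivAt (x s) (deriv (x s) ρ) ρ)
    (hw_deriv : ∀ ρ, HasDerivAt (w t) (deriv (w t) ρ) ρ)
    (hws : Continuous (w s)) (hwt : Continuous (timeDeriv T w t)) (hg : Continuous (Function.uncurry g))
    (hxtt : Continuous (timeDeriv T x t)) (hxsc : Continuous (deriv (x s)))
    (hlow : ∀ ρ, m ≤ ‖deriv (x t) ρ‖) (hup : ∀ ρ, ‖deriv (x t) ρ‖ ≤ M)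
    (hups : ∀ ρ, ‖deriv (x s) ρ‖ ≤ M)
    (hlip : ∀ a b, ‖deriv (x t) b - deriv (x t) a‖ ≤ Cx * |b - a|)
    (hw : ∀ ρ, |w t ρ| ≤ Cw) (hwρ : ∀ ρ, |deriv (w t) ρ| ≤ Cw)
    (hwlip : ∀ a b, |deriv (w t) b - deriv (w t) a| ≤ Cw' * |b - a|)
    {x₂ : ℝ → Plane} {w₂ : ℝ → ℝ} (hx₂ : ∀ᵐ ρ, HasDerivAt (deriv (x t)) (x₂ ρ) ρ)
    (hw₂ : ∀ᵐ ρ, HasDerivAt (deriv (w t)) (w₂ ρ) ρ)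
    (hr : ∀ ρ, ‖timeDeriv T x t ρ - (t - s)⁻¹ • (x t ρ - x s ρ)‖ ^ 2 ≤ r)
    (he : ∫ ρ in (0 : ℝ)..1, ‖timeDeriv T w t ρ - (t - s)⁻¹ • (w t ρ - w s ρ)‖ ^ 2 ≤ e) :
    ∃ Z : ℝ → ℝ, Monotone Z ∧
    (∀ ρ, Z (ρ + 1) - Z ρ ≤ (2 * m⁻¹ * Cx * Cw + Cw) ^ 2 * r + M ^ 2 * e) ∧
      ∀ a b, a ≤ b → ∀ p q : ℝ,
      |(∫ ρ in a..b,
          (‖deriv (x t) ρ‖ * ((t - s)⁻¹ * (w t ρ - w s ρ))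
            + ⟪(t - s)⁻¹ • (deriv (x t) ρ - deriv (x s) ρ), tangent (x t) ρ⟫ * w t ρ
            - ‖deriv (x t) ρ‖ * g (normalVel T x t ρ) (w t ρ)) * (p + (ρ - a) * q)
          + (⟪(t - s)⁻¹ • (x t ρ - x s ρ), tangent (x t) ρ⟫ * w t ρ
            + d * (deriv (w t) ρ / ‖deriv (x t) ρ‖)) * q)
        - ((⟪(t - s)⁻¹ • (x t b - x s b), tangent (x t) b⟫ * w t b
            + d * (deriv (w t) b / ‖deriv (x t) b‖)) * (p + (b - a) * q)
          - (⟪(t - s)⁻¹ • (x t a - x s a), tangent (x t) a⟫ * w t a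
            + d * (deriv (w t) a / ‖deriv (x t) a‖)) * p)| ≤
        (Z b - Z a) + ((b - a) * (p ^ 2 + (p + (b - a) * q) ^ 2)) := by
  have hne : ∀ ρ, deriv (x t) ρ ≠ 0 := fun ρ => norm_pos_iff.1 (hm.trans_le (hlow ρ))
  have hM : 0 ≤ M := (norm_nonneg _).trans (hup 0)
  have hCw : 0 ≤ Cw := (abs_nonneg _).trans (hw 0)
  have hk : 0 < t - s := sub_pos.2 hst
  have hr0 : 0 ≤ r := (sq_nonneg _).trans (hr 0)
  set A := 2 * m⁻¹ * Cx * Cw + Cw with hA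
  set k := (t - s)⁻¹ with hkdef
  have hA0 : 0 ≤ A := by positivity
  have hτlip := norm_tangent_sub_le hm hlow hlip
  have hpc : Continuous (deriv (x t)) := continuous_of_norm_sub_le hCx (fun a b => hlip a b)
  have hwc : Continuous (w t) := continuous_iff_continuousAt.2 fun ρ => (hw_deriv ρ).continuousAt
  have hxtc : Continuous (x t) := continuous_iff_continuousAt.2 fun ρ => (hxt_deriv ρ).continuousAt
  have hxs' : Continuous (x s) := continuous_iff_continuousAt.2 fun ρ => (hxs_deriv ρ).continuousAt
  have hτc : Continuous (tangent (x t)) := by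
    unfold tangent
    exact (hpc.norm.inv₀ fun ρ => norm_ne_zero_iff.2 (hne ρ)).smul hpc
  have hCw' : 0 ≤ Cw' := by
    have := (abs_nonneg _).trans (hwlip 0 1)
    simpa using this
  have hwρc : Continuous (deriv (w t)) := continuous_of_norm_sub_le hCw' (fun a b => hwlip a b)
  -- the error of the difference quotient of `w`
  set E : ℝ → ℝ := fun ρ => timeDeriv T w t ρ - k * (w t ρ - w s ρ) with hE
  have hEc : Continuous E := hwt.sub (continuous_const.mul (hwc.sub hws))
  have hEper : Function.Periodic E 1 := fun ρ => by
    simp only [hE, hw_per t ρ, hw_per s ρ, timeDeriv, fun s => hw_per s ρ]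
  have hFc : Continuous fun ρ => A ^ 2 * r + M ^ 2 * E ρ ^ 2 := by fun_prop
  -- `Z` accumulates the squared residual caused by replacing time derivatives with difference
  -- quotients. As a primitive, its increments over the elements of any partition add up to the
  -- value over one period, which `r` and `e` control.
  set Z : ℝ → ℝ := fun ρ => ∫ y in (0 : ℝ)..ρ, (A ^ 2 * r + M ^ 2 * E y ^ 2) with hZ
  have hZsub : ∀ a b, Z b - Z a = ∫ y in a..b, (A ^ 2 * r + M ^ 2 * E y ^ 2) := fun a b =>
    intervalIntegral.integral_interval_sub_left (hFc.intervalIntegrable _ _)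
      (hFc.intervalIntegrable _ _)
  refine ⟨Z, fun a b hab => ?_, fun ρ => ?_, fun a b hab p q => ?_⟩
  · rw [← sub_nonneg, hZsub]
    exact intervalIntegral.integral_nonneg hab fun y _ => by positivity
  · have hper : Function.Periodic (fun y => A ^ 2 * r + M ^ 2 * E y ^ 2) 1 := fun y => by
      simp only [hEper y]
    rw [hZsub, hper.intervalIntegral_add_eq ρ 0, zero_add,
      intervalIntegral.integral_add (by simp)
        (show IntervalIntegrable (fun y => M ^ 2 * E y ^ 2) volume 0 1 from
          (continuous_const.mul (hEc.pow 2)).intervalIntegrable _ _),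
      intervalIntegral.integral_const, intervalIntegral.integral_const_mul]
    have : ∫ y in (0 : ℝ)..1, E y ^ 2 ≤ e := by
      refine le_of_eq_of_le ?_ he
      refine intervalIntegral.integral_congr fun y _ => ?_
      simp only [hE, smul_eq_mul, Real.norm_eq_abs, sq_abs]
    simp only [sub_zero, one_smul]
    gcongr
  · set Φ : ℝ → ℝ := fun ρ => ⟪k • (x t ρ - x s ρ), tangent (x t) ρ⟫ * w t ρ
      + d * (deriv (w t) ρ / ‖deriv (x t) ρ‖) with hΦ
    set R : ℝ → ℝ := fun ρ => ‖deriv (x t) ρ‖ * (k * (w t ρ - w s ρ))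
      + ⟪k • (deriv (x t) ρ - deriv (x s) ρ), tangent (x t) ρ⟫ * w t ρ
      - ‖deriv (x t) ρ‖ * g (normalVel T x t ρ) (w t ρ) with hR
    have hnvc : Continuous (normalVel T x t) := by
      unfold normalVel normal
      exact hxtt.inner (perpCLM.continuous.comp hτc)
    have hRc : Continuous R := by
      have hgc : Continuous fun ρ => g (normalVel T x t ρ) (w t ρ) :=
        hg.comp (hnvc.prodMk hwc)
      have h1 : Continuous fun ρ => ⟪k • (deriv (x t) ρ - deriv (x s) ρ), tangent (x t) ρ⟫ :=
        ((hpc.sub hxsc).const_smul k).inner hτc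
      exact ((hpc.norm.mul (continuous_const.mul (hwc.sub hws))).add (h1.mul hwc)).sub
        (hpc.norm.mul hgc)
    have hΦc : Continuous Φ := by
      have h1 : Continuous fun ρ => ⟪k • (x t ρ - x s ρ), tangent (x t) ρ⟫ :=
        ((hxtc.sub hxs').const_smul k).inner hτc
      exact (h1.mul hwc).add (continuous_const.mul
        (hwρc.div hpc.norm fun ρ => norm_ne_zero_iff.2 (hne ρ)))
    have hηac : AbsolutelyContinuousOnInterval (fun ρ => p + (ρ - a) * q) a b := by
      refine absolutelyContinuous_of_norm_sub_le (C := |q|) (fun y z => ?_) a b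
      rw [Real.norm_eq_abs, show p + (z - a) * q - (p + (y - a) * q) = q * (z - y) by ring, abs_mul]
    have hΦac : AbsolutelyContinuousOnInterval Φ a b := by
      have hDlip : ∀ y z, ‖k • (x t z - x s z) - k • (x t y - x s y)‖ ≤
          (|k| * (M + M)) * |z - y| := by
        intro y z
        have h1 : ∀ (u : ℝ → Plane), (∀ ρ, HasDerivAt u (deriv u ρ) ρ) → (∀ ρ, ‖deriv u ρ‖ ≤ M) →
            ‖u z - u y‖ ≤ M * |z - y| := by
          intro u hu hb
          have := convex_univ.norm_image_sub_le_of_norm_hasDerivWithin_le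
            (fun ρ _ => (hu ρ).hasDerivWithinAt) (fun ρ _ => hb ρ) (mem_univ y) (mem_univ z)
          simpa using this
        rw [← smul_sub, norm_smul, Real.norm_eq_abs, mul_assoc]
        refine mul_le_mul_of_nonneg_left ?_ (abs_nonneg _)
        rw [sub_sub_sub_comm]
        refine (norm_sub_le _ _).trans ?_
        linarith [h1 _ hxt_deriv hup, h1 _ hxs_deriv hups]
      have hwlip0 : ∀ y z, ‖w t z - w t y‖ ≤ Cw * |z - y| := by
        intro y z
        have := convex_univ.norm_image_sub_le_of_norm_hasDerivWithin_le
            (fun ρ _ => (hw_deriv ρ).hasDerivWithinAt) (fun ρ _ => hwρ ρ) (mem_univ y) (mem_univ z)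
        simpa using this
      have hinv : ∀ y z, ‖‖deriv (x t) z‖⁻¹ - ‖deriv (x t) y‖⁻¹‖ ≤ (m⁻¹ * m⁻¹ * Cx) * |z - y| := by
        intro y z
        have hy := hm.trans_le (hlow y)
        have hz := hm.trans_le (hlow z)
        have h1 : ‖deriv (x t) z‖⁻¹ - ‖deriv (x t) y‖⁻¹ =
            ‖deriv (x t) z‖⁻¹ * ‖deriv (x t) y‖⁻¹ * (‖deriv (x t) y‖ - ‖deriv (x t) z‖) := by
          field_simp
        rw [h1, Real.norm_eq_abs, abs_mul, abs_of_pos (by positivity), mul_assoc (m⁻¹ * m⁻¹)]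
        have h2 := (abs_norm_sub_norm_le (deriv (x t) y) (deriv (x t) z)).trans
          ((norm_sub_rev _ _).trans_le (hlip y z))
        have h3 := inv_anti₀ hm (hlow y)
        have h4 := inv_anti₀ hm (hlow z)
        gcongr
      have hθ : AbsolutelyContinuousOnInterval (fun ρ => deriv (w t) ρ / ‖deriv (x t) ρ‖) a b := by
        simp only [div_eq_mul_inv]
        exact (absolutelyContinuous_of_norm_sub_le (fun y z => hwlip y z) a b).fun_mul
          (absolutelyContinuous_of_norm_sub_le hinv a b)
      exact ((absolutelyContinuous_inner hDlip hτlip a b).fun_mul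
        (absolutelyContinuous_of_norm_sub_le hwlip0 a b)).fun_add (hθ.const_mul d)
    -- the derivative of the flux
    have hae : ∀ᵐ ρ, HasDerivAt Φ (deriv Φ ρ) ρ ∧ |deriv Φ ρ - R ρ| ≤ A * √r + M * |E ρ| := by
      filter_upwards [ae_scalar_identity hw_eq ht hne hx₂ hw₂] with ρ h3
      obtain ⟨h4, h5, h6⟩ := h3
      have hD : HasDerivAt (fun ρ => k • (x t ρ - x s ρ))
          (k • (deriv (x t) ρ - deriv (x s) ρ)) ρ :=
        ((hxt_deriv ρ).sub (hxs_deriv ρ)).const_smul k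
      have hΦd := ((hD.inner ℝ h4).mul (hw_deriv ρ)).add (h5.const_mul d)
      have hΦd' : HasDerivAt Φ _ ρ := hΦd
      refine ⟨hΦd'.differentiableAt.hasDerivAt, ?_⟩
      rw [hΦd'.deriv]
      set τ' := deriv (tangent (x t)) ρ with hτ'
      set θ' := deriv (fun r => deriv (w t) r / ‖deriv (x t) r‖) ρ with hθ'
      set δ := timeDeriv T x t ρ - k • (x t ρ - x s ρ) with hδ
      have hδD : k • (x t ρ - x s ρ) = timeDeriv T x t ρ - δ := by rw [hδ, sub_sub_cancel]
      have hδn : ‖δ‖ ≤ √r := Real.le_sqrt_of_sq_le (hr ρ)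
      -- The flux derivative misses the zeroth order part by a residual linear in the two difference
      -- quotient errors `δ` and `E ρ`; the exact terms cancel by the scalar identity `h6`.
      have hid : (⟪k • (x t ρ - x s ρ), τ'⟫ + ⟪k • (deriv (x t) ρ - deriv (x s) ρ),
            tangent (x t) ρ⟫) * w t ρ
          + ⟪k • (x t ρ - x s ρ), tangent (x t) ρ⟫ * deriv (w t) ρ + d * θ' - R ρ =
          -(⟪δ, τ'⟫ * w t ρ + ⟪δ, tangent (x t) ρ⟫ * deriv (w t) ρ) + ‖deriv (x t) ρ‖ * E ρ := by
        rw [hδD]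
        simp only [inner_sub_left, hR, hE]
        linear_combination -h6
      rw [hid]
      have hτn : ‖τ'‖ ≤ 2 * m⁻¹ * Cx := norm_le_of_hasDerivAt_of_lip hτlip h4
      have hunit : ‖tangent (x t) ρ‖ = 1 := norm_unit (hne ρ)
      have c1 : |⟪δ, τ'⟫ * w t ρ| ≤ √r * (2 * m⁻¹ * Cx) * Cw := by
        rw [abs_mul]
        exact mul_le_mul ((abs_real_inner_le_norm _ _).trans
          (mul_le_mul hδn hτn (norm_nonneg _) (Real.sqrt_nonneg _))) (hw ρ) (abs_nonneg _)
          (by positivity)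
      have c2 : |⟪δ, tangent (x t) ρ⟫ * deriv (w t) ρ| ≤ √r * Cw := by
        rw [abs_mul]
        refine mul_le_mul ((abs_real_inner_le_norm _ _).trans ?_) (hwρ ρ) (abs_nonneg _)
          (Real.sqrt_nonneg _)
        rw [hunit, mul_one]
        exact hδn
      have c3 : |‖deriv (x t) ρ‖ * E ρ| ≤ M * |E ρ| := by
        rw [abs_mul, abs_norm]
        exact mul_le_mul_of_nonneg_right (hup ρ) (abs_nonneg _)
      refine (abs_add_le _ _).trans (add_le_add ?_ c3)
      rw [abs_neg]
      refine (abs_add_le _ _).trans ((add_le_add c1 c2).trans_eq ?_)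
      rw [hA]
      ring
    have hprod : ∀ᵐ ρ, HasDerivAt (fun ρ => Φ ρ * (p + (ρ - a) * q))
        (deriv Φ ρ * (p + (ρ - a) * q) + Φ ρ * q) ρ := by
      filter_upwards [hae] with ρ h1
      have hη : HasDerivAt (fun ρ => p + (ρ - a) * q) q ρ := by
        have := (((hasDerivAt_id ρ).sub_const a).mul_const q).const_add p
        simpa using this
      exact h1.1.mul hη
    have hac := hΦac.fun_mul hηac
    have hint := integral_eq_sub_of_ae_hasDerivAt hac hprod
    have hii := intervalIntegrable_of_ae_hasDerivAt hac hprod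
    have hRi : IntervalIntegrable (fun ρ => R ρ * (p + (ρ - a) * q) + Φ ρ * q) volume a b :=
      ((hRc.mul (by fun_prop)).add (hΦc.mul continuous_const)).intervalIntegrable _ _
    have hgoal : (∫ ρ in a..b, (R ρ * (p + (ρ - a) * q) + Φ ρ * q))
        - (Φ b * (p + (b - a) * q) - Φ a * p) =
        ∫ ρ in a..b, ((R ρ * (p + (ρ - a) * q) + Φ ρ * q)
          - (deriv Φ ρ * (p + (ρ - a) * q) + Φ ρ * q)) := by
      rw [intervalIntegral.integral_sub hRi hii, hint, sub_self, zero_mul, add_zero]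
    rw [hgoal, hZsub, ← Real.norm_eq_abs]
    have hbound : ∀ᵐ ρ, ρ ∈ Ioc a b → ‖(R ρ * (p + (ρ - a) * q) + Φ ρ * q)
          - (deriv Φ ρ * (p + (ρ - a) * q) + Φ ρ * q)‖ ≤
        (A ^ 2 * r + M ^ 2 * E ρ ^ 2) + (p ^ 2 + (p + (b - a) * q) ^ 2) := by
      filter_upwards [hae] with ρ h1 hρ
      set η := p + (ρ - a) * q with hη
      have e1 : (R ρ * η + Φ ρ * q) - (deriv Φ ρ * η + Φ ρ * q) = -((deriv Φ ρ - R ρ) * η) := by ring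
      have e2 : η ^ 2 ≤ p ^ 2 + (p + (b - a) * q) ^ 2 := sq_affine_le (Ioc_subset_Icc_self hρ) p q
      rw [e1, norm_neg, Real.norm_eq_abs, abs_mul]
      have e3 : |deriv Φ ρ - R ρ| * |η| ≤ (A * √r + M * |E ρ|) * |η| :=
        mul_le_mul_of_nonneg_right h1.2 (abs_nonneg _)
      have e4 : (A * √r) ^ 2 = A ^ 2 * r := by rw [mul_pow, Real.sq_sqrt hr0]
      have e5 : |E ρ| ^ 2 = E ρ ^ 2 := sq_abs _
      have e6 : |η| ^ 2 = η ^ 2 := sq_abs _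
      have e7 := add_mul_le_sq (X := A * √r) (Y := M * |E ρ|) (N := |η|)
      rw [e4, e6, mul_pow, e5] at e7
      linarith
    refine (intervalIntegral.norm_integral_le_of_norm_le hab hbound
      ((hFc.add continuous_const).intervalIntegrable _ _)).trans ?_
    rw [intervalIntegral.integral_add (hFc.intervalIntegrable _ _) (by simp),
      intervalIntegral.integral_const, smul_eq_mul]

end ScalarWeakForm

/-! ### Quantitative regularity of the exact solution. -/

section Regularity

/-- `Y` is the running integral of the squared derivative. It records oscillations so that they are
square summable over an arbitrary partition, where no uniform bound is at hand. -/
lemma H1Pair.exists_osc {E : Type*} [NormedAddCommGroup E] [NormedSpace ℝ E] {u u' : ℝ → E}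
    (h : H1Pair u u') {C : ℝ} (hC : ∫ s in (0 : ℝ)..1, ‖u' s‖ ^ 2 ≤ C) :
    ∃ Y : ℝ → ℝ, Monotone Y ∧ (∀ ρ, Y (ρ + 1) - Y ρ ≤ C) ∧
      ∀ a b, a ≤ b → ‖u b - u a‖ ^ 2 ≤ (b - a) * (Y b - Y a) := by
  have hY : ∀ a b, (∫ s in (0 : ℝ)..b, ‖u' s‖ ^ 2) - ∫ s in (0 : ℝ)..a, ‖u' s‖ ^ 2 =
      ∫ s in a..b, ‖u' s‖ ^ 2 := fun a b =>
    intervalIntegral.integral_interval_sub_left (h.integrable_sq _ _) (h.integrable_sq _ _)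
  refine ⟨fun ρ => ∫ s in (0 : ℝ)..ρ, ‖u' s‖ ^ 2, fun a b hab => ?_, fun ρ => ?_, fun a b hab => ?_⟩
  · rw [← sub_nonneg, hY]
    exact intervalIntegral.integral_nonneg hab fun _ _ => sq_nonneg _
  · rw [hY, h.per_sq.intervalIntegral_add_eq ρ 0, zero_add]
    exact hC
  · rw [hY]
    exact h.sq_norm_sub_le hab

lemma norm_sub_le_of_deriv_le {E : Type*} [NormedAddCommGroup E] [NormedSpace ℝ E] {u u' : ℝ → E}
    {C : ℝ} (hu : ∀ ρ, HasDerivAt u (u' ρ) ρ) (hb : ∀ ρ, ‖u' ρ‖ ≤ C) (a b : ℝ) :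
    ‖u b - u a‖ ≤ C * |b - a| := by
  have := convex_univ.norm_image_sub_le_of_norm_hasDerivWithin_le
    (fun ρ _ => (hu ρ).hasDerivWithinAt) (fun ρ _ => hb ρ) (mem_univ a) (mem_univ b)
  simpa using this

/-- Integrate the derivative of the inner product of x_ρ with an affine function. Affine tests on
single intervals suffice because finite element test functions are affine on each element. -/
lemma curve_weak_form {T α : ℝ} {f : ℝ → ℝ} {x : ℝ → ℝ → Plane} {w : ℝ → ℝ → ℝ} {t C : ℝ}
    (hx : ∀ ρ, HasDerivAt (x t) (deriv (x t) ρ) ρ)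
    (hlip : ∀ a b, ‖deriv (x t) b - deriv (x t) a‖ ≤ C * |b - a|)
    (hae : ∀ᵐ ρ, HasDerivAt (deriv (x t))
      (curveForce α f (deriv (x t) ρ) (timeDeriv T x t ρ) (w t ρ)) ρ) (a b : ℝ) (p q : Plane) :
    ∫ ρ in a..b, ⟪curveForce α f (deriv (x t) ρ) (timeDeriv T x t ρ) (w t ρ), p + (ρ - a) • q⟫ =
      ⟪deriv (x t) b, p + (b - a) • q⟫ - ⟪deriv (x t) a, p⟫ - ⟪x t b - x t a, q⟫ := by
  have hC : 0 ≤ C := by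
    have := (norm_nonneg _).trans (hlip 0 1)
    simpa using this
  have hη : ∀ ρ, HasDerivAt (fun ρ : ℝ => p + (ρ - a) • q) q ρ := fun ρ => by
    have := (((hasDerivAt_id ρ).sub_const a).smul_const q).const_add p
    simpa using this
  have hac := absolutelyContinuous_inner hlip
    (norm_sub_le_of_deriv_le hη (fun _ => le_refl ‖q‖)) a b
  have hder : ∀ᵐ ρ, HasDerivAt (fun ρ => ⟪deriv (x t) ρ, p + (ρ - a) • q⟫)
      (⟪deriv (x t) ρ, q⟫ +
        ⟪curveForce α f (deriv (x t) ρ) (timeDeriv T x t ρ) (w t ρ), p + (ρ - a) • q⟫) ρ := by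
    filter_upwards [hae] with ρ h1 using h1.inner ℝ (hη ρ)
  have h1 := integral_eq_sub_of_ae_hasDerivAt hac hder
  have h2 := intervalIntegrable_of_ae_hasDerivAt hac hder
  have hpc : Continuous (deriv (x t)) := continuous_of_norm_sub_le hC (fun a b => hlip a b)
  have hqc : Continuous fun ρ => ⟪deriv (x t) ρ, q⟫ := hpc.inner continuous_const
  have h3 : ∫ ρ in a..b, ⟪deriv (x t) ρ, q⟫ = ⟪x t b - x t a, q⟫ := by
    rw [inner_sub_left]
    refine intervalIntegral.integral_eq_sub_of_hasDerivAt (f := fun ρ => ⟪x t ρ, q⟫)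
      (fun ρ _ => ?_) (hqc.intervalIntegrable _ _)
    have := (hx ρ).inner ℝ (hasDerivAt_const ρ q)
    simpa using this
  have h4 := intervalIntegral.integral_sub h2 (hqc.intervalIntegrable a b)
  simp only [add_sub_cancel_left] at h4
  rw [h4, h1, h3]
  simp

/-- The Sobolev regularity of a solution of the system implies the quantitative regularity. -/
theorem exists_reg (T α d m M : ℝ) (hT : 0 < T) (hd : 0 < d) (hm : 0 < m)
    (f : ℝ → ℝ) (g : ℝ → ℝ → ℝ)
    (hf : ContDiff ℝ 1 f) (hg : ContDiff ℝ 1 (fun p : ℝ × ℝ => g p.1 p.2))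
    (x : ℝ → ℝ → Plane) (w : ℝ → ℝ → ℝ)
    (hx_per : ∀ t, Function.Periodic (x t) 1) (hw_per : ∀ t, Function.Periodic (w t) 1)
    (hx_cont : ContinuousOn (fun q : ℝ × ℝ => x q.1 q.2) (Set.Icc 0 T ×ˢ Set.univ))
    (hw_cont : ContinuousOn (fun q : ℝ × ℝ => w q.1 q.2) (Set.Icc 0 T ×ˢ Set.univ))
    (hx₁ : MemWH T 1 ⊤ 2 x) (hx₂ : MemWH T 2 2 1 x)
    (hw₁ : MemCH T 2 w) (hw₂ : MemWH T 1 ⊤ 1 w) (hw₃ : MemWH T 2 2 0 w)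
    (hx_nondeg : ∀ t ∈ Set.Icc 0 T, ∀ ρ, m ≤ ‖deriv (x t) ρ‖ ∧ ‖deriv (x t) ρ‖ ≤ M)
    (hx_eq : SolvesCurveEq T α f x w) (hw_eq : SolvesScalarEq T d g x w) :
    ∃ (K : ℝ) (G : ℝ → ℝ), Reg T α d f g x w K G := by
  have h0T : (0 : ℝ) ∈ Icc 0 T := ⟨le_rfl, hT.le⟩
  have hM : 0 ≤ M := (norm_nonneg _).trans (hx_nondeg 0 h0T 0).2
  have hxc : ∀ t ∈ Icc 0 T, Continuous (x t) := fun t ht => continuous_slice hx_cont ht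
  have hwc : ∀ t ∈ Icc 0 T, Continuous (w t) := fun t ht => continuous_slice hw_cont ht
  -- regularity of the curve
  obtain ⟨Ux, Kx, hKx, hUx, hLx⟩ := hx₁.exists_lipschitz hT hx_per hx_cont
  have hx2 := fun t ht => (hUx t ht).h2 (hx_per t) (hxc t ht)
  have hxd : ∀ t ∈ Icc 0 T, ∀ ρ, HasDerivAt (x t) (deriv (x t) ρ) ρ := fun t ht => (hx2 t ht).1
  have hxdiff := fun s hs t ht => ((hUx t ht).sub (hUx s hs)).h2 ((hx_per t).sub (hx_per s))
    ((hxc t ht).sub (hxc s hs))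
  have hderiv_sub : ∀ s ∈ Icc 0 T, ∀ t ∈ Icc 0 T,
      deriv (x t - x s) = fun ρ => deriv (x t) ρ - deriv (x s) ρ := fun s hs t ht =>
    funext fun ρ => ((hxd t ht ρ).sub (hxd s hs ρ)).deriv
  have hx_time : ∀ s ∈ Icc 0 T, ∀ t ∈ Icc 0 T, ∀ ρ, ‖x t ρ - x s ρ‖ ≤ 2 * Kx * |t - s| := by
    intro s hs t ht ρ
    have h1 := norm_rep_le (Ux t - Ux s) ρ
    rw [← ((hUx t ht).sub (hUx s hs)).eq_rep ((hx_per t).sub (hx_per s))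
      ((hxc t ht).sub (hxc s hs))] at h1
    have h2 := hLx s t
    simp only [Pi.sub_apply] at h1
    linarith
  have hxρ_time : ∀ s ∈ Icc 0 T, ∀ t ∈ Icc 0 T, ∀ ρ,
      ‖deriv (x t) ρ - deriv (x s) ρ‖ ≤ 2 * Kx * |t - s| := by
    intro s hs t ht ρ
    have h1 := (hxdiff s hs t ht).2.1 ρ
    rw [hderiv_sub s hs t ht] at h1
    have h2 := hLx s t
    linarith
  have hxρ_osc : ∀ s ∈ Icc 0 T, ∀ t ∈ Icc 0 T, ∃ Y : ℝ → ℝ, Monotone Y ∧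
      (∀ ρ, Y (ρ + 1) - Y ρ ≤ Kx ^ 2 * (t - s) ^ 2) ∧ ∀ a b, a ≤ b →
      ‖(deriv (x t) b - deriv (x s) b) - (deriv (x t) a - deriv (x s) a)‖ ^ 2 ≤
        (b - a) * (Y b - Y a) := by
    intro s hs t ht
    obtain ⟨u'', h1, h2⟩ := (hxdiff s hs t ht).2.2.2
    have h3 := pow_le_pow_left₀ (norm_nonneg _) (hLx s t) 2
    rw [mul_pow, sq_abs] at h3
    obtain ⟨Y, hY1, hY2, hY3⟩ := h1.exists_osc (h2.trans h3)
    rw [hderiv_sub s hs t ht] at hY3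
    exact ⟨Y, hY1, hY2, hY3⟩
  obtain ⟨G₁, hG₁, hxt_deriv, hxt_est⟩ := hx₂.timeDeriv_estimate hT hx_per hx_cont
  have hxt_le : ∀ t ∈ Icc 0 T, ∀ ρ, ‖timeDeriv T x t ρ‖ ≤ 2 * Kx := fun t ht ρ =>
    norm_le_of_hasDerivWithinAt hT ht (hxt_deriv t ht ρ) fun s hs => hx_time t ht s hs ρ
  have hxt_lip : ∀ t ∈ Icc 0 T, ∀ a b,
      ‖timeDeriv T x t b - timeDeriv T x t a‖ ≤ 2 * Kx * |b - a| := by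
    intro t ht a b
    refine norm_le_of_hasDerivWithinAt hT ht ((hxt_deriv t ht b).sub (hxt_deriv t ht a)) ?_
    intro s hs
    have h1 := norm_sub_le_of_deriv_le (u := fun ρ => x s ρ - x t ρ)
      (fun ρ => (hxd s hs ρ).sub (hxd t ht ρ)) (fun ρ => hxρ_time t ht s hs ρ) a b
    simp only [Pi.sub_apply]
    rw [sub_sub_sub_comm]
    linarith
  -- regularity of the scalar
  obtain ⟨Uw, hUw, hUwc⟩ := hw₁
  obtain ⟨B, hB⟩ := isCompact_Icc.exists_bound_of_continuousOn hUwc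
  have hB0 : 0 ≤ B := (norm_nonneg _).trans (hB 0 h0T)
  have hw2 := fun t ht => (hUw t ht).h2 (hw_per t) (hwc t ht)
  have hwd : ∀ t ∈ Icc 0 T, ∀ ρ, HasDerivAt (w t) (deriv (w t) ρ) ρ := fun t ht => (hw2 t ht).1
  have hw_le : ∀ t ∈ Icc 0 T, ∀ ρ, |w t ρ| ≤ 2 * B := by
    intro t ht ρ
    have h1 := norm_rep_le (Uw t) ρ
    rw [← (hUw t ht).eq_rep (hw_per t) (hwc t ht), Real.norm_eq_abs] at h1
    linarith [hB t ht]
  have hwρ_le : ∀ t ∈ Icc 0 T, ∀ ρ, |deriv (w t) ρ| ≤ 2 * B := by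
    intro t ht ρ
    have h1 := (hw2 t ht).2.1 ρ
    rw [Real.norm_eq_abs] at h1
    linarith [hB t ht]
  obtain ⟨U₁, K₁, hK₁, hU₁, hL₁⟩ := hw₂.exists_lipschitz hT hw_per hw_cont
  have hw_time : ∀ s ∈ Icc 0 T, ∀ t ∈ Icc 0 T, ∀ ρ, |w t ρ - w s ρ| ≤ 2 * K₁ * |t - s| := by
    intro s hs t ht ρ
    have h1 := norm_rep_le (U₁ t - U₁ s) ρ
    rw [← ((hU₁ t ht).sub (hU₁ s hs)).eq_rep ((hw_per t).sub (hw_per s))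
      ((hwc t ht).sub (hwc s hs)), Real.norm_eq_abs] at h1
    have h2 := hL₁ s t
    simp only [Pi.sub_apply] at h1
    linarith
  have hw_osc : ∀ s ∈ Icc 0 T, ∀ t ∈ Icc 0 T, ∃ Y : ℝ → ℝ, Monotone Y ∧
      (∀ ρ, Y (ρ + 1) - Y ρ ≤ K₁ ^ 2 * (t - s) ^ 2) ∧ ∀ a b, a ≤ b →
      ((w t b - w s b) - (w t a - w s a)) ^ 2 ≤ (b - a) * (Y b - Y a) := by
    intro s hs t ht
    obtain ⟨u', h1, -, h2⟩ := ((hU₁ t ht).sub (hU₁ s hs)).exists_h1Pair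
      ((hw_per t).sub (hw_per s)) ((hwc t ht).sub (hwc s hs))
    have h3 := pow_le_pow_left₀ (norm_nonneg _) (hL₁ s t) 2
    rw [mul_pow, sq_abs] at h3
    obtain ⟨Y, hY1, hY2, hY3⟩ := h1.exists_osc (h2.trans h3)
    refine ⟨Y, hY1, hY2, fun a b hab => ?_⟩
    have h4 := hY3 a b hab
    rwa [Real.norm_eq_abs, sq_abs] at h4
  obtain ⟨G₂, hG₂, hwt⟩ := hw₃.timeDeriv_estimate_L2 hT hw_per hw_cont hK₁ hU₁ hL₁
  have hwt_le : ∀ t ∈ Icc 0 T, ∀ ρ, |timeDeriv T w t ρ| ≤ 2 * K₁ := fun t ht ρ =>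
    norm_le_of_hasDerivWithinAt hT ht ((hwt t ht).1 ρ) fun s hs => hw_time t ht s hs ρ
  -- Lipschitz bounds from the equations
  have hIoc : ∀ {t}, t ∈ Ioc 0 T → t ∈ Icc 0 T := fun ht => Ioc_subset_Icc_self ht
  have hne : ∀ t ∈ Icc 0 T, ∀ ρ, deriv (x t) ρ ≠ 0 := fun t ht ρ =>
    norm_pos_iff.1 (hm.trans_le (hx_nondeg t ht ρ).1)
  obtain ⟨C₁, hC₁, hC₁b, -⟩ := exists_curveForce_bound α hf (max M (max (2 * Kx) (2 * B)))
  have hx_ae : ∀ t ∈ Ioc 0 T, ∀ᵐ ρ, HasDerivAt (deriv (x t))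
      (curveForce α f (deriv (x t) ρ) (timeDeriv T x t ρ) (w t ρ)) ρ := by
    intro t ht
    obtain ⟨u'', h1, -⟩ := (hx2 t (hIoc ht)).2.2.2
    exact ae_hasDerivAt_curve hx_eq ht (hne t (hIoc ht)) h1.ae_hasDerivAt
  have hxρ_lip' : ∀ t ∈ Ioc 0 T, ∀ a b, ‖deriv (x t) b - deriv (x t) a‖ ≤ C₁ * |b - a| := by
    intro t ht a b
    obtain ⟨u'', h1, -⟩ := (hx2 t (hIoc ht)).2.2.2
    refine h1.norm_sub_le ?_ a b
    filter_upwards [h1.ae_hasDerivAt, hx_ae t ht] with ρ h2 h3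
    rw [h2.unique h3]
    exact hC₁b _ _ _ ((hx_nondeg t (hIoc ht) ρ).2.trans (le_max_left _ _))
      ((hxt_le t (hIoc ht) ρ).trans ((le_max_left _ _).trans (le_max_right _ _)))
      ((hw_le t (hIoc ht) ρ).trans ((le_max_right _ _).trans (le_max_right _ _)))
  have hxρ_lip : ∀ t ∈ Icc 0 T, ∀ a b, ‖deriv (x t) b - deriv (x t) a‖ ≤ C₁ * |b - a| := by
    intro t ht a b
    -- The curve equation is imposed only for t > 0. At t = 0 the Lipschitz bound is the limit of
    -- those at small positive times, since x_ρ is Lipschitz in time.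
    rcases ht.1.eq_or_lt with rfl | h0
    · have hb : ∀ s ∈ Ioc 0 T, ‖deriv (x 0) b - deriv (x 0) a‖ ≤ C₁ * |b - a| + 4 * Kx * s := by
        intro s hs
        have e1 := hxρ_lip' s hs a b
        have e2 := hxρ_time 0 h0T s (hIoc hs) a
        have e3 := hxρ_time s (hIoc hs) 0 h0T b
        rw [sub_zero, abs_of_pos hs.1] at e2
        rw [zero_sub, abs_neg, abs_of_pos hs.1] at e3
        have e4 : deriv (x 0) b - deriv (x 0) a = (deriv (x 0) b - deriv (x s) b)
            + (deriv (x s) b - deriv (x s) a) + (deriv (x s) a - deriv (x 0) a) := by abel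
        rw [e4]
        refine (norm_add₃_le).trans ?_
        linarith
      refine le_of_forall_pos_le_add fun ε hε => ?_
      have hpos : 0 < min T (ε / (4 * Kx + 1)) := by positivity
      refine (hb _ ⟨hpos, min_le_left _ _⟩).trans (add_le_add le_rfl ?_)
      have h1 : min T (ε / (4 * Kx + 1)) * (4 * Kx + 1) ≤ ε := by
        rw [← le_div_iff₀ (by positivity)]
        exact min_le_right _ _
      nlinarith
    · exact hxρ_lip' t ⟨h0, ht.2⟩ a b
  obtain ⟨Cg, hCg, hCgb, -⟩ := exists_lipschitz_bound hg (max (2 * Kx) (2 * B))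
  have hgb : ∀ v z, |v| ≤ 2 * Kx → |z| ≤ 2 * B → |g v z| ≤ Cg := by
    intro v z hv hz
    refine hCgb (v, z) ?_
    simp only [Prod.norm_def, Real.norm_eq_abs]
    exact max_le_max hv hz
  set C₂ := d⁻¹ * (M * (2 * K₁) + M * Cg + 2 * Kx * (2 * m⁻¹ * C₁) * (2 * B) + 2 * Kx * (2 * B)) * M
      + 2 * B * m⁻¹ * C₁ with hC₂
  have hC₂0 : 0 ≤ C₂ := by positivity
  -- No limit t → 0 is taken here: the gradient of the scalar is only ever evaluated at the new,
  -- positive, time level.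
  have hwρ_lip : ∀ t ∈ Ioc 0 T, ∀ a b, |deriv (w t) b - deriv (w t) a| ≤ C₂ * |b - a| := by
    intro t ht a b
    obtain ⟨u'', h1, -⟩ := (hw2 t (hIoc ht)).2.2.2
    exact h1.norm_sub_le (ae_second_deriv_bound hw_eq hd ht hm hC₁
      (fun ρ => (hx_nondeg t (hIoc ht) ρ).1) (fun ρ => (hx_nondeg t (hIoc ht) ρ).2)
      (hxρ_lip t (hIoc ht)) (hxt_le t (hIoc ht)) (hw_le t (hIoc ht)) (hwρ_le t (hIoc ht))
      (hwt_le t (hIoc ht)) hgb (hx_ae t ht) h1.ae_hasDerivAt) a b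
  set A := 2 * m⁻¹ * C₁ * (2 * B) + 2 * B with hA
  have hm' : 0 < m⁻¹ := inv_pos.2 hm
  set DG := (G₁ T + G₂ T) - (G₁ 0 + G₂ 0) with hDG
  have hDG0 : 0 ≤ DG := by linarith [hG₁ hT.le, hG₂ hT.le]
  -- Every constant is nonnegative, so their sum dominates each of them; 1 is included to have K ≥ 1
  -- and `m⁻¹` for the lower bound on |x_ρ|.
  obtain ⟨K, hK⟩ : ∃ K : ℝ, K = 1 + m⁻¹ + M + 2 * Kx + Kx ^ 2 + C₁ + 2 * B + C₂ + 2 * K₁ + K₁ ^ 2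
      + (A ^ 2 + M ^ 2) + DG := ⟨_, rfl⟩
  have s1 := sq_nonneg Kx
  have s2 := sq_nonneg K₁
  have s3 := sq_nonneg A
  have s4 := sq_nonneg M
  have hmono : Monotone fun t => G₁ t + G₂ t := hG₁.add hG₂
  refine ⟨K, fun t => G₁ t + G₂ t, ?_⟩
  refine
    { one_le := by linarith
      mono := hmono
      G_le := by linarith
      x_per := hx_per
      w_per := hw_per
      x_deriv := hxd
      le_xρ := fun t ht ρ => (inv_le_of_inv_le₀ hm (by linarith)).trans (hx_nondeg t ht ρ).1
      xρ_le := fun t ht ρ => (hx_nondeg t ht ρ).2.trans (by linarith)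
      xρ_lip := fun t ht a b => (hxρ_lip t ht a b).trans
        (mul_le_mul_of_nonneg_right (by linarith) (abs_nonneg _))
      x_time := fun s hs t ht ρ => (hx_time s hs t ht ρ).trans
        (mul_le_mul_of_nonneg_right (by linarith) (abs_nonneg _))
      xρ_time := fun s hs t ht ρ => (hxρ_time s hs t ht ρ).trans
        (mul_le_mul_of_nonneg_right (by linarith) (abs_nonneg _))
      xρ_osc := fun s hs t ht => ?_
      xt_le := fun t ht ρ => (hxt_le t ht ρ).trans (by linarith)
      xt_lip := fun t ht a b => (hxt_lip t ht a b).trans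
        (mul_le_mul_of_nonneg_right (by linarith) (abs_nonneg _))
      xt_est := fun s hs t ht hst ρ => (hxt_est s hs t ht hst ρ).trans
        (mul_le_mul_of_nonneg_left (by linarith [hG₂ hst.le]) (by linarith))
      w_deriv := hwd
      w_le := fun t ht ρ => (hw_le t ht ρ).trans (by linarith)
      wρ_le := fun t ht ρ => (hwρ_le t ht ρ).trans (by linarith)
      wρ_lip := fun t ht a b => (hwρ_lip t ht a b).trans
        (mul_le_mul_of_nonneg_right (by linarith) (abs_nonneg _))
      w_time := fun s hs t ht ρ => (hw_time s hs t ht ρ).trans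
        (mul_le_mul_of_nonneg_right (by linarith) (abs_nonneg _))
      w_osc := fun s hs t ht => ?_
      curve_weak := fun t ht a b p q =>
        curve_weak_form (hxd t (hIoc ht)) (hxρ_lip t (hIoc ht)) (hx_ae t ht) a b p q
      scalar_weak := fun t ht s hs hst => ?_ }
  · obtain ⟨Y, h1, h2, h3⟩ := hxρ_osc s hs t ht
    exact ⟨Y, h1, fun ρ => (h2 ρ).trans
      (mul_le_mul_of_nonneg_right (by linarith) (sq_nonneg _)), h3⟩
  · obtain ⟨Y, h1, h2, h3⟩ := hw_osc s hs t ht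
    exact ⟨Y, h1, fun ρ => (h2 ρ).trans
      (mul_le_mul_of_nonneg_right (by linarith) (sq_nonneg _)), h3⟩
  · obtain ⟨u'', h1, -⟩ := (hw2 t (hIoc ht)).2.2.2
    have hxtc : Continuous (timeDeriv T x t) :=
      continuous_of_norm_sub_le (by positivity) fun a b => hxt_lip t (hIoc ht) a b
    have hxsc : Continuous (deriv (x s)) := continuous_of_norm_sub_le hC₁ fun a b => hxρ_lip s hs a b
    obtain ⟨Z, hZ1, hZ2, hZ3⟩ := scalar_weak_form hw_eq ht hst hm hC₁ hw_per (hxd t (hIoc ht))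
      (hxd s hs) (hwd t (hIoc ht)) (hwc s hs) (hwt t (hIoc ht)).2.1 hg.continuous hxtc hxsc
      (fun ρ => (hx_nondeg t (hIoc ht) ρ).1) (fun ρ => (hx_nondeg t (hIoc ht) ρ).2)
      (fun ρ => (hx_nondeg s hs ρ).2) (hxρ_lip t (hIoc ht)) (hw_le t (hIoc ht))
      (hwρ_le t (hIoc ht)) (hwρ_lip t ht) (hx_ae t ht) h1.ae_hasDerivAt
      (hxt_est s hs t (hIoc ht) hst) ((hwt t (hIoc ht)).2.2 s hs hst)
    have hk : 0 ≤ t - s := by linarith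
    have g1 : 0 ≤ (t - s) * (G₁ t - G₁ s) := mul_nonneg hk (sub_nonneg.2 (hG₁ hst.le))
    have g2 : 0 ≤ (t - s) * (G₂ t - G₂ s) := mul_nonneg hk (sub_nonneg.2 (hG₂ hst.le))
    refine ⟨Z, hZ1, fun ρ => (hZ2 ρ).trans ?_, fun a b hab p q => (hZ3 a b hab p q).trans ?_⟩
    · have e1 : A ^ 2 ≤ K := by linarith
      have e2 : M ^ 2 ≤ K := by linarith
      have e3 : (t - s) * (G₁ t + G₂ t - (G₁ s + G₂ s)) =
          (t - s) * (G₁ t - G₁ s) + (t - s) * (G₂ t - G₂ s) := by ring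
      rw [e3, mul_add]
      exact add_le_add (mul_le_mul_of_nonneg_right e1 g1) (mul_le_mul_of_nonneg_right e2 g2)
    · have e1 : 0 ≤ (b - a) * (p ^ 2 + (p + (b - a) * q) ^ 2) :=
        mul_nonneg (by linarith) (by positivity)
      have e2 : 1 ≤ K := by linarith
      nlinarith

end Regularity

/-! ### Partitions of one period. -/

lemma sum_succ_sub_castSucc {A : Type*} [AddCommGroup A] :
    ∀ (n : ℕ) (φ : Fin (n + 1) → A),
      ∑ j : Fin n, (φ j.succ - φ j.castSucc) = φ (Fin.last n) - φ 0
  | 0, φ => by simp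
  | n + 1, φ => by
    rw [Fin.sum_univ_castSucc]
    have := sum_succ_sub_castSucc n (fun i => φ i.castSucc)
    simp only [Fin.succ_castSucc, Fin.succ_last]
    rw [this]
    simp

lemma integral_affine (a b p q : ℝ) :
    ∫ ρ in a..b, (p + (ρ - a) * q) = (b - a) / 2 * (p + (p + (b - a) * q)) := by
  have h : ∀ ρ ∈ uIcc a b, HasDerivAt (fun r => (r - a) * p + (r - a) ^ 2 / 2 * q)
      (p + (ρ - a) * q) ρ := fun ρ _ => by
    have h1 := ((hasDerivAt_id ρ).sub_const a)
    have h2 := (h1.mul_const p).add (((h1.pow 2).div_const 2).mul_const q)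
    refine h2.congr_deriv ?_
    simp only [Nat.cast_ofNat, id_eq, mul_one, one_mul]
    ring
  rw [intervalIntegral.integral_eq_sub_of_hasDerivAt h
    (by apply Continuous.intervalIntegrable; fun_prop)]
  ring

namespace Partition

section Basic

variable {a b : ℝ} (P : Partition a b)

lemma left_lt_right (j : Fin P.count) : P.left j < P.right j :=
  P.strictMono j.castSucc_lt_succ

lemma step_pos (j : Fin P.count) : 0 < P.step j := sub_pos.2 (P.left_lt_right j)

lemma step_le_maxStep (j : Fin P.count) : P.step j ≤ P.maxStep :=
  le_ciSup (Set.finite_range _).bddAbove j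

lemma sum_telescope {A : Type*} [AddCommGroup A] (Y : ℝ → A) :
    ∑ j, (Y (P.right j) - Y (P.left j)) = Y b - Y a := by
  have := sum_succ_sub_castSucc P.count (fun i => Y (P.node i))
  simp only [P.first, P.last] at this
  exact this

lemma sum_step : ∑ j, P.step j = b - a := P.sum_telescope (fun r => r)

lemma exists_mem_Ico {ρ : ℝ} (hρ : ρ ∈ Ico a b) : ∃ j, ρ ∈ Ico (P.left j) (P.right j) := by
  by_contra hcon
  push Not at hcon
  have h : ∀ i, P.node i ≤ ρ := by
    intro i
    induction i using Fin.induction with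
    | zero => rw [P.first]; exact hρ.1
    | succ j ih =>
      by_contra h
      exact hcon j ⟨ih, not_le.1 h⟩
  have := h (Fin.last _)
  rw [P.last] at this
  exact absurd hρ.2 (not_lt.2 this)

lemma node_mem (i : Fin (P.count + 1)) : P.node i ∈ Icc a b := by
  constructor
  · exact P.first.symm.le.trans (P.strictMono.monotone (Fin.zero_le i))
  · exact (P.strictMono.monotone (Fin.le_last i)).trans P.last.le

lemma left_mem (j : Fin P.count) : P.left j ∈ Icc a b := P.node_mem _

lemma right_mem (j : Fin P.count) : P.right j ∈ Icc a b := P.node_mem _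

/-- Mass lumping is the trapezoidal rule on each element. From here on the lumped terms are sums
over nodal values. -/
lemma lumped_eq (φ : Fin P.count → ℝ → ℝ) :
    P.lumped φ = ∑ j, P.step j / 2 * (φ j (P.left j) + φ j (P.right j)) := by
  refine Finset.sum_congr rfl fun j _ => ?_
  simp only [localInterp, grad, smul_eq_mul]
  rw [integral_affine]
  have h : P.right j - P.left j ≠ 0 := (P.step_pos j).ne'
  simp only [step]
  field_simp
  ring

lemma integral_const_eq (c : Fin P.count → ℝ) :
    P.integral (fun j _ => c j) = ∑ j, P.step j * c j := by
  simp [integral, step]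

/-- A nonnegative function that is bounded on each subinterval. -/
lemma integral_le_sum {φ : ℝ → ℝ} (hab : a ≤ b) (hφ : ∀ ρ, 0 ≤ φ ρ) {B : Fin P.count → ℝ}
    (h : ∀ j, ∀ ρ ∈ Ioo (P.left j) (P.right j), φ ρ ≤ B j) :
    ∫ ρ in a..b, φ ρ ≤ ∑ j, P.step j * B j := by
  have hint : ∀ j, Integrable (indicator (Ioo (P.left j) (P.right j)) fun _ => B j) volume :=
    fun j => (integrable_indicator_iff measurableSet_Ioo).2 (by simp)
  have hB : ∀ j, 0 ≤ B j := fun j => by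
    obtain ⟨ρ, hρ⟩ := exists_between (P.left_lt_right j)
    exact (hφ ρ).trans (h j ρ hρ)
  have hnn : ∀ j ρ, 0 ≤ indicator (Ioo (P.left j) (P.right j)) (fun _ => B j) ρ :=
    fun j ρ => indicator_nonneg (fun _ _ => hB j) ρ
  rw [intervalIntegral.integral_of_le hab]
  have key : ∫ ρ in Ioc a b, φ ρ ≤
      ∫ ρ in Ioc a b, ∑ j, indicator (Ioo (P.left j) (P.right j)) (fun _ => B j) ρ := by
    refine integral_mono_of_nonneg (Filter.Eventually.of_forall hφ)
      (integrable_finsetSum _ fun j _ => (hint j).integrableOn) ?_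
    -- The bound is known only inside the open elements, since a finite element function may have
    -- kinks at the nodes; the nodes form a null set.
    have hfin : (range P.node).Finite := Set.finite_range _
    have hnull : ∀ᵐ ρ ∂(volume.restrict (Ioc a b)), ρ ∉ range P.node :=
      ae_restrict_of_ae (hfin.countable.ae_notMem _)
    filter_upwards [hnull, ae_restrict_mem measurableSet_Ioc] with ρ h1 h2
    have hb : ρ ≠ b := fun e => h1 ⟨Fin.last _, by rw [P.last, e]⟩
    obtain ⟨j, hj⟩ := P.exists_mem_Ico ⟨h2.1.le, lt_of_le_of_ne h2.2 hb⟩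
    have hj' : ρ ∈ Ioo (P.left j) (P.right j) :=
      ⟨lt_of_le_of_ne hj.1 fun e => h1 ⟨j.castSucc, e⟩, hj.2⟩
    calc φ ρ ≤ B j := h j ρ hj'
      _ = indicator (Ioo (P.left j) (P.right j)) (fun _ => B j) ρ := by
        rw [indicator_of_mem hj']
      _ ≤ _ := Finset.single_le_sum (f := fun j =>
          indicator (Ioo (P.left j) (P.right j)) (fun _ => B j) ρ)
          (fun j _ => hnn j ρ) (Finset.mem_univ j)
  refine key.trans ?_
  rw [integral_finsetSum _ fun j _ => (hint j).integrableOn]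
  refine Finset.sum_le_sum fun j _ => ?_
  refine (setIntegral_le_integral (hint j) (Filter.Eventually.of_forall (hnn j))).trans ?_
  rw [integral_indicator measurableSet_Ioo]
  have := max_eq_left (P.step_pos j).le
  simp only [step] at this
  simp [step, this]

end Basic

section Periodic

variable {ρ₀ : ℝ} (P : Partition ρ₀ (ρ₀ + 1))
variable {E : Type*} [NormedAddCommGroup E] [NormedSpace ℝ E]

lemma sum_step_one : ∑ j, P.step j = 1 := by rw [P.sum_step]; ring

lemma count_pos : 0 < P.count := by
  rcases Nat.eq_zero_or_pos P.count with h | h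
  · have h1 := P.sum_step_one
    have : IsEmpty (Fin P.count) := by rw [h]; infer_instance
    simp at h1
  · exact h

lemma maxStep_pos : 0 < P.maxStep :=
  (P.step_pos ⟨0, P.count_pos⟩).trans_le (P.step_le_maxStep _)

/-- The subinterval that follows the `j`-th one on the periodic unit interval. -/
def next : Equiv.Perm (Fin P.count) := finRotate P.count

/-- The last element is followed by the first, whose left end point lies one period further left.
This is the only place where the shift by one occurs. -/
lemma left_next (j : Fin P.count) :
    P.left (P.next j) = P.right j ∨ P.left (P.next j) + 1 = P.right j := by
  rcases P with ⟨n, node, hmono, h0, hl⟩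
  cases n with
  | zero => exact j.elim0
  | succ n =>
    simp only [next, left, right] at *
    rcases eq_or_ne j (Fin.last n) with rfl | hj
    · right
      rw [finRotate_last, Fin.castSucc_zero, Fin.succ_last, h0, hl]
    · left
      have : j < Fin.last n := lt_of_le_of_ne (Fin.le_last j) hj
      congr 1
      ext
      rw [Fin.val_castSucc, coe_finRotate_of_ne_last hj, Fin.val_succ]

lemma apply_left_next {F : Type*} {u : ℝ → F} (hu : Function.Periodic u 1) (j : Fin P.count) :
    u (P.left (P.next j)) = u (P.right j) := by
  rcases P.left_next j with h | h
  · rw [h]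
  · rw [← h, hu]

lemma sum_next {A : Type*} [AddCommMonoid A] (φ : Fin P.count → A) :
    ∑ j, φ (P.next j) = ∑ j, φ j := Equiv.sum_comp P.next φ

lemma sum_boundary {u : ℝ → ℝ} (hu : Function.Periodic u 1) :
    ∑ j, (u (P.right j) - u (P.left j)) = 0 := by
  rw [P.sum_telescope, hu, sub_self]

lemma sum_mono_le {Y : ℝ → ℝ} {c : ℝ} (h : ∀ ρ, Y (ρ + 1) - Y ρ ≤ c) :
    ∑ j, (Y (P.right j) - Y (P.left j)) ≤ c := by
  rw [P.sum_telescope]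
  exact h ρ₀

end Periodic

end Partition

/-! ### Finite element functions and interpolation. -/

section FE

variable {ρ₀ : ℝ} (P : Partition ρ₀ (ρ₀ + 1))
variable {E : Type*} [NormedAddCommGroup E] [NormedSpace ℝ E]

/-- Continuity carries the affine formula from the open element to its closure, which then
determines the two coefficients from the end values. -/
lemma IsFE.eq_localInterp {P : Partition ρ₀ (ρ₀ + 1)} {χ : ℝ → E} (h : IsFE P χ)
    (j : Fin P.count) {ρ : ℝ} (hρ : ρ ∈ Icc (P.left j) (P.right j)) :
    χ ρ = P.localInterp j χ ρ := by
  obtain ⟨a, b, hab⟩ := h.2.2 j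
  have hcl : EqOn χ (fun r => a + r • b) (Icc (P.left j) (P.right j)) := by
    rw [← closure_Ioo (P.left_lt_right j).ne]
    exact EqOn.closure hab h.1 (by fun_prop)
  have h1 := hcl (left_mem_Icc.2 (P.left_lt_right j).le)
  have h2 := hcl (right_mem_Icc.2 (P.left_lt_right j).le)
  have h3 := hcl hρ
  simp only at h1 h2 h3
  have hs : P.step j ≠ 0 := (P.step_pos j).ne'
  rw [h3, Partition.localInterp, Partition.grad, h1, h2,
    show a + P.right j • b - (a + P.left j • b) = P.step j • b by
      simp only [Partition.step, sub_smul]; abel,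
    smul_smul, smul_smul, inv_mul_cancel_right₀ hs, sub_smul]
  abel

/-- Modulo the period every left end point is the right end point of the preceding element, so the
right end points carry all degrees of freedom without repetition. -/
lemma IsFE.ext {P : Partition ρ₀ (ρ₀ + 1)} {χ ψ : ℝ → E} (h : IsFE P χ) (k : IsFE P ψ)
    (hr : ∀ j, χ (P.right j) = ψ (P.right j)) : χ = ψ := by
  have hl : ∀ j, χ (P.left j) = ψ (P.left j) := fun j => by
    have := hr (P.next.symm j)
    rw [← P.apply_left_next h.2.1, ← P.apply_left_next k.2.1] at this
    simpa using this
  funext ρ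
  obtain ⟨y, hy, hy'⟩ := h.2.1.exists_mem_Ico (zero_lt_one) ρ ρ₀
  have hfg : ∀ z ∈ Ico ρ₀ (ρ₀ + 1), χ z = ψ z := fun z hz => by
    obtain ⟨j, hj⟩ := P.exists_mem_Ico hz
    have hj' := Ico_subset_Icc_self hj
    rw [h.eq_localInterp j hj', k.eq_localInterp j hj']
    simp only [Partition.localInterp, Partition.grad, hr, hl]
  have e1 := (h.2.1.sub k.2.1).exists_mem_Ico (zero_lt_one) ρ ρ₀
  obtain ⟨z, hz, hz'⟩ := e1
  simp only [Pi.sub_apply, hfg z hz, sub_self] at hz'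
  exact sub_eq_zero.1 hz'

/-- A continuous function that is affine between consecutive points and takes given values at
them. -/
lemma exists_piecewise_affine (y : ℕ → ℝ) (v : ℕ → E) (n : ℕ) (hy : ∀ i < n, y i < y (i + 1)) :
    ∃ F : ℝ → E, Continuous F ∧ (∀ i ≤ n, F (y i) = v i) ∧
      (∀ i < n, ∃ a b : E, ∀ ρ ∈ Icc (y i) (y (i + 1)), F ρ = a + ρ • b) ∧
      ∃ a b : E, ∀ ρ, y n ≤ ρ → F ρ = a + ρ • b := by
  induction n with
  | zero =>
    refine ⟨fun _ => v 0, continuous_const, fun i hi => by simp [Nat.le_zero.1 hi],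
      fun i hi => absurd hi (Nat.not_lt_zero i), v 0, 0, fun ρ _ => by simp⟩
  | succ n ih =>
    obtain ⟨F, hF, hv, haff, a, b, hab⟩ := ih fun i hi => hy i (hi.trans n.lt_succ_self)
    have hn := hy n n.lt_succ_self
    have hmono : ∀ i ≤ n, y i ≤ y n := fun i hi => by
      have : ∀ m, i ≤ m → m ≤ n → y i ≤ y m := by
        intro m him
        induction m, him using Nat.le_induction with
        | base => intro _; exact le_rfl
        | succ m _ ihm => intro hm; exact (ihm (by omega)).trans (hy m (by omega)).le
      exact this n hi le_rfl
    -- The change of slope at `y n` that corrects the value at `y (n + 1)`; the added hinge function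
    -- vanishes to the left of `y n`.
    set c : E := (y (n + 1) - y n)⁻¹ • (v (n + 1) - F (y (n + 1))) with hc
    have hz : ∀ ρ ≤ y n, max (ρ - y n) 0 = 0 := fun ρ hρ => max_eq_right (by linarith)
    refine ⟨fun ρ => F ρ + max (ρ - y n) 0 • c, by fun_prop, ?_, ?_, ?_⟩
    · intro i hi
      rcases Nat.lt_or_eq_of_le hi with h | h
      · have h' : i ≤ n := Nat.lt_succ_iff.1 h
        simp only [hz _ (hmono i h'), zero_smul, add_zero, hv i h']
      · subst h
        simp only
        rw [max_eq_left (by linarith), hc, smul_smul, mul_inv_cancel₀ (by linarith), one_smul]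
        abel
    · intro i hi
      rcases Nat.lt_or_eq_of_le (Nat.lt_succ_iff.1 hi) with h | h
      · obtain ⟨a', b', h'⟩ := haff i h
        refine ⟨a', b', fun ρ hρ => ?_⟩
        simp only
        rw [hz _ (hρ.2.trans (hmono _ h)), zero_smul, add_zero, h' ρ hρ]
      · subst h
        refine ⟨a - y i • c, b + c, fun ρ hρ => ?_⟩
        simp only
        rw [max_eq_left (by linarith [hρ.1]), hab ρ hρ.1, sub_smul, smul_add]
        abel
    · refine ⟨a - y n • c, b + c, fun ρ hρ => ?_⟩
      simp only
      rw [max_eq_left (by linarith), hab ρ (by linarith), sub_smul, smul_add]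
      abel

lemma exists_isInterp {u : ℝ → E} (hu : Function.Periodic u 1) : ∃ χ, IsInterp P u χ := by
  set y : ℕ → ℝ := fun i => if h : i < P.count + 1 then P.node ⟨i, h⟩ else 0 with hy
  have hyn : ∀ i : Fin (P.count + 1), y i = P.node i := fun i => by
    simp only [hy, i.2, dite_true]
  have hyL : ∀ j : Fin P.count, y j = P.left j := fun j => hyn j.castSucc
  have hyR : ∀ j : Fin P.count, y (j + 1) = P.right j := fun j => hyn j.succ
  obtain ⟨F, hF, hv, haff, -⟩ := exists_piecewise_affine y (fun i => u (y i)) P.count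
    (fun i hi => by
      have := P.left_lt_right ⟨i, hi⟩
      rwa [← hyL, ← hyR] at this)
  have hFn : ∀ i, F (P.node i) = u (P.node i) := fun i => by
    rw [← hyn]; exact hv i (Nat.lt_succ_iff.1 i.2)
  have hF0 : F ρ₀ = u ρ₀ := by have := hFn 0; rwa [P.first] at this
  have hF1 : F (ρ₀ + 1) = u ρ₀ := by have := hFn (Fin.last _); rwa [P.last, hu] at this
  -- The interpolant on one period is repeated. Its end values agree because `u` is periodic, so no
  -- jump arises at the seam.
  set χ : ℝ → E := fun ρ => F (ρ₀ + Int.fract (ρ - ρ₀)) with hχ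
  have hcont : Continuous χ := by
    have h1 : Continuous ((fun r => F (ρ₀ + r)) ∘ Int.fract) :=
      ContinuousOn.comp_fract'' (by fun_prop) (by simp [hF0, hF1])
    exact h1.comp (continuous_sub_right ρ₀)
  have hper : Function.Periodic χ 1 := fun ρ => by
    simp only [hχ]
    rw [show ρ + 1 - ρ₀ = ρ - ρ₀ + 1 by ring, Int.fract_add_one]
  have heq : ∀ ρ ∈ Icc ρ₀ (ρ₀ + 1), χ ρ = F ρ := fun ρ hρ => by
    rcases eq_or_lt_of_le hρ.2 with h | h
    · rw [h, hper, hF1, ← hF0]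
      simp [hχ]
    · simp only [hχ]
      rw [Int.fract_eq_self.2 ⟨by linarith [hρ.1], by linarith⟩]
      congr 1; ring
  refine ⟨χ, ⟨hcont, hper, fun j => ?_⟩, fun i => by rw [heq _ (P.node_mem i), hFn]⟩
  obtain ⟨a, b, hab⟩ := haff j j.2
  refine ⟨a, b, fun ρ hρ => ?_⟩
  rw [heq ρ ⟨(P.left_mem j).1.trans hρ.1.le, hρ.2.le.trans (P.right_mem j).2⟩]
  refine hab ρ ?_
  rw [hyL, hyR]
  exact Ioo_subset_Icc_self hρ

lemma IsInterp.left {P : Partition ρ₀ (ρ₀ + 1)} {u χ : ℝ → E} (h : IsInterp P u χ)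
    (j : Fin P.count) : χ (P.left j) = u (P.left j) := h.2 _

lemma IsInterp.right {P : Partition ρ₀ (ρ₀ + 1)} {u χ : ℝ → E} (h : IsInterp P u χ)
    (j : Fin P.count) : χ (P.right j) = u (P.right j) := h.2 _

lemma IsInterp.grad {P : Partition ρ₀ (ρ₀ + 1)} {u χ : ℝ → E} (h : IsInterp P u χ)
    (j : Fin P.count) : P.grad χ j = P.grad u j := by
  simp only [Partition.grad, h.left, h.right]

/-- A periodic function with prescribed values at the right end points. -/
lemma exists_periodic_right (c : Fin P.count → E) :
    ∃ u : ℝ → E, Function.Periodic u 1 ∧ ∀ j, u (P.right j) = c j := by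
  classical
  refine ⟨fun ρ => ∑ j, if Int.fract (ρ - P.right j) = 0 then c j else 0, fun ρ => ?_,
    fun i => ?_⟩
  · refine Finset.sum_congr rfl fun j _ => ?_
    rw [show ρ + 1 - P.right j = ρ - P.right j + 1 by ring, Int.fract_add_one]
  · simp only
    rw [Finset.sum_eq_single i]
    · simp
    · intro j _ hj
      rw [if_neg]
      intro h0
      obtain ⟨z, hz⟩ := Int.fract_eq_zero_iff.1 h0
      have hi := P.right_mem i
      have hj' := P.right_mem j
      have hil : ρ₀ < P.right i := (P.left_mem i).1.trans_lt (P.left_lt_right i)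
      have hjl : ρ₀ < P.right j := (P.left_mem j).1.trans_lt (P.left_lt_right j)
      have h1 : (z : ℝ) < 1 := by rw [hz]; linarith [hi.2]
      have h2 : (-1 : ℝ) < z := by rw [hz]; linarith [hj'.2]
      have hz0 : z = 0 := by
        have h1' : z < 1 := by exact_mod_cast h1
        have h2' : -1 < z := by exact_mod_cast h2
        omega
      rw [hz0, Int.cast_zero] at hz
      have heq : P.right i = P.right j := by linarith
      exact hj (Fin.succ_injective _ (P.strictMono.injective heq)).symm
    · simp
end FE

/-- The trapezoidal rule is exact for affine functions, so a pointwise affine bound on the deviation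
from an affine function integrates to a bound with nodal weights. -/
lemma abs_integral_sub_le {F : ℝ → ℝ} {a b A A' C C' : ℝ} (hab : a ≤ b)
    (hF : IntervalIntegrable F volume a b)
    (h : ∀ ρ ∈ Icc a b, |F ρ - (A + (ρ - a) * A')| ≤ C + (ρ - a) * C') :
    |(∫ ρ in a..b, F ρ) - (b - a) / 2 * (A + (A + (b - a) * A'))| ≤
      (b - a) / 2 * (C + (C + (b - a) * C')) := by
  have hi : ∀ p q : ℝ, IntervalIntegrable (fun ρ => p + (ρ - a) * q) volume a b :=
    fun p q => by apply Continuous.intervalIntegrable; fun_prop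
  rw [← integral_affine, ← integral_affine, ← intervalIntegral.integral_sub hF (hi _ _)]
  refine (intervalIntegral.abs_integral_le_integral_abs hab).trans ?_
  exact intervalIntegral.integral_mono_on hab (hF.sub (hi _ _)).abs (hi _ _) h

/-- Mass lumping against an affine test function. -/
lemma abs_integral_inner_sub_le {E : Type*} [NormedAddCommGroup E] [InnerProductSpace ℝ E]
    {φ : ℝ → E} {a b : ℝ} (hab : a < b) (hφ : Continuous φ) {cL cR : E} {BL BR : ℝ}
    (hL : ∀ ρ ∈ Icc a b, ‖φ ρ - cL‖ ≤ BL) (hR : ∀ ρ ∈ Icc a b, ‖φ ρ - cR‖ ≤ BR) (p q : E) :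
    |(∫ ρ in a..b, ⟪φ ρ, p + (ρ - a) • q⟫)
        - (b - a) / 2 * (⟪cL, p⟫ + ⟪cR, p + (b - a) • q⟫)| ≤
      (b - a) / 2 * (BL * ‖p‖ + BR * ‖p + (b - a) • q‖) := by
  have hba : 0 < b - a := sub_pos.2 hab
  set r := p + (b - a) • q with hr
  have key := abs_integral_sub_le (F := fun ρ => ⟪φ ρ, p + (ρ - a) • q⟫)
    (A := ⟪cL, p⟫) (A' := (b - a)⁻¹ * (⟪cR, r⟫ - ⟪cL, p⟫)) (C := BL * ‖p‖)
    (C' := (b - a)⁻¹ * (BR * ‖r‖ - BL * ‖p‖)) hab.le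
    (by apply Continuous.intervalIntegrable; fun_prop) ?_
  · rw [mul_inv_cancel_left₀ hba.ne', mul_inv_cancel_left₀ hba.ne', add_sub_cancel,
      add_sub_cancel] at key
    exact key
  · intro ρ hρ
    -- In barycentric form the test function is (1 - θ) p + θ r, and φ is compared with `cL` in the
    -- first part and with `cR` in the second. The bound then contains only nodal values of the test
    -- function and never its gradient.
    set θ := (ρ - a) * (b - a)⁻¹ with hθ
    have hθ0 : 0 ≤ θ := mul_nonneg (by linarith [hρ.1]) (inv_nonneg.2 hba.le)
    have hθ1 : θ ≤ 1 := by
      rw [hθ, ← div_eq_mul_inv, div_le_one hba]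
      linarith [hρ.2]
    have hq : p + (ρ - a) • q = (1 - θ) • p + θ • r := by
      rw [hr, smul_add, smul_smul, hθ, inv_mul_cancel_right₀ hba.ne']
      module
    have e1 : ⟪φ ρ, p + (ρ - a) • q⟫
        - (⟪cL, p⟫ + (ρ - a) * ((b - a)⁻¹ * (⟪cR, r⟫ - ⟪cL, p⟫))) =
        (1 - θ) * ⟪φ ρ - cL, p⟫ + θ * ⟪φ ρ - cR, r⟫ := by
      rw [hq, ← mul_assoc, ← hθ]
      simp only [inner_add_right, inner_smul_right, inner_sub_left]
      ring
    have e2 : BL * ‖p‖ + (ρ - a) * ((b - a)⁻¹ * (BR * ‖r‖ - BL * ‖p‖)) =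
        (1 - θ) * (BL * ‖p‖) + θ * (BR * ‖r‖) := by
      rw [← mul_assoc, ← hθ]; ring
    rw [e1, e2]
    have i1 : |⟪φ ρ - cL, p⟫| ≤ BL * ‖p‖ := (abs_real_inner_le_norm _ _).trans
      (mul_le_mul_of_nonneg_right (hL ρ hρ) (norm_nonneg _))
    have i2 : |⟪φ ρ - cR, r⟫| ≤ BR * ‖r‖ := (abs_real_inner_le_norm _ _).trans
      (mul_le_mul_of_nonneg_right (hR ρ hρ) (norm_nonneg _))
    refine (abs_add_le _ _).trans (add_le_add ?_ ?_)
    · rw [abs_mul, abs_of_nonneg (by linarith : (0 : ℝ) ≤ 1 - θ)]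
      exact mul_le_mul_of_nonneg_left i1 (by linarith)
    · rw [abs_mul, abs_of_nonneg hθ0]
      exact mul_le_mul_of_nonneg_left i2 hθ0

/-! ### Discrete norms, inverse inequalities and summation by parts. -/

namespace Partition

section Norms

variable {a b : ℝ} (P : Partition a b)
variable {E : Type*} [NormedAddCommGroup E] [NormedSpace ℝ E]

/-- The square of the mass-lumped `L²` norm. -/
def massSq (u : ℝ → E) : ℝ := ∑ j, P.step j / 2 * (‖u (P.left j)‖ ^ 2 + ‖u (P.right j)‖ ^ 2)

/-- The square of the `L²` norm of the derivative of the interpolant. -/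
def gradSq (u : ℝ → E) : ℝ := ∑ j, P.step j * ‖P.grad u j‖ ^ 2

lemma massSq_nonneg (u : ℝ → E) : 0 ≤ P.massSq u :=
  Finset.sum_nonneg fun j _ => by have := P.step_pos j; positivity

lemma gradSq_nonneg (u : ℝ → E) : 0 ≤ P.gradSq u :=
  Finset.sum_nonneg fun j _ => by have := P.step_pos j; positivity

lemma grad_sub (u v : ℝ → E) (j : Fin P.count) :
    P.grad (fun ρ => u ρ - v ρ) j = P.grad u j - P.grad v j := by
  simp only [grad, ← smul_sub]
  congr 1
  abel

lemma grad_add (u v : ℝ → E) (j : Fin P.count) : P.grad (u + v) j = P.grad u j + P.grad v j := by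
  simp only [grad, ← smul_add, Pi.add_apply]
  congr 1
  abel

lemma grad_smul (c : ℝ) (u : ℝ → E) (j : Fin P.count) : P.grad (c • u) j = c • P.grad u j := by
  simp only [grad, Pi.smul_apply, ← smul_sub, smul_comm c]

lemma grad_diffQuot (k : ℝ) (u v : ℝ → E) (j : Fin P.count) :
    P.grad (diffQuot k u v) j = k⁻¹ • (P.grad v j - P.grad u j) := by
  simp only [grad, diffQuot, ← smul_sub, smul_comm k⁻¹]
  congr 2
  abel

lemma step_smul_grad (u : ℝ → E) (j : Fin P.count) :
    P.step j • P.grad u j = u (P.right j) - u (P.left j) := by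
  rw [grad, smul_smul, mul_inv_cancel₀ (P.step_pos j).ne', one_smul]

lemma left_add_grad (u : ℝ → E) (j : Fin P.count) :
    u (P.left j) + (P.right j - P.left j) • P.grad u j = u (P.right j) := by
  have := P.step_smul_grad u j
  rw [step] at this
  rw [this]
  abel

lemma step_mul_norm_grad_sq_le (u : ℝ → E) (j : Fin P.count) :
    P.step j * ‖P.grad u j‖ ^ 2 ≤ P.gradSq u :=
  Finset.single_le_sum (f := fun j => P.step j * ‖P.grad u j‖ ^ 2)
    (fun i _ => by have := P.step_pos i; positivity) (Finset.mem_univ j)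

lemma step_mul_norm_sq_le (u : ℝ → E) (j : Fin P.count) :
    P.step j / 2 * (‖u (P.left j)‖ ^ 2 + ‖u (P.right j)‖ ^ 2) ≤ P.massSq u :=
  Finset.single_le_sum
    (f := fun j => P.step j / 2 * (‖u (P.left j)‖ ^ 2 + ‖u (P.right j)‖ ^ 2))
    (fun i _ => by have := P.step_pos i; positivity) (Finset.mem_univ j)

/-- Inverse inequality for the gradient. -/
lemma norm_grad_sq_le {c : ℝ} (hq : ∀ j, P.maxStep ≤ c * P.step j) (u : ℝ → E) (j : Fin P.count) :
    P.maxStep * ‖P.grad u j‖ ^ 2 ≤ c * P.gradSq u := by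
  have h1 := P.step_mul_norm_grad_sq_le u j
  have hc : 0 ≤ c := by
    by_contra h
    have := mul_neg_of_neg_of_pos (not_le.1 h) (P.step_pos j)
    linarith [hq j, P.step_pos j, P.step_le_maxStep j]
  calc P.maxStep * ‖P.grad u j‖ ^ 2 ≤ c * P.step j * ‖P.grad u j‖ ^ 2 :=
        mul_le_mul_of_nonneg_right (hq j) (by positivity)
    _ = c * (P.step j * ‖P.grad u j‖ ^ 2) := by ring
    _ ≤ _ := mul_le_mul_of_nonneg_left h1 hc

/-- Inverse inequality for the nodal values. -/
lemma norm_sq_le {c : ℝ} (hq : ∀ j, P.maxStep ≤ c * P.step j) (u : ℝ → E) (j : Fin P.count) :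
    P.maxStep * ‖u (P.left j)‖ ^ 2 ≤ 2 * c * P.massSq u ∧
      P.maxStep * ‖u (P.right j)‖ ^ 2 ≤ 2 * c * P.massSq u := by
  have h1 := P.step_mul_norm_sq_le u j
  have hc : 0 ≤ c := by
    by_contra h
    have := mul_neg_of_neg_of_pos (not_le.1 h) (P.step_pos j)
    linarith [hq j, P.step_pos j, P.step_le_maxStep j]
  have h2 : P.maxStep * (‖u (P.left j)‖ ^ 2 + ‖u (P.right j)‖ ^ 2) ≤ 2 * c * P.massSq u := by
    calc P.maxStep * (‖u (P.left j)‖ ^ 2 + ‖u (P.right j)‖ ^ 2)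
        ≤ c * P.step j * (‖u (P.left j)‖ ^ 2 + ‖u (P.right j)‖ ^ 2) :=
          mul_le_mul_of_nonneg_right (hq j) (by positivity)
      _ = 2 * c * (P.step j / 2 * (‖u (P.left j)‖ ^ 2 + ‖u (P.right j)‖ ^ 2)) := by ring
      _ ≤ _ := mul_le_mul_of_nonneg_left h1 (by positivity)
  have hm : 0 ≤ P.maxStep := (P.step_pos j).le.trans (P.step_le_maxStep j)
  constructor <;>
  nlinarith [mul_nonneg hm (sq_nonneg ‖u (P.left j)‖), mul_nonneg hm (sq_nonneg ‖u (P.right j)‖)]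

end Norms

/-- Summation by parts with a piecewise constant direction `τ`. -/
lemma sum_by_parts {ρ₀ : ℝ} (P : Partition ρ₀ (ρ₀ + 1)) {D : ℝ → Plane} {ζ : ℝ → ℝ}
    (hD : Function.Periodic D 1) (hζ : Function.Periodic ζ 1) (τ : Fin P.count → Plane) :
    ∑ j, P.step j / 2 * (⟪P.grad D j, τ j⟫ * ζ (P.left j) + ⟪P.grad D j, τ j⟫ * ζ (P.right j)) =
      ∑ j, ⟪D (P.right j), τ j - τ (P.next j)⟫ * ζ (P.right j)
      - ∑ j, P.step j / 2 *
        (⟪D (P.left j), τ j⟫ * P.grad ζ j + ⟪D (P.right j), τ j⟫ * P.grad ζ j) := by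
  -- A cyclic shift of the index: by periodicity the right end of one element is the left end of the
  -- next. What remains of the boundary terms is the jump of τ at the node.
  have h1 : ∑ j, ⟪D (P.right j), τ (P.next j)⟫ * ζ (P.right j) =
      ∑ j, ⟪D (P.left j), τ j⟫ * ζ (P.left j) := by
    rw [← P.sum_next (fun j => ⟪D (P.left j), τ j⟫ * ζ (P.left j))]
    refine Finset.sum_congr rfl fun j _ => ?_
    rw [P.apply_left_next hD, P.apply_left_next hζ]
  simp only [inner_sub_right, sub_mul, Finset.sum_sub_distrib]
  rw [h1, ← Finset.sum_sub_distrib, ← Finset.sum_sub_distrib]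
  refine Finset.sum_congr rfl fun j _ => ?_
  have e1 : P.step j * ⟪P.grad D j, τ j⟫ = ⟪D (P.right j), τ j⟫ - ⟪D (P.left j), τ j⟫ := by
    rw [← inner_sub_left, ← P.step_smul_grad, real_inner_smul_left]
  have e2 : P.step j * P.grad ζ j = ζ (P.right j) - ζ (P.left j) := by
    rw [← P.step_smul_grad, smul_eq_mul]
  linear_combination (ζ (P.left j) + ζ (P.right j)) / 2 * e1
    + (⟪D (P.left j), τ j⟫ + ⟪D (P.right j), τ j⟫) / 2 * e2

end Partition

/-! ### Definite linear systems on the finite element space. -/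

section Solvability

/-- Definiteness makes the map into the dual space injective, and the dimensions agree. Symmetry is
not required, which matters for the advection term of the scalar scheme. -/
lemma existsUnique_of_definite {V : Type*} [AddCommGroup V] [Module ℝ V] [FiniteDimensional ℝ V]
    (B : V →ₗ[ℝ] V →ₗ[ℝ] ℝ) (hB : ∀ u, B u u = 0 → u = 0) (ℓ : V →ₗ[ℝ] ℝ) : ∃! u, B u = ℓ := by
  have hinj : Function.Injective B := by
    rw [← LinearMap.ker_eq_bot, LinearMap.ker_eq_bot']
    intro u hu
    exact hB u (by rw [hu]; rfl)
  have hsurj : Function.Surjective B :=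
    (LinearMap.injective_iff_surjective_of_finrank_eq_finrank
      (Subspace.dual_finrank_eq (K := ℝ) (V := V)).symm).1 hinj
  obtain ⟨u, hu⟩ := hsurj ℓ
  exact ⟨u, hu, fun v hv => hinj (hv.trans hu.symm)⟩

variable {ρ₀ : ℝ} (P : Partition ρ₀ (ρ₀ + 1))
variable {E : Type*} [NormedAddCommGroup E] [NormedSpace ℝ E]

variable (E) in
/-- The finite element space. -/
def feSpace : Submodule ℝ (ℝ → E) where
  carrier := {χ | IsFE P χ}
  add_mem' {χ ψ} h k := ⟨h.1.add k.1, h.2.1.add k.2.1, fun j => by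
    obtain ⟨a, b, hab⟩ := h.2.2 j
    obtain ⟨a', b', hab'⟩ := k.2.2 j
    refine ⟨a + a', b + b', fun ρ hρ => ?_⟩
    rw [Pi.add_apply, hab ρ hρ, hab' ρ hρ, smul_add]
    abel⟩
  zero_mem' := ⟨continuous_const, fun _ => rfl, fun _ => ⟨0, 0, by simp⟩⟩
  smul_mem' c χ h := ⟨h.1.const_smul c, fun ρ => by simp [h.2.1 ρ], fun j => by
    obtain ⟨a, b, hab⟩ := h.2.2 j
    refine ⟨c • a, c • b, fun ρ hρ => ?_⟩
    rw [Pi.smul_apply, hab ρ hρ, smul_add, smul_comm c ρ b]⟩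

lemma finiteDimensional_feSpace [FiniteDimensional ℝ E] : FiniteDimensional ℝ (feSpace P E) := by
  let φ : feSpace P E →ₗ[ℝ] (Fin P.count → E) :=
    { toFun := fun χ j => χ.1 (P.right j)
      map_add' := fun _ _ => rfl
      map_smul' := fun _ _ => rfl }
  have hφ : Function.Injective φ := fun χ ψ h =>
    Subtype.ext (IsFE.ext χ.2 ψ.2 fun j => congrFun h j)
  exact FiniteDimensional.of_injective φ hφ

/-- The forms are defined on all functions and then restricted; definiteness need only be checked at
the right end points. -/
lemma existsUnique_isFE [FiniteDimensional ℝ E] (B : (ℝ → E) →ₗ[ℝ] (ℝ → E) →ₗ[ℝ] ℝ)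
    (hB : ∀ u, IsFE P u → B u u = 0 → ∀ j, u (P.right j) = 0) (ℓ : (ℝ → E) →ₗ[ℝ] ℝ) :
    ∃ u, IsFE P u ∧ (∀ v, IsFE P v → B u v = ℓ v) ∧
      ∀ u', IsFE P u' → (∀ v, IsFE P v → B u' v = ℓ v) → u' = u := by
  have := finiteDimensional_feSpace P (E := E)
  obtain ⟨u, hu, huniq⟩ := existsUnique_of_definite
    (B.domRestrict₁₂ (feSpace P E) (feSpace P E))
    (fun u hu => Subtype.ext (IsFE.ext u.2 (feSpace P E).zero_mem (hB u.1 u.2 hu)))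
    (ℓ.domRestrict (feSpace P E))
  refine ⟨u.1, u.2, fun v hv => LinearMap.congr_fun hu ⟨v, hv⟩, fun u' hu' h => ?_⟩
  have := huniq ⟨u', hu'⟩ (LinearMap.ext fun v => h v.1 v.2)
  exact congrArg Subtype.val this

end Solvability

/-! ### The two schemes in nodal values and their solvability. -/

section Schemes

variable {ρ₀ : ℝ} {P : Partition ρ₀ (ρ₀ + 1)} {α d k : ℝ} {f : ℝ → ℝ} {g : ℝ → ℝ → ℝ}
variable {X₀ X : ℝ → Plane} {W₀ W : ℝ → ℝ}

lemma curveForce_sub (a D D' : Plane) (s : ℝ) :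
    curveForce α f a D s - curveForce α f a D' s =
      (α * ‖a‖ ^ 2) • (D - D') + ((1 - α) * ⟪D - D', perp a⟫) • perp a := by
  rw [curveForce_eq, curveForce_eq, inner_sub_left, smul_sub, mul_sub, sub_smul]
  abel

/-- The curve scheme, written with `curveForce` and nodal values. -/
lemma curveStep_iff : CurveStep P α f k X₀ W₀ X ↔ ∀ ξ : ℝ → Plane, IsFE P ξ →
    ∑ j, (P.step j / 2 *
      (⟪curveForce α f (P.grad X₀ j) (diffQuot k X₀ X (P.left j)) (W₀ (P.left j)), ξ (P.left j)⟫
      + ⟪curveForce α f (P.grad X₀ j) (diffQuot k X₀ X (P.right j)) (W₀ (P.right j)),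
          ξ (P.right j)⟫)
      + P.step j * ⟪P.grad X j, P.grad ξ j⟫) = 0 := by
  refine forall₂_congr fun ξ _ => ?_
  rw [P.lumped_eq, P.lumped_eq, P.integral_const_eq, ← sub_eq_zero, ← Finset.sum_add_distrib,
    ← Finset.sum_sub_distrib]
  refine Eq.congr_left (Finset.sum_congr rfl fun j _ => ?_)
  simp only [curveForce, inner_sub_left, discNormal, discTangent]
  ring

/-- The scheme sees a test function only through its nodal values, so any periodic function may be
used via its interpolant. The error x - X is periodic but not piecewise affine. -/
lemma CurveStep.of_periodic (h : CurveStep P α f k X₀ W₀ X) {ξ : ℝ → Plane}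
    (hξ : Function.Periodic ξ 1) :
    ∑ j, (P.step j / 2 *
      (⟪curveForce α f (P.grad X₀ j) (diffQuot k X₀ X (P.left j)) (W₀ (P.left j)), ξ (P.left j)⟫
      + ⟪curveForce α f (P.grad X₀ j) (diffQuot k X₀ X (P.right j)) (W₀ (P.right j)),
          ξ (P.right j)⟫)
      + P.step j * ⟪P.grad X j, P.grad ξ j⟫) = 0 := by
  obtain ⟨χ, hχ⟩ := exists_isInterp P hξ
  have := curveStep_iff.1 h χ hχ.1
  simpa only [hχ.left, hχ.right, hχ.grad] using this

/-- The equation at a node: the jump of the discrete derivative. -/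
lemma CurveStep.jump (h : CurveStep P α f k X₀ W₀ X) (hX₀ : Function.Periodic X₀ 1)
    (hX : Function.Periodic X 1) (hW₀ : Function.Periodic W₀ 1) (j : Fin P.count) :
    P.grad X (P.next j) - P.grad X j =
      (P.step j / 2) •
        curveForce α f (P.grad X₀ j) (diffQuot k X₀ X (P.right j)) (W₀ (P.right j))
      + (P.step (P.next j) / 2) • curveForce α f (P.grad X₀ (P.next j))
        (diffQuot k X₀ X (P.right j)) (W₀ (P.right j)) := by
  set F : Fin P.count → ℝ → Plane := fun j ρ =>
    curveForce α f (P.grad X₀ j) (diffQuot k X₀ X ρ) (W₀ ρ) with hF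
  have hFper : ∀ i, Function.Periodic (F i) 1 := fun i ρ => by
    simp only [hF, diffQuot, hX₀ ρ, hX ρ, hW₀ ρ]
  -- The residual of the claim at each node. A test function with these nodal values turns the
  -- scheme into a vanishing sum of the squares ‖c j‖².
  set c : Fin P.count → Plane := fun j => (P.step j / 2) • F j (P.right j)
    + (P.step (P.next j) / 2) • F (P.next j) (P.right j) - (P.grad X (P.next j) - P.grad X j)
    with hc
  obtain ⟨ξ, hξ, hξc⟩ := exists_periodic_right P c
  have key := h.of_periodic hξ
  have e1 : ∑ j, (P.step j / 2 * (⟪F j (P.left j), ξ (P.left j)⟫ + ⟪F j (P.right j), ξ (P.right j)⟫)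
      + P.step j * ⟪P.grad X j, P.grad ξ j⟫) =
      ∑ j, ⟪(P.step j / 2) • F j (P.left j) - P.grad X j, ξ (P.left j)⟫
      + ∑ j, ⟪(P.step j / 2) • F j (P.right j) + P.grad X j, ξ (P.right j)⟫ := by
    rw [← Finset.sum_add_distrib]
    refine Finset.sum_congr rfl fun j _ => ?_
    have : P.step j * ⟪P.grad X j, P.grad ξ j⟫ =
        ⟪P.grad X j, ξ (P.right j)⟫ - ⟪P.grad X j, ξ (P.left j)⟫ := by
      rw [← inner_sub_right, ← P.step_smul_grad, real_inner_smul_right]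
    rw [this]
    simp only [inner_sub_left, inner_add_left, real_inner_smul_left]
    ring
  rw [e1, ← P.sum_next, ← Finset.sum_add_distrib] at key
  have e2 : ∀ j, ⟪(P.step (P.next j) / 2) • F (P.next j) (P.left (P.next j))
      - P.grad X (P.next j), ξ (P.left (P.next j))⟫
      + ⟪(P.step j / 2) • F j (P.right j) + P.grad X j, ξ (P.right j)⟫ = ‖c j‖ ^ 2 := fun j => by
    rw [P.apply_left_next hξ, P.apply_left_next (hFper _), hξc, ← inner_add_left,
      ← real_inner_self_eq_norm_sq]
    congr 1
    simp only [hc]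
    abel
  simp only [e2] at key
  have h0 := (Finset.sum_eq_zero_iff_of_nonneg fun i _ => by positivity).1 key j
    (Finset.mem_univ j)
  have h1 : c j = 0 := by simpa using h0
  exact (sub_eq_zero.1 h1).symm

/-- The scalar scheme in nodal values. -/
lemma ScalarStep.of_periodic (h : ScalarStep P d g k X₀ X W₀ W) {η : ℝ → ℝ}
    (hη : Function.Periodic η 1) :
    (∑ j, P.step j / 2 * (‖P.grad X j‖ * W (P.left j) * η (P.left j)
          + ‖P.grad X j‖ * W (P.right j) * η (P.right j))
        - ∑ j, P.step j / 2 * (‖P.grad X₀ j‖ * W₀ (P.left j) * η (P.left j)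
          + ‖P.grad X₀ j‖ * W₀ (P.right j) * η (P.right j))) / k
      + d * ∑ j, P.step j * (P.grad W j / ‖P.grad X j‖ * P.grad η j)
      + ∑ j, P.step j / 2 *
        (⟪diffQuot k X₀ X (P.left j), discTangent P X j⟫ * W (P.left j) * P.grad η j
        + ⟪diffQuot k X₀ X (P.right j), discTangent P X j⟫ * W (P.right j) * P.grad η j)
    = ∑ j, P.step j / 2 *
        (‖P.grad X j‖ * g ⟪diffQuot k X₀ X (P.left j), discNormal P X j⟫ (W₀ (P.left j))
            * η (P.left j)
        + ‖P.grad X j‖ * g ⟪diffQuot k X₀ X (P.right j), discNormal P X j⟫ (W₀ (P.right j))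
            * η (P.right j)) := by
  obtain ⟨χ, hχ⟩ := exists_isInterp P hη
  have := h χ hχ.1
  simpa only [P.lumped_eq, P.integral_const_eq, hχ.left, hχ.right, hχ.grad] using this

/-- The lumped mobility term is at least α ‖X₀_ρ‖² / k times the squared nodal values, and the
stiffness term is nonnegative. -/
lemma curve_solvable (hα : α ∈ Ioc (0 : ℝ) 1) (hk : 0 < k) (h₀ : ∀ j, P.grad X₀ j ≠ 0) :
    ∃ X, IsFE P X ∧ CurveStep P α f k X₀ W₀ X ∧
      ∀ Y, IsFE P Y → CurveStep P α f k X₀ W₀ Y → Y = X := by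
  set A : Fin P.count → Plane → Plane := fun j D =>
    (k⁻¹ * (α * ‖P.grad X₀ j‖ ^ 2)) • D
      + (k⁻¹ * ((1 - α) * ⟪D, perp (P.grad X₀ j)⟫)) • perp (P.grad X₀ j) with hA
  have hAadd : ∀ j D D', A j (D + D') = A j D + A j D' := fun j D D' => by
    simp only [hA, inner_add_left, smul_add, mul_add, add_smul]; abel
  have hAsmul : ∀ j (c : ℝ) D, A j (c • D) = c • A j D := fun j c D => by
    simp only [hA, real_inner_smul_left, smul_add, smul_smul]
    congr 2 <;> ring
  have hpos : ∀ j D, 0 ≤ ⟪A j D, D⟫ := fun j D => by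
    simp only [hA, inner_add_left, real_inner_smul_left, real_inner_self_eq_norm_sq]
    rw [real_inner_comm D (perp _)]
    have h1 := hα.1
    have h2 : 0 ≤ 1 - α := by linarith [hα.2]
    have : (k⁻¹ * ((1 - α) * ⟪D, perp (P.grad X₀ j)⟫)) * ⟪D, perp (P.grad X₀ j)⟫ =
      k⁻¹ * (1 - α) * ⟪D, perp (P.grad X₀ j)⟫ ^ 2 := by ring
    rw [this]
    positivity
  have hpos' : ∀ j D, ⟪A j D, D⟫ = 0 → D = 0 := fun j D h => by
    have h1 : k⁻¹ * (α * ‖P.grad X₀ j‖ ^ 2) * ‖D‖ ^ 2 ≤ ⟪A j D, D⟫ := by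
      simp only [hA, inner_add_left, real_inner_smul_left, real_inner_self_eq_norm_sq]
      rw [real_inner_comm D (perp _)]
      have h2 : 0 ≤ 1 - α := by linarith [hα.2]
      have : (k⁻¹ * ((1 - α) * ⟪D, perp (P.grad X₀ j)⟫)) * ⟪D, perp (P.grad X₀ j)⟫ =
        k⁻¹ * (1 - α) * ⟪D, perp (P.grad X₀ j)⟫ ^ 2 := by ring
      rw [this]
      have : 0 ≤ k⁻¹ * (1 - α) * ⟪D, perp (P.grad X₀ j)⟫ ^ 2 := by positivity
      linarith
    have h3 : 0 < k⁻¹ * (α * ‖P.grad X₀ j‖ ^ 2) := by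
      have := norm_pos_iff.2 (h₀ j)
      have := hα.1
      positivity
    rw [h] at h1
    by_contra hD
    have := mul_pos h3 (pow_pos (norm_pos_iff.2 hD) 2)
    linarith
  let B : (ℝ → Plane) →ₗ[ℝ] (ℝ → Plane) →ₗ[ℝ] ℝ := LinearMap.mk₂ ℝ
    (fun Y ξ => ∑ j, (P.step j / 2 * (⟪A j (Y (P.left j)), ξ (P.left j)⟫
      + ⟪A j (Y (P.right j)), ξ (P.right j)⟫) + P.step j * ⟪P.grad Y j, P.grad ξ j⟫))
    (fun Y Y' ξ => by
      rw [← Finset.sum_add_distrib]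
      refine Finset.sum_congr rfl fun j _ => ?_
      simp only [Pi.add_apply, hAadd, inner_add_left, P.grad_add]
      ring)
    (fun c Y ξ => by
      rw [smul_eq_mul, Finset.mul_sum]
      refine Finset.sum_congr rfl fun j _ => ?_
      simp only [Pi.smul_apply, hAsmul, real_inner_smul_left, P.grad_smul]
      ring)
    (fun Y ξ ξ' => by
      rw [← Finset.sum_add_distrib]
      refine Finset.sum_congr rfl fun j _ => ?_
      simp only [Pi.add_apply, inner_add_right, P.grad_add]
      ring)
    (fun c Y ξ => by
      rw [smul_eq_mul, Finset.mul_sum]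
      refine Finset.sum_congr rfl fun j _ => ?_
      simp only [Pi.smul_apply, real_inner_smul_right, P.grad_smul]
      ring)
  have hB : ∀ Y ξ, B Y ξ = ∑ j, (P.step j / 2 * (⟪A j (Y (P.left j)), ξ (P.left j)⟫
      + ⟪A j (Y (P.right j)), ξ (P.right j)⟫) + P.step j * ⟪P.grad Y j, P.grad ξ j⟫) :=
    fun _ _ => rfl
  set c : Fin P.count → ℝ → Plane := fun j ρ =>
    A j (X₀ ρ) + (‖P.grad X₀ j‖ * f (W₀ ρ)) • perp (P.grad X₀ j) with hc
  let ℓ : (ℝ → Plane) →ₗ[ℝ] ℝ :=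
    { toFun := fun ξ => ∑ j, P.step j / 2 *
        (⟪c j (P.left j), ξ (P.left j)⟫ + ⟪c j (P.right j), ξ (P.right j)⟫)
      map_add' := fun ξ ξ' => by
        rw [← Finset.sum_add_distrib]
        refine Finset.sum_congr rfl fun j _ => ?_
        simp only [Pi.add_apply, inner_add_right]
        ring
      map_smul' := fun r ξ => by
        rw [RingHom.id_apply, smul_eq_mul, Finset.mul_sum]
        refine Finset.sum_congr rfl fun j _ => ?_
        simp only [Pi.smul_apply, real_inner_smul_right]
        ring }
  have hℓ : ∀ ξ, ℓ ξ = ∑ j, P.step j / 2 *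
        (⟪c j (P.left j), ξ (P.left j)⟫ + ⟪c j (P.right j), ξ (P.right j)⟫) := fun _ => rfl
  have hforce : ∀ (Y : ℝ → Plane) j ρ,
      curveForce α f (P.grad X₀ j) (diffQuot k X₀ Y ρ) (W₀ ρ) = A j (Y ρ) - c j ρ := by
    intro Y j ρ
    simp only [curveForce_eq, hc, hA, diffQuot, inner_sub_left, real_inner_smul_left, smul_smul,
      smul_sub]
    module
  have hiff : ∀ Y, CurveStep P α f k X₀ W₀ Y ↔ ∀ ξ, IsFE P ξ → B Y ξ = ℓ ξ := fun Y => by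
    rw [curveStep_iff]
    refine forall₂_congr fun ξ _ => ?_
    rw [← sub_eq_zero (a := B Y ξ), hB, hℓ, ← Finset.sum_sub_distrib]
    refine Eq.congr_left (Finset.sum_congr rfl fun j _ => ?_)
    simp only [hforce, inner_sub_left]
    ring
  obtain ⟨X, h1, h2, h3⟩ := existsUnique_isFE P B (fun u _ hu j => by
    rw [hB] at hu
    have hnn : ∀ i, 0 ≤ P.step i / 2 * (⟪A i (u (P.left i)), u (P.left i)⟫
        + ⟪A i (u (P.right i)), u (P.right i)⟫) + P.step i * ⟪P.grad u i, P.grad u i⟫ :=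
      fun i => by
        have := P.step_pos i
        have := hpos i (u (P.left i))
        have := hpos i (u (P.right i))
        have : (0 : ℝ) ≤ ⟪P.grad u i, P.grad u i⟫ := real_inner_self_nonneg
        positivity
    have h0 := (Finset.sum_eq_zero_iff_of_nonneg fun i _ => hnn i).1 hu j (Finset.mem_univ j)
    apply hpos' j
    have s0 := P.step_pos j
    have s1 := hpos j (u (P.left j))
    have s2 := hpos j (u (P.right j))
    have s3 : (0 : ℝ) ≤ P.step j * ⟪P.grad u j, P.grad u j⟫ :=
      mul_nonneg s0.le real_inner_self_nonneg
    by_contra hne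
    have s4 := lt_of_le_of_ne s2 (Ne.symm hne)
    have : 0 < P.step j / 2 * (⟪A j (u (P.left j)), u (P.left j)⟫
        + ⟪A j (u (P.right j)), u (P.right j)⟫) := by positivity
    linarith) ℓ
  exact ⟨X, h1, (hiff X).2 h2, fun Y hY hYs => h3 Y hY ((hiff Y).1 hYs)⟩

/-- The advection term has no sign. The condition that k |D_t X|² is at most d lets half of the mass
term together with the diffusion absorb it. -/
lemma scalar_solvable (hd : 0 < d) (hk : 0 < k) (hX : ∀ j, P.grad X j ≠ 0)
    (hΨ : ∀ j, k * ‖diffQuot k X₀ X (P.left j)‖ ^ 2 ≤ d ∧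
      k * ‖diffQuot k X₀ X (P.right j)‖ ^ 2 ≤ d) :
    ∃ W, IsFE P W ∧ ScalarStep P d g k X₀ X W₀ W ∧
      ∀ Z, IsFE P Z → ScalarStep P d g k X₀ X W₀ Z → Z = W := by
  set Ψ : Fin P.count → ℝ → ℝ := fun j ρ => ⟪diffQuot k X₀ X ρ, discTangent P X j⟫ with hΨdef
  have hΨ' : ∀ j ρ, k * ‖diffQuot k X₀ X ρ‖ ^ 2 ≤ d → k * Ψ j ρ ^ 2 ≤ d := fun j ρ h => by
    have h1 : |Ψ j ρ| ≤ ‖diffQuot k X₀ X ρ‖ := by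
      refine (abs_real_inner_le_norm _ _).trans ?_
      rw [discTangent, norm_unit (hX j), mul_one]
    have h2 : Ψ j ρ ^ 2 ≤ ‖diffQuot k X₀ X ρ‖ ^ 2 := sq_le_sq' (by linarith [neg_abs_le (Ψ j ρ)])
      ((le_abs_self _).trans h1)
    nlinarith
  let B : (ℝ → ℝ) →ₗ[ℝ] (ℝ → ℝ) →ₗ[ℝ] ℝ := LinearMap.mk₂ ℝ
    (fun Y η => ∑ j, (P.step j / 2 *
      (‖P.grad X j‖ * Y (P.left j) * η (P.left j) / k
        + Ψ j (P.left j) * Y (P.left j) * P.grad η j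
        + ‖P.grad X j‖ * Y (P.right j) * η (P.right j) / k
        + Ψ j (P.right j) * Y (P.right j) * P.grad η j)
      + d * (P.step j * (P.grad Y j / ‖P.grad X j‖ * P.grad η j))))
    (fun Y Y' η => by
      rw [← Finset.sum_add_distrib]
      refine Finset.sum_congr rfl fun j _ => ?_
      simp only [Pi.add_apply, P.grad_add]
      ring)
    (fun c Y η => by
      rw [smul_eq_mul, Finset.mul_sum]
      refine Finset.sum_congr rfl fun j _ => ?_
      simp only [Pi.smul_apply, P.grad_smul, smul_eq_mul]
      ring)
    (fun Y η η' => by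
      rw [← Finset.sum_add_distrib]
      refine Finset.sum_congr rfl fun j _ => ?_
      simp only [Pi.add_apply, P.grad_add]
      ring)
    (fun c Y η => by
      rw [smul_eq_mul, Finset.mul_sum]
      refine Finset.sum_congr rfl fun j _ => ?_
      simp only [Pi.smul_apply, P.grad_smul, smul_eq_mul]
      ring)
  have hB : ∀ Y η, B Y η = ∑ j, (P.step j / 2 *
      (‖P.grad X j‖ * Y (P.left j) * η (P.left j) / k
        + Ψ j (P.left j) * Y (P.left j) * P.grad η j
        + ‖P.grad X j‖ * Y (P.right j) * η (P.right j) / k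
        + Ψ j (P.right j) * Y (P.right j) * P.grad η j)
      + d * (P.step j * (P.grad Y j / ‖P.grad X j‖ * P.grad η j))) := fun _ _ => rfl
  set c : Fin P.count → ℝ → ℝ := fun j ρ => ‖P.grad X₀ j‖ * W₀ ρ / k
    + ‖P.grad X j‖ * g ⟪diffQuot k X₀ X ρ, discNormal P X j⟫ (W₀ ρ) with hc
  let ℓ : (ℝ → ℝ) →ₗ[ℝ] ℝ :=
    { toFun := fun η => ∑ j, P.step j / 2 *
        (c j (P.left j) * η (P.left j) + c j (P.right j) * η (P.right j))
      map_add' := fun η η' => by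
        rw [← Finset.sum_add_distrib]
        refine Finset.sum_congr rfl fun j _ => ?_
        simp only [Pi.add_apply]
        ring
      map_smul' := fun r η => by
        rw [RingHom.id_apply, smul_eq_mul, Finset.mul_sum]
        refine Finset.sum_congr rfl fun j _ => ?_
        simp only [Pi.smul_apply, smul_eq_mul]
        ring }
  have hℓ : ∀ η, ℓ η = ∑ j, P.step j / 2 *
        (c j (P.left j) * η (P.left j) + c j (P.right j) * η (P.right j)) := fun _ => rfl
  have hiff : ∀ Y, ScalarStep P d g k X₀ X W₀ Y ↔ ∀ η, IsFE P η → B Y η = ℓ η := fun Y => by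
    refine forall₂_congr fun η _ => ?_
    rw [← sub_eq_zero, ← sub_eq_zero (a := B Y η), hB, hℓ]
    simp only [P.lumped_eq, P.integral_const_eq]
    refine Eq.congr_left ?_
    rw [← Finset.sum_sub_distrib, Finset.sum_div, Finset.mul_sum, ← Finset.sum_add_distrib,
      ← Finset.sum_add_distrib, ← Finset.sum_sub_distrib, ← Finset.sum_sub_distrib]
    refine Finset.sum_congr rfl fun j _ => ?_
    simp only [hc, hΨdef]
    ring
  have hloc : ∀ q ψ y s : ℝ, 0 < q → k * ψ ^ 2 ≤ d →
      q * y ^ 2 / (2 * k) ≤ q * y * y / k + ψ * y * s + d * (s / q * s) := by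
    intro q ψ y s hq hψ
    -- Completing the square bounds ψ y s from below by half of the mass term and k ψ² s² / (2 q),
    -- and the latter is covered by the diffusion.
    have h1 : 0 ≤ k / (2 * q) * (q * y / k + ψ * s) ^ 2 := by positivity
    have h2 : k / (2 * q) * (q * y / k + ψ * s) ^ 2 =
        q * y ^ 2 / (2 * k) + ψ * y * s + k * ψ ^ 2 * s ^ 2 / (2 * q) := by
      field_simp; ring
    have h3 : k * ψ ^ 2 * s ^ 2 / (2 * q) ≤ d * (s / q * s) := by
      rw [show d * (s / q * s) = 2 * d * s ^ 2 / (2 * q) by field_simp]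
      exact div_le_div_of_nonneg_right
        (mul_le_mul_of_nonneg_right (by linarith) (sq_nonneg s)) (by positivity)
    have h4 : q * y * y / k = q * y ^ 2 / (2 * k) + q * y ^ 2 / (2 * k) := by field_simp; ring
    linarith
  obtain ⟨W, h1, h2, h3⟩ := existsUnique_isFE P B (fun u _ hu j => by
    rw [hB] at hu
    have hnn : ∀ i, P.step i / 2 * (‖P.grad X i‖ * u (P.left i) ^ 2 / (2 * k)
        + ‖P.grad X i‖ * u (P.right i) ^ 2 / (2 * k)) ≤ P.step i / 2 *
      (‖P.grad X i‖ * u (P.left i) * u (P.left i) / k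
        + Ψ i (P.left i) * u (P.left i) * P.grad u i
        + ‖P.grad X i‖ * u (P.right i) * u (P.right i) / k
        + Ψ i (P.right i) * u (P.right i) * P.grad u i)
      + d * (P.step i * (P.grad u i / ‖P.grad X i‖ * P.grad u i)) := fun i => by
        have e1 := hloc ‖P.grad X i‖ (Ψ i (P.left i)) (u (P.left i)) (P.grad u i)
          (norm_pos_iff.2 (hX i)) (hΨ' i _ (hΨ i).1)
        have e2 := hloc ‖P.grad X i‖ (Ψ i (P.right i)) (u (P.right i)) (P.grad u i)
          (norm_pos_iff.2 (hX i)) (hΨ' i _ (hΨ i).2)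
        have := mul_le_mul_of_nonneg_left (add_le_add e1 e2) (half_pos (P.step_pos i)).le
        refine this.trans (le_of_eq ?_)
        ring
    have hq := norm_pos_iff.2 (hX j)
    have h0 := (Finset.sum_eq_zero_iff_of_nonneg fun i _ => by
      refine le_trans ?_ (hnn i)
      have := P.step_pos i
      positivity).1 hu j (Finset.mem_univ j)
    by_contra hne
    have s0 := P.step_pos j
    have s1 : 0 < ‖P.grad X j‖ * u (P.right j) ^ 2 / (2 * k) := by positivity
    have s2 : 0 ≤ ‖P.grad X j‖ * u (P.left j) ^ 2 / (2 * k) := by positivity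
    have s3 := hnn j
    rw [h0] at s3
    have : 0 < P.step j / 2 * (‖P.grad X j‖ * u (P.left j) ^ 2 / (2 * k)
        + ‖P.grad X j‖ * u (P.right j) ^ 2 / (2 * k)) := by positivity
    linarith) ℓ
  exact ⟨W, h1, (hiff W).2 h2, fun Y hY hYs => h3 Y hY ((hiff Y).1 hYs)⟩

end Schemes

/-- The discrete gradient is the mean of the derivative over the element; the mean value inequality
is applied to u minus a linear function. -/
lemma Partition.norm_grad_sub_le {a b : ℝ} (P : Partition a b) {E : Type*} [NormedAddCommGroup E]
    [NormedSpace ℝ E] {u u' : ℝ → E} (hu : ∀ r, HasDerivAt u (u' r) r) (j : Fin P.count) {c : E}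
    {B : ℝ} (h : ∀ r ∈ Icc (P.left j) (P.right j), ‖u' r - c‖ ≤ B) :
    ‖P.grad u j - c‖ ≤ B := by
  have hs := P.step_pos j
  have h1 := norm_image_sub_le_of_norm_deriv_le_segment' (f := fun r => u r - r • c)
    (f' := fun r => u' r - c) (C := B) (a := P.left j) (b := P.right j)
    (fun r _ => by
      have h2 := ((hu r).sub ((hasDerivAt_id r).smul_const c)).hasDerivWithinAt
        (s := Icc (P.left j) (P.right j))
      exact h2.congr_deriv (by simp))
    (fun r hr => h r (Ico_subset_Icc_self hr)) (P.right j) (right_mem_Icc.2 (P.left_lt_right j).le)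
  have h2 : u (P.right j) - P.right j • c - (u (P.left j) - P.left j • c) =
      P.step j • (P.grad u j - c) := by
    rw [smul_sub, P.step_smul_grad, Partition.step, sub_smul]
    abel
  rw [h2, norm_smul, Real.norm_of_nonneg hs.le, mul_comm] at h1
  exact le_of_mul_le_mul_right h1 hs

lemma periodic_deriv {E : Type*} [NormedAddCommGroup E] [NormedSpace ℝ E] {u : ℝ → E}
    (hu : Function.Periodic u 1) : Function.Periodic (deriv u) 1 := fun ρ => by
  have h : (fun r => u (r + 1)) = u := funext hu
  rw [← deriv_comp_add_const u 1 ρ, h]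

lemma periodic_diffQuot {E : Type*} [NormedAddCommGroup E] [NormedSpace ℝ E] {k : ℝ} {u v : ℝ → E}
    (hu : Function.Periodic u 1) (hv : Function.Periodic v 1) :
    Function.Periodic (diffQuot k u v) 1 := fun ρ => by
  simp only [diffQuot, hu ρ, hv ρ]

lemma diffQuot_sub {E : Type*} [NormedAddCommGroup E] [NormedSpace ℝ E] (k : ℝ)
    (u v u' v' : ℝ → E) (ρ : ℝ) :
    diffQuot k (fun r => u r - u' r) (fun r => v r - v' r) ρ =
      diffQuot k u v ρ - diffQuot k u' v' ρ := by
  simp only [diffQuot, ← smul_sub]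
  congr 1
  abel

/-! ### Consistency and energy estimate for the curve scheme. -/

section Consistency

variable {T α d K : ℝ} {f : ℝ → ℝ} {g : ℝ → ℝ → ℝ} {x : ℝ → ℝ → Plane} {w : ℝ → ℝ → ℝ}
  {G : ℝ → ℝ}

namespace Reg

lemma K_pos (hR : Reg T α d f g x w K G) : 0 < K := zero_lt_one.trans_le hR.one_le

lemma continuous_xρ (hR : Reg T α d f g x w K G) {t : ℝ} (ht : t ∈ Icc 0 T) :
    Continuous (deriv (x t)) :=
  continuous_of_norm_sub_le hR.K_pos.le fun a b => hR.xρ_lip t ht a b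

lemma continuous_x (hR : Reg T α d f g x w K G) {t : ℝ} (ht : t ∈ Icc 0 T) : Continuous (x t) :=
  continuous_iff_continuousAt.2 fun ρ => (hR.x_deriv t ht ρ).continuousAt

lemma continuous_w (hR : Reg T α d f g x w K G) {t : ℝ} (ht : t ∈ Icc 0 T) : Continuous (w t) :=
  continuous_iff_continuousAt.2 fun ρ => (hR.w_deriv t ht ρ).continuousAt

lemma continuous_xt (hR : Reg T α d f g x w K G) {t : ℝ} (ht : t ∈ Icc 0 T) :
    Continuous (timeDeriv T x t) :=
  continuous_of_norm_sub_le hR.K_pos.le fun a b => hR.xt_lip t ht a b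

lemma xρ_ne_zero (hR : Reg T α d f g x w K G) {t : ℝ} (ht : t ∈ Icc 0 T) (ρ : ℝ) :
    deriv (x t) ρ ≠ 0 := fun h => by
  have := hR.le_xρ t ht ρ
  rw [h, norm_zero] at this
  exact absurd this (not_le.2 (inv_pos.2 hR.K_pos))

lemma w_lip (hR : Reg T α d f g x w K G) {t : ℝ} (ht : t ∈ Icc 0 T) (a b : ℝ) :
    |w t b - w t a| ≤ K * |b - a| :=
  norm_sub_le_of_deriv_le (hR.w_deriv t ht) (hR.wρ_le t ht) a b

lemma diffQuot_x_le (hR : Reg T α d f g x w K G) {s t : ℝ} (hs : s ∈ Icc 0 T) (ht : t ∈ Icc 0 T)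
    (hst : s < t) (ρ : ℝ) :
    ‖diffQuot (t - s) (x s) (x t) ρ‖ ≤ K := by
  have hk : 0 < t - s := sub_pos.2 hst
  rw [diffQuot, norm_smul, norm_inv, Real.norm_of_nonneg hk.le, inv_mul_le_iff₀ hk, mul_comm]
  simpa [abs_of_pos hk] using hR.x_time s hs t ht ρ

lemma diffQuot_w_le (hR : Reg T α d f g x w K G) {s t : ℝ} (hs : s ∈ Icc 0 T) (ht : t ∈ Icc 0 T)
    (hst : s < t) (ρ : ℝ) :
    |diffQuot (t - s) (w s) (w t) ρ| ≤ K := by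
  have hk : 0 < t - s := sub_pos.2 hst
  rw [diffQuot, smul_eq_mul, abs_mul, abs_inv, abs_of_pos hk, inv_mul_le_iff₀ hk, mul_comm]
  simpa [abs_of_pos hk] using hR.w_time s hs t ht ρ

lemma xt_sub_le (hR : Reg T α d f g x w K G) {s t : ℝ} (hs : s ∈ Icc 0 T) (ht : t ∈ Icc 0 T)
    (hst : s < t) (ρ : ℝ) :
    ‖timeDeriv T x t ρ - diffQuot (t - s) (x s) (x t) ρ‖ ≤ √((t - s) * (G t - G s)) :=
  Real.le_sqrt_of_sq_le (hR.xt_est s hs t ht hst ρ)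

lemma sq_sqrt_rate (hR : Reg T α d f g x w K G) {s t : ℝ} (hst : s < t) :
    √((t - s) * (G t - G s)) ^ 2 = (t - s) * (G t - G s) :=
  Real.sq_sqrt (mul_nonneg (sub_pos.2 hst).le (sub_nonneg.2 (hR.mono hst.le)))

variable {ρ₀ : ℝ} (P : Partition ρ₀ (ρ₀ + 1))

lemma grad_x_sub_le (hR : Reg T α d f g x w K G) {t : ℝ} (ht : t ∈ Icc 0 T) (j : Fin P.count)
    {ρ : ℝ}
    (hρ : ρ ∈ Icc (P.left j) (P.right j)) :
    ‖P.grad (x t) j - deriv (x t) ρ‖ ≤ K * P.maxStep := by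
  refine P.norm_grad_sub_le (hR.x_deriv t ht) j fun r hr => (hR.xρ_lip t ht _ _).trans ?_
  refine mul_le_mul_of_nonneg_left ?_ hR.K_pos.le
  refine le_trans ?_ (P.step_le_maxStep j)
  rw [abs_le, Partition.step]
  constructor <;> linarith [hρ.1, hρ.2, hr.1, hr.2]

lemma grad_w_sub_le (hR : Reg T α d f g x w K G) {t : ℝ} (ht : t ∈ Ioc 0 T) (j : Fin P.count)
    {ρ : ℝ}
    (hρ : ρ ∈ Icc (P.left j) (P.right j)) :
    |P.grad (w t) j - deriv (w t) ρ| ≤ K * P.maxStep := by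
  refine P.norm_grad_sub_le (hR.w_deriv t (Ioc_subset_Icc_self ht)) j fun r hr =>
    (hR.wρ_lip t ht _ _).trans ?_
  refine mul_le_mul_of_nonneg_left ?_ hR.K_pos.le
  refine le_trans ?_ (P.step_le_maxStep j)
  rw [abs_le, Partition.step]
  constructor <;> linarith [hρ.1, hρ.2, hr.1, hr.2]

end Reg

lemma Partition.abs_sub_le_maxStep {a b : ℝ} (P : Partition a b) (j : Fin P.count) {ρ σ : ℝ}
    (hρ : ρ ∈ Icc (P.left j) (P.right j)) (hσ : σ ∈ Icc (P.left j) (P.right j)) :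
    |ρ - σ| ≤ P.maxStep := by
  refine le_trans ?_ (P.step_le_maxStep j)
  rw [abs_le, Partition.step]
  constructor <;> linarith [hρ.1, hρ.2, hσ.1, hσ.2]

lemma Partition.left_mem_elem {a b : ℝ} (P : Partition a b) (j : Fin P.count) :
    P.left j ∈ Icc (P.left j) (P.right j) := left_mem_Icc.2 (P.left_lt_right j).le

lemma Partition.right_mem_elem {a b : ℝ} (P : Partition a b) (j : Fin P.count) :
    P.right j ∈ Icc (P.left j) (P.right j) := right_mem_Icc.2 (P.left_lt_right j).le

/-- Consistency error of the curve equation, at one end point of one element. -/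
lemma exists_curve_consistency (hR : Reg T α d f g x w K G) (hf : ContDiff ℝ 1 f) {Ct : ℝ}
    (hCt : 0 ≤ Ct) : ∃ C, 0 ≤ C ∧ ∀ {ρ₀ : ℝ} (P : Partition ρ₀ (ρ₀ + 1)) {s t : ℝ}, s ∈ Icc 0 T →
      t ∈ Icc 0 T → s < t → t - s ≤ Ct * P.maxStep → ∀ {X₀ : ℝ → Plane} {W₀ : ℝ → ℝ}
      (j : Fin P.count) {σ ρ : ℝ}, σ ∈ Icc (P.left j) (P.right j) →
      ρ ∈ Icc (P.left j) (P.right j) → ‖P.grad X₀ j‖ ≤ 2 * K → |W₀ σ| ≤ 2 * K →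
      ‖curveForce α f (deriv (x t) ρ) (timeDeriv T x t ρ) (w t ρ)
        - curveForce α f (P.grad X₀ j) (diffQuot (t - s) (x s) (x t) σ) (W₀ σ)‖ ≤
      C * (P.maxStep + √((t - s) * (G t - G s)) + ‖P.grad (fun r => x s r - X₀ r) j‖
        + |w s σ - W₀ σ|) := by
  obtain ⟨C, hC, -, hlip⟩ := exists_curveForce_bound α hf (2 * K)
  have hK := hR.K_pos
  refine ⟨C * (3 * K + 2 * K * Ct), by positivity, ?_⟩
  intro ρ₀ P s t hs ht hst hk X₀ W₀ j σ ρ hσ hρ hX hW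
  have hh : 0 < P.maxStep := P.maxStep_pos
  have hρσ : |ρ - σ| ≤ P.maxStep := P.abs_sub_le_maxStep j hρ hσ
  have hts : |t - s| ≤ Ct * P.maxStep := by rwa [abs_of_pos (sub_pos.2 hst)]
  have i1 : ‖deriv (x t) ρ - P.grad X₀ j‖ ≤ K * (Ct * P.maxStep) + K * P.maxStep
      + ‖P.grad (fun r => x s r - X₀ r) j‖ := by
    have e : deriv (x t) ρ - P.grad X₀ j = (deriv (x t) ρ - deriv (x s) ρ)
        - (P.grad (x s) j - deriv (x s) ρ) + P.grad (fun r => x s r - X₀ r) j := by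
      rw [P.grad_sub]; abel
    rw [e]
    refine (norm_add_le _ _).trans (add_le_add ((norm_sub_le _ _).trans (add_le_add ?_ ?_)) le_rfl)
    · exact (hR.xρ_time s hs t ht ρ).trans (mul_le_mul_of_nonneg_left hts hK.le)
    · exact hR.grad_x_sub_le P hs j hρ
  have i2 : ‖timeDeriv T x t ρ - diffQuot (t - s) (x s) (x t) σ‖ ≤
      K * P.maxStep + √((t - s) * (G t - G s)) := by
    have e : timeDeriv T x t ρ - diffQuot (t - s) (x s) (x t) σ =
        (timeDeriv T x t ρ - timeDeriv T x t σ)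
        + (timeDeriv T x t σ - diffQuot (t - s) (x s) (x t) σ) := by abel
    rw [e]
    refine (norm_add_le _ _).trans (add_le_add ?_ (hR.xt_sub_le hs ht hst σ))
    exact (hR.xt_lip t ht _ _).trans (mul_le_mul_of_nonneg_left hρσ hK.le)
  have i3 : |w t ρ - W₀ σ| ≤ K * P.maxStep + K * (Ct * P.maxStep) + |w s σ - W₀ σ| := by
    have e : w t ρ - W₀ σ = (w t ρ - w t σ) + (w t σ - w s σ) + (w s σ - W₀ σ) := by ring
    rw [e]
    refine (abs_add_le _ _).trans (add_le_add ((abs_add_le _ _).trans (add_le_add ?_ ?_)) le_rfl)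
    · exact (hR.w_lip ht _ _).trans (mul_le_mul_of_nonneg_left hρσ hK.le)
    · exact (hR.w_time s hs t ht σ).trans (mul_le_mul_of_nonneg_left hts hK.le)
  have key := hlip (deriv (x t) ρ) (timeDeriv T x t ρ) (w t ρ) (P.grad X₀ j)
    (diffQuot (t - s) (x s) (x t) σ) (W₀ σ) ((hR.xρ_le t ht ρ).trans (by linarith))
    ((hR.xt_le t ht ρ).trans (by linarith)) ((hR.w_le t ht ρ).trans (by linarith)) hX
    ((hR.diffQuot_x_le hs ht hst σ).trans (by linarith)) hW
  refine key.trans ?_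
  rw [mul_assoc]
  refine mul_le_mul_of_nonneg_left ?_ hC
  set A := √((t - s) * (G t - G s)) with hA
  set B := ‖P.grad (fun r => x s r - X₀ r) j‖
  set D := |w s σ - W₀ σ|
  have hA0 : 0 ≤ A := Real.sqrt_nonneg _
  have hB0 : 0 ≤ B := norm_nonneg _
  have hD0 : 0 ≤ D := abs_nonneg _
  have hc1 : 1 ≤ 3 * K + 2 * K * Ct := by
    have := hR.one_le
    have : 0 ≤ 2 * K * Ct := by positivity
    linarith
  have hABD : A + B + D ≤ (3 * K + 2 * K * Ct) * (A + B + D) :=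
    le_mul_of_one_le_left (by positivity) hc1
  nlinarith

lemma continuous_curveForce (hf : Continuous f) {a D : ℝ → Plane} {s : ℝ → ℝ} (ha : Continuous a)
    (hD : Continuous D) (hs : Continuous s) :
    Continuous fun ρ => curveForce α f (a ρ) (D ρ) (s ρ) := by
  have hp : Continuous fun ρ => perp (a ρ) := perpCLM.continuous.comp ha
  simp only [curveForce_eq]
  fun_prop

/-- One step of the curve scheme: energy estimate for the error. -/
lemma exists_curve_estimate (hR : Reg T α d f g x w K G) (hα : α ∈ Ioc (0 : ℝ) 1)
    (hf : ContDiff ℝ 1 f) {Ct : ℝ} (hCt : 0 ≤ Ct) :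
    ∃ C, 0 ≤ C ∧ ∀ {ρ₀ : ℝ} (P : Partition ρ₀ (ρ₀ + 1)) {s t : ℝ}, s ∈ Icc 0 T → t ∈ Ioc 0 T →
      s < t → t - s ≤ Ct * P.maxStep → ∀ {X₀ X : ℝ → Plane} {W₀ : ℝ → ℝ},
      Function.Periodic X₀ 1 → Function.Periodic X 1 →
      (∀ j, (2 * K)⁻¹ ≤ ‖P.grad X₀ j‖ ∧ ‖P.grad X₀ j‖ ≤ 2 * K) →
      (∀ j, |W₀ (P.left j)| ≤ 2 * K ∧ |W₀ (P.right j)| ≤ 2 * K) →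
      CurveStep P α f (t - s) X₀ W₀ X →
      P.gradSq (fun r => x t r - X r) + α / (4 * K ^ 2) *
        ((t - s) * P.massSq (diffQuot (t - s) (fun r => x s r - X₀ r) fun r => x t r - X r)
        + (t - s) ^ 2 *
          P.gradSq (diffQuot (t - s) (fun r => x s r - X₀ r) fun r => x t r - X r)) ≤
      P.gradSq (fun r => x s r - X₀ r) + C * (t - s) * (P.maxStep ^ 2 + (t - s) * (G t - G s)
        + P.gradSq (fun r => x s r - X₀ r) + P.massSq (fun r => w s r - W₀ r)) := by
  obtain ⟨C₁, hC₁, hcons⟩ := exists_curve_consistency hR hf hCt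
  have hK := hR.K_pos
  set c := α / (4 * K ^ 2) with hc
  have hc0 : 0 < c := div_pos hα.1 (by positivity)
  have hc1 : c ≤ 1 := by
    rw [hc, div_le_one (by positivity)]
    nlinarith [hR.one_le, hα.2]
  refine ⟨4 * C₁ ^ 2 / c, by positivity, ?_⟩
  intro ρ₀ P s t hs ht hst hk X₀ X W₀ hX₀p hXp hX₀ hW₀ hstep
  have ht' := Ioc_subset_Icc_self ht
  have hk0 : 0 < t - s := sub_pos.2 hst
  set k := t - s with hkdef
  set e₀ : ℝ → Plane := fun r => x s r - X₀ r with he₀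
  set e₁ : ℝ → Plane := fun r => x t r - X r with he₁
  set ξ := diffQuot k e₀ e₁ with hξ
  set z₀ : ℝ → ℝ := fun r => w s r - W₀ r with hz₀
  set r := √(k * (G t - G s)) with hr
  have hr2 : r ^ 2 = k * (G t - G s) := hR.sq_sqrt_rate hst
  set h := P.maxStep
  have hξp : Function.Periodic ξ 1 :=
    periodic_diffQuot ((hR.x_per s).sub hX₀p) ((hR.x_per t).sub hXp)
  set Φ : ℝ → Plane := fun ρ => curveForce α f (deriv (x t) ρ) (timeDeriv T x t ρ) (w t ρ) with hΦ
  have hΦc : Continuous Φ := continuous_curveForce hf.continuous (hR.continuous_xρ ht')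
    (hR.continuous_xt ht') (hR.continuous_w ht')
  set F : Fin P.count → ℝ → Plane := fun j ρ =>
    curveForce α f (P.grad X₀ j) (diffQuot k X₀ X ρ) (W₀ ρ) with hF
  -- The discrete force evaluated at the exact difference quotient. From `F'` to `F` only the
  -- velocity changes, which is linear and coercive in ξ; from the exact force to `F'` there is only
  -- a consistency error.
  set F' : Fin P.count → ℝ → Plane := fun j ρ =>
    curveForce α f (P.grad X₀ j) (diffQuot k (x s) (x t) ρ) (W₀ ρ) with hF'
  set I : Fin P.count → ℝ := fun j => ∫ ρ in P.left j..P.right j,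
    ⟪Φ ρ, ξ (P.left j) + (ρ - P.left j) • P.grad ξ j⟫ with hI
  have k1 := hstep.of_periodic hξp
  -- The exact equation against the same test function; the boundary terms of the elements cancel by
  -- periodicity.
  have k2 : ∑ j, (I j + P.step j * ⟪P.grad (x t) j, P.grad ξ j⟫) = 0 := by
    have hper : Function.Periodic (fun ρ => ⟪deriv (x t) ρ, ξ ρ⟫) 1 := fun ρ => by
      simp only [periodic_deriv (hR.x_per t) ρ, hξp ρ]
    rw [← P.sum_boundary hper]
    refine Finset.sum_congr rfl fun j _ => ?_
    have := hR.curve_weak t ht (P.left j) (P.right j) (ξ (P.left j)) (P.grad ξ j)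
    rw [P.left_add_grad, ← P.step_smul_grad, real_inner_smul_left] at this
    simp only [hI, hΦ]
    rw [this]
    ring
  set b : Fin P.count → ℝ → ℝ := fun j σ => C₁ * (h + r + ‖P.grad e₀ j‖ + |z₀ σ|) with hb
  have k3 : ∀ j, |I j - P.step j / 2 * (⟪F' j (P.left j), ξ (P.left j)⟫
      + ⟪F' j (P.right j), ξ (P.right j)⟫)| ≤ P.step j / 2 *
        (b j (P.left j) * ‖ξ (P.left j)‖ + b j (P.right j) * ‖ξ (P.right j)‖) := fun j => by
    have := abs_integral_inner_sub_le (P.left_lt_right j) hΦc (cL := F' j (P.left j))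
      (cR := F' j (P.right j)) (BL := b j (P.left j)) (BR := b j (P.right j))
      (fun ρ hρ => hcons P hs ht' hst hk j (P.left_mem_elem j) hρ (hX₀ j).2 (hW₀ j).1)
      (fun ρ hρ => hcons P hs ht' hst hk j (P.right_mem_elem j) hρ (hX₀ j).2 (hW₀ j).2)
      (ξ (P.left j)) (P.grad ξ j)
    rwa [P.left_add_grad] at this
  have coer : ∀ j σ, c * ‖ξ σ‖ ^ 2 ≤ ⟪F' j σ, ξ σ⟫ - ⟪F j σ, ξ σ⟫ := fun j σ => by
    rw [← inner_sub_left]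
    simp only [hF, hF']
    rw [curveForce_sub, ← diffQuot_sub, ← hξ, inner_add_left, real_inner_smul_left,
      real_inner_smul_left, real_inner_self_eq_norm_sq, real_inner_comm (ξ σ) (perp _)]
    have e1 : 0 ≤ (1 - α) * ⟪ξ σ, perp (P.grad X₀ j)⟫ * ⟪ξ σ, perp (P.grad X₀ j)⟫ := by
      rw [mul_assoc]
      exact mul_nonneg (by linarith [hα.2]) (mul_self_nonneg _)
    -- The constant c is α (2K)⁻², from the lower bound on the old length element.
    have e2 : c ≤ α * ‖P.grad X₀ j‖ ^ 2 := by
      have : c = α * ((2 * K)⁻¹) ^ 2 := by rw [hc]; field_simp; norm_num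
      rw [this]
      exact mul_le_mul_of_nonneg_left
        (pow_le_pow_left₀ (by positivity) (hX₀ j).1 2) hα.1.le
    nlinarith [mul_le_mul_of_nonneg_right e2 (sq_nonneg ‖ξ σ‖)]
  have young : ∀ j σ, b j σ * ‖ξ σ‖ ≤ c / 2 * ‖ξ σ‖ ^ 2
      + 2 * C₁ ^ 2 / c * (h ^ 2 + r ^ 2 + ‖P.grad e₀ j‖ ^ 2 + |z₀ σ| ^ 2) := fun j σ => by
    have e1 : b j σ * ‖ξ σ‖ ≤ c / 2 * ‖ξ σ‖ ^ 2 + b j σ ^ 2 / (2 * c) := by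
      have : 0 ≤ (c * ‖ξ σ‖ - b j σ) ^ 2 / (2 * c) := by positivity
      have e : (c * ‖ξ σ‖ - b j σ) ^ 2 / (2 * c) =
          c / 2 * ‖ξ σ‖ ^ 2 + b j σ ^ 2 / (2 * c) - b j σ * ‖ξ σ‖ := by field_simp; ring
      linarith
    refine e1.trans (add_le_add le_rfl ?_)
    have e2 : (h + r + ‖P.grad e₀ j‖ + |z₀ σ|) ^ 2 ≤
        4 * (h ^ 2 + r ^ 2 + ‖P.grad e₀ j‖ ^ 2 + |z₀ σ| ^ 2) := by
      nlinarith [sq_nonneg (h - r), sq_nonneg (h - ‖P.grad e₀ j‖), sq_nonneg (h - |z₀ σ|),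
        sq_nonneg (r - ‖P.grad e₀ j‖), sq_nonneg (r - |z₀ σ|),
        sq_nonneg (‖P.grad e₀ j‖ - |z₀ σ|)]
    have e3 : b j σ ^ 2 / (2 * c) = C₁ ^ 2 / (2 * c) * (h + r + ‖P.grad e₀ j‖ + |z₀ σ|) ^ 2 := by
      simp only [hb]; ring
    rw [e3]
    refine (mul_le_mul_of_nonneg_left e2 (by positivity)).trans (le_of_eq ?_)
    field_simp
    ring
  have main : ∑ j, P.step j * ⟪P.grad e₁ j, P.grad ξ j⟫ ≤
      -(c / 2) * P.massSq ξ + 2 * C₁ ^ 2 / c *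
        (h ^ 2 + r ^ 2 + P.gradSq e₀ + P.massSq z₀) := by
    have e1 : ∑ j, P.step j * ⟪P.grad e₁ j, P.grad ξ j⟫ =
        ∑ j, (P.step j / 2 * (⟪F j (P.left j), ξ (P.left j)⟫ + ⟪F j (P.right j), ξ (P.right j)⟫)
          - I j) := by
      rw [← sub_eq_zero, ← sub_zero (0 : ℝ)]
      nth_rewrite 1 [← k2]
      rw [← k1, ← Finset.sum_sub_distrib, ← Finset.sum_sub_distrib]
      refine Finset.sum_congr rfl fun j _ => ?_
      simp only [he₁, P.grad_sub, inner_sub_left, hF]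
      ring
    have e2 : -(c / 2) * P.massSq ξ + 2 * C₁ ^ 2 / c *
        (h ^ 2 + r ^ 2 + P.gradSq e₀ + P.massSq z₀) =
        ∑ j, P.step j / 2 * (-(c / 2) * (‖ξ (P.left j)‖ ^ 2 + ‖ξ (P.right j)‖ ^ 2)
          + 2 * C₁ ^ 2 / c * (2 * (h ^ 2 + r ^ 2) + 2 * ‖P.grad e₀ j‖ ^ 2
            + (|z₀ (P.left j)| ^ 2 + |z₀ (P.right j)| ^ 2))) := by
      have : h ^ 2 + r ^ 2 = ∑ j, P.step j * (h ^ 2 + r ^ 2) := by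
        rw [← Finset.sum_mul, P.sum_step_one, one_mul]
      conv_lhs => rw [this]
      rw [Partition.massSq, Partition.gradSq, Partition.massSq, ← Finset.sum_add_distrib,
        ← Finset.sum_add_distrib, Finset.mul_sum, Finset.mul_sum, ← Finset.sum_add_distrib]
      refine Finset.sum_congr rfl fun j _ => ?_
      simp only [Real.norm_eq_abs]
      ring
    rw [e1, e2]
    refine Finset.sum_le_sum fun j _ => ?_
    have s0 := half_pos (P.step_pos j)
    have a1 := (abs_le.1 (k3 j)).1
    have a2 := mul_le_mul_of_nonneg_left
      (add_le_add (add_le_add (coer j (P.left j)) (coer j (P.right j)))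
        (add_le_add (young j (P.left j)) (young j (P.right j)))) s0.le
    linarith
  -- Implicit treatment of the stiffness term gives, besides the increment of the energy, the
  -- dissipation k² |ξ_ρ|². It is kept because the scalar estimate needs it.
  have lhs : k * ∑ j, P.step j * ⟪P.grad e₁ j, P.grad ξ j⟫ =
      (P.gradSq e₁ - P.gradSq e₀ + k ^ 2 * P.gradSq ξ) / 2 := by
    simp only [Partition.gradSq]
    rw [Finset.mul_sum, Finset.mul_sum, ← Finset.sum_sub_distrib, ← Finset.sum_add_distrib,
      Finset.sum_div]
    refine Finset.sum_congr rfl fun j _ => ?_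
    have e1 : k • P.grad ξ j = P.grad e₁ j - P.grad e₀ j := by
      rw [hξ, P.grad_diffQuot, smul_smul, mul_inv_cancel₀ hk0.ne', one_smul]
    have e2 : k * ⟪P.grad e₁ j, P.grad ξ j⟫ = ‖P.grad e₁ j‖ ^ 2 - ⟪P.grad e₁ j, P.grad e₀ j⟫ := by
      rw [← real_inner_smul_right, e1, inner_sub_right, real_inner_self_eq_norm_sq]
    have e3 : k ^ 2 * ‖P.grad ξ j‖ ^ 2 =
        ‖P.grad e₁ j‖ ^ 2 - 2 * ⟪P.grad e₁ j, P.grad e₀ j⟫ + ‖P.grad e₀ j‖ ^ 2 := by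
      rw [← norm_sub_sq_real, ← e1, norm_smul, mul_pow, Real.norm_eq_abs, sq_abs]
    linear_combination P.step j * e2 - P.step j / 2 * e3
  have fin := mul_le_mul_of_nonneg_left main hk0.le
  rw [lhs, hr2] at fin
  have n1 := P.gradSq_nonneg ξ
  have n2 : c * (k ^ 2 * P.gradSq ξ) ≤ k ^ 2 * P.gradSq ξ :=
    mul_le_of_le_one_left (by positivity) hc1
  have n3 : 4 * C₁ ^ 2 / c * k * (h ^ 2 + k * (G t - G s) + P.gradSq e₀ + P.massSq z₀) =
      2 * (k * (2 * C₁ ^ 2 / c * (h ^ 2 + k * (G t - G s) + P.gradSq e₀ + P.massSq z₀))) := by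
    ring
  rw [n3]
  linarith

end Consistency

/-! ### Consistency of the scalar scheme. -/

lemma abs_mul_sub_mul_le (a b a' b' : ℝ) :
    |a * b - a' * b'| ≤ |a - a'| * |b| + |a'| * |b - b'| := by
  rw [show a * b - a' * b' = (a - a') * b + a' * (b - b') by ring, ← abs_mul, ← abs_mul]
  exact abs_add_le _ _

lemma abs_inner_sub_inner_le {E : Type*} [NormedAddCommGroup E] [InnerProductSpace ℝ E]
    (a b a' b' : E) : |⟪a, b⟫ - ⟪a', b'⟫| ≤ ‖a - a'‖ * ‖b‖ + ‖a'‖ * ‖b - b'‖ := by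
  rw [show ⟪a, b⟫ - ⟪a', b'⟫ = ⟪a - a', b⟫ + ⟪a', b - b'⟫ by
    rw [inner_sub_left, inner_sub_right]; ring]
  exact (abs_add_le _ _).trans
    (add_le_add (abs_real_inner_le_norm _ _) (abs_real_inner_le_norm _ _))

/-- Lumping of the two parts of the scalar equation. -/
lemma abs_integral_scalar_sub_le {R Φ : ℝ → ℝ} {a b : ℝ} (hab : a < b) (hRc : Continuous R)
    (hΦc : Continuous Φ) {cL cR cL' cR' BL BR BL' BR' : ℝ}
    (hL : ∀ ρ ∈ Icc a b, |R ρ - cL| ≤ BL) (hR : ∀ ρ ∈ Icc a b, |R ρ - cR| ≤ BR)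
    (hL' : ∀ ρ ∈ Icc a b, |Φ ρ - cL'| ≤ BL') (hR' : ∀ ρ ∈ Icc a b, |Φ ρ - cR'| ≤ BR')
    (p q r : ℝ) (hr : r = p + (b - a) * q) :
    |(∫ ρ in a..b, (R ρ * (p + (ρ - a) * q) + Φ ρ * q))
        - (b - a) / 2 * ((cL * p + cL' * q) + (cR * r + cR' * q))| ≤
      (b - a) / 2 * ((BL * |p| + BL' * |q|) + (BR * |r| + BR' * |q|)) := by
  have hba : 0 < b - a := sub_pos.2 hab
  have key := abs_integral_sub_le (F := fun ρ => R ρ * (p + (ρ - a) * q) + Φ ρ * q)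
    (A := cL * p + cL' * q) (A' := (b - a)⁻¹ * (cR * r + cR' * q - (cL * p + cL' * q)))
    (C := BL * |p| + BL' * |q|)
    (C' := (b - a)⁻¹ * (BR * |r| + BR' * |q| - (BL * |p| + BL' * |q|))) hab.le
    (by apply Continuous.intervalIntegrable; fun_prop) ?_
  · rw [mul_inv_cancel_left₀ hba.ne', mul_inv_cancel_left₀ hba.ne', add_sub_cancel,
      add_sub_cancel] at key
    exact key
  · intro ρ hρ
    set θ := (ρ - a) * (b - a)⁻¹ with hθ
    have hθ0 : 0 ≤ θ := mul_nonneg (by linarith [hρ.1]) (inv_nonneg.2 hba.le)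
    have hθ1 : 0 ≤ 1 - θ := by
      rw [sub_nonneg, hθ, ← div_eq_mul_inv, div_le_one hba]
      linarith [hρ.2]
    have hq : p + (ρ - a) * q = (1 - θ) * p + θ * r := by
      have : ρ - a = θ * (b - a) := by rw [hθ, inv_mul_cancel_right₀ hba.ne']
      rw [hr, this]; ring
    have e1 : R ρ * (p + (ρ - a) * q) + Φ ρ * q
        - (cL * p + cL' * q + (ρ - a) * ((b - a)⁻¹ * (cR * r + cR' * q - (cL * p + cL' * q)))) =
        (1 - θ) * ((R ρ - cL) * p + (Φ ρ - cL') * q)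
          + θ * ((R ρ - cR) * r + (Φ ρ - cR') * q) := by
      rw [hq, ← mul_assoc, ← hθ]
      ring
    have e2 : BL * |p| + BL' * |q| + (ρ - a) * ((b - a)⁻¹ *
        (BR * |r| + BR' * |q| - (BL * |p| + BL' * |q|))) =
        (1 - θ) * (BL * |p| + BL' * |q|) + θ * (BR * |r| + BR' * |q|) := by
      rw [← mul_assoc, ← hθ]; ring
    rw [e1, e2]
    have aux : ∀ {u v c e B B' : ℝ}, |u| ≤ B → |v| ≤ B' → |u * c + v * e| ≤ B * |c| + B' * |e| :=
      fun {u v c e B B'} hu hv => by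
        refine (abs_add_le _ _).trans ?_
        rw [abs_mul, abs_mul]
        exact add_le_add (mul_le_mul_of_nonneg_right hu (abs_nonneg _))
          (mul_le_mul_of_nonneg_right hv (abs_nonneg _))
    refine (abs_add_le _ _).trans (add_le_add ?_ ?_)
    · rw [abs_mul, abs_of_nonneg hθ1]
      exact mul_le_mul_of_nonneg_left (aux (hL ρ hρ) (hL' ρ hρ)) hθ1
    · rw [abs_mul, abs_of_nonneg hθ0]
      exact mul_le_mul_of_nonneg_left (aux (hR ρ hρ) (hR' ρ hρ)) hθ0

/-- Square summable oscillation over the elements. -/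
lemma exists_osc {ρ₀ : ℝ} (P : Partition ρ₀ (ρ₀ + 1)) {E : Type*} [NormedAddCommGroup E]
    [NormedSpace ℝ E] {u : ℝ → E} {Y : ℝ → ℝ} {K k : ℝ} (hk : 0 < k) (hY : Monotone Y)
    (hYK : ∀ ρ, Y (ρ + 1) - Y ρ ≤ K * k ^ 2)
    (hu : ∀ a b, a ≤ b → ‖u b - u a‖ ^ 2 ≤ (b - a) * (Y b - Y a)) :
    ∃ β : Fin P.count → ℝ, (∀ j, 0 ≤ β j) ∧ ∑ j, P.step j * β j ^ 2 ≤ K * P.maxStep ^ 2 ∧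
      ∀ j, ∀ ρ ∈ Icc (P.left j) (P.right j), ∀ σ ∈ Icc (P.left j) (P.right j),
        ‖k⁻¹ • u ρ - k⁻¹ • u σ‖ ≤ β j := by
  have hh := P.maxStep_pos.le
  have hYn : ∀ j, 0 ≤ Y (P.right j) - Y (P.left j) := fun j =>
    sub_nonneg.2 (hY (P.left_lt_right j).le)
  -- The increments of `Y` sum to at most K k², so the factor k⁻² cancels, and the two factors of
  -- the mesh size give the order h².
  refine ⟨fun j => k⁻¹ * √(P.maxStep * (Y (P.right j) - Y (P.left j))), fun j => by positivity,
    ?_, ?_⟩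
  · have h1 : ∀ j, P.step j * (k⁻¹ * √(P.maxStep * (Y (P.right j) - Y (P.left j)))) ^ 2 ≤
        P.maxStep ^ 2 * (k⁻¹) ^ 2 * (Y (P.right j) - Y (P.left j)) := fun j => by
      rw [mul_pow, Real.sq_sqrt (mul_nonneg hh (hYn j))]
      calc P.step j * ((k⁻¹) ^ 2 * (P.maxStep * (Y (P.right j) - Y (P.left j))))
          ≤ P.maxStep * ((k⁻¹) ^ 2 * (P.maxStep * (Y (P.right j) - Y (P.left j)))) :=
            mul_le_mul_of_nonneg_right (P.step_le_maxStep j)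
              (mul_nonneg (by positivity) (mul_nonneg hh (hYn j)))
        _ = _ := by ring
    refine (Finset.sum_le_sum fun j _ => h1 j).trans ?_
    rw [← Finset.mul_sum]
    calc P.maxStep ^ 2 * (k⁻¹) ^ 2 * ∑ j, (Y (P.right j) - Y (P.left j))
        ≤ P.maxStep ^ 2 * (k⁻¹) ^ 2 * (K * k ^ 2) :=
          mul_le_mul_of_nonneg_left (P.sum_mono_le hYK) (by positivity)
      _ = K * P.maxStep ^ 2 := by field_simp
  · have key : ∀ j, ∀ ρ ∈ Icc (P.left j) (P.right j), ∀ σ ∈ Icc (P.left j) (P.right j), ρ ≤ σ →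
        ‖u σ - u ρ‖ ≤ √(P.maxStep * (Y (P.right j) - Y (P.left j))) := by
      intro j ρ hρ σ hσ h
      refine Real.le_sqrt_of_sq_le ((hu ρ σ h).trans ?_)
      have h1 : σ - ρ ≤ P.maxStep := (le_abs_self _).trans (P.abs_sub_le_maxStep j hσ hρ)
      have h2 : Y σ - Y ρ ≤ Y (P.right j) - Y (P.left j) := by
        linarith [hY hσ.2, hY hρ.1]
      exact mul_le_mul h1 h2 (sub_nonneg.2 (hY h)) hh
    intro j ρ hρ σ hσ
    rw [← smul_sub, norm_smul, norm_inv, Real.norm_of_nonneg hk.le]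
    refine mul_le_mul_of_nonneg_left ?_ (inv_nonneg.2 hk.le)
    rcases le_total ρ σ with h | h
    · rw [norm_sub_rev]; exact key j ρ hρ σ hσ h
    · exact key j σ hσ ρ hρ h

section Scalar

variable {T α d K : ℝ} {f : ℝ → ℝ} {g : ℝ → ℝ → ℝ} {x : ℝ → ℝ → Plane} {w : ℝ → ℝ → ℝ}
  {G : ℝ → ℝ}

/-- The force is affine in the velocity. Linear growth is needed because no uniform bound on the
discrete velocity is available. -/
lemma exists_curveForce_growth (hα : α ∈ Ioc (0 : ℝ) 1) (hf : ContDiff ℝ 1 f) {R : ℝ}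
    (hR : 0 ≤ R) : ∃ C, 0 ≤ C ∧ ∀ (a D : Plane) (s : ℝ), ‖a‖ ≤ R → |s| ≤ R →
      ‖curveForce α f a D s‖ ≤ C * (1 + ‖D‖) := by
  obtain ⟨C, hC, hbd, -⟩ := exists_curveForce_bound α hf R
  refine ⟨C + R ^ 2, by positivity, fun a D s ha hs => ?_⟩
  have h1 := hbd a 0 s ha (by simpa using hR) hs
  have h2 : ‖curveForce α f a D s - curveForce α f a 0 s‖ ≤ R ^ 2 * ‖D‖ := by
    rw [curveForce_sub, sub_zero]
    have e1 : ‖(α * ‖a‖ ^ 2) • D‖ ≤ α * R ^ 2 * ‖D‖ := by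
      rw [norm_smul, Real.norm_of_nonneg (mul_nonneg hα.1.le (sq_nonneg _))]
      exact mul_le_mul_of_nonneg_right (mul_le_mul_of_nonneg_left
        (pow_le_pow_left₀ (norm_nonneg _) ha 2) hα.1.le) (norm_nonneg _)
    have e2 : ‖((1 - α) * ⟪D, perp a⟫) • perp a‖ ≤ (1 - α) * R ^ 2 * ‖D‖ := by
      have hα' : 0 ≤ 1 - α := by linarith [hα.2]
      rw [norm_smul, norm_mul, Real.norm_of_nonneg hα', norm_perp]
      have e3 : ‖⟪D, perp a⟫‖ ≤ ‖D‖ * ‖a‖ := by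
        have := norm_inner_le_norm (𝕜 := ℝ) D (perp a)
        rwa [norm_perp] at this
      calc (1 - α) * ‖⟪D, perp a⟫‖ * ‖a‖ ≤ (1 - α) * (‖D‖ * ‖a‖) * ‖a‖ := by gcongr
        _ = (1 - α) * ‖a‖ ^ 2 * ‖D‖ := by ring
        _ ≤ _ := by gcongr
    calc _ ≤ _ := norm_add_le _ _
      _ ≤ α * R ^ 2 * ‖D‖ + (1 - α) * R ^ 2 * ‖D‖ := add_le_add e1 e2
      _ = R ^ 2 * ‖D‖ := by ring
  have h3 : ‖curveForce α f a D s‖ ≤ ‖curveForce α f a D s - curveForce α f a 0 s‖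
      + ‖curveForce α f a 0 s‖ := by
    simpa using norm_add_le (curveForce α f a D s - curveForce α f a 0 s) (curveForce α f a 0 s)
  have : 0 ≤ C * ‖D‖ := by positivity
  nlinarith [sq_nonneg R]

/-- The discrete tangents of neighbouring elements differ by the order of the mesh width. -/
lemma exists_tangent_jump (hα : α ∈ Ioc (0 : ℝ) 1) (hf : ContDiff ℝ 1 f) (hK : 0 < K) :
    ∃ C, 0 ≤ C ∧ ∀ {ρ₀ : ℝ} (P : Partition ρ₀ (ρ₀ + 1)) {k : ℝ} {X₀ X : ℝ → Plane} {W₀ : ℝ → ℝ},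
      Function.Periodic X₀ 1 → Function.Periodic X 1 → Function.Periodic W₀ 1 →
      (∀ j, ‖P.grad X₀ j‖ ≤ 2 * K) → (∀ j, |W₀ (P.right j)| ≤ 2 * K) →
      (∀ j, (2 * K)⁻¹ ≤ ‖P.grad X j‖) → CurveStep P α f k X₀ W₀ X → ∀ j,
      ‖discTangent P X j - discTangent P X (P.next j)‖ ≤
        C * P.maxStep * (1 + ‖diffQuot k X₀ X (P.right j)‖) := by
  obtain ⟨C, hC, hgr⟩ := exists_curveForce_growth hα hf (R := 2 * K) (by positivity)
  refine ⟨4 * K * C, by positivity, ?_⟩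
  intro ρ₀ P k X₀ X W₀ hX₀p hXp hW₀p hX₀ hW₀ hX hstep j
  have hne : ∀ j, P.grad X j ≠ 0 := fun j h => by
    have := hX j
    rw [h, norm_zero] at this
    exact absurd this (not_le.2 (by positivity))
  have hjump := hstep.jump hX₀p hXp hW₀p j
  set δ := 1 + ‖diffQuot k X₀ X (P.right j)‖ with hδ
  have hδ0 : 0 ≤ δ := by positivity
  -- The curve scheme plays the role of a bound on the second derivative of the discrete curve.
  have h1 : ‖P.grad X (P.next j) - P.grad X j‖ ≤ C * P.maxStep * δ := by
    rw [hjump]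
    refine (norm_add_le _ _).trans ?_
    rw [norm_smul, norm_smul, Real.norm_of_nonneg (half_pos (P.step_pos _)).le,
      Real.norm_of_nonneg (half_pos (P.step_pos _)).le]
    have a1 := hgr (P.grad X₀ j) (diffQuot k X₀ X (P.right j)) (W₀ (P.right j)) (hX₀ j) (hW₀ j)
    have a2 := hgr (P.grad X₀ (P.next j)) (diffQuot k X₀ X (P.right j)) (W₀ (P.right j))
      (hX₀ _) (hW₀ j)
    calc _ ≤ P.maxStep / 2 * (C * δ) + P.maxStep / 2 * (C * δ) := by
          have s1 := P.step_le_maxStep j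
          have s2 := P.step_le_maxStep (P.next j)
          have s3 := P.maxStep_pos
          gcongr
      _ = _ := by ring
  have h2 := norm_unit_sub_le (hne j) (hne (P.next j))
  have h3 : ‖P.grad X (P.next j)‖⁻¹ ≤ 2 * K := inv_le_of_inv_le₀ (by positivity) (hX _)
  calc ‖discTangent P X j - discTangent P X (P.next j)‖
      ≤ 2 * ‖P.grad X (P.next j)‖⁻¹ * ‖P.grad X j - P.grad X (P.next j)‖ := h2
    _ ≤ 2 * (2 * K) * (C * P.maxStep * δ) := by
        rw [norm_sub_rev (P.grad X j)]
        gcongr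
    _ = _ := by ring

/-- The length element changes by the tangential part of the increment, up to second order. -/
lemma norm_sub_norm_remainder {a b : Plane} (ha : a ≠ 0) :
    ⟪a - b, ‖a‖⁻¹ • a⟫ - (‖a‖ - ‖b‖) ≤ ‖a - b‖ ^ 2 / ‖a‖ ∧
      0 ≤ ⟪a - b, ‖a‖⁻¹ • a⟫ - (‖a‖ - ‖b‖) := by
  have hp : 0 < ‖a‖ := norm_pos_iff.2 ha
  have e1 : ⟪a - b, ‖a‖⁻¹ • a⟫ = ‖a‖ - ⟪b, a⟫ / ‖a‖ := by
    rw [inner_sub_left, real_inner_smul_right, real_inner_smul_right, real_inner_self_eq_norm_sq]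
    field_simp
  -- The remainder is the defect in the Cauchy-Schwarz inequality for a and b, hence nonnegative and
  -- quadratic in a - b.
  have e2 : ⟪a - b, ‖a‖⁻¹ • a⟫ - (‖a‖ - ‖b‖) = (‖a‖ * ‖b‖ - ⟪b, a⟫) / ‖a‖ := by
    rw [e1]; field_simp; ring
  have e3 : ⟪b, a⟫ ≤ ‖a‖ * ‖b‖ := by rw [mul_comm]; exact real_inner_le_norm b a
  have e4 : ‖a - b‖ ^ 2 = ‖a‖ ^ 2 - 2 * ⟪b, a⟫ + ‖b‖ ^ 2 := by
    rw [norm_sub_sq_real, real_inner_comm]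
  have h0 : 0 ≤ (‖a‖ * ‖b‖ - ⟪b, a⟫) / ‖a‖ := div_nonneg (by linarith) hp.le
  rw [e2]
  refine ⟨?_, h0⟩
  refine div_le_div_of_nonneg_right ?_ hp.le
  nlinarith [sq_nonneg (‖a‖ - ‖b‖)]

lemma Reg.diffQuot_x_lip (hR : Reg T α d f g x w K G) {s t : ℝ} (hs : s ∈ Icc 0 T)
    (ht : t ∈ Icc 0 T) (hst : s < t) (a b : ℝ) :
    ‖diffQuot (t - s) (x s) (x t) b - diffQuot (t - s) (x s) (x t) a‖ ≤ K * |b - a| := by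
  have hk : 0 < t - s := sub_pos.2 hst
  refine norm_sub_le_of_deriv_le (u' := fun ρ => (t - s)⁻¹ • (deriv (x t) ρ - deriv (x s) ρ))
    (fun ρ => ((hR.x_deriv t ht ρ).sub (hR.x_deriv s hs ρ)).const_smul _) (fun ρ => ?_) a b
  rw [norm_smul, norm_inv, Real.norm_of_nonneg hk.le, inv_mul_le_iff₀ hk, mul_comm]
  simpa [abs_of_pos hk] using hR.xρ_time s hs t ht ρ

lemma Reg.grad_diffQuot_x_le (hR : Reg T α d f g x w K G) {ρ₀ : ℝ} (P : Partition ρ₀ (ρ₀ + 1))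
    {s t : ℝ} (hs : s ∈ Icc 0 T) (ht : t ∈ Icc 0 T) (hst : s < t) (j : Fin P.count) :
    ‖P.grad (diffQuot (t - s) (x s) (x t)) j‖ ≤ K := by
  have h := hR.diffQuot_x_lip hs ht hst (P.left j) (P.right j)
  have hs := P.step_pos j
  rw [← P.step_smul_grad, norm_smul, Real.norm_of_nonneg hs.le, ← Partition.step, abs_of_pos hs,
    mul_comm] at h
  exact le_of_mul_le_mul_right h hs

/-- Differences of the geometric quantities of the exact and the discrete curve. -/
lemma Reg.tangent_sub_le (hR : Reg T α d f g x w K G) {ρ₀ : ℝ} (P : Partition ρ₀ (ρ₀ + 1))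
    {t : ℝ} (ht : t ∈ Icc 0 T) {X : ℝ → Plane} (j : Fin P.count) (hX : P.grad X j ≠ 0) {ρ : ℝ}
    (hρ : ρ ∈ Icc (P.left j) (P.right j)) :
    ‖deriv (x t) ρ - P.grad X j‖ ≤ K * (P.maxStep + ‖P.grad (fun r => x t r - X r) j‖) ∧
    ‖tangent (x t) ρ - discTangent P X j‖ ≤
      2 * K ^ 2 * (P.maxStep + ‖P.grad (fun r => x t r - X r) j‖) := by
  have hK := hR.K_pos
  have h1 : ‖deriv (x t) ρ - P.grad X j‖ ≤
      K * (P.maxStep + ‖P.grad (fun r => x t r - X r) j‖) := by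
    have e : deriv (x t) ρ - P.grad X j =
        -(P.grad (x t) j - deriv (x t) ρ) + P.grad (fun r => x t r - X r) j := by
      rw [P.grad_sub]; abel
    rw [e, mul_add]
    refine (norm_add_le _ _).trans (add_le_add ?_ ?_)
    · rw [norm_neg]; exact hR.grad_x_sub_le P ht j hρ
    · exact le_mul_of_one_le_left (norm_nonneg _) hR.one_le
  refine ⟨h1, ?_⟩
  have h2 := norm_unit_sub_le hX (hR.xρ_ne_zero ht ρ)
  have h3 : ‖deriv (x t) ρ‖⁻¹ ≤ K := inv_le_of_inv_le₀ hK (hR.le_xρ t ht ρ)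
  calc ‖tangent (x t) ρ - discTangent P X j‖
      = ‖‖P.grad X j‖⁻¹ • P.grad X j - ‖deriv (x t) ρ‖⁻¹ • deriv (x t) ρ‖ := norm_sub_rev _ _
    _ ≤ _ := h2
    _ ≤ 2 * K * (K * (P.maxStep + ‖P.grad (fun r => x t r - X r) j‖)) := by
        rw [norm_sub_rev (P.grad X j)]
        gcongr
    _ = _ := by ring

/-- The discrete velocity V is not assumed bounded. Passing through g v y', the change in the scalar
uses the local C¹ bound and the change in the velocity the global Lipschitz hypothesis. -/
lemma exists_reaction_bound (hg : ContDiff ℝ 1 (fun p : ℝ × ℝ => g p.1 p.2))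
    (hg_lip : ∀ L > 0, ∃ CL ≥ 0, ∀ v₁ v₂ z : ℝ, |z| ≤ L → |g v₁ z - g v₂ z| ≤ CL * |v₁ - v₂|)
    (hK : 0 < K) : ∃ C, 0 ≤ C ∧ ∀ v V y y' : ℝ, |v| ≤ 2 * K → |y| ≤ 2 * K → |y'| ≤ 2 * K →
      |g v y| ≤ C ∧ |g v y - g V y'| ≤ C * (|v - V| + |y - y'|) := by
  obtain ⟨C, hC, hb, hl⟩ := exists_lipschitz_bound hg (2 * K)
  obtain ⟨CL, hCL, hgl⟩ := hg_lip (2 * K) (by positivity)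
  refine ⟨C + CL, add_nonneg hC hCL, fun v V y y' hv hy hy' => ?_⟩
  have n1 : ‖(v, y)‖ ≤ 2 * K := by
    rw [Prod.norm_def]; exact max_le hv hy
  have n2 : ‖(v, y')‖ ≤ 2 * K := by
    rw [Prod.norm_def]; exact max_le hv hy'
  have h1 := hb (v, y) n1
  have h2 := hl (v, y) (v, y') n1 n2
  have h3 := hgl v V y' hy'
  have h4 : ‖(v, y) - (v, y')‖ = |y - y'| := by
    rw [Prod.mk_sub_mk, sub_self, Prod.norm_def]
    simp
  rw [h4] at h2
  simp only [Real.norm_eq_abs] at h1 h2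
  refine ⟨h1.trans (le_add_of_nonneg_right hCL), ?_⟩
  have h5 : |g v y - g V y'| ≤ |g v y - g v y'| + |g v y' - g V y'| := abs_sub_le _ _ _
  have p1 := mul_nonneg hC (abs_nonneg (v - V))
  have p2 := mul_nonneg hCL (abs_nonneg (y - y'))
  nlinarith

/-- Consistency error of the zeroth order part of the scalar equation. -/
lemma exists_scalar_consistency (hR : Reg T α d f g x w K G)
    (hg : ContDiff ℝ 1 (fun p : ℝ × ℝ => g p.1 p.2))
    (hg_lip : ∀ L > 0, ∃ CL ≥ 0, ∀ v₁ v₂ z : ℝ, |z| ≤ L → |g v₁ z - g v₂ z| ≤ CL * |v₁ - v₂|)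
    {Ct : ℝ} (hCt : 0 ≤ Ct) :
    ∃ C, 0 ≤ C ∧ ∀ {ρ₀ : ℝ} (P : Partition ρ₀ (ρ₀ + 1)) {s t : ℝ}, s ∈ Icc 0 T → t ∈ Icc 0 T →
      s < t → t - s ≤ Ct * P.maxStep → ∀ {X₀ X : ℝ → Plane} {W₀ : ℝ → ℝ} (j : Fin P.count)
      {σ ρ β γ : ℝ}, σ ∈ Icc (P.left j) (P.right j) → ρ ∈ Icc (P.left j) (P.right j) →
      P.grad X j ≠ 0 → ‖P.grad X j‖ ≤ 2 * K → |W₀ σ| ≤ 2 * K → 0 ≤ β → 0 ≤ γ →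
      |diffQuot (t - s) (w s) (w t) ρ - diffQuot (t - s) (w s) (w t) σ| ≤ β →
      ‖(t - s)⁻¹ • (deriv (x t) ρ - deriv (x s) ρ)
        - P.grad (diffQuot (t - s) (x s) (x t)) j‖ ≤ γ →
      |(‖deriv (x t) ρ‖ * ((t - s)⁻¹ * (w t ρ - w s ρ))
            + ⟪(t - s)⁻¹ • (deriv (x t) ρ - deriv (x s) ρ), tangent (x t) ρ⟫ * w t ρ
            - ‖deriv (x t) ρ‖ * g (normalVel T x t ρ) (w t ρ))
        - (‖P.grad X j‖ * diffQuot (t - s) (w s) (w t) σ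
            + ⟪P.grad (diffQuot (t - s) (x s) (x t)) j, discTangent P X j⟫ * w s σ
            - ‖P.grad X j‖ * g ⟪diffQuot (t - s) X₀ X σ, discNormal P X j⟫ (W₀ σ))| ≤
      C * (P.maxStep + √((t - s) * (G t - G s)) + ‖P.grad (fun r => x t r - X r) j‖
        + ‖diffQuot (t - s) (fun r => x s r - X₀ r) (fun r => x t r - X r) σ‖
        + |w s σ - W₀ σ| + β + γ) := by
  have hK := hR.K_pos
  obtain ⟨Cg, hCg, hgb⟩ := exists_reaction_bound hg hg_lip hK
  refine ⟨(K * K + 2 * K) + (K + K * (2 * K ^ 2) * K + K * (K * (1 + Ct)))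
    + (K * Cg + 2 * K * (Cg * ((K + K * (2 * K ^ 2)) + K * (1 + Ct)))), by positivity, ?_⟩
  intro ρ₀ P s t hs ht hst hk X₀ X W₀ j σ ρ β γ hσ hρ hXne hX hW hβ hγ hβw hγx
  have hh : 0 < P.maxStep := P.maxStep_pos
  have hρσ : |ρ - σ| ≤ P.maxStep := P.abs_sub_le_maxStep j hρ hσ
  have hts : |t - s| ≤ Ct * P.maxStep := by rwa [abs_of_pos (sub_pos.2 hst)]
  obtain ⟨q1, q2⟩ := hR.tangent_sub_le P ht j hXne hρ
  have hK1 := hR.one_le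
  set h := P.maxStep
  set r := √((t - s) * (G t - G s)) with hr
  set e := ‖P.grad (fun r => x t r - X r) j‖
  set De := ‖diffQuot (t - s) (fun r => x s r - X₀ r) (fun r => x t r - X r) σ‖ with hDe
  set y := |w s σ - W₀ σ|
  have hr0 : 0 ≤ r := Real.sqrt_nonneg _
  have he0 : 0 ≤ e := norm_nonneg _
  have hDe0 : 0 ≤ De := norm_nonneg _
  have hy0 : 0 ≤ y := abs_nonneg _
  -- All sources of error are gathered in one quantity, and each of the differences below is bounded
  -- by a constant times it.
  set S := h + r + e + De + y + β + γ with hS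
  have hS0 : 0 ≤ S := by positivity
  have p0 : h + e ≤ S := by rw [hS]; linarith
  have p1 : ‖deriv (x t) ρ - P.grad X j‖ ≤ K * S := q1.trans (by gcongr)
  have p1' : |‖deriv (x t) ρ‖ - ‖P.grad X j‖| ≤ K * S := (abs_norm_sub_norm_le _ _).trans p1
  have p2 : ‖tangent (x t) ρ - discTangent P X j‖ ≤ 2 * K ^ 2 * S := q2.trans (by gcongr)
  have p3 : ‖timeDeriv T x t ρ - diffQuot (t - s) X₀ X σ‖ ≤ K * S := by
    have e1 : timeDeriv T x t ρ - diffQuot (t - s) X₀ X σ =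
        (timeDeriv T x t ρ - timeDeriv T x t σ)
        + (timeDeriv T x t σ - diffQuot (t - s) (x s) (x t) σ)
        + diffQuot (t - s) (fun r => x s r - X₀ r) (fun r => x t r - X r) σ := by
      rw [diffQuot_sub]; abel
    have e2 : ‖timeDeriv T x t ρ - diffQuot (t - s) X₀ X σ‖ ≤ K * h + r + De := by
      rw [e1]
      refine (norm_add_le _ _).trans (add_le_add ((norm_add_le _ _).trans
        (add_le_add ?_ (hR.xt_sub_le hs ht hst σ))) le_rfl)
      exact (hR.xt_lip t ht _ _).trans (mul_le_mul_of_nonneg_left hρσ hK.le)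
    have e3 : r + De + (e + y + β + γ) ≤ K * (r + De + (e + y + β + γ)) :=
      le_mul_of_one_le_left (by positivity) hK1
    rw [hS]
    linarith
  have p4a : |w t ρ - w s σ| ≤ K * (1 + Ct) * h := by
    have e1 : |w t ρ - w s σ| ≤ |w t ρ - w t σ| + |w t σ - w s σ| := abs_sub_le _ _ _
    have e2 : |w t ρ - w t σ| ≤ K * h :=
      (hR.w_lip ht _ _).trans (mul_le_mul_of_nonneg_left hρσ hK.le)
    have e3 : |w t σ - w s σ| ≤ K * (Ct * h) :=
      (hR.w_time s hs t ht σ).trans (mul_le_mul_of_nonneg_left hts hK.le)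
    linarith
  have hhS : h ≤ S := by rw [hS]; linarith
  have p4 : |w t ρ - w s σ| ≤ K * (1 + Ct) * S := p4a.trans (by gcongr)
  have p5 : |w t ρ - W₀ σ| ≤ K * (1 + Ct) * S := by
    have e1 : |w t ρ - W₀ σ| ≤ |w t ρ - w s σ| + y := abs_sub_le _ _ _
    have e2 : 1 ≤ K * (1 + Ct) := by nlinarith
    have e3 : y ≤ K * (1 + Ct) * y := le_mul_of_one_le_left hy0 e2
    have e4 : K * (1 + Ct) * (h + y) ≤ K * (1 + Ct) * S :=
      mul_le_mul_of_nonneg_left (by rw [hS]; linarith) (by positivity)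
    linarith
  have hN : ‖discNormal P X j‖ = 1 := by
    rw [discNormal, norm_perp, discTangent, norm_unit hXne]
  have hT1 : ‖discTangent P X j‖ = 1 := norm_unit hXne
  have hτ1 : ‖tangent (x t) ρ‖ = 1 := norm_unit (hR.xρ_ne_zero ht ρ)
  have hν1 : ‖normal (x t) ρ‖ = 1 := by rw [normal, norm_perp, hτ1]
  have p6 : |normalVel T x t ρ - ⟪diffQuot (t - s) X₀ X σ, discNormal P X j⟫| ≤
      (K + K * (2 * K ^ 2)) * S := by
    have e1 := abs_inner_sub_inner_le (normal (x t) ρ) (timeDeriv T x t ρ) (discNormal P X j)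
      (diffQuot (t - s) X₀ X σ)
    rw [real_inner_comm, real_inner_comm (diffQuot (t - s) X₀ X σ), hN, one_mul] at e1
    have e2 : ‖normal (x t) ρ - discNormal P X j‖ ≤ 2 * K ^ 2 * S := by
      rw [normal, discNormal, ← perp_sub, norm_perp]; exact p2
    have e3 : ‖normal (x t) ρ - discNormal P X j‖ * ‖timeDeriv T x t ρ‖ ≤ 2 * K ^ 2 * S * K :=
      mul_le_mul e2 (hR.xt_le t ht ρ) (norm_nonneg _) (by positivity)
    refine e1.trans ?_
    linarith
  have hv : |normalVel T x t ρ| ≤ 2 * K := by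
    refine (abs_real_inner_le_norm _ _).trans ?_
    rw [hν1, mul_one]
    linarith [hR.xt_le t ht ρ]
  obtain ⟨g1, g2⟩ := hgb (normalVel T x t ρ) ⟪diffQuot (t - s) X₀ X σ, discNormal P X j⟫ (w t ρ)
    (W₀ σ) hv ((hR.w_le t ht ρ).trans (by linarith)) hW
  have p7 : |g (normalVel T x t ρ) (w t ρ)
      - g ⟪diffQuot (t - s) X₀ X σ, discNormal P X j⟫ (W₀ σ)| ≤
      Cg * ((K + K * (2 * K ^ 2)) + K * (1 + Ct)) * S := by
    refine g2.trans ?_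
    rw [mul_assoc]
    refine mul_le_mul_of_nonneg_left ?_ hCg
    linarith
  have hXabs : |‖P.grad X j‖| ≤ 2 * K := by rwa [abs_norm]
  have hβS : β ≤ S := by rw [hS]; linarith
  have hγS : γ ≤ S := by rw [hS]; linarith
  have t1 : |‖deriv (x t) ρ‖ * ((t - s)⁻¹ * (w t ρ - w s ρ))
      - ‖P.grad X j‖ * diffQuot (t - s) (w s) (w t) σ| ≤ (K * K + 2 * K) * S := by
    have e0 := hR.diffQuot_w_le hs ht hst ρ
    refine (abs_mul_sub_mul_le ‖deriv (x t) ρ‖ (diffQuot (t - s) (w s) (w t) ρ) ‖P.grad X j‖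
      (diffQuot (t - s) (w s) (w t) σ)).trans ?_
    have e1 := mul_le_mul p1' e0 (abs_nonneg _) (by positivity)
    have e2 := mul_le_mul hXabs (hβw.trans hβS) (abs_nonneg _) (by positivity)
    linarith
  have hgx := hR.grad_diffQuot_x_le P hs ht hst j
  have t2 : |⟪(t - s)⁻¹ • (deriv (x t) ρ - deriv (x s) ρ), tangent (x t) ρ⟫ * w t ρ
      - ⟪P.grad (diffQuot (t - s) (x s) (x t)) j, discTangent P X j⟫ * w s σ| ≤
      (K + K * (2 * K ^ 2) * K + K * (K * (1 + Ct))) * S := by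
    refine (abs_mul_sub_mul_le _ _ _ _).trans ?_
    have e1 := abs_inner_sub_inner_le ((t - s)⁻¹ • (deriv (x t) ρ - deriv (x s) ρ))
      (tangent (x t) ρ) (P.grad (diffQuot (t - s) (x s) (x t)) j) (discTangent P X j)
    rw [hτ1, mul_one] at e1
    have e2 : |⟪(t - s)⁻¹ • (deriv (x t) ρ - deriv (x s) ρ), tangent (x t) ρ⟫
        - ⟪P.grad (diffQuot (t - s) (x s) (x t)) j, discTangent P X j⟫| ≤
        S + K * (2 * K ^ 2 * S) :=
      e1.trans (add_le_add (hγx.trans hγS) (mul_le_mul hgx p2 (norm_nonneg _) hK.le))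
    have e3 := mul_le_mul e2 (hR.w_le t ht ρ) (abs_nonneg _) (by positivity)
    have e4 : |⟪P.grad (diffQuot (t - s) (x s) (x t)) j, discTangent P X j⟫| ≤ K := by
      refine (abs_real_inner_le_norm _ _).trans ?_
      rwa [hT1, mul_one]
    have e5 := mul_le_mul e4 p4 (abs_nonneg _) hK.le
    linarith
  have t3 : |‖deriv (x t) ρ‖ * g (normalVel T x t ρ) (w t ρ)
      - ‖P.grad X j‖ * g ⟪diffQuot (t - s) X₀ X σ, discNormal P X j⟫ (W₀ σ)| ≤
      (K * Cg + 2 * K * (Cg * ((K + K * (2 * K ^ 2)) + K * (1 + Ct)))) * S := by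
    refine (abs_mul_sub_mul_le _ _ _ _).trans ?_
    have e1 := mul_le_mul p1' g1 (abs_nonneg _) (by positivity)
    have e2 := mul_le_mul hXabs p7 (abs_nonneg _) (by positivity)
    linarith
  rw [abs_le] at t1 t2 t3 ⊢
  constructor <;> linarith [t1.1, t1.2, t2.1, t2.2, t3.1, t3.2]

/-- Consistency error of the flux of the scalar equation. -/
lemma exists_flux_consistency (hR : Reg T α d f g x w K G) (hd : 0 < d) :
    ∃ C, 0 ≤ C ∧ ∀ {ρ₀ : ℝ} (P : Partition ρ₀ (ρ₀ + 1)) {s t : ℝ}, s ∈ Icc 0 T → t ∈ Ioc 0 T →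
      s < t → ∀ {X : ℝ → Plane} (j : Fin P.count)
      {σ ρ : ℝ}, σ ∈ Icc (P.left j) (P.right j) → ρ ∈ Icc (P.left j) (P.right j) →
      (2 * K)⁻¹ ≤ ‖P.grad X j‖ →
      |(⟪(t - s)⁻¹ • (x t ρ - x s ρ), tangent (x t) ρ⟫ * w t ρ
            + d * (deriv (w t) ρ / ‖deriv (x t) ρ‖))
        - (⟪diffQuot (t - s) (x s) (x t) σ, discTangent P X j⟫ * w t σ
            + d * (P.grad (w t) j / ‖P.grad X j‖))| ≤
      C * (P.maxStep + ‖P.grad (fun r => x t r - X r) j‖) := by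
  have hK := hR.K_pos
  refine ⟨((K + K * (2 * K ^ 2)) * K + K * K) + d * (K * (2 * K) + K * (K * (2 * K) * K)),
    by positivity, ?_⟩
  intro ρ₀ P s t hs ht hst X j σ ρ hσ hρ hX
  have ht' := Ioc_subset_Icc_self ht
  have hXne : P.grad X j ≠ 0 := fun h => by
    rw [h, norm_zero] at hX
    exact absurd hX (not_le.2 (by positivity))
  have hh : 0 < P.maxStep := P.maxStep_pos
  have hρσ : |ρ - σ| ≤ P.maxStep := P.abs_sub_le_maxStep j hρ hσ
  obtain ⟨q1, q2⟩ := hR.tangent_sub_le P ht' j hXne hρ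
  set S := P.maxStep + ‖P.grad (fun r => x t r - X r) j‖ with hS
  have hhS : P.maxStep ≤ S := le_add_of_nonneg_right (norm_nonneg _)
  have hS0 : 0 ≤ S := hh.le.trans hhS
  have hT1 : ‖discTangent P X j‖ = 1 := norm_unit hXne
  have hτ1 : ‖tangent (x t) ρ‖ = 1 := norm_unit (hR.xρ_ne_zero ht' ρ)
  have hDx := hR.diffQuot_x_le hs ht' hst σ
  have t1 : |⟪(t - s)⁻¹ • (x t ρ - x s ρ), tangent (x t) ρ⟫ * w t ρ
      - ⟪diffQuot (t - s) (x s) (x t) σ, discTangent P X j⟫ * w t σ| ≤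
      ((K + K * (2 * K ^ 2)) * K + K * K) * S := by
    refine (abs_mul_sub_mul_le _ _ _ _).trans ?_
    have e1 := abs_inner_sub_inner_le (diffQuot (t - s) (x s) (x t) ρ)
      (tangent (x t) ρ) (diffQuot (t - s) (x s) (x t) σ) (discTangent P X j)
    rw [hτ1, mul_one] at e1
    have e0 : ‖diffQuot (t - s) (x s) (x t) ρ - diffQuot (t - s) (x s) (x t) σ‖ ≤ K * S :=
      (hR.diffQuot_x_lip hs ht' hst σ ρ).trans
        (mul_le_mul_of_nonneg_left (hρσ.trans hhS) hK.le)
    have e2 : |⟪diffQuot (t - s) (x s) (x t) ρ, tangent (x t) ρ⟫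
        - ⟪diffQuot (t - s) (x s) (x t) σ, discTangent P X j⟫| ≤
        K * S + K * (2 * K ^ 2 * S) :=
      e1.trans (add_le_add e0 (mul_le_mul hDx q2 (norm_nonneg _) hK.le))
    have e3 := mul_le_mul e2 (hR.w_le t ht' ρ) (abs_nonneg _) (by positivity)
    have e4 : |⟪diffQuot (t - s) (x s) (x t) σ, discTangent P X j⟫| ≤ K := by
      refine (abs_real_inner_le_norm _ _).trans ?_
      rwa [hT1, mul_one]
    have e5 := mul_le_mul e4 ((hR.w_lip ht' σ ρ).trans
      (mul_le_mul_of_nonneg_left (hρσ.trans hhS) hK.le)) (abs_nonneg _) hK.le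
    simp only [diffQuot] at e3 e5 ⊢
    linarith
  have hq := norm_pos_iff.2 (hR.xρ_ne_zero ht' ρ)
  have hQ := norm_pos_iff.2 hXne
  have i1 : ‖deriv (x t) ρ‖⁻¹ ≤ K := inv_le_of_inv_le₀ hK (hR.le_xρ t ht' ρ)
  have i2 : ‖P.grad X j‖⁻¹ ≤ 2 * K := inv_le_of_inv_le₀ (by positivity) hX
  have t2 : |deriv (w t) ρ / ‖deriv (x t) ρ‖ - P.grad (w t) j / ‖P.grad X j‖| ≤
      (K * (2 * K) + K * (K * (2 * K) * K)) * S := by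
    have e1 : deriv (w t) ρ / ‖deriv (x t) ρ‖ - P.grad (w t) j / ‖P.grad X j‖ =
        -(P.grad (w t) j - deriv (w t) ρ) * ‖P.grad X j‖⁻¹
        + deriv (w t) ρ * (‖deriv (x t) ρ‖⁻¹ * ‖P.grad X j‖⁻¹
          * (‖P.grad X j‖ - ‖deriv (x t) ρ‖)) := by
      field_simp; ring
    rw [e1]
    refine (abs_add_le _ _).trans ?_
    rw [abs_mul, abs_neg, abs_mul, abs_mul, abs_mul, abs_inv, abs_inv, abs_norm, abs_norm]
    have a1 : |‖P.grad X j‖ - ‖deriv (x t) ρ‖| ≤ K * S := by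
      rw [abs_sub_comm]; exact (abs_norm_sub_norm_le _ _).trans q1
    have a2 : |P.grad (w t) j - deriv (w t) ρ| ≤ K * S :=
      (hR.grad_w_sub_le P ht j hρ).trans (mul_le_mul_of_nonneg_left hhS hK.le)
    have a3 := hR.wρ_le t ht' ρ
    calc _ ≤ K * S * (2 * K) + K * (K * (2 * K) * (K * S)) := by gcongr
      _ = _ := by ring
  have t3 : |d * (deriv (w t) ρ / ‖deriv (x t) ρ‖) - d * (P.grad (w t) j / ‖P.grad X j‖)| ≤
      d * ((K * (2 * K) + K * (K * (2 * K) * K)) * S) := by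
    rw [← mul_sub, abs_mul, abs_of_pos hd]
    exact mul_le_mul_of_nonneg_left t2 hd.le
  rw [abs_le] at t1 t3 ⊢
  constructor <;> linarith [t1.1, t1.2, t3.1, t3.2]

end Scalar

/-! ### Sums over the end points of the elements. -/

namespace Partition

section NodalSum

variable {a b : ℝ} (P : Partition a b)
variable {E : Type*} [NormedAddCommGroup E] [NormedSpace ℝ E]

/-- The sum over the end points of the elements with the weights of mass lumping. -/
def nodalSum (φ : Fin P.count → ℝ → ℝ) : ℝ :=
  ∑ j, P.step j / 2 * (φ j (P.left j) + φ j (P.right j))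

lemma nodalSum_add (φ ψ : Fin P.count → ℝ → ℝ) :
    P.nodalSum (fun j ρ => φ j ρ + ψ j ρ) = P.nodalSum φ + P.nodalSum ψ := by
  simp only [nodalSum, ← Finset.sum_add_distrib]
  exact Finset.sum_congr rfl fun j _ => by ring

lemma nodalSum_const_mul (c : ℝ) (φ : Fin P.count → ℝ → ℝ) :
    P.nodalSum (fun j ρ => c * φ j ρ) = c * P.nodalSum φ := by
  simp only [nodalSum, Finset.mul_sum]
  exact Finset.sum_congr rfl fun j _ => by ring

lemma nodalSum_elem (c : Fin P.count → ℝ) : P.nodalSum (fun j _ => c j) = ∑ j, P.step j * c j :=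
  Finset.sum_congr rfl fun j _ => by ring

lemma nodalSum_mono {φ ψ : Fin P.count → ℝ → ℝ}
    (h : ∀ j σ, σ = P.left j ∨ σ = P.right j → φ j σ ≤ ψ j σ) : P.nodalSum φ ≤ P.nodalSum ψ :=
  Finset.sum_le_sum fun j _ => mul_le_mul_of_nonneg_left
    (add_le_add (h j _ (Or.inl rfl)) (h j _ (Or.inr rfl))) (half_pos (P.step_pos j)).le

lemma massSq_eq (u : ℝ → E) : P.massSq u = P.nodalSum fun _ ρ => ‖u ρ‖ ^ 2 := rfl

/-- The square of the mass-lumped `L²` norm on the curve `X`. -/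
def weightSq (X : ℝ → Plane) (u : ℝ → ℝ) : ℝ := P.nodalSum fun j ρ => ‖P.grad X j‖ * u ρ ^ 2

end NodalSum

end Partition

/-! ### Energy inequality of the scalar scheme. -/

section ScalarEnergy

variable {ρ₀ : ℝ} {P : Partition ρ₀ (ρ₀ + 1)} {d k : ℝ} {g : ℝ → ℝ → ℝ}
variable {X₀ X Dx De : ℝ → Plane} {W₀ W w₀ w₁ : ℝ → ℝ}

/-- A discrete product rule, with Q and p the new and the old length element. It extracts half the
increment of the weighted squared error, a nonnegative dissipation, and the rate (Q - p)/k
multiplied by w₀ z - z²/2. Splitting the rate isolates b, the part that is summed by parts. -/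
lemma nodal_energy_identity {Q p k w₁ w₀ z z₀ ψ μ a b : ℝ} (hk : k ≠ 0)
    (h : (Q - p) / k = a - b - ψ * μ) :
    (Q * (w₁ - z) * z - p * (w₀ - z₀) * z) / k =
      (Q * (k⁻¹ * (w₁ - w₀)) + a * w₀) * z - a * z ^ 2 / 2 - b * (w₀ * z - z ^ 2 / 2)
        - ψ * μ * (w₀ * z - z ^ 2 / 2) - (Q * z ^ 2 - p * z₀ ^ 2) / (2 * k)
        - p * (z - z₀) ^ 2 / (2 * k) := by
  have e : (Q * (w₁ - z) * z - p * (w₀ - z₀) * z) / k =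
      Q * (k⁻¹ * (w₁ - w₀)) * z + (Q - p) / k * (w₀ * z - z ^ 2 / 2)
        - (Q * z ^ 2 - p * z₀ ^ 2) / (2 * k) - p * (z - z₀) ^ 2 / (2 * k) := by
    field_simp
    ring
  rw [e, h]
  ring

/-- One step of the scalar scheme, tested with the error. -/
lemma ScalarStep.energy (h : ScalarStep P d g k X₀ X W₀ W) (hk : 0 < k)
    (hX : ∀ j, P.grad X j ≠ 0) (hW : Function.Periodic W 1) (hw₀ : Function.Periodic w₀ 1)
    (hw₁ : Function.Periodic w₁ 1) (hDe : Function.Periodic De 1)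
    (hD : ∀ ρ, diffQuot k X₀ X ρ = Dx ρ - De ρ) :
    (P.weightSq X (fun ρ => w₁ ρ - W ρ) - P.weightSq X₀ (fun ρ => w₀ ρ - W₀ ρ)) / (2 * k)
      + d * ∑ j, P.step j * (P.grad (fun ρ => w₁ ρ - W ρ) j ^ 2 / ‖P.grad X j‖) ≤
    P.nodalSum (fun j ρ => (‖P.grad X j‖ * diffQuot k w₀ w₁ ρ
          + ⟪P.grad Dx j, discTangent P X j⟫ * w₀ ρ
          - ‖P.grad X j‖ * g ⟪diffQuot k X₀ X ρ, discNormal P X j⟫ (W₀ ρ)) * (w₁ ρ - W ρ)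
        + (⟪Dx ρ, discTangent P X j⟫ * w₁ ρ + d * (P.grad w₁ j / ‖P.grad X j‖))
          * P.grad (fun ρ => w₁ ρ - W ρ) j)
      + P.nodalSum (fun j ρ => -(⟪P.grad Dx j, discTangent P X j⟫ * (w₁ ρ - W ρ) ^ 2 / 2)
        - ⟪Dx ρ, discTangent P X j⟫ * (w₁ ρ - W ρ) * P.grad (fun ρ => w₁ ρ - W ρ) j
        - ⟪De ρ, discTangent P X j⟫ * W ρ * P.grad (fun ρ => w₁ ρ - W ρ) j)
      + P.nodalSum (fun j ρ => ⟪De ρ, discTangent P X j⟫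
        * P.grad (fun ρ => w₀ ρ * (w₁ ρ - W ρ) - (w₁ ρ - W ρ) ^ 2 / 2) j)
      + P.nodalSum (fun j ρ => k * ‖P.grad (diffQuot k X₀ X) j‖ ^ 2 / ‖P.grad X j‖
        * |w₀ ρ * (w₁ ρ - W ρ) - (w₁ ρ - W ρ) ^ 2 / 2|)
      + ∑ j, |⟪De (P.right j), discTangent P X j - discTangent P X (P.next j)⟫
        * (w₀ (P.right j) * (w₁ (P.right j) - W (P.right j))
          - (w₁ (P.right j) - W (P.right j)) ^ 2 / 2)| := by
  set z : ℝ → ℝ := fun ρ => w₁ ρ - W ρ with hz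
  -- The factor that accompanies the rate of change of the length element in
  -- `nodal_energy_identity`.
  set ζ : ℝ → ℝ := fun ρ => w₀ ρ * z ρ - z ρ ^ 2 / 2 with hζ
  have hzp : Function.Periodic z 1 := hw₁.sub hW
  have hζp : Function.Periodic ζ 1 := fun ρ => by simp only [hζ, hw₀ ρ, hzp ρ]
  have sbp := P.sum_by_parts hDe hζp (discTangent P X)
  have key := h.of_periodic hzp
  -- The remainder in expanding the change of the length element about the tangential part of D_t
  -- X_ρ; it is nonnegative and of order k |D_t X_ρ|².
  set μ : Fin P.count → ℝ := fun j => ⟪P.grad (diffQuot k X₀ X) j, discTangent P X j⟫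
    - (‖P.grad X j‖ - ‖P.grad X₀ j‖) / k with hμ
  have hkD : ∀ j, P.grad X j - P.grad X₀ j = k • P.grad (diffQuot k X₀ X) j := fun j => by
    rw [P.grad_diffQuot, smul_smul, mul_inv_cancel₀ hk.ne', one_smul]
  have hμk : ∀ j, μ j = (⟪P.grad X j - P.grad X₀ j, discTangent P X j⟫
      - (‖P.grad X j‖ - ‖P.grad X₀ j‖)) / k := fun j => by
    simp only [hμ]
    rw [hkD, real_inner_smul_left]
    field_simp
  have hμ0 : ∀ j, 0 ≤ μ j := fun j => by
    rw [hμk]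
    exact div_nonneg (norm_sub_norm_remainder (hX j)).2 hk.le
  have hμ1 : ∀ j, μ j ≤ k * ‖P.grad (diffQuot k X₀ X) j‖ ^ 2 / ‖P.grad X j‖ := fun j => by
    rw [hμk, div_le_iff₀ hk]
    refine (norm_sub_norm_remainder (hX j)).1.trans (le_of_eq ?_)
    rw [hkD, norm_smul, Real.norm_of_nonneg hk.le]
    ring
  have hgradD : ∀ j, P.grad (diffQuot k X₀ X) j = P.grad Dx j - P.grad De j := fun j => by
    rw [← P.grad_sub]
    congr 1
    exact funext hD
  have hQ : ∀ j, (‖P.grad X j‖ - ‖P.grad X₀ j‖) / k = ⟪P.grad Dx j, discTangent P X j⟫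
      - ⟪P.grad De j, discTangent P X j⟫ - 1 * μ j := fun j => by
    simp only [hμ]
    rw [hgradD, inner_sub_left]
    ring
  have id1 : (P.weightSq X z - P.weightSq X₀ (fun ρ => w₀ ρ - W₀ ρ)) / (2 * k)
      + d * ∑ j, P.step j * (P.grad z j ^ 2 / ‖P.grad X j‖)
      + P.nodalSum (fun j ρ => ‖P.grad X₀ j‖ * (z ρ - (w₀ ρ - W₀ ρ)) ^ 2 / (2 * k)) =
    P.nodalSum (fun j ρ => (‖P.grad X j‖ * diffQuot k w₀ w₁ ρ
          + ⟪P.grad Dx j, discTangent P X j⟫ * w₀ ρ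
          - ‖P.grad X j‖ * g ⟪diffQuot k X₀ X ρ, discNormal P X j⟫ (W₀ ρ)) * z ρ
        + (⟪Dx ρ, discTangent P X j⟫ * w₁ ρ + d * (P.grad w₁ j / ‖P.grad X j‖)) * P.grad z j)
      + P.nodalSum (fun j ρ => -(⟪P.grad Dx j, discTangent P X j⟫ * z ρ ^ 2 / 2)
        - ⟪Dx ρ, discTangent P X j⟫ * z ρ * P.grad z j
        - ⟪De ρ, discTangent P X j⟫ * W ρ * P.grad z j)
      - ∑ j, P.step j / 2 * (⟪P.grad De j, discTangent P X j⟫ * ζ (P.left j)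
        + ⟪P.grad De j, discTangent P X j⟫ * ζ (P.right j))
      - P.nodalSum (fun j ρ => μ j * ζ ρ) := by
    rw [← sub_eq_zero] at key ⊢
    rw [← neg_eq_zero, ← key]
    simp only [Partition.weightSq, Partition.nodalSum]
    simp only [← Finset.sum_sub_distrib, ← Finset.sum_add_distrib, Finset.mul_sum,
      Finset.sum_div, ← Finset.sum_neg_distrib]
    refine Finset.sum_congr rfl fun j _ => ?_
    have nL := nodal_energy_identity (w₁ := w₁ (P.left j)) (w₀ := w₀ (P.left j))
      (z := z (P.left j)) (z₀ := w₀ (P.left j) - W₀ (P.left j)) hk.ne' (hQ j)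
    have nR := nodal_energy_identity (w₁ := w₁ (P.right j)) (w₀ := w₀ (P.right j))
      (z := z (P.right j)) (z₀ := w₀ (P.right j) - W₀ (P.right j)) hk.ne' (hQ j)
    have wL : w₁ (P.left j) - z (P.left j) = W (P.left j) := by simp [hz]
    have wR : w₁ (P.right j) - z (P.right j) = W (P.right j) := by simp [hz]
    have wG : P.grad W j = P.grad w₁ j - P.grad z j := by
      rw [hz, P.grad_sub]; ring
    have w0L : w₀ (P.left j) - (w₀ (P.left j) - W₀ (P.left j)) = W₀ (P.left j) := by ring
    have w0R : w₀ (P.right j) - (w₀ (P.right j) - W₀ (P.right j)) = W₀ (P.right j) := by ring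
    rw [wL, w0L] at nL
    rw [wR, w0R] at nR
    have dL : ⟪diffQuot k X₀ X (P.left j), discTangent P X j⟫ =
        ⟪Dx (P.left j), discTangent P X j⟫ - ⟪De (P.left j), discTangent P X j⟫ := by
      rw [hD, inner_sub_left]
    have dR : ⟪diffQuot k X₀ X (P.right j), discTangent P X j⟫ =
        ⟪Dx (P.right j), discTangent P X j⟫ - ⟪De (P.right j), discTangent P X j⟫ := by
      rw [hD, inner_sub_left]
    rw [dL, dR, wG]
    have eL : diffQuot k w₀ w₁ (P.left j) = k⁻¹ * (w₁ (P.left j) - w₀ (P.left j)) := rfl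
    have eR : diffQuot k w₀ w₁ (P.right j) = k⁻¹ * (w₁ (P.right j) - w₀ (P.right j)) := rfl
    rw [eL, eR]
    simp only [hζ]
    clear_value μ z
    linear_combination -(P.step j / 2) * nL - P.step j / 2 * nR
      + P.step j / 2 * (⟪Dx (P.left j), discTangent P X j⟫ * P.grad z j) * wL
      + P.step j / 2 * (⟪Dx (P.right j), discTangent P X j⟫ * P.grad z j) * wR
  -- The numerical dissipation of the scalar scheme is discarded.
  have nn : 0 ≤ P.nodalSum
      (fun j ρ => ‖P.grad X₀ j‖ * (z ρ - (w₀ ρ - W₀ ρ)) ^ 2 / (2 * k)) := by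
    refine Finset.sum_nonneg fun j _ => ?_
    have := P.step_pos j
    positivity
  have i1 : -P.nodalSum (fun j ρ => μ j * ζ ρ) ≤ P.nodalSum (fun j ρ =>
      k * ‖P.grad (diffQuot k X₀ X) j‖ ^ 2 / ‖P.grad X j‖ * |ζ ρ|) := by
    have : -P.nodalSum (fun j ρ => μ j * ζ ρ) = P.nodalSum (fun j ρ => -1 * (μ j * ζ ρ)) := by
      rw [P.nodalSum_const_mul]; ring
    rw [this]
    refine P.nodalSum_mono fun j σ _ => ?_
    calc -1 * (μ j * ζ σ) = μ j * (-ζ σ) := by ring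
      _ ≤ μ j * |ζ σ| := mul_le_mul_of_nonneg_left (neg_le_abs _) (hμ0 j)
      _ ≤ _ := mul_le_mul_of_nonneg_right (hμ1 j) (abs_nonneg _)
  have i2 : -∑ j, ⟪De (P.right j), discTangent P X j - discTangent P X (P.next j)⟫
      * ζ (P.right j) ≤ ∑ j, |⟪De (P.right j), discTangent P X j - discTangent P X (P.next j)⟫
        * ζ (P.right j)| := by
    rw [← Finset.sum_neg_distrib]
    exact Finset.sum_le_sum fun j _ => neg_le_abs _
  have i3 : P.nodalSum (fun j ρ => ⟪De ρ, discTangent P X j⟫ * P.grad ζ j) =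
      ∑ j, P.step j / 2 * (⟪De (P.left j), discTangent P X j⟫ * P.grad ζ j
        + ⟪De (P.right j), discTangent P X j⟫ * P.grad ζ j) := rfl
  rw [i3]
  linarith

end ScalarEnergy

/-! ### Scalar inequalities for the individual terms. -/

section NodalBounds

lemma mul_le_eps {ε a b : ℝ} (hε : 0 < ε) : a * b ≤ ε * b ^ 2 + a ^ 2 / (4 * ε) := by
  have h : 0 ≤ (2 * ε * b - a) ^ 2 / (4 * ε) := by positivity
  have e : (2 * ε * b - a) ^ 2 / (4 * ε) = ε * b ^ 2 + a ^ 2 / (4 * ε) - a * b := by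
    field_simp; ring
  linarith

/-- Young's inequality. `H` stands for the sum of all squared error quantities at a node; the lemmas
that follow reduce each term to a multiple of `H` and, where a gradient s of the error occurs, a
small multiple of s². -/
lemma consistency_term_le {C h r E D y β γ z H : ℝ} (hC : 0 ≤ C)
    (hH : h ^ 2 + r ^ 2 + E ^ 2 + D ^ 2 + y ^ 2 + β ^ 2 + γ ^ 2 + z ^ 2 ≤ H) :
    C * (h + r + E + D + y + β + γ) * |z| ≤ 4 * C * H := by
  have e : (h + r + E + D + y + β + γ) * |z| ≤ 4 * H := by
    have hz : |z| ^ 2 = z ^ 2 := sq_abs z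
    nlinarith [sq_nonneg (h - |z|), sq_nonneg (r - |z|), sq_nonneg (E - |z|),
      sq_nonneg (D - |z|), sq_nonneg (y - |z|), sq_nonneg (β - |z|), sq_nonneg (γ - |z|),
      sq_nonneg h, sq_nonneg r, sq_nonneg E, sq_nonneg D, sq_nonneg y, sq_nonneg β, sq_nonneg γ]
  calc C * (h + r + E + D + y + β + γ) * |z| = C * ((h + r + E + D + y + β + γ) * |z|) := by ring
    _ ≤ C * (4 * H) := mul_le_mul_of_nonneg_left e hC
    _ = _ := by ring

lemma flux_term_le {ε C h E s H : ℝ} (hε : 0 < ε) (hH : h ^ 2 + E ^ 2 ≤ H) :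
    C * (h + E) * |s| ≤ ε * s ^ 2 + C ^ 2 / (2 * ε) * H := by
  have e1 := mul_le_eps (a := C * (h + E)) (b := |s|) hε
  rw [sq_abs] at e1
  refine e1.trans (add_le_add le_rfl ?_)
  have e2 : (C * (h + E)) ^ 2 / (4 * ε) = C ^ 2 / (2 * ε) * ((h + E) ^ 2 / 2) := by
    field_simp; ring
  rw [e2]
  exact mul_le_mul_of_nonneg_left (by nlinarith [sq_nonneg (h - E)]) (by positivity)

lemma sq_add_le_of_one_le {K Z : ℝ} (hK : 1 ≤ K) : K ^ 2 + Z ^ 2 ≤ K ^ 2 * (1 + Z ^ 2) := by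
  have : 1 ≤ K ^ 2 := by nlinarith
  nlinarith [sq_nonneg Z]

/-- K + Z bounds the discrete scalar and D the velocity error. The product of the three factors is
split so that only (1 + Z²) D² has to be controlled by `H`. -/
lemma drift_aux {ε K Z D s H : ℝ} (hε : 0 < ε) (hK : 1 ≤ K)
    (hH : (1 + Z ^ 2) * D ^ 2 ≤ H) :
    D * (K + Z) * |s| ≤ ε * s ^ 2 + K ^ 2 / (2 * ε) * H := by
  have e1 := mul_le_eps (a := D * (K + Z)) (b := |s|) hε
  rw [sq_abs] at e1
  refine e1.trans (add_le_add le_rfl ?_)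
  have e2 : (D * (K + Z)) ^ 2 / (4 * ε) = 1 / (2 * ε) * ((K + Z) ^ 2 / 2 * D ^ 2) := by
    field_simp; ring
  have e3 : (K + Z) ^ 2 / 2 ≤ K ^ 2 * (1 + Z ^ 2) :=
    le_trans (by nlinarith [sq_nonneg (K - Z)]) (sq_add_le_of_one_le hK)
  have e4 : (K + Z) ^ 2 / 2 * D ^ 2 ≤ K ^ 2 * H :=
    (mul_le_mul_of_nonneg_right e3 (sq_nonneg D)).trans (by
      rw [mul_assoc]; exact mul_le_mul_of_nonneg_left hH (by positivity))
  rw [e2]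
  refine (mul_le_mul_of_nonneg_left e4 (by positivity)).trans (le_of_eq ?_)
  ring

lemma drift_term_le {ε K Z D s z W a₁ a₂ a₃ H : ℝ} (hε : 0 < ε) (hK : 1 ≤ K)
    (h₁ : |a₁| ≤ K) (h₂ : |a₂| ≤ K) (h₃ : |a₃| ≤ D) (hW : |W| ≤ K + Z) (hz : z ^ 2 ≤ H)
    (hD : (1 + Z ^ 2) * D ^ 2 ≤ H) :
    -(a₁ * z ^ 2 / 2) - a₂ * z * s - a₃ * W * s ≤
      2 * ε * s ^ 2 + (K / 2 + K ^ 2 / (4 * ε) + K ^ 2 / (2 * ε)) * H := by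
  have e1 : -(a₁ * z ^ 2 / 2) ≤ K / 2 * H := by
    have : -a₁ ≤ K := (neg_le_abs _).trans h₁
    nlinarith [mul_le_mul_of_nonneg_right this (sq_nonneg z)]
  have e2 : -(a₂ * z * s) ≤ ε * s ^ 2 + K ^ 2 / (4 * ε) * H := by
    have i1 : -(a₂ * z * s) ≤ K * |z| * |s| := by
      refine (neg_le_abs _).trans ?_
      rw [abs_mul, abs_mul]
      gcongr
    have i2 := mul_le_eps (a := K * |z|) (b := |s|) hε
    rw [sq_abs, mul_pow, sq_abs] at i2
    have i3 : K ^ 2 * z ^ 2 / (4 * ε) ≤ K ^ 2 / (4 * ε) * H := by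
      rw [mul_div_right_comm]
      exact mul_le_mul_of_nonneg_left hz (by positivity)
    linarith
  have e3 : -(a₃ * W * s) ≤ ε * s ^ 2 + K ^ 2 / (2 * ε) * H := by
    have i1 : -(a₃ * W * s) ≤ D * (K + Z) * |s| := by
      refine (neg_le_abs _).trans ?_
      rw [abs_mul, abs_mul]
      have := (abs_nonneg a₃).trans h₃
      gcongr
    exact i1.trans (drift_aux hε hK hD)
  linarith

/-- After summation by parts the difference falls on ζ, whose gradient `gζ` is controlled by that of
z. The latter is absorbed by diffusion. -/
lemma parts_term_le {ε K Z D s y a gζ H : ℝ} (hε : 0 < ε) (hK : 1 ≤ K) (ha : |a| ≤ D)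
    (hg : |gζ| ≤ (K + Z) * |s| + K * |y|) (hy : y ^ 2 ≤ H) (hD : (1 + Z ^ 2) * D ^ 2 ≤ H) :
    a * gζ ≤ ε * s ^ 2 + (K ^ 2 / (2 * ε) + K) * H := by
  have hD0 : 0 ≤ D := (abs_nonneg a).trans ha
  have e1 : a * gζ ≤ D * ((K + Z) * |s| + K * |y|) := by
    refine (le_abs_self _).trans ?_
    rw [abs_mul]
    exact mul_le_mul ha hg (abs_nonneg _) hD0
  have e2 := drift_aux (s := s) hε hK hD
  have e3 : D * |y| ≤ H := by
    have : D ^ 2 ≤ H := le_trans (by nlinarith [mul_nonneg (sq_nonneg Z) (sq_nonneg D)]) hD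
    nlinarith [sq_nonneg (D - |y|), sq_abs y]
  nlinarith

/-- The first two bounds vanish with z and serve terms of first order in the velocity error. The
third does not contain z and serves the terms quadratic in that error. -/
lemma abs_zeta_le {K Z w z : ℝ} (hK : 1 ≤ K) (hw : |w| ≤ K) (hz : |z| ≤ Z) :
    |w * z - z ^ 2 / 2| ≤ K * |z| + z ^ 2 / 2 ∧ |w * z - z ^ 2 / 2| ≤ (K + Z) * |z| ∧
      |w * z - z ^ 2 / 2| ≤ K ^ 2 * (1 + Z ^ 2) := by
  have h0 := abs_nonneg z
  have h1 : |w * z - z ^ 2 / 2| ≤ K * |z| + z ^ 2 / 2 := by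
    refine (abs_sub _ _).trans ?_
    rw [abs_mul, abs_of_nonneg (by positivity : (0 : ℝ) ≤ z ^ 2 / 2)]
    gcongr
  have h2 : z ^ 2 / 2 ≤ Z * |z| := by
    rw [← sq_abs]
    nlinarith
  refine ⟨h1, by linarith, h1.trans ?_⟩
  have h3 : z ^ 2 ≤ Z ^ 2 := by rw [← sq_abs]; exact pow_le_pow_left₀ h0 hz 2
  have h4 := sq_add_le_of_one_le (Z := Z) hK
  nlinarith [sq_nonneg (K - |z|), sq_abs z]

/-- The squared velocity gradient is split into the exact part, bounded by K, and the error part δe.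
In the first, k ≤ Ct h turns k |z| into h² + z²; in the second, k δe² is covered by the numerical
dissipation of the curve. -/
lemma remainder_term_le {K Z T Ct h k Q δ δe w z H : ℝ} (hK : 1 ≤ K) (hk : 0 ≤ k) (hkT : k ≤ T)
    (hkh : k ≤ Ct * h) (hQ0 : 0 < Q) (hQ : Q⁻¹ ≤ 2 * K) (hδ0 : 0 ≤ δ) (hδ : δ ≤ K + δe)
    (hw : |w| ≤ K) (hz : |z| ≤ Z) (hzH : z ^ 2 ≤ H) (hhH : h ^ 2 ≤ H)
    (hδH : (1 + Z ^ 2) * (k * δe ^ 2) ≤ H) :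
    k * δ ^ 2 / Q * |w * z - z ^ 2 / 2| ≤
      (2 * K ^ 4 * Ct ^ 2 + 2 * K ^ 4 + 2 * K ^ 3 * T + 4 * K ^ 3) * H := by
  obtain ⟨z1, -, z3⟩ := abs_zeta_le hK hw hz
  have hK0 : 0 ≤ K := by linarith
  have hδ2 : δ ^ 2 ≤ 2 * K ^ 2 + 2 * δe ^ 2 :=
    (pow_le_pow_left₀ hδ0 hδ 2).trans (by nlinarith [sq_nonneg (K - δe)])
  have e1 : k * δ ^ 2 / Q ≤ 4 * k * K ^ 3 + 4 * K * (k * δe ^ 2) := by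
    rw [div_eq_mul_inv]
    calc k * δ ^ 2 * Q⁻¹ ≤ k * (2 * K ^ 2 + 2 * δe ^ 2) * (2 * K) := by gcongr
      _ = _ := by ring
  have hk2 : k ^ 2 ≤ Ct ^ 2 * h ^ 2 := by
    rw [← mul_pow]; exact pow_le_pow_left₀ hk hkh 2
  have hH0 : 0 ≤ H := (sq_nonneg z).trans hzH
  have e2 : 4 * k * K ^ 3 * |w * z - z ^ 2 / 2| ≤
      (2 * K ^ 4 * Ct ^ 2 + 2 * K ^ 4 + 2 * K ^ 3 * T) * H := by
    have i1 : k * |z| ≤ (Ct ^ 2 * H + H) / 2 := by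
      have : Ct ^ 2 * h ^ 2 ≤ Ct ^ 2 * H := mul_le_mul_of_nonneg_left hhH (sq_nonneg _)
      nlinarith [sq_nonneg (k - |z|), sq_abs z]
    have i2 : k * z ^ 2 ≤ T * H := mul_le_mul hkT hzH (sq_nonneg z) (hk.trans hkT)
    calc 4 * k * K ^ 3 * |w * z - z ^ 2 / 2|
        ≤ 4 * k * K ^ 3 * (K * |z| + z ^ 2 / 2) := by gcongr
      _ = 4 * K ^ 4 * (k * |z|) + 2 * K ^ 3 * (k * z ^ 2) := by ring
      _ ≤ 4 * K ^ 4 * ((Ct ^ 2 * H + H) / 2) + 2 * K ^ 3 * (T * H) := by gcongr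
      _ = _ := by ring
  have e3 : 4 * K * (k * δe ^ 2) * |w * z - z ^ 2 / 2| ≤ 4 * K ^ 3 * H := by
    calc 4 * K * (k * δe ^ 2) * |w * z - z ^ 2 / 2|
        ≤ 4 * K * (k * δe ^ 2) * (K ^ 2 * (1 + Z ^ 2)) := by gcongr
      _ = 4 * K ^ 3 * ((1 + Z ^ 2) * (k * δe ^ 2)) := by ring
      _ ≤ _ := by gcongr
  have e4 := mul_le_mul_of_nonneg_right e1 (abs_nonneg (w * z - z ^ 2 / 2))
  nlinarith

/-- The jump carries a factor 1 + Dt ≤ 1 + K + D. The part linear in D uses the bound of ζ that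
vanishes with z, the quadratic part the one that does not. -/
lemma jump_term_le {K Z C D Dt w z H : ℝ} (hK : 1 ≤ K) (hC : 0 ≤ C) (hD : 0 ≤ D)
    (hDt : Dt ≤ K + D) (hw : |w| ≤ K) (hz : |z| ≤ Z) (hzH : z ^ 2 ≤ H)
    (hDH : (1 + Z ^ 2) * D ^ 2 ≤ H) :
    D * (C * (1 + Dt)) * |w * z - z ^ 2 / 2| ≤ C * ((1 + K) ^ 2 * K ^ 2 + 1 + K ^ 2) * H := by
  obtain ⟨-, z2, z3⟩ := abs_zeta_le hK hw hz
  have hZ : 0 ≤ Z := (abs_nonneg z).trans hz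
  have hH0 : 0 ≤ H := (sq_nonneg z).trans hzH
  have e1 : D * (1 + K) * |w * z - z ^ 2 / 2| ≤ ((1 + K) ^ 2 * K ^ 2 + 1) * H := by
    calc D * (1 + K) * |w * z - z ^ 2 / 2| ≤ D * (1 + K) * ((K + Z) * |z|) := by gcongr
      _ = (D * (1 + K) * (K + Z)) * |z| := by ring
      _ ≤ ((D * (1 + K) * (K + Z)) ^ 2 + |z| ^ 2) / 2 := by
          nlinarith [sq_nonneg (D * (1 + K) * (K + Z) - |z|)]
      _ = (1 + K) ^ 2 * ((K + Z) ^ 2 / 2) * D ^ 2 + z ^ 2 / 2 := by rw [sq_abs]; ring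
      _ ≤ (1 + K) ^ 2 * (K ^ 2 * (1 + Z ^ 2)) * D ^ 2 + z ^ 2 / 2 := by
          have : (K + Z) ^ 2 / 2 ≤ K ^ 2 * (1 + Z ^ 2) :=
            le_trans (by nlinarith [sq_nonneg (K - Z)]) (sq_add_le_of_one_le hK)
          gcongr
      _ = (1 + K) ^ 2 * K ^ 2 * ((1 + Z ^ 2) * D ^ 2) + z ^ 2 / 2 := by ring
      _ ≤ (1 + K) ^ 2 * K ^ 2 * H + H := by
          gcongr
          nlinarith
      _ = _ := by ring
  have e2 : D * D * |w * z - z ^ 2 / 2| ≤ K ^ 2 * H := by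
    calc D * D * |w * z - z ^ 2 / 2| ≤ D * D * (K ^ 2 * (1 + Z ^ 2)) := by gcongr
      _ = K ^ 2 * ((1 + Z ^ 2) * D ^ 2) := by ring
      _ ≤ _ := by gcongr
  have e3 : D * (C * (1 + Dt)) * |w * z - z ^ 2 / 2| ≤
      C * (D * (1 + K) * |w * z - z ^ 2 / 2| + D * D * |w * z - z ^ 2 / 2|) := by
    have : D * (C * (1 + Dt)) ≤ D * (C * (1 + (K + D))) := by gcongr
    refine (mul_le_mul_of_nonneg_right this (abs_nonneg _)).trans (le_of_eq ?_)
    ring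
  refine e3.trans ?_
  calc _ ≤ C * (((1 + K) ^ 2 * K ^ 2 + 1) * H + K ^ 2 * H) :=
        mul_le_mul_of_nonneg_left (add_le_add e1 e2) hC
    _ = _ := by ring

end NodalBounds

/-! ### Consistency error against a finite element test function. -/

section ScalarConsistency

variable {T α d K : ℝ} {f : ℝ → ℝ} {g : ℝ → ℝ → ℝ} {x : ℝ → ℝ → Plane} {w : ℝ → ℝ → ℝ}
  {G : ℝ → ℝ}

lemma Reg.grad_w_le (hR : Reg T α d f g x w K G) {ρ₀ : ℝ} (P : Partition ρ₀ (ρ₀ + 1))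
    {t : ℝ} (ht : t ∈ Icc 0 T) (j : Fin P.count) : |P.grad (w t) j| ≤ K := by
  have h := hR.w_lip ht (P.left j) (P.right j)
  have hs := P.step_pos j
  rw [← P.step_smul_grad, smul_eq_mul, abs_mul, ← Partition.step, abs_of_pos hs, mul_comm] at h
  exact le_of_mul_le_mul_right h hs

/-- The consistency error of the scalar scheme against the test function `z`. -/
lemma exists_scalar_weak_consistency (hR : Reg T α d f g x w K G) (hd : 0 < d)
    (hg : ContDiff ℝ 1 (fun p : ℝ × ℝ => g p.1 p.2))
    (hg_lip : ∀ L > 0, ∃ CL ≥ 0, ∀ v₁ v₂ z : ℝ, |z| ≤ L → |g v₁ z - g v₂ z| ≤ CL * |v₁ - v₂|)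
    {Ct : ℝ} (hCt : 0 ≤ Ct) :
    ∃ C, 0 ≤ C ∧ ∀ {ρ₀ : ℝ} (P : Partition ρ₀ (ρ₀ + 1)) {s t : ℝ}, s ∈ Icc 0 T → t ∈ Ioc 0 T →
      s < t → t - s ≤ Ct * P.maxStep → ∀ {X₀ X : ℝ → Plane} {W₀ z : ℝ → ℝ},
      Function.Periodic z 1 → (∀ j, (2 * K)⁻¹ ≤ ‖P.grad X j‖ ∧ ‖P.grad X j‖ ≤ 2 * K) →
      (∀ j, |W₀ (P.left j)| ≤ 2 * K ∧ |W₀ (P.right j)| ≤ 2 * K) →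
      ∃ β γ : Fin P.count → ℝ, ∑ j, P.step j * β j ^ 2 ≤ K * P.maxStep ^ 2 ∧
      ∑ j, P.step j * γ j ^ 2 ≤ K * P.maxStep ^ 2 ∧
      P.nodalSum (fun j ρ => (‖P.grad X j‖ * diffQuot (t - s) (w s) (w t) ρ
          + ⟪P.grad (diffQuot (t - s) (x s) (x t)) j, discTangent P X j⟫ * w s ρ
          - ‖P.grad X j‖ * g ⟪diffQuot (t - s) X₀ X ρ, discNormal P X j⟫ (W₀ ρ)) * z ρ
        + (⟪diffQuot (t - s) (x s) (x t) ρ, discTangent P X j⟫ * w t ρ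
            + d * (P.grad (w t) j / ‖P.grad X j‖)) * P.grad z j) ≤
      P.nodalSum (fun j ρ => C * (P.maxStep + √((t - s) * (G t - G s))
          + ‖P.grad (fun r => x t r - X r) j‖
          + ‖diffQuot (t - s) (fun r => x s r - X₀ r) (fun r => x t r - X r) ρ‖
          + |w s ρ - W₀ ρ| + β j + γ j) * |z ρ|
        + C * (P.maxStep + ‖P.grad (fun r => x t r - X r) j‖) * |P.grad z j|)
      + (K * ((t - s) * (G t - G s)) + 2 * K * P.massSq z) := by
  have hK := hR.K_pos
  obtain ⟨C₁, hC₁, hc₁⟩ := exists_scalar_consistency hR hg hg_lip hCt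
  obtain ⟨C₂, hC₂, hc₂⟩ := exists_flux_consistency hR hd
  refine ⟨C₁ + C₂, by positivity, ?_⟩
  intro ρ₀ P s t hs ht hst hk X₀ X W₀ z hzp hX hW₀
  have ht' := Ioc_subset_Icc_self ht
  have hk0 : 0 < t - s := sub_pos.2 hst
  have hXne : ∀ j, P.grad X j ≠ 0 := fun j h => by
    have := (hX j).1
    rw [h, norm_zero] at this
    exact absurd this (not_le.2 (by positivity))
  obtain ⟨Yw, hYw, hYwK, hYwo⟩ := hR.w_osc s hs t ht'
  -- The difference quotients of w, and of x_ρ below, are only in H¹ in space. Their oscillations on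
  -- the elements are square summable of order h², which is enough after Young's inequality.
  obtain ⟨β, hβ0, hβ, hβo⟩ := exists_osc P (u := fun ρ => w t ρ - w s ρ) hk0 hYw hYwK
    (fun a b hab => by rw [Real.norm_eq_abs, sq_abs]; exact hYwo a b hab)
  obtain ⟨Yx, hYx, hYxK, hYxo⟩ := hR.xρ_osc s hs t ht'
  obtain ⟨γ, hγ0, hγ, hγo⟩ := exists_osc P (u := fun ρ => deriv (x t) ρ - deriv (x s) ρ) hk0 hYx
    hYxK hYxo
  refine ⟨β, γ, hβ, hγ, ?_⟩
  have hγx : ∀ j, ∀ ρ ∈ Icc (P.left j) (P.right j),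
      ‖(t - s)⁻¹ • (deriv (x t) ρ - deriv (x s) ρ)
        - P.grad (diffQuot (t - s) (x s) (x t)) j‖ ≤ γ j := fun j ρ hρ => by
    rw [norm_sub_rev]
    exact P.norm_grad_sub_le (u' := fun ρ => (t - s)⁻¹ • (deriv (x t) ρ - deriv (x s) ρ))
      (fun r => ((hR.x_deriv t ht' r).sub (hR.x_deriv s hs r)).const_smul _) j
      fun r hr => hγo j r hr ρ hρ
  obtain ⟨Y, hY, hYK, hweak⟩ := hR.scalar_weak t ht s hs hst
  set k := t - s with hkdef
  set Rr : ℝ → ℝ := fun ρ => ‖deriv (x t) ρ‖ * (k⁻¹ * (w t ρ - w s ρ))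
    + ⟪k⁻¹ • (deriv (x t) ρ - deriv (x s) ρ), tangent (x t) ρ⟫ * w t ρ
    - ‖deriv (x t) ρ‖ * g (normalVel T x t ρ) (w t ρ) with hRr
  set Φ : ℝ → ℝ := fun ρ => ⟪k⁻¹ • (x t ρ - x s ρ), tangent (x t) ρ⟫ * w t ρ
    + d * (deriv (w t) ρ / ‖deriv (x t) ρ‖) with hΦ
  set c₀ : Fin P.count → ℝ → ℝ := fun j ρ => ‖P.grad X j‖ * diffQuot k (w s) (w t) ρ
    + ⟪P.grad (diffQuot k (x s) (x t)) j, discTangent P X j⟫ * w s ρ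
    - ‖P.grad X j‖ * g ⟪diffQuot k X₀ X ρ, discNormal P X j⟫ (W₀ ρ) with hc₀
  set c₁ : Fin P.count → ℝ → ℝ := fun j ρ =>
    ⟪diffQuot k (x s) (x t) ρ, discTangent P X j⟫ * w t ρ
    + d * (P.grad (w t) j / ‖P.grad X j‖) with hc₁def
  have c1 := hR.continuous_xρ ht'
  have c2 := hR.continuous_xρ hs
  have c3 := hR.continuous_w ht'
  have c4 := hR.continuous_w hs
  have c5 := hR.continuous_xt ht'
  have c8 := hR.continuous_x ht'
  have c9 := hR.continuous_x hs
  have hne : ∀ ρ, ‖deriv (x t) ρ‖ ≠ 0 := fun ρ => norm_ne_zero_iff.2 (hR.xρ_ne_zero ht' ρ)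
  have c6 : Continuous (tangent (x t)) := (c1.norm.inv₀ hne).smul c1
  have c7 : Continuous (normalVel T x t) := c5.inner (perpCLM.continuous.comp c6)
  have c10 : Continuous fun ρ => g (normalVel T x t ρ) (w t ρ) :=
    hg.continuous.comp (c7.prodMk c3)
  have c11 : Continuous (deriv (w t)) :=
    continuous_of_norm_sub_le hR.K_pos.le fun a b => hR.wρ_lip t ht a b
  have hRc : Continuous Rr := by simp only [hRr]; fun_prop
  have hΦc : Continuous Φ := by
    simp only [hΦ]
    exact ((((c8.sub c9).const_smul k⁻¹).inner c6).mul c3).add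
      (continuous_const.mul (c11.div c1.norm hne))
  have hΦp : Function.Periodic Φ 1 := fun ρ => by
    simp only [hΦ, tangent, periodic_deriv (hR.x_per t) ρ, periodic_deriv (hR.w_per t) ρ,
      hR.x_per t ρ, hR.x_per s ρ, hR.w_per t ρ]
  set S₁ : Fin P.count → ℝ → ℝ := fun j ρ => P.maxStep + √(k * (G t - G s))
    + ‖P.grad (fun r => x t r - X r) j‖
    + ‖diffQuot k (fun r => x s r - X₀ r) (fun r => x t r - X r) ρ‖
    + |w s ρ - W₀ ρ| + β j + γ j with hS₁
  set S₂ : Fin P.count → ℝ := fun j => P.maxStep + ‖P.grad (fun r => x t r - X r) j‖ with hS₂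
  have hh := P.maxStep_pos
  have hS₁0 : ∀ j ρ, 0 ≤ S₁ j ρ := fun j ρ => by
    have := hβ0 j
    have := hγ0 j
    simp only [hS₁]; positivity
  have hS₂0 : ∀ j, 0 ≤ S₂ j := fun j => by simp only [hS₂]; positivity
  set I : Fin P.count → ℝ := fun j => ∫ ρ in P.left j..P.right j,
    (Rr ρ * (z (P.left j) + (ρ - P.left j) * P.grad z j) + Φ ρ * P.grad z j) with hI
  have hzR : ∀ j, z (P.left j) + (P.right j - P.left j) * P.grad z j = z (P.right j) := fun j =>
    P.left_add_grad z j
  have hloc : ∀ j, P.step j / 2 * ((c₀ j (P.left j) * z (P.left j) + c₁ j (P.left j) * P.grad z j)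
      + (c₀ j (P.right j) * z (P.right j) + c₁ j (P.right j) * P.grad z j)) ≤
      P.step j / 2 * (((C₁ + C₂) * S₁ j (P.left j) * |z (P.left j)|
          + (C₁ + C₂) * S₂ j * |P.grad z j|)
        + ((C₁ + C₂) * S₁ j (P.right j) * |z (P.right j)|
          + (C₁ + C₂) * S₂ j * |P.grad z j|)) + I j := fun j => by
    have e1 := abs_integral_scalar_sub_le (P.left_lt_right j) hRc hΦc
      (cL := c₀ j (P.left j)) (cR := c₀ j (P.right j)) (cL' := c₁ j (P.left j))
      (cR' := c₁ j (P.right j)) (BL := C₁ * S₁ j (P.left j)) (BR := C₁ * S₁ j (P.right j))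
      (BL' := C₂ * S₂ j) (BR' := C₂ * S₂ j)
      (fun ρ hρ => hc₁ P hs ht' hst hk j (P.left_mem_elem j) hρ (hXne j) (hX j).2 (hW₀ j).1
        (hβ0 j) (hγ0 j) (hβo j ρ hρ _ (P.left_mem_elem j)) (hγx j ρ hρ))
      (fun ρ hρ => hc₁ P hs ht' hst hk j (P.right_mem_elem j) hρ (hXne j) (hX j).2 (hW₀ j).2
        (hβ0 j) (hγ0 j) (hβo j ρ hρ _ (P.right_mem_elem j)) (hγx j ρ hρ))
      (fun ρ hρ => hc₂ P hs ht hst j (P.left_mem_elem j) hρ (hX j).1)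
      (fun ρ hρ => hc₂ P hs ht hst j (P.right_mem_elem j) hρ (hX j).1)
      (z (P.left j)) (P.grad z j) (z (P.right j)) (hzR j).symm
    have e2 := (abs_le.1 e1).1
    have e3 : P.step j / 2 * ((C₁ * S₁ j (P.left j) * |z (P.left j)| + C₂ * S₂ j * |P.grad z j|)
        + (C₁ * S₁ j (P.right j) * |z (P.right j)| + C₂ * S₂ j * |P.grad z j|)) ≤
        P.step j / 2 * (((C₁ + C₂) * S₁ j (P.left j) * |z (P.left j)|
          + (C₁ + C₂) * S₂ j * |P.grad z j|)
        + ((C₁ + C₂) * S₁ j (P.right j) * |z (P.right j)|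
          + (C₁ + C₂) * S₂ j * |P.grad z j|)) := by
      have h1 := hS₁0 j (P.left j)
      have h2 := hS₁0 j (P.right j)
      have h3 := hS₂0 j
      have h4 := (P.step_pos j).le
      gcongr <;> linarith
    have e4 : (P.right j - P.left j) / 2 = P.step j / 2 := rfl
    rw [e4] at e2
    linarith
  -- The flux times z is periodic, so its boundary values telescope to zero. The increments of `Y`
  -- leave the time consistency error of one step.
  have hsumI : ∑ j, I j ≤ K * (k * (G t - G s)) + 2 * K * P.massSq z := by
    have hb : ∑ j, (Φ (P.right j) * z (P.right j) - Φ (P.left j) * z (P.left j)) = 0 :=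
      P.sum_boundary (u := fun ρ => Φ ρ * z ρ) (fun ρ => by simp only [hΦp ρ, hzp ρ])
    have e1 : ∀ j, I j ≤ (Φ (P.right j) * z (P.right j) - Φ (P.left j) * z (P.left j))
        + (Y (P.right j) - Y (P.left j))
        + 2 * K * (P.step j / 2 * (‖z (P.left j)‖ ^ 2 + ‖z (P.right j)‖ ^ 2)) := fun j => by
      have e2 := hweak (P.left j) (P.right j) (P.left_lt_right j).le (z (P.left j)) (P.grad z j)
      rw [hzR] at e2
      have e3 := (abs_le.1 e2).2
      have e4 : P.right j - P.left j = P.step j := rfl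
      rw [e4] at e3
      simp only [Real.norm_eq_abs, sq_abs]
      simp only [hI, hRr, hΦ]
      linarith
    refine (Finset.sum_le_sum fun j _ => e1 j).trans ?_
    rw [Finset.sum_add_distrib, Finset.sum_add_distrib, hb, ← Finset.mul_sum, ← Partition.massSq]
    linarith [P.sum_mono_le hYK]
  calc _ ≤ ∑ j, (P.step j / 2 * (((C₁ + C₂) * S₁ j (P.left j) * |z (P.left j)|
          + (C₁ + C₂) * S₂ j * |P.grad z j|)
        + ((C₁ + C₂) * S₁ j (P.right j) * |z (P.right j)|
          + (C₁ + C₂) * S₂ j * |P.grad z j|)) + I j) := Finset.sum_le_sum fun j _ => hloc j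
    _ ≤ _ := by
      rw [Finset.sum_add_distrib]
      exact add_le_add le_rfl hsumI

end ScalarConsistency

/-! ### Energy estimate for the scalar scheme. -/

section ScalarEstimate

variable {T α d K : ℝ} {f : ℝ → ℝ} {g : ℝ → ℝ → ℝ} {x : ℝ → ℝ → Plane} {w : ℝ → ℝ → ℝ}
  {G : ℝ → ℝ}

/-- A discrete product rule: the gradient of z is multiplied by w at the left node minus the mean of
z, and the gradient of w by z at the right node. -/
lemma abs_grad_zeta_le {a b K Z : ℝ} (P : Partition a b) {w z : ℝ → ℝ} (j : Fin P.count)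
    (hw : |w (P.left j)| ≤ K) (hgw : |P.grad w j| ≤ K)
    (hL : |z (P.left j)| ≤ Z) (hR : |z (P.right j)| ≤ Z) :
    |P.grad (fun ρ => w ρ * z ρ - z ρ ^ 2 / 2) j| ≤
      (K + Z) * |P.grad z j| + K * |z (P.right j)| := by
  have hs := (P.step_pos j).ne'
  have e : P.grad (fun ρ => w ρ * z ρ - z ρ ^ 2 / 2) j =
      (w (P.left j) - (z (P.left j) + z (P.right j)) / 2) * P.grad z j
        + P.grad w j * z (P.right j) := by
    simp only [Partition.grad, smul_eq_mul]
    field_simp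
    ring
  rw [e]
  refine (abs_add_le _ _).trans ?_
  rw [abs_mul, abs_mul]
  have h1 : |w (P.left j) - (z (P.left j) + z (P.right j)) / 2| ≤ K + Z := by
    rw [abs_le] at *
    constructor <;> linarith [hw.1, hw.2, hL.1, hL.2, hR.1, hR.2]
  gcongr

set_option maxHeartbeats 800000 in
/-- One step of the scalar scheme: energy estimate for the error, with a bound `Z` on the nodal
values of the new error. -/
lemma exists_scalar_estimate (hR : Reg T α d f g x w K G) (hα : α ∈ Ioc (0 : ℝ) 1) (hd : 0 < d)
    (hf : ContDiff ℝ 1 f) (hg : ContDiff ℝ 1 (fun p : ℝ × ℝ => g p.1 p.2))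
    (hg_lip : ∀ L > 0, ∃ CL ≥ 0, ∀ v₁ v₂ z : ℝ, |z| ≤ L → |g v₁ z - g v₂ z| ≤ CL * |v₁ - v₂|)
    {Ct Cm : ℝ} (hCt : 0 ≤ Ct) (hCm : 0 ≤ Cm) :
    ∃ C, 0 ≤ C ∧ ∀ {ρ₀ : ℝ} (P : Partition ρ₀ (ρ₀ + 1)) {s t : ℝ}, s ∈ Icc 0 T → t ∈ Ioc 0 T →
      s < t → t - s ≤ Ct * P.maxStep → (∀ j, P.maxStep ≤ Cm * P.step j) →
      ∀ {X₀ X : ℝ → Plane} {W₀ W : ℝ → ℝ}, Function.Periodic X₀ 1 → Function.Periodic X 1 →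
      Function.Periodic W₀ 1 → Function.Periodic W 1 → (∀ j, ‖P.grad X₀ j‖ ≤ 2 * K) →
      (∀ j, (2 * K)⁻¹ ≤ ‖P.grad X j‖ ∧ ‖P.grad X j‖ ≤ 2 * K) →
      (∀ j, |W₀ (P.left j)| ≤ 2 * K ∧ |W₀ (P.right j)| ≤ 2 * K) →
      CurveStep P α f (t - s) X₀ W₀ X → ScalarStep P d g (t - s) X₀ X W₀ W →
      ∀ {Z : ℝ}, (∀ j, |w t (P.left j) - W (P.left j)| ≤ Z ∧
        |w t (P.right j) - W (P.right j)| ≤ Z) →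
      P.weightSq X (fun r => w t r - W r)
        + d / (2 * K) * ((t - s) * P.gradSq (fun r => w t r - W r)) ≤
      P.weightSq X₀ (fun r => w s r - W₀ r)
        + C * (t - s) * (P.massSq (fun r => w t r - W r) + P.massSq (fun r => w s r - W₀ r)
          + P.gradSq (fun r => x t r - X r) + P.maxStep ^ 2 + (t - s) * (G t - G s))
        + C * (1 + Z ^ 2) *
          ((t - s) * P.massSq (diffQuot (t - s) (fun r => x s r - X₀ r) fun r => x t r - X r)
          + (t - s) ^ 2 *
            P.gradSq (diffQuot (t - s) (fun r => x s r - X₀ r) fun r => x t r - X r)) := by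
  have hK := hR.K_pos
  have hK1 := hR.one_le
  obtain ⟨C₁, hC₁, hcons⟩ := exists_scalar_weak_consistency hR hd hg hg_lip hCt
  obtain ⟨CJ, hCJ, hjump⟩ := exists_tangent_jump hα hf hK
  -- The five groups of terms below spend ε + 2ε + ε on the gradient of z, in total half of the
  -- coefficient d/(2K) provided by diffusion.
  set ε := d / (16 * K) with hε
  have hε0 : 0 < ε := by positivity
  set cr := 2 * K ^ 4 * Ct ^ 2 + 2 * K ^ 4 + 2 * K ^ 3 * |T| + 4 * K ^ 3 with hcr
  set cj := CJ * Cm * ((1 + K) ^ 2 * K ^ 2 + 1 + K ^ 2) with hcj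
  set C₀ := (4 * C₁ + C₁ ^ 2 / (2 * ε)) + (K / 2 + K ^ 2 / (4 * ε) + K ^ 2 / (2 * ε))
    + (K ^ 2 / (2 * ε) + K) + cr + 2 * cj with hC₀
  have hC₀0 : 0 ≤ C₀ := by
    have : 0 ≤ |T| := abs_nonneg T
    positivity
  refine ⟨2 * (C₀ * (2 + 2 * K) + 2 * K), by positivity, ?_⟩
  intro ρ₀ P s t hs ht hst hk hqu X₀ X W₀ W hX₀p hXp hW₀p hWp hX₀ hX hW₀ hcurve hscalar Z hZ
  have ht' := Ioc_subset_Icc_self ht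
  have hk0 : 0 < t - s := sub_pos.2 hst
  have hkT : t - s ≤ |T| := le_trans (by linarith [hs.1, ht.2]) (le_abs_self T)
  have hXne : ∀ j, P.grad X j ≠ 0 := fun j h => by
    have := (hX j).1
    rw [h, norm_zero] at this
    exact absurd this (not_le.2 (by positivity))
  have hT1 : ∀ j, ‖discTangent P X j‖ = 1 := fun j => norm_unit (hXne j)
  have hr2 := hR.sq_sqrt_rate hst
  have hzp : Function.Periodic (fun r => w t r - W r) 1 := (hR.w_per t).sub hWp
  have hDep : Function.Periodic
      (diffQuot (t - s) (fun r => x s r - X₀ r) fun r => x t r - X r) 1 :=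
    periodic_diffQuot ((hR.x_per s).sub hX₀p) ((hR.x_per t).sub hXp)
  obtain ⟨β, γ, hβ, hγ, hA⟩ := hcons P hs ht hst hk (X₀ := X₀) (W₀ := W₀) hzp hX hW₀
  have hDsplit : ∀ ρ, diffQuot (t - s) X₀ X ρ = diffQuot (t - s) (x s) (x t) ρ
      - diffQuot (t - s) (fun r => x s r - X₀ r) (fun r => x t r - X r) ρ := fun ρ => by
    rw [diffQuot_sub]; abel
  have hen := hscalar.energy hk0 hXne hWp (hR.w_per s) (hR.w_per t) hDep hDsplit
  have hJ := hjump P hX₀p hXp hW₀p hX₀ (fun j => (hW₀ j).2) (fun j => (hX j).1) hcurve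
  have hDxσ := fun σ => hR.diffQuot_x_le hs ht' hst σ
  have hgDx := fun j => hR.grad_diffQuot_x_le P hs ht' hst j
  have hgD : ∀ j, ‖P.grad (diffQuot (t - s) X₀ X) j‖ ≤
      K + ‖P.grad (diffQuot (t - s) (fun r => x s r - X₀ r) fun r => x t r - X r) j‖ :=
    fun j => by
      have e : P.grad (diffQuot (t - s) X₀ X) j = P.grad (diffQuot (t - s) (x s) (x t)) j
          - P.grad (diffQuot (t - s) (fun r => x s r - X₀ r) fun r => x t r - X r) j := by
        rw [← P.grad_sub]
        congr 1
        exact funext hDsplit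
      rw [e]
      exact (norm_sub_le _ _).trans (add_le_add (hgDx j) le_rfl)
  have hDR : ∀ σ, ‖diffQuot (t - s) X₀ X σ‖ ≤
      K + ‖diffQuot (t - s) (fun r => x s r - X₀ r) (fun r => x t r - X r) σ‖ := fun σ => by
    rw [hDsplit]
    exact (norm_sub_le _ _).trans (add_le_add (hDxσ σ) le_rfl)
  set k := t - s with hkdef
  set h := P.maxStep with hh
  set r := √(k * (G t - G s)) with hr
  set De := diffQuot k (fun r => x s r - X₀ r) fun r => x t r - X r with hDe
  set Dx := diffQuot k (x s) (x t) with hDx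
  set D := diffQuot k X₀ X with hD
  set e₁ : ℝ → Plane := fun r => x t r - X r with he₁
  set z : ℝ → ℝ := fun r => w t r - W r with hz
  set z₀ : ℝ → ℝ := fun r => w s r - W₀ r with hz₀
  -- Both nodal values of the element enter, because the gradient of ζ seen from either end involves
  -- z at the right node.
  set M : Fin P.count → ℝ := fun j => z (P.left j) ^ 2 + z (P.right j) ^ 2 with hM
  set H : Fin P.count → ℝ → ℝ := fun j σ => M j + z₀ σ ^ 2 + ‖P.grad e₁ j‖ ^ 2 + h ^ 2 + r ^ 2
    + β j ^ 2 + γ j ^ 2 + (1 + Z ^ 2) * (‖De σ‖ ^ 2 + k * ‖P.grad De j‖ ^ 2) with hH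
  have hM0 : ∀ j, 0 ≤ M j := fun j => by simp only [hM]; positivity
  have hZ2 : 0 ≤ Z ^ 2 := sq_nonneg Z
  have hH1 : ∀ j σ, h ^ 2 + r ^ 2 + ‖P.grad e₁ j‖ ^ 2 + ‖De σ‖ ^ 2 + |z₀ σ| ^ 2 + β j ^ 2
      + γ j ^ 2 + M j ≤ H j σ := fun j σ => by
    have a1 : 0 ≤ Z ^ 2 * ‖De σ‖ ^ 2 := by positivity
    have a2 : 0 ≤ (1 + Z ^ 2) * (k * ‖P.grad De j‖ ^ 2) := by positivity
    simp only [hH, sq_abs]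
    linarith
  have hH2 : ∀ j σ, (1 + Z ^ 2) * ‖De σ‖ ^ 2 ≤ H j σ ∧
      (1 + Z ^ 2) * (k * ‖P.grad De j‖ ^ 2) ≤ H j σ ∧ M j ≤ H j σ ∧ h ^ 2 ≤ H j σ ∧
      h ^ 2 + ‖P.grad e₁ j‖ ^ 2 ≤ H j σ := fun j σ => by
    have a0 := hM0 j
    have a1 : 0 ≤ (1 + Z ^ 2) * ‖De σ‖ ^ 2 := by positivity
    have a2 : 0 ≤ (1 + Z ^ 2) * (k * ‖P.grad De j‖ ^ 2) := by positivity
    have a3 := sq_nonneg (z₀ σ)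
    have a4 := sq_nonneg ‖P.grad e₁ j‖
    have a5 := sq_nonneg h
    have a6 := sq_nonneg r
    have a7 := sq_nonneg (β j)
    have a8 := sq_nonneg (γ j)
    simp only [hH]
    refine ⟨?_, ?_, ?_, ?_, ?_⟩ <;> linarith
  have hzM : ∀ j σ, σ = P.left j ∨ σ = P.right j → z σ ^ 2 ≤ M j := fun j σ hσ => by
    simp only [hM]
    rcases hσ with e | e <;> rw [e]
    · linarith [sq_nonneg (z (P.right j))]
    · linarith [sq_nonneg (z (P.left j))]
  have hzZ : ∀ j σ, σ = P.left j ∨ σ = P.right j → |z σ| ≤ Z := fun j σ hσ => by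
    rcases hσ with e | e <;> rw [e]
    · exact (hZ j).1
    · exact (hZ j).2
  have hin : ∀ j (y : Plane), |⟪y, discTangent P X j⟫| ≤ ‖y‖ := fun j y => by
    have := abs_real_inner_le_norm y (discTangent P X j)
    rwa [hT1, mul_one] at this
  -- the five groups of terms
  have B1 : P.nodalSum (fun j ρ => C₁ * (h + r + ‖P.grad e₁ j‖ + ‖De ρ‖ + |z₀ ρ| + β j + γ j)
        * |z ρ| + C₁ * (h + ‖P.grad e₁ j‖) * |P.grad z j|) ≤
      P.nodalSum (fun j ρ => ε * P.grad z j ^ 2 + (4 * C₁ + C₁ ^ 2 / (2 * ε)) * H j ρ) := by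
    refine P.nodalSum_mono fun j σ hσ => ?_
    have a1 := consistency_term_le (C := C₁) hC₁
      ((add_le_add le_rfl (hzM j σ hσ)).trans (hH1 j σ))
    have a2 := flux_term_le (C := C₁) (s := P.grad z j) hε0 (hH2 j σ).2.2.2.2
    linarith
  have B2 : P.nodalSum (fun j ρ => -(⟪P.grad Dx j, discTangent P X j⟫ * (w t ρ - W ρ) ^ 2 / 2)
        - ⟪Dx ρ, discTangent P X j⟫ * (w t ρ - W ρ) * P.grad z j
        - ⟪De ρ, discTangent P X j⟫ * W ρ * P.grad z j) ≤
      P.nodalSum (fun j ρ => 2 * ε * P.grad z j ^ 2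
        + (K / 2 + K ^ 2 / (4 * ε) + K ^ 2 / (2 * ε)) * H j ρ) := by
    refine P.nodalSum_mono fun j σ hσ => ?_
    have hWσ : |W σ| ≤ K + Z := by
      have e : W σ = w t σ - z σ := by simp only [hz]; ring
      rw [e]
      exact (abs_sub _ _).trans (add_le_add (hR.w_le t ht' σ) (hzZ j σ hσ))
    exact drift_term_le (z := z σ) hε0 hK1 ((hin j _).trans (hgDx j))
      ((hin j _).trans (hDxσ σ)) (hin j _) hWσ ((hzM j σ hσ).trans (hH2 j σ).2.2.1) (hH2 j σ).1
  have B3 : P.nodalSum (fun j ρ => ⟪De ρ, discTangent P X j⟫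
        * P.grad (fun ρ => w s ρ * (w t ρ - W ρ) - (w t ρ - W ρ) ^ 2 / 2) j) ≤
      P.nodalSum (fun j ρ => ε * P.grad z j ^ 2 + (K ^ 2 / (2 * ε) + K) * H j ρ) := by
    refine P.nodalSum_mono fun j σ _ => ?_
    refine parts_term_le (Z := Z) (y := z (P.right j)) hε0 hK1 (hin j _) ?_
      ((hzM j _ (Or.inr rfl)).trans (hH2 j σ).2.2.1) (hH2 j σ).1
    exact abs_grad_zeta_le P (z := z) j (hR.w_le s hs _) (hR.grad_w_le P hs j) (hZ j).1 (hZ j).2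
  have B4 : P.nodalSum (fun j ρ => k * ‖P.grad D j‖ ^ 2 / ‖P.grad X j‖
        * |w s ρ * (w t ρ - W ρ) - (w t ρ - W ρ) ^ 2 / 2|) ≤
      P.nodalSum (fun j ρ => cr * H j ρ) := by
    refine P.nodalSum_mono fun j σ hσ => ?_
    exact remainder_term_le (z := z σ) hK1 hk0.le hkT hk (norm_pos_iff.2 (hXne j))
      (inv_le_of_inv_le₀ (by positivity) (hX j).1) (norm_nonneg _) (hgD j) (hR.w_le s hs σ)
      (hzZ j σ hσ) ((hzM j σ hσ).trans (hH2 j σ).2.2.1) (hH2 j σ).2.2.2.1 (hH2 j σ).2.1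
  have B5 : ∑ j, |⟪De (P.right j), discTangent P X j - discTangent P X (P.next j)⟫
        * (w s (P.right j) * (w t (P.right j) - W (P.right j))
          - (w t (P.right j) - W (P.right j)) ^ 2 / 2)| ≤
      P.nodalSum (fun j ρ => 2 * cj * H j ρ) := by
    refine Finset.sum_le_sum fun j _ => ?_
    -- The jump supplies a factor h but the sum over the nodes has no weights. Quasi-uniformity
    -- trades h for `P.step j`.
    have a1 : |⟪De (P.right j), discTangent P X j - discTangent P X (P.next j)⟫| ≤
        P.step j * (‖De (P.right j)‖ * (CJ * Cm * (1 + ‖D (P.right j)‖))) := by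
      refine (abs_real_inner_le_norm _ _).trans ?_
      calc ‖De (P.right j)‖ * ‖discTangent P X j - discTangent P X (P.next j)‖
          ≤ ‖De (P.right j)‖ * (CJ * h * (1 + ‖D (P.right j)‖)) :=
            mul_le_mul_of_nonneg_left (hJ j) (norm_nonneg _)
        _ ≤ ‖De (P.right j)‖ * (CJ * (Cm * P.step j) * (1 + ‖D (P.right j)‖)) := by
            have := hqu j
            gcongr
        _ = _ := by ring
    have a2 := jump_term_le (C := CJ * Cm) (z := z (P.right j)) hK1 (by positivity)
      (norm_nonneg (De (P.right j))) (hDR (P.right j)) (hR.w_le s hs (P.right j)) (hZ j).2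
      ((hzM j _ (Or.inr rfl)).trans (hH2 j (P.right j)).2.2.1) (hH2 j (P.right j)).1
    have a3 := P.step_pos j
    have a4 : 0 ≤ H j (P.left j) := (hM0 j).trans (hH2 j _).2.2.1
    have hcj0 : 0 ≤ cj := by positivity
    rw [abs_mul]
    calc _ ≤ P.step j * (‖De (P.right j)‖ * (CJ * Cm * (1 + ‖D (P.right j)‖)))
          * |w s (P.right j) * z (P.right j) - z (P.right j) ^ 2 / 2| :=
          mul_le_mul_of_nonneg_right a1 (abs_nonneg _)
      _ = P.step j * (‖De (P.right j)‖ * (CJ * Cm * (1 + ‖D (P.right j)‖))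
          * |w s (P.right j) * z (P.right j) - z (P.right j) ^ 2 / 2|) := by ring
      _ ≤ P.step j * (cj * H j (P.right j)) := mul_le_mul_of_nonneg_left a2 a3.le
      _ ≤ P.step j * (cj * (H j (P.left j) + H j (P.right j))) := by
          gcongr
          linarith
      _ = _ := by ring
  have hHsum : P.nodalSum H ≤ (2 + 2 * K) * (P.massSq z + P.massSq z₀ + P.gradSq e₁ + h ^ 2
      + k * (G t - G s)) + (1 + Z ^ 2) * (P.massSq De + k * P.gradSq De) := by
    have e1 : P.nodalSum H = 2 * P.massSq z + P.massSq z₀ + P.gradSq e₁ + (h ^ 2 + r ^ 2)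
        + ∑ j, P.step j * β j ^ 2 + ∑ j, P.step j * γ j ^ 2
        + (1 + Z ^ 2) * (P.massSq De + k * P.gradSq De) := by
      have e2 : h ^ 2 + r ^ 2 = ∑ j, P.step j * (h ^ 2 + r ^ 2) := by
        rw [← Finset.sum_mul, P.sum_step_one, one_mul]
      conv_rhs => rw [e2]
      simp only [Partition.nodalSum, Partition.massSq, Partition.gradSq, Finset.mul_sum,
        ← Finset.sum_add_distrib]
      refine Finset.sum_congr rfl fun j _ => ?_
      simp only [hH, hM, Real.norm_eq_abs, sq_abs]
      ring
    rw [e1, hr2]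
    have n1 := P.massSq_nonneg z
    have n2 := P.massSq_nonneg z₀
    have n3 := P.gradSq_nonneg e₁
    have n4 := sq_nonneg h
    have n5 : 0 ≤ k * (G t - G s) := by rw [← hr2]; exact sq_nonneg r
    have n6 : 0 ≤ K * (P.massSq z + P.massSq z₀ + P.gradSq e₁ + k * (G t - G s)) := by positivity
    linarith
  have hgrad : P.nodalSum (fun j _ => P.grad z j ^ 2) = P.gradSq z := by
    rw [P.nodalSum_elem]
    simp only [Partition.gradSq, Real.norm_eq_abs, sq_abs]
  -- The upper bound 2K on the new length element gives the coefficient of the diffusion.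
  have hdiff : d / (2 * K) * P.gradSq z ≤
      d * ∑ j, P.step j * (P.grad z j ^ 2 / ‖P.grad X j‖) := by
    rw [div_mul_eq_mul_div, mul_div_assoc]
    refine mul_le_mul_of_nonneg_left ?_ hd.le
    rw [Partition.gradSq, Finset.sum_div]
    refine Finset.sum_le_sum fun j _ => ?_
    rw [Real.norm_eq_abs, sq_abs, mul_div_assoc]
    exact mul_le_mul_of_nonneg_left (div_le_div_of_nonneg_left (sq_nonneg _)
      (norm_pos_iff.2 (hXne j)) (hX j).2) (P.step_pos j).le
  simp only [P.nodalSum_add, P.nodalSum_const_mul, hgrad] at B1 B2 B3 B4 B5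
  have hεd : 4 * ε = d / (2 * K) / 2 := by rw [hε]; field_simp; norm_num
  have total : (P.weightSq X z - P.weightSq X₀ z₀) / (2 * k) + d / (2 * K) * P.gradSq z ≤
      4 * ε * P.gradSq z + C₀ * P.nodalSum H + (K * (k * (G t - G s)) + 2 * K * P.massSq z) := by
    have hA' := hA
    simp only [P.nodalSum_add] at hA' hen
    rw [hC₀]
    linarith
  rw [hεd] at total
  have t1 : (P.weightSq X z - P.weightSq X₀ z₀) / (2 * k) ≤
      -(d / (2 * K) / 2 * P.gradSq z) + C₀ * P.nodalSum H
        + (K * (k * (G t - G s)) + 2 * K * P.massSq z) := by linarith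
  rw [div_le_iff₀ (by positivity)] at t1
  have t2 := mul_le_mul_of_nonneg_left hHsum hC₀0
  set A := P.massSq z + P.massSq z₀ + P.gradSq e₁ + h ^ 2 + k * (G t - G s) with hAdef
  have n1 := P.massSq_nonneg z
  have n2 := P.massSq_nonneg z₀
  have n3 := P.gradSq_nonneg e₁
  have n4 := sq_nonneg h
  have n5 : 0 ≤ k * (G t - G s) := by rw [← hr2]; exact sq_nonneg r
  have t3 : K * (k * (G t - G s)) + 2 * K * P.massSq z ≤ 2 * K * A := by
    have : 0 ≤ K * (P.massSq z₀ + P.gradSq e₁ + h ^ 2) := by positivity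
    have : 0 ≤ K * (k * (G t - G s)) := by positivity
    rw [hAdef]
    linarith
  have n6 : 0 ≤ P.massSq De + k * P.gradSq De := by
    have := P.massSq_nonneg De
    have := P.gradSq_nonneg De
    positivity
  have t4 : C₀ * ((1 + Z ^ 2) * (P.massSq De + k * P.gradSq De)) ≤
      (C₀ * (2 + 2 * K) + 2 * K) * ((1 + Z ^ 2) * (P.massSq De + k * P.gradSq De)) := by
    refine mul_le_mul_of_nonneg_right ?_ (by positivity)
    have := mul_nonneg hC₀0 hK.le
    linarith
  have t5 : C₀ * P.nodalSum H + (K * (k * (G t - G s)) + 2 * K * P.massSq z) ≤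
      (C₀ * (2 + 2 * K) + 2 * K) * (A + (1 + Z ^ 2) * (P.massSq De + k * P.gradSq De)) := by
    linarith
  have t6 := mul_le_mul_of_nonneg_right t5 (by positivity : (0 : ℝ) ≤ 2 * k)
  have e1 : 2 * (C₀ * (2 + 2 * K) + 2 * K) * k * A
      + 2 * (C₀ * (2 + 2 * K) + 2 * K) * (1 + Z ^ 2) * (k * P.massSq De + k ^ 2 * P.gradSq De) =
      (C₀ * (2 + 2 * K) + 2 * K) * (A + (1 + Z ^ 2) * (P.massSq De + k * P.gradSq De)) * (2 * k) := by
    ring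
  have e2 : d / (2 * K) * (k * P.gradSq z) = d / (2 * K) / 2 * P.gradSq z * (2 * k) := by ring
  rw [add_assoc, e1, e2]
  linarith

end ScalarEstimate

/-! ### Smallness conditions and their consequences. -/

section OneStep

/-- One small number has to meet finitely many conditions; listing the coefficients avoids nested
minima. -/
lemma exists_small : ∀ l : List ℝ, ∃ δ : ℝ, 0 < δ ∧ ∀ A ∈ l, A * δ ≤ 1
  | [] => ⟨1, one_pos, by simp⟩
  | A :: l => by
    obtain ⟨δ, hδ, h⟩ := exists_small l
    refine ⟨min δ (1 + |A|)⁻¹, lt_min hδ (by positivity), ?_⟩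
    intro B hB
    have hm : 0 ≤ min δ (1 + |A|)⁻¹ := le_min hδ.le (by positivity)
    rcases List.mem_cons.1 hB with rfl | hB
    · calc B * min δ (1 + |B|)⁻¹ ≤ |B| * (1 + |B|)⁻¹ :=
            mul_le_mul (le_abs_self B) (min_le_right _ _) hm (abs_nonneg B)
        _ ≤ 1 := by
          rw [← div_eq_mul_inv, div_le_one (by positivity)]
          linarith
    · rcases le_total B 0 with h0 | h0
      · exact (mul_nonpos_of_nonpos_of_nonneg h0 hm).trans zero_le_one
      · exact (mul_le_mul_of_nonneg_left (min_le_left _ _) h0).trans (h B hB)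

variable {T α d K : ℝ} {f : ℝ → ℝ} {g : ℝ → ℝ → ℝ} {x : ℝ → ℝ → Plane} {w : ℝ → ℝ → ℝ}
  {G : ℝ → ℝ} {ρ₀ : ℝ} (P : Partition ρ₀ (ρ₀ + 1))

lemma Partition.gradSq_eq_zero_of_nodes {a b : ℝ} (P : Partition a b) {E : Type*}
    [NormedAddCommGroup E] [NormedSpace ℝ E] {u : ℝ → E} (h : ∀ i, u (P.node i) = 0) :
    P.gradSq u = 0 :=
  Finset.sum_eq_zero fun j _ => by
    simp [Partition.grad, Partition.left, Partition.right, h]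

lemma Partition.weightSq_nonneg {a b : ℝ} (P : Partition a b) (X : ℝ → Plane) (u : ℝ → ℝ) :
    0 ≤ P.weightSq X u := by
  rw [Partition.weightSq, Partition.nodalSum]
  exact Finset.sum_nonneg fun j _ => by have := P.step_pos j; positivity

lemma Partition.massSq_le_weightSq {a b : ℝ} (P : Partition a b) {X : ℝ → Plane} (hK : 0 < K)
    (hX : ∀ j, (2 * K)⁻¹ ≤ ‖P.grad X j‖) (u : ℝ → ℝ) :
    P.massSq u ≤ 2 * K * P.weightSq X u := by
  rw [P.massSq_eq, Partition.weightSq, ← P.nodalSum_const_mul]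
  refine P.nodalSum_mono fun j σ _ => ?_
  rw [Real.norm_eq_abs, sq_abs, ← mul_assoc]
  refine le_mul_of_one_le_left (sq_nonneg _) ?_
  have := mul_le_mul_of_nonneg_left (hX j) (by positivity : 0 ≤ 2 * K)
  rwa [mul_inv_cancel₀ (by positivity)] at this

lemma Partition.abs_le_one_of_massSq {Cm : ℝ} (hqu : ∀ j, P.maxStep ≤ Cm * P.step j)
    {u : ℝ → ℝ} (hu : 2 * Cm * P.massSq u ≤ P.maxStep) (j : Fin P.count) :
    |u (P.left j)| ≤ 1 ∧ |u (P.right j)| ≤ 1 := by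
  have hh := P.maxStep_pos
  obtain ⟨h1, h2⟩ := P.norm_sq_le hqu u j
  have aux : ∀ y : ℝ, P.maxStep * ‖y‖ ^ 2 ≤ 2 * Cm * P.massSq u → |y| ≤ 1 := fun y hy => by
    rw [Real.norm_eq_abs] at hy
    have h3 : P.maxStep * |y| ^ 2 ≤ P.maxStep * 1 := by linarith
    have h4 := le_of_mul_le_mul_left h3 hh
    exact (sq_le_one_iff₀ (abs_nonneg y)).1 h4
  exact ⟨aux _ h1, aux _ h2⟩

/-- A small gradient error keeps the length element of the discrete curve in a fixed interval. -/
lemma Reg.grad_bounds (hR : Reg T α d f g x w K G) {Cm : ℝ}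
    (hqu : ∀ j, P.maxStep ≤ Cm * P.step j) {t : ℝ} (ht : t ∈ Icc 0 T)
    (hh : 4 * K ^ 2 * P.maxStep ≤ 1) {X : ℝ → Plane}
    (he : 16 * K ^ 2 * (Cm * P.gradSq (fun r => x t r - X r)) ≤ P.maxStep) (j : Fin P.count) :
    (2 * K)⁻¹ ≤ ‖P.grad X j‖ ∧ ‖P.grad X j‖ ≤ 2 * K := by
  have hK := hR.K_pos
  have hK1 := hR.one_le
  have hm := P.maxStep_pos
  set e := ‖P.grad (fun r => x t r - X r) j‖ with hedef
  have h1 := P.norm_grad_sq_le hqu (fun r => x t r - X r) j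
  have h2 : (4 * K * e) ^ 2 ≤ 1 := by
    have : P.maxStep * (4 * K * e) ^ 2 ≤ P.maxStep * 1 := by
      have := mul_le_mul_of_nonneg_left h1 (by positivity : 0 ≤ 16 * K ^ 2)
      calc P.maxStep * (4 * K * e) ^ 2 = 16 * K ^ 2 * (P.maxStep * e ^ 2) := by ring
        _ ≤ _ := by linarith
    exact le_of_mul_le_mul_left this hm
  have h3 : 4 * K * e ≤ 1 := (sq_le_one_iff₀ (by positivity)).1 h2
  have h4 := hR.grad_x_sub_le P ht j (P.left_mem_elem j)
  have h5 : P.grad X j = deriv (x t) (P.left j) + (P.grad (x t) j - deriv (x t) (P.left j))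
      - P.grad (fun r => x t r - X r) j := by
    rw [P.grad_sub]; abel
  have h6 : ‖P.grad X j - deriv (x t) (P.left j)‖ ≤ K * P.maxStep + e := by
    have : P.grad X j - deriv (x t) (P.left j) = (P.grad (x t) j - deriv (x t) (P.left j))
      - P.grad (fun r => x t r - X r) j := by rw [h5]; abel
    rw [this]
    exact (norm_sub_le _ _).trans (add_le_add h4 le_rfl)
  -- Interpolation error and discrete error are each at most 1/(4K), half of the margin between K⁻¹
  -- and (2K)⁻¹ being spent on either.
  have h7 : K * P.maxStep + e ≤ (2 * K)⁻¹ := by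
    rw [← one_div, le_div_iff₀ (by positivity)]
    nlinarith
  have h8 : (2 * K)⁻¹ + (2 * K)⁻¹ = K⁻¹ := by field_simp; norm_num
  have h9 : (2 * K)⁻¹ ≤ K := (inv_le_one_of_one_le₀ (by linarith)).trans hK1
  have l1 := norm_sub_norm_le (deriv (x t) (P.left j)) (P.grad X j)
  rw [norm_sub_rev] at l1
  have l2 := norm_sub_norm_le (P.grad X j) (deriv (x t) (P.left j))
  have l3 := hR.le_xρ t ht (P.left j)
  have l4 := hR.xρ_le t ht (P.left j)
  constructor <;> linarith

/-- The new energy on the right is moved to the left. For y ≤ 1/2 one has 1 + y ≤ (1 - y)(1 + 4 y)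
and 1 ≤ 2 (1 - y). -/
lemma absorb {E₀ E₁ b y q : ℝ} (hy : 0 ≤ y) (hy1 : 2 * y ≤ 1) (hE : 0 ≤ E₀) (hb : 0 ≤ b)
    (hq : 0 ≤ q) (h : E₁ + b ≤ E₀ + y * (E₁ + E₀ + q)) :
    E₁ + b ≤ (1 + 4 * y) * E₀ + 2 * y * q := by
  have h1 : 0 < 1 - y := by linarith
  refine le_of_mul_le_mul_left ?_ h1
  have e1 : 0 ≤ y * (1 - 2 * y) * E₀ := mul_nonneg (mul_nonneg hy (by linarith)) hE
  have e2 : 0 ≤ y * (1 - 2 * y) * q := mul_nonneg (mul_nonneg hy (by linarith)) hq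
  have e3 : 0 ≤ y * b := mul_nonneg hy hb
  nlinarith

end OneStep

/-! ### One time step under the smallness hypothesis. -/

section OneStepEstimate

variable {T α d K : ℝ} {f : ℝ → ℝ} {g : ℝ → ℝ → ℝ} {x : ℝ → ℝ → Plane} {w : ℝ → ℝ → ℝ}
  {G : ℝ → ℝ}

set_option maxHeartbeats 1000000 in
/-- If the error energy is at most `δ h`, the next time step is uniquely solvable, and the energy
after it satisfies a Gronwall type inequality. -/
lemma exists_one_step (hR : Reg T α d f g x w K G) (hα : α ∈ Ioc (0 : ℝ) 1) (hd : 0 < d)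
    (hf : ContDiff ℝ 1 f) (hg : ContDiff ℝ 1 (fun p : ℝ × ℝ => g p.1 p.2))
    (hg_lip : ∀ L > 0, ∃ CL ≥ 0, ∀ v₁ v₂ z : ℝ, |z| ≤ L → |g v₁ z - g v₂ z| ≤ CL * |v₁ - v₂|)
    {Ct Cm : ℝ} (hCt : 0 ≤ Ct) (hCm : 0 < Cm) :
    ∃ Λ ≥ (1 : ℝ), ∃ c > (0 : ℝ), ∃ C ≥ (0 : ℝ), ∃ δ > (0 : ℝ), ∃ hs > (0 : ℝ),
      ∀ {ρ₀ : ℝ} (P : Partition ρ₀ (ρ₀ + 1)), (∀ j, P.maxStep ≤ Cm * P.step j) →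
      P.maxStep ≤ hs →
      (∀ t ∈ Icc 0 T, ∀ (X : ℝ → Plane) (W : ℝ → ℝ), Λ * P.gradSq (fun r => x t r - X r)
        + P.weightSq X (fun r => w t r - W r) ≤ δ * P.maxStep →
        ∀ j, (2 * K)⁻¹ ≤ ‖P.grad X j‖) ∧
      ∀ {s t : ℝ}, s ∈ Icc 0 T → t ∈ Ioc 0 T → s < t → t - s ≤ Ct * P.maxStep →
      ∀ {X₀ : ℝ → Plane} {W₀ : ℝ → ℝ}, IsFE P X₀ → IsFE P W₀ →
      Λ * P.gradSq (fun r => x s r - X₀ r) + P.weightSq X₀ (fun r => w s r - W₀ r) ≤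
        δ * P.maxStep →
      ∃ X W, (IsFE P X ∧ CurveStep P α f (t - s) X₀ W₀ X ∧
          ∀ Y, IsFE P Y → CurveStep P α f (t - s) X₀ W₀ Y → Y = X) ∧
        (IsFE P W ∧ ScalarStep P d g (t - s) X₀ X W₀ W ∧
          ∀ Y, IsFE P Y → ScalarStep P d g (t - s) X₀ X W₀ Y → Y = W) ∧
        (Λ * P.gradSq (fun r => x t r - X r) + P.weightSq X (fun r => w t r - W r))
          + c * ((t - s) * (P.massSq (diffQuot (t - s) (fun r => x s r - X₀ r)
            fun r => x t r - X r) + P.gradSq (fun r => w t r - W r))) ≤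
        (1 + C * (t - s)) * (Λ * P.gradSq (fun r => x s r - X₀ r)
            + P.weightSq X₀ (fun r => w s r - W₀ r))
          + C * (t - s) * (P.maxStep ^ 2 + (t - s) * (G t - G s)) := by
  have hK := hR.K_pos
  have hK1 := hR.one_le
  obtain ⟨C₁, hC₁, hcurve⟩ := exists_curve_estimate hR hα hf hCt
  obtain ⟨C₂, hC₂, hscalar⟩ := exists_scalar_estimate hR hα hd hf hg hg_lip hCt hCm.le
  set c₁ := α / (4 * K ^ 2) with hc₁
  have hc₁0 : 0 < c₁ := div_pos hα.1 (by positivity)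
  -- With this weight the dissipation Λ c₁ Δ of the curve pays for the term 2 C₂ Δ of the scalar
  -- estimate at Z = 1 and leaves Δ over, which contains the lumped norm of D_t e.
  set Λ := (2 * C₂ + 1) / c₁ + 1 with hΛ
  have hΛ1 : 1 ≤ Λ := le_add_of_nonneg_left (by positivity)
  have hΛc : 2 * C₂ + 1 ≤ Λ * c₁ := by
    rw [hΛ, add_mul, div_mul_cancel₀ _ hc₁0.ne']
    linarith
  set C₃ := C₂ * (2 * K + 1) + Λ * C₁ * (2 * K + 1) with hC₃
  have hC₃0 : 0 ≤ C₃ := by positivity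
  -- In order: δ ≤ 1; bounds on the length element; solvability of the scalar system; absorption of
  -- the term with Z²; nodal values of the scalar errors at most one.
  obtain ⟨δ, hδ, hδA⟩ := exists_small [1, 32 * K ^ 2 * Cm, 16 * Cm / (c₁ * d),
    32 * C₂ * Cm * K / c₁, 4 * Cm * K * (4 + 4 * C₂ / c₁)]
  have d1 : δ ≤ 1 := by simpa using hδA 1 (by simp)
  have d2 := hδA (32 * K ^ 2 * Cm) (by simp)
  have d3 := hδA (16 * Cm / (c₁ * d)) (by simp)
  have d4 := hδA (32 * C₂ * Cm * K / c₁) (by simp)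
  have d5 := hδA (4 * Cm * K * (4 + 4 * C₂ / c₁)) (by simp)
  -- In order: h ≤ 1; interpolation error of x_ρ; growth of the curve energy within one step;
  -- solvability of the scalar system; absorption of the new scalar energy; growth of the scalar
  -- energy; absorption in the final inequality.
  obtain ⟨hs, hs0, hsA⟩ := exists_small [1, 4 * K ^ 2, C₁ * Ct * (2 + 2 * K + Ct * K) / δ,
    4 * K ^ 2 * Ct / d, 8 * C₂ * Ct * K, C₂ * Ct * (3 + 2 * K + Ct * K) / δ, 2 * (C₃ * Ct)]
  refine ⟨Λ, hΛ1, min 1 (d / (2 * K)), lt_min one_pos (by positivity), 4 * C₃, by positivity, δ, hδ,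
    hs, hs0, ?_⟩
  intro ρ₀ P hqu hmesh
  set h := P.maxStep with hh
  have hh0 : 0 < h := P.maxStep_pos
  have scale : ∀ A, A * hs ≤ 1 → 0 ≤ A → A * h ≤ 1 := fun A hA hA0 =>
    (mul_le_mul_of_nonneg_left hmesh hA0).trans hA
  have m1 : h ≤ 1 := by simpa using scale 1 (hsA 1 (by simp)) zero_le_one
  have hh2 : h ^ 2 ≤ h := by
    rw [sq]
    exact mul_le_of_le_one_left hh0.le m1
  have m2 := scale (4 * K ^ 2) (hsA _ (by simp)) (by positivity)
  have m3 := scale (C₁ * Ct * (2 + 2 * K + Ct * K) / δ) (hsA _ (by simp)) (by positivity)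
  have m4 := scale (4 * K ^ 2 * Ct / d) (hsA _ (by simp)) (by positivity)
  have m5 := scale (8 * C₂ * Ct * K) (hsA _ (by simp)) (by positivity)
  have m6 := scale (C₂ * Ct * (3 + 2 * K + Ct * K) / δ) (hsA _ (by simp)) (by positivity)
  have m7 := scale (2 * (C₃ * Ct)) (hsA _ (by simp)) (by positivity)
  rw [div_mul_eq_mul_div, div_le_one hδ] at m3 m6
  rw [div_mul_eq_mul_div, div_le_one hd] at m4
  rw [div_mul_eq_mul_div, div_le_one (by positivity)] at d3 d4
  -- Stated with 2 δ h because the old curve satisfies the bound δ h, while a priori the new one may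
  -- have doubled it.
  have hbnd : ∀ t ∈ Icc 0 T, ∀ X : ℝ → Plane, P.gradSq (fun r => x t r - X r) ≤ 2 * δ * h →
      ∀ j, (2 * K)⁻¹ ≤ ‖P.grad X j‖ ∧ ‖P.grad X j‖ ≤ 2 * K := fun t ht X hX j => by
    refine hR.grad_bounds P hqu ht m2 ?_ j
    calc 16 * K ^ 2 * (Cm * P.gradSq (fun r => x t r - X r))
        ≤ 16 * K ^ 2 * (Cm * (2 * δ * h)) := by gcongr
      _ = 32 * K ^ 2 * Cm * δ * h := by ring
      _ ≤ 1 * h := mul_le_mul_of_nonneg_right d2 hh0.le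
      _ = h := one_mul h
  have hsmallG : ∀ {a b : ℝ}, 0 ≤ a → 0 ≤ b → Λ * a + b ≤ δ * h → a ≤ δ * h ∧ b ≤ δ * h :=
    fun {a b} ha hb hab => by
      have : a ≤ Λ * a := le_mul_of_one_le_left ha hΛ1
      have : 0 ≤ Λ * a := by positivity
      constructor <;> linarith
  have hδh : 0 ≤ δ * h := by positivity
  refine ⟨fun t ht X W hE j => (hbnd t ht X ?_ j).1, ?_⟩
  · have := (hsmallG (P.gradSq_nonneg _) (P.weightSq_nonneg _ _) hE).1
    linarith
  intro s t hsT ht hst hk X₀ W₀ hX₀ hW₀ hE₀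
  have ht' := Ioc_subset_Icc_self ht
  have hk0 : 0 < t - s := sub_pos.2 hst
  obtain ⟨hG₀, hQ₀⟩ := hsmallG (P.gradSq_nonneg _) (P.weightSq_nonneg _ _) hE₀
  have bX₀ := hbnd s hsT X₀ (by linarith)
  have hne : ∀ {X : ℝ → Plane}, (∀ j, (2 * K)⁻¹ ≤ ‖P.grad X j‖ ∧ ‖P.grad X j‖ ≤ 2 * K) →
      ∀ j, P.grad X j ≠ 0 := fun hX j h0 => by
    have := (hX j).1
    rw [h0, norm_zero] at this
    exact absurd this (not_le.2 (by positivity))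
  have hN₀ := P.massSq_le_weightSq hK (fun j => (bX₀ j).1) (fun r => w s r - W₀ r)
  have hN₀' : P.massSq (fun r => w s r - W₀ r) ≤ 2 * K * (δ * h) :=
    hN₀.trans (by gcongr)
  have hz₀ : ∀ j, |w s (P.left j) - W₀ (P.left j)| ≤ 1 ∧
      |w s (P.right j) - W₀ (P.right j)| ≤ 1 := by
    refine P.abs_le_one_of_massSq (u := fun r => w s r - W₀ r) hqu ?_
    have e1 : 4 * Cm * K * δ ≤ 1 := by
      refine le_trans ?_ d5
      have : 1 ≤ 4 + 4 * C₂ / c₁ := by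
        have : 0 ≤ 4 * C₂ / c₁ := by positivity
        linarith
      have e0 : 0 ≤ 4 * Cm * K := by positivity
      exact mul_le_mul_of_nonneg_right (le_mul_of_one_le_right e0 this) hδ.le
    calc 2 * Cm * P.massSq (fun r => w s r - W₀ r) ≤ 2 * Cm * (2 * K * (δ * h)) := by gcongr
      _ = 4 * Cm * K * δ * h := by ring
      _ ≤ 1 * h := mul_le_mul_of_nonneg_right e1 hh0.le
      _ = h := one_mul h
  have bW₀ : ∀ j, |W₀ (P.left j)| ≤ 2 * K ∧ |W₀ (P.right j)| ≤ 2 * K := fun j => by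
    have aux : ∀ σ, |w s σ - W₀ σ| ≤ 1 → |W₀ σ| ≤ 2 * K := fun σ hσ => by
      have e1 := hR.w_le s hsT σ
      rw [abs_le] at *
      constructor <;> linarith [e1.1, e1.2, hσ.1, hσ.2]
    exact ⟨aux _ (hz₀ j).1, aux _ (hz₀ j).2⟩
  obtain ⟨X, hXfe, hXstep, hXuniq⟩ := curve_solvable (f := f) (W₀ := W₀) hα hk0 (hne bX₀)
  have est₁ := hcurve P hsT ht hst hk hX₀.2.1 hXfe.2.1 bX₀ bW₀ hXstep
  have hrate : 0 ≤ (t - s) * (G t - G s) :=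
    mul_nonneg hk0.le (sub_nonneg.2 (hR.mono hst.le))
  have hrate' : (t - s) * (G t - G s) ≤ Ct * K * h := by
    have e1 : G t - G s ≤ K := by
      have := hR.mono hsT.1
      have := hR.mono ht.2
      linarith [hR.G_le]
    calc (t - s) * (G t - G s) ≤ (Ct * h) * K := by
          have := sub_nonneg.2 (hR.mono hst.le)
          gcongr
      _ = _ := by ring
  set k := t - s with hkdef
  set e₀ : ℝ → Plane := fun r => x s r - X₀ r with he₀
  set e₁ : ℝ → Plane := fun r => x t r - X r with he₁
  set De := diffQuot k e₀ e₁ with hDe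
  set z₀ : ℝ → ℝ := fun r => w s r - W₀ r with hz₀def
  set r2 := k * (G t - G s) with hr2
  have nG₀ := P.gradSq_nonneg e₀
  have nG₁ := P.gradSq_nonneg e₁
  have nQ₀ := P.weightSq_nonneg X₀ z₀
  have nN₀ := P.massSq_nonneg z₀
  have nDe := P.massSq_nonneg De
  have nGDe := P.gradSq_nonneg De
  set Δ := k * P.massSq De + k ^ 2 * P.gradSq De with hΔ
  have hΔ0 : 0 ≤ Δ := by positivity
  have hrhs : C₁ * k * (h ^ 2 + r2 + P.gradSq e₀ + P.massSq z₀) ≤ δ * h := by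
    have b1 : h ^ 2 + r2 + P.gradSq e₀ + P.massSq z₀ ≤ (2 + 2 * K + Ct * K) * h := by
      have a1 := hh2
      have a2 : δ * h ≤ h := mul_le_of_le_one_left hh0.le d1
      have a3 : 2 * K * (δ * h) ≤ 2 * K * h := by gcongr
      linarith
    have b0 : 0 ≤ h ^ 2 + r2 + P.gradSq e₀ + P.massSq z₀ := by positivity
    calc C₁ * k * (h ^ 2 + r2 + P.gradSq e₀ + P.massSq z₀)
        ≤ C₁ * (Ct * h) * ((2 + 2 * K + Ct * K) * h) := by gcongr
      _ = C₁ * Ct * (2 + 2 * K + Ct * K) * h * h := by ring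
      _ ≤ δ * h := mul_le_mul_of_nonneg_right m3 hh0.le
  -- The curve estimate does not involve the new scalar. It therefore yields nondegeneracy of the
  -- new curve and a bound on its velocity before the scalar system is solved.
  have hcΔ : c₁ * Δ ≤ 2 * δ * h := by linarith
  have hG₁ : P.gradSq e₁ ≤ 2 * δ * h := by
    have : 0 ≤ c₁ * Δ := by positivity
    linarith
  have bX := hbnd t ht' X hG₁
  have hΔh : Δ ≤ 2 * δ / c₁ * h := by
    rw [div_mul_eq_mul_div, le_div_iff₀ hc₁0]
    linarith
  have hDbound : ∀ σ, h * ‖De σ‖ ^ 2 ≤ 2 * Cm * P.massSq De → k * ‖diffQuot k X₀ X σ‖ ^ 2 ≤ d :=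
    fun σ hσ => by
      have e1 : ‖diffQuot k X₀ X σ‖ ≤ K + ‖De σ‖ := by
        have : diffQuot k X₀ X σ = diffQuot k (x s) (x t) σ - De σ := by
          rw [hDe, diffQuot_sub]; abel
        rw [this]
        exact (norm_sub_le _ _).trans (add_le_add (hR.diffQuot_x_le hsT ht' hst σ) le_rfl)
      have e2 : ‖diffQuot k X₀ X σ‖ ^ 2 ≤ 2 * K ^ 2 + 2 * ‖De σ‖ ^ 2 :=
        (pow_le_pow_left₀ (norm_nonneg _) e1 2).trans (by linarith [add_sq_le (a := K) (b := ‖De σ‖)])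
      have e3 : h * (k * ‖De σ‖ ^ 2) ≤ h * (4 * Cm * δ / c₁) := by
        calc h * (k * ‖De σ‖ ^ 2) = k * (h * ‖De σ‖ ^ 2) := by ring
          _ ≤ k * (2 * Cm * P.massSq De) := by gcongr
          _ = 2 * Cm * (k * P.massSq De) := by ring
          _ ≤ 2 * Cm * Δ := by
            have : k * P.massSq De ≤ Δ := le_add_of_nonneg_right (by positivity)
            gcongr
          _ ≤ 2 * Cm * (2 * δ / c₁ * h) := by gcongr
          _ = h * (4 * Cm * δ / c₁) := by ring
      have e4 := le_of_mul_le_mul_left e3 hh0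
      have e5 : 4 * Cm * δ / c₁ ≤ d / 4 := by
        rw [div_le_iff₀ hc₁0]
        linarith
      have e6 : k * (2 * K ^ 2) ≤ d / 2 := by
        have : k * (2 * K ^ 2) ≤ Ct * h * (2 * K ^ 2) := by gcongr
        linarith
      calc k * ‖diffQuot k X₀ X σ‖ ^ 2 ≤ k * (2 * K ^ 2 + 2 * ‖De σ‖ ^ 2) := by gcongr
        _ = k * (2 * K ^ 2) + 2 * (k * ‖De σ‖ ^ 2) := by ring
        _ ≤ d := by linarith
  obtain ⟨W, hWfe, hWstep, hWuniq⟩ := scalar_solvable (g := g) (X₀ := X₀) (W₀ := W₀) hd hk0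
    (hne bX) (fun j => ⟨hDbound _ (P.norm_sq_le hqu De j).1, hDbound _ (P.norm_sq_le hqu De j).2⟩)
  refine ⟨X, W, ⟨hXfe, hXstep, hXuniq⟩, ⟨hWfe, hWstep, hWuniq⟩, ?_⟩
  have est₂ := @hscalar ρ₀ P s t hsT ht hst hk hqu X₀ X W₀ W hX₀.2.1 hXfe.2.1 hW₀.2.1 hWfe.2.1
    (fun j => (bX₀ j).2) bX bW₀ hXstep hWstep
  set z : ℝ → ℝ := fun r => w t r - W r with hz
  have nQ₁ := P.weightSq_nonneg X z
  have nN₁ := P.massSq_nonneg z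
  have nGz := P.gradSq_nonneg z
  have hN₁ := P.massSq_le_weightSq hK (fun j => (bX j).1) z
  have p0 : 0 ≤ d / (2 * K) * (k * P.gradSq z) := by positivity
  -- first pass: the nodal values of the new error are at most one
  have hz1 : ∀ j, |z (P.left j)| ≤ 1 ∧ |z (P.right j)| ≤ 1 := by
    -- The inverse inequality gives this nodal bound without any smallness of z.
    set Z := √(2 * Cm * P.massSq z / h) with hZ
    have hZ2 : Z ^ 2 = 2 * Cm * P.massSq z / h := Real.sq_sqrt (by positivity)
    have hzZ : ∀ j, |z (P.left j)| ≤ Z ∧ |z (P.right j)| ≤ Z := fun j => by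
      have aux : ∀ y : ℝ, h * ‖y‖ ^ 2 ≤ 2 * Cm * P.massSq z → |y| ≤ Z := fun y hy => by
        refine Real.le_sqrt_of_sq_le ?_
        rw [le_div_iff₀ hh0, mul_comm]
        exact hy
      exact ⟨aux _ (P.norm_sq_le hqu z j).1, aux _ (P.norm_sq_le hqu z j).2⟩
    have q0 := @est₂ Z hzZ
    have q1 : C₂ * k * P.massSq z ≤ P.weightSq X z / 4 := by
      calc C₂ * k * P.massSq z ≤ C₂ * (Ct * h) * (2 * K * P.weightSq X z) := by gcongr
        _ = (8 * C₂ * Ct * K * h) * (P.weightSq X z / 4) := by ring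
        _ ≤ 1 * (P.weightSq X z / 4) := mul_le_mul_of_nonneg_right m5 (by positivity)
        _ = _ := one_mul _
    -- Z² costs a factor 1/h, but Δ is at most a multiple of δ h, so the product is a small multiple
    -- of the new scalar energy and can be absorbed.
    have q2 : C₂ * Z ^ 2 * Δ ≤ P.weightSq X z / 4 := by
      rw [hZ2]
      calc C₂ * (2 * Cm * P.massSq z / h) * Δ
          ≤ C₂ * (2 * Cm * (2 * K * P.weightSq X z) / h) * (2 * δ / c₁ * h) := by gcongr
        _ = (32 * C₂ * Cm * K * δ) / c₁ * (P.weightSq X z / 4) := by field_simp; ring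
        _ ≤ 1 * (P.weightSq X z / 4) := by
            refine mul_le_mul_of_nonneg_right ?_ (by positivity)
            rw [div_le_one hc₁0]
            exact d4
        _ = _ := one_mul _
    have q3 : C₂ * k * (P.massSq z₀ + P.gradSq e₁ + h ^ 2 + r2) ≤ δ * h := by
      have b1 : P.massSq z₀ + P.gradSq e₁ + h ^ 2 + r2 ≤ (3 + 2 * K + Ct * K) * h := by
        have a1 := hh2
        have a2 : δ * h ≤ h := mul_le_of_le_one_left hh0.le d1
        have a3 : 2 * K * (δ * h) ≤ 2 * K * h := by gcongr
        linarith
      have b0 : 0 ≤ P.massSq z₀ + P.gradSq e₁ + h ^ 2 + r2 := by positivity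
      calc C₂ * k * (P.massSq z₀ + P.gradSq e₁ + h ^ 2 + r2)
          ≤ C₂ * (Ct * h) * ((3 + 2 * K + Ct * K) * h) := by gcongr
        _ = C₂ * Ct * (3 + 2 * K + Ct * K) * h * h := by ring
        _ ≤ δ * h := mul_le_mul_of_nonneg_right m6 hh0.le
    have q4 : C₂ * Δ ≤ 2 * C₂ / c₁ * (δ * h) := by
      calc C₂ * Δ ≤ C₂ * (2 * δ / c₁ * h) := by gcongr
        _ = _ := by ring
    have q5 : P.weightSq X z ≤ (4 + 4 * C₂ / c₁) * (δ * h) := by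
      have e1 : (4 + 4 * C₂ / c₁) * (δ * h) = 2 * (2 * (δ * h) + 2 * C₂ / c₁ * (δ * h)) := by ring
      have e2 : C₂ * k * (P.massSq z + P.massSq z₀ + P.gradSq e₁ + h ^ 2 + r2) =
          C₂ * k * P.massSq z + C₂ * k * (P.massSq z₀ + P.gradSq e₁ + h ^ 2 + r2) := by ring
      have e3 : C₂ * (1 + Z ^ 2) * Δ = C₂ * Δ + C₂ * Z ^ 2 * Δ := by ring
      rw [e2, e3] at q0
      rw [e1]
      linarith
    refine P.abs_le_one_of_massSq (u := z) hqu ?_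
    calc 2 * Cm * P.massSq z ≤ 2 * Cm * (2 * K * ((4 + 4 * C₂ / c₁) * (δ * h))) := by
          have := hN₁.trans (mul_le_mul_of_nonneg_left q5 (by positivity : 0 ≤ 2 * K))
          gcongr
      _ = (4 * Cm * K * (4 + 4 * C₂ / c₁) * δ) * h := by ring
      _ ≤ 1 * h := mul_le_mul_of_nonneg_right d5 hh0.le
      _ = h := one_mul h
  -- Second pass: with Z = 1 the velocity terms carry a fixed constant, independent of the mesh.
  have q0 := @est₂ 1 hz1
  set E₀ := Λ * P.gradSq e₀ + P.weightSq X₀ z₀ with hE₀def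
  set E₁ := Λ * P.gradSq e₁ + P.weightSq X z with hE₁def
  set b := k * P.massSq De + d / (2 * K) * (k * P.gradSq z) with hb
  have comb : E₁ + b ≤ E₀ + C₃ * k * (E₁ + E₀ + (h ^ 2 + r2)) := by
    have a1 := mul_le_mul_of_nonneg_left est₁ (by linarith : 0 ≤ Λ)
    have a2 : (2 * C₂ + 1) * Δ ≤ Λ * c₁ * Δ := mul_le_mul_of_nonneg_right hΛc hΔ0
    have a3 : k * P.massSq De ≤ Δ := le_add_of_nonneg_right (by positivity)
    have g0 : P.gradSq e₀ ≤ Λ * P.gradSq e₀ := le_mul_of_one_le_left nG₀ hΛ1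
    have g1 : P.gradSq e₁ ≤ Λ * P.gradSq e₁ := le_mul_of_one_le_left nG₁ hΛ1
    have f1 : P.massSq z + P.massSq z₀ + P.gradSq e₁ + h ^ 2 + r2 ≤
        (2 * K + 1) * (E₁ + E₀ + (h ^ 2 + r2)) := by
      have : 0 ≤ 2 * K * (Λ * P.gradSq e₁ + Λ * P.gradSq e₀ + (h ^ 2 + r2)) := by positivity
      have : 0 ≤ Λ * P.gradSq e₀ := by positivity
      rw [hE₀def, hE₁def]
      linarith
    have f2 : h ^ 2 + r2 + P.gradSq e₀ + P.massSq z₀ ≤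
        (2 * K + 1) * (E₁ + E₀ + (h ^ 2 + r2)) := by
      have : 0 ≤ 2 * K * (Λ * P.gradSq e₁ + P.weightSq X z + Λ * P.gradSq e₀ + (h ^ 2 + r2)) := by
        positivity
      have : 0 ≤ Λ * P.gradSq e₁ := by positivity
      rw [hE₀def, hE₁def]
      linarith
    have f3 : C₂ * k * (P.massSq z + P.massSq z₀ + P.gradSq e₁ + h ^ 2 + r2) ≤
        C₂ * k * ((2 * K + 1) * (E₁ + E₀ + (h ^ 2 + r2))) :=
      mul_le_mul_of_nonneg_left f1 (by positivity)
    have f4 : Λ * (C₁ * k * (h ^ 2 + r2 + P.gradSq e₀ + P.massSq z₀)) ≤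
        Λ * (C₁ * k * ((2 * K + 1) * (E₁ + E₀ + (h ^ 2 + r2)))) :=
      mul_le_mul_of_nonneg_left (mul_le_mul_of_nonneg_left f2 (by positivity)) (by linarith)
    have f5 : C₃ * k * (E₁ + E₀ + (h ^ 2 + r2)) =
        C₂ * k * ((2 * K + 1) * (E₁ + E₀ + (h ^ 2 + r2)))
        + Λ * (C₁ * k * ((2 * K + 1) * (E₁ + E₀ + (h ^ 2 + r2)))) := by
      rw [hC₃]; ring
    have q1 : P.weightSq X z + d / (2 * K) * (k * P.gradSq z) ≤ P.weightSq X₀ z₀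
        + C₂ * k * (P.massSq z + P.massSq z₀ + P.gradSq e₁ + h ^ 2 + r2) + 2 * C₂ * Δ := by
      have f6 : C₂ * (1 + 1 ^ 2) * Δ = 2 * C₂ * Δ := by ring
      rw [← f6]
      exact q0
    rw [f5]
    clear_value Δ r2
    have a1' : Λ * P.gradSq e₁ + Λ * c₁ * Δ ≤ Λ * P.gradSq e₀
        + Λ * (C₁ * k * (h ^ 2 + r2 + P.gradSq e₀ + P.massSq z₀)) := by linarith
    generalize C₂ * k * ((2 * K + 1) * (E₁ + E₀ + (h ^ 2 + r2))) = R₂ at f3 ⊢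
    generalize Λ * (C₁ * k * ((2 * K + 1) * (E₁ + E₀ + (h ^ 2 + r2)))) = R₁ at f4 ⊢
    rw [hE₀def, hE₁def, hb]
    clear f1 f2 f5 q0 est₁ est₂ hcurve hscalar
    linarith
  have hE₀0 : 0 ≤ E₀ := by positivity
  have hb0 : 0 ≤ b := by positivity
  have hy : 2 * (C₃ * k) ≤ 1 := by
    have : C₃ * k ≤ C₃ * (Ct * h) := by gcongr
    linarith
  have fin := absorb (by positivity : 0 ≤ C₃ * k) hy hE₀0 hb0 (by positivity : 0 ≤ h ^ 2 + r2) comb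
  have hmin : min 1 (d / (2 * K)) * (k * (P.massSq De + P.gradSq z)) ≤ b := by
    have i1 := mul_le_mul_of_nonneg_right (min_le_left 1 (d / (2 * K)))
      (by positivity : 0 ≤ k * P.massSq De)
    have i2 := mul_le_mul_of_nonneg_right (min_le_right 1 (d / (2 * K)))
      (by positivity : 0 ≤ k * P.gradSq z)
    rw [hb]
    linarith
  have hlast : 2 * (C₃ * k) * (h ^ 2 + r2) ≤ 4 * C₃ * k * (h ^ 2 + r2) := by
    have : 0 ≤ C₃ * k * (h ^ 2 + r2) := by positivity
    linarith
  have hmid : (1 + 4 * (C₃ * k)) * E₀ = (1 + 4 * C₃ * k) * E₀ := by ring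
  linarith

end OneStepEstimate

/-! ### From nodal errors to norms of the errors. -/

section Errors

variable {E : Type*} [NormedAddCommGroup E] [NormedSpace ℝ E] {ρ₀ : ℝ}
  {P : Partition ρ₀ (ρ₀ + 1)}

lemma Partition.period_integral_le (P : Partition ρ₀ (ρ₀ + 1)) {φ : ℝ → ℝ}
    (hp : Function.Periodic φ 1) (hφ : ∀ ρ, 0 ≤ φ ρ) {B : Fin P.count → ℝ}
    (h : ∀ j, ∀ ρ ∈ Ioo (P.left j) (P.right j), φ ρ ≤ B j) :
    ∫ ρ in (0 : ℝ)..1, φ ρ ≤ ∑ j, P.step j * B j := by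
  have h1 := hp.intervalIntegral_add_eq 0 ρ₀
  rw [zero_add] at h1
  rw [h1]
  exact P.integral_le_sum (by linarith) hφ h

lemma IsFE.hasDerivAt {χ : ℝ → E} (h : IsFE P χ) (j : Fin P.count) {ρ : ℝ}
    (hρ : ρ ∈ Ioo (P.left j) (P.right j)) : HasDerivAt χ (P.grad χ j) ρ := by
  have h1 : HasDerivAt (fun r => χ (P.left j) + (r - P.left j) • P.grad χ j) (P.grad χ j) ρ := by
    simpa using (((hasDerivAt_id ρ).sub_const (P.left j)).smul_const (P.grad χ j)).const_add
      (χ (P.left j))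
  refine h1.congr_of_eventuallyEq ?_
  filter_upwards [isOpen_Ioo.mem_nhds hρ] with r hr
  exact h.eq_localInterp j (Ioo_subset_Icc_self hr)

lemma IsFE.diffQuot {χ ψ : ℝ → E} (h : IsFE P χ) (k : IsFE P ψ) (c : ℝ) :
    IsFE P (diffQuot c χ ψ) := by
  refine ⟨(k.1.sub h.1).const_smul c⁻¹, periodic_diffQuot h.2.1 k.2.1, fun j => ?_⟩
  obtain ⟨a, b, hab⟩ := h.2.2 j
  obtain ⟨a', b', hab'⟩ := k.2.2 j
  refine ⟨c⁻¹ • (a' - a), c⁻¹ • (b' - b), fun ρ hρ => ?_⟩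
  rw [CurveRD.diffQuot, hab ρ hρ, hab' ρ hρ]
  module

/-- The `H¹` seminorm of an error in terms of its interpolant. -/
lemma seminormSq_sub_le {u χ : ℝ → E} (hu : Function.Periodic u 1)
    (hd : ∀ ρ, HasDerivAt u (deriv u ρ) ρ) (hχ : IsFE P χ) {A : ℝ}
    (hA : ∀ j, ∀ ρ ∈ Icc (P.left j) (P.right j), ‖P.grad u j - deriv u ρ‖ ≤ A) :
    seminormSq (fun ρ => u ρ - χ ρ) ≤ 2 * A ^ 2 + 2 * P.gradSq (fun ρ => u ρ - χ ρ) := by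
  have h1 : seminormSq (fun ρ => u ρ - χ ρ) ≤
      ∑ j, P.step j * (2 * A ^ 2 + 2 * ‖P.grad (fun ρ => u ρ - χ ρ) j‖ ^ 2) := by
    refine P.period_integral_le ?_ (fun ρ => by positivity) fun j ρ hρ => ?_
    · intro ρ
      have := periodic_deriv (u := fun ρ => u ρ - χ ρ) (hu.sub hχ.2.1) ρ
      simp only [this]
    · have e1 : deriv (fun ρ => u ρ - χ ρ) ρ =
          (deriv u ρ - P.grad u j) + P.grad (fun ρ => u ρ - χ ρ) j := by
        rw [((hd ρ).fun_sub (hχ.hasDerivAt j hρ)).deriv, P.grad_sub]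
        abel
      have e2 : ‖deriv (fun ρ => u ρ - χ ρ) ρ‖ ≤ A + ‖P.grad (fun ρ => u ρ - χ ρ) j‖ := by
        rw [e1]
        refine (norm_add_le _ _).trans (add_le_add ?_ le_rfl)
        rw [norm_sub_rev]
        exact hA j ρ (Ioo_subset_Icc_self hρ)
      have e3 := pow_le_pow_left₀ (norm_nonneg _) e2 2
      linarith [add_sq_le (a := A) (b := ‖P.grad (fun ρ => u ρ - χ ρ) j‖)]
  refine h1.trans_eq ?_
  have h2 := P.sum_step_one
  simp only [mul_add, Finset.sum_add_distrib, ← Finset.sum_mul, h2, Partition.gradSq,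
    Finset.mul_sum, one_mul]
  congr 1
  exact Finset.sum_congr rfl fun j _ => by ring

/-- The `L²` norm of an error in terms of nodal values. -/
lemma normSq_sub_le {u χ z : ℝ → E} (hu : Function.Periodic u 1) (hχ : IsFE P χ) {A : ℝ}
    (hA : ∀ j, ∀ ρ ∈ Ioo (P.left j) (P.right j), ‖u ρ - χ (P.left j)‖ ≤ A + ‖z (P.left j)‖ ∧
      ‖u ρ - χ (P.right j)‖ ≤ A + ‖z (P.right j)‖) :
    normSq (fun ρ => u ρ - χ ρ) ≤ 2 * A ^ 2 + 4 * P.massSq z := by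
  have h1 : normSq (fun ρ => u ρ - χ ρ) ≤
      ∑ j, P.step j * (2 * A ^ 2 + 2 * (‖z (P.left j)‖ ^ 2 + ‖z (P.right j)‖ ^ 2)) := by
    refine P.period_integral_le ?_ (fun ρ => by positivity) fun j ρ hρ => ?_
    · intro ρ
      simp only [hu ρ, hχ.2.1 ρ]
    · obtain ⟨a1, a2⟩ := hA j ρ hρ
      set θ := (ρ - P.left j) / P.step j with hθ
      have hs := P.step_pos j
      have hs' : P.step j = P.right j - P.left j := rfl
      have hθ0 : 0 ≤ θ := div_nonneg (by linarith [hρ.1]) hs.le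
      have hθ1 : θ ≤ 1 := (div_le_one hs).2 (by linarith [hρ.2])
      -- Inside an element χ is a convex combination of its end values, so the error is at most the
      -- larger of its distances to them.
      have e1 : u ρ - χ ρ = (1 - θ) • (u ρ - χ (P.left j)) + θ • (u ρ - χ (P.right j)) := by
        rw [hχ.eq_localInterp j (Ioo_subset_Icc_self hρ), Partition.localInterp, Partition.grad,
          smul_smul, ← div_eq_mul_inv, ← hθ]
        module
      have e2 : ‖u ρ - χ ρ‖ ≤ max (A + ‖z (P.left j)‖) (A + ‖z (P.right j)‖) := by
        rw [e1]
        refine (norm_add_le _ _).trans ?_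
        rw [norm_smul, norm_smul, Real.norm_of_nonneg hθ0, Real.norm_of_nonneg (sub_nonneg.2 hθ1)]
        have i1 := mul_le_mul_of_nonneg_left (a1.trans (le_max_left _ (A + ‖z (P.right j)‖)))
          (sub_nonneg.2 hθ1)
        have i2 := mul_le_mul_of_nonneg_left (a2.trans (le_max_right (A + ‖z (P.left j)‖) _)) hθ0
        linarith
      have aux : ∀ y : ℝ, ‖u ρ - χ ρ‖ ≤ A + y → ‖u ρ - χ ρ‖ ^ 2 ≤ 2 * A ^ 2 + 2 * y ^ 2 :=
        fun y hy => by
          have e3 := pow_le_pow_left₀ (norm_nonneg _) hy 2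
          linarith [add_sq_le (a := A) (b := y)]
      rcases le_max_iff.1 e2 with e3 | e3
      · have := aux _ e3
        have := sq_nonneg ‖z (P.right j)‖
        linarith
      · have := aux _ e3
        have := sq_nonneg ‖z (P.left j)‖
        linarith
  refine h1.trans_eq ?_
  have h2 := P.sum_step_one
  simp only [Partition.massSq, Finset.mul_sum]
  have h3 : 2 * A ^ 2 = ∑ j, P.step j * (2 * A ^ 2) := by rw [← Finset.sum_mul, h2, one_mul]
  rw [h3, ← Finset.sum_add_distrib]
  exact Finset.sum_congr rfl fun j _ => by rw [← h3]; ring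

end Errors

/-- Dependent choice along a finite sequence. -/
lemma exists_chain {σ : Type*} {N : ℕ} {A : Fin (N + 1) → σ → Prop} {R : Fin N → σ → σ → Prop}
    {a : σ} (h0 : A 0 a) (hstep : ∀ n s, A n.castSucc s → ∃ s', A n.succ s' ∧ R n s s') :
    ∃ u : Fin (N + 1) → σ, u 0 = a ∧ (∀ n, A n (u n)) ∧ ∀ n, R n (u n.castSucc) (u n.succ) := by
  choose! F hF using hstep
  let u : Fin (N + 1) → σ := fun n => Fin.induction (motive := fun _ => σ) a (fun n s => F n s) n
  have hA : ∀ n, A n (u n) := fun n => by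
    induction n using Fin.induction with
    | zero => exact h0
    | succ n ih =>
      have := (hF n _ ih).1
      simpa only [u, Fin.induction_succ] using this
  refine ⟨u, rfl, hA, fun n => ?_⟩
  have := (hF n _ (hA n.castSucc)).2
  simpa only [u, Fin.induction_succ] using this

/-- One step of the Gronwall argument. -/
lemma gronwall_step {C s t e₀ e₁ D c b φ₀ φ₁ : ℝ} (hC : 0 ≤ C) (hs : 0 ≤ s) (hst : s ≤ t)
    (he : 0 ≤ e₀) (hc : 0 ≤ c * D) (h₀ : e₀ + c * D ≤ Real.exp (C * s) * φ₀) (hφ : φ₀ ≤ φ₁)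
    (h₁ : e₁ + c * b ≤ (1 + C * (t - s)) * e₀ + (φ₁ - φ₀)) :
    e₁ + c * (D + b) ≤ Real.exp (C * t) * φ₁ := by
  have hk : 0 ≤ C * (t - s) := mul_nonneg hC (sub_nonneg.2 hst)
  have a1 : 1 + C * (t - s) ≤ Real.exp (C * (t - s)) := by
    linarith [Real.add_one_le_exp (C * (t - s))]
  have a2 : Real.exp (C * t) = Real.exp (C * (t - s)) * Real.exp (C * s) := by
    rw [← Real.exp_add]; congr 1; ring
  have a3 : 1 ≤ Real.exp (C * t) := Real.one_le_exp (mul_nonneg hC (hs.trans hst))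
  have a4 : (1 + C * (t - s)) * (e₀ + c * D) ≤ Real.exp (C * t) * φ₀ := by
    rw [a2, mul_assoc]
    exact mul_le_mul a1 h₀ (add_nonneg he hc) (Real.exp_pos _).le
  have a5 := le_mul_of_one_le_left (sub_nonneg.2 hφ) a3
  have a6 := mul_nonneg hk hc
  linarith

/-! ### Induction over the time steps. -/

section Convergence

variable {T α d K : ℝ} {f : ℝ → ℝ} {g : ℝ → ℝ → ℝ} {x : ℝ → ℝ → Plane} {w : ℝ → ℝ → ℝ}
  {G : ℝ → ℝ}

/-- Every time step is uniquely solvable on sufficiently fine meshes, and the discrete error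
energies are of second order in the mesh size. -/
lemma exists_discrete_solution (hT : 0 < T) (hR : Reg T α d f g x w K G)
    (hα : α ∈ Ioc (0 : ℝ) 1) (hd : 0 < d)
    (hf : ContDiff ℝ 1 f) (hg : ContDiff ℝ 1 (fun p : ℝ × ℝ => g p.1 p.2))
    (hg_lip : ∀ L > 0, ∃ CL ≥ 0, ∀ v₁ v₂ z : ℝ, |z| ≤ L → |g v₁ z - g v₂ z| ≤ CL * |v₁ - v₂|)
    {Ct Cm : ℝ} (hCt : 0 ≤ Ct) (hCm : 0 < Cm) :
    ∃ hs > (0 : ℝ), ∃ B ≥ (0 : ℝ), ∀ {ρ₀ : ℝ} (P : Partition ρ₀ (ρ₀ + 1)) (S : Partition 0 T),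
      (∀ j, P.maxStep ≤ Cm * P.step j) → P.maxStep ≤ hs → S.maxStep ≤ Ct * P.maxStep →
      ∃ (X : Fin (S.count + 1) → ℝ → Plane) (W : Fin (S.count + 1) → ℝ → ℝ),
        IsDiscreteSolution P S α d f g (x 0) (w 0) X W ∧
        (∀ n : Fin S.count,
          (∀ Y : ℝ → Plane, IsFE P Y →
            CurveStep P α f (S.step n) (X n.castSucc) (W n.castSucc) Y → Y = X n.succ) ∧
          (∀ Z : ℝ → ℝ, IsFE P Z →
            ScalarStep P d g (S.step n) (X n.castSucc) (X n.succ) (W n.castSucc) Z →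
              Z = W n.succ)) ∧
        (∀ n j, (2 * K)⁻¹ ≤ ‖P.grad (X n) j‖) ∧
        (∀ n, P.gradSq (fun r => x (S.node n) r - X n r)
          + P.weightSq (X n) (fun r => w (S.node n) r - W n r) ≤ B * P.maxStep ^ 2) ∧
        ∑ n : Fin S.count, S.step n *
          (P.massSq (diffQuot (S.step n) (fun r => x (S.node n.castSucc) r - X n.castSucc r)
              fun r => x (S.node n.succ) r - X n.succ r)
            + P.gradSq (fun r => w (S.node n.succ) r - W n.succ r)) ≤ B * P.maxStep ^ 2 := by
  have hK := hR.K_pos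
  obtain ⟨Λ, hΛ, c, hc, C, hC, δ, hδ, hs, hs0, hone⟩ :=
    exists_one_step hR hα hd hf hg hg_lip hCt hCm
  set B := Real.exp (C * T) * (C * (T + Ct ^ 2 * K)) with hB
  have hB0 : 0 ≤ B := by positivity
  -- The second restriction gives B h² ≤ δ h: the bound from Gronwall reproduces the smallness
  -- hypothesis of the next step.
  refine ⟨min hs (δ / (B + 1)), lt_min hs0 (by positivity), B + B / c, by positivity, ?_⟩
  intro ρ₀ P S hqu hmesh htime
  obtain ⟨hnd, hstep⟩ := hone P hqu (hmesh.trans (min_le_left _ _))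
  set h := P.maxStep with hh
  have hh0 : 0 < h := P.maxStep_pos
  have hBh : B * h ^ 2 ≤ δ * h := by
    have h1 : h * (B + 1) ≤ δ := (le_div_iff₀ (by linarith)).1 (hmesh.trans (min_le_right _ _))
    have h2 := mul_le_mul_of_nonneg_right h1 hh0.le
    have h3 : h * (B + 1) * h = B * h ^ 2 + h ^ 2 := by ring
    linarith [sq_nonneg h]
  obtain ⟨X₀, hX₀⟩ := exists_isInterp P (hR.x_per 0)
  obtain ⟨W₀, hW₀⟩ := exists_isInterp P (hR.w_per 0)
  let en : ℝ → (ℝ → Plane) → (ℝ → ℝ) → ℝ := fun t X W =>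
    Λ * P.gradSq (fun r => x t r - X r) + P.weightSq X (fun r => w t r - W r)
  have hen : ∀ t X W, 0 ≤ en t X W := fun t X W => by
    have := P.gradSq_nonneg (fun r => x t r - X r)
    have := P.weightSq_nonneg X (fun r => w t r - W r)
    positivity
  -- The consistency error accumulated up to time t, in space and in time; the second part uses Δt ≤
  -- Ct h.
  let φ : ℝ → ℝ := fun t => C * (t * h ^ 2 + (Ct * h) ^ 2 * (G t - G 0))
  have hφT : ∀ t ∈ Icc 0 T, Real.exp (C * t) * φ t ≤ B * h ^ 2 := fun t ht => by
    have g0 : 0 ≤ G t - G 0 := sub_nonneg.2 (hR.mono ht.1)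
    have g1 : G t - G 0 ≤ K := by linarith [hR.mono ht.2, hR.G_le]
    have ht0 := ht.1
    have e1 : φ t ≤ C * (T * h ^ 2 + (Ct * h) ^ 2 * K) := by
      have := ht.2
      simp only [φ]
      gcongr
    have e2 : Real.exp (C * t) ≤ Real.exp (C * T) :=
      Real.exp_le_exp.2 (mul_le_mul_of_nonneg_left ht.2 hC)
    calc Real.exp (C * t) * φ t ≤ Real.exp (C * T) * (C * (T * h ^ 2 + (Ct * h) ^ 2 * K)) := by
          have : 0 ≤ φ t := by positivity
          gcongr
      _ = B * h ^ 2 := by rw [hB]; ring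
  -- The state consists of curve, scalar and the dissipation summed so far, so that one Gronwall
  -- argument bounds both the energy and the sum over the time steps.
  let A : Fin (S.count + 1) → (ℝ → Plane) × (ℝ → ℝ) × ℝ → Prop := fun n u =>
    IsFE P u.1 ∧ IsFE P u.2.1 ∧ 0 ≤ u.2.2 ∧
      en (S.node n) u.1 u.2.1 + c * u.2.2 ≤ Real.exp (C * S.node n) * φ (S.node n)
  let dis : Fin S.count → (ℝ → Plane) → (ℝ → Plane) → (ℝ → ℝ) → ℝ := fun n X Y V =>
    S.step n * (P.massSq (diffQuot (S.step n) (fun r => x (S.node n.castSucc) r - X r)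
      fun r => x (S.node n.succ) r - Y r) + P.gradSq (fun r => w (S.node n.succ) r - V r))
  let R : Fin S.count → (ℝ → Plane) × (ℝ → ℝ) × ℝ → (ℝ → Plane) × (ℝ → ℝ) × ℝ → Prop :=
    fun n u v => CurveStep P α f (S.step n) u.1 u.2.1 v.1 ∧
      (∀ Y, IsFE P Y → CurveStep P α f (S.step n) u.1 u.2.1 Y → Y = v.1) ∧
      ScalarStep P d g (S.step n) u.1 v.1 u.2.1 v.2.1 ∧
      (∀ Y, IsFE P Y → ScalarStep P d g (S.step n) u.1 v.1 u.2.1 Y → Y = v.2.1) ∧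
      v.2.2 - u.2.2 = dis n u.1 v.1 v.2.1
  have hA0 : A 0 (X₀, W₀, 0) := by
    refine ⟨hX₀.1, hW₀.1, le_rfl, ?_⟩
    -- The initial data are interpolated, so the nodal errors vanish at the start.
    have e1 : en (S.node 0) X₀ W₀ = 0 := by
      have i1 := P.gradSq_eq_zero_of_nodes (u := fun r => x (S.node 0) r - X₀ r) fun i => by
        rw [S.first, hX₀.2, sub_self]
      have i2 : P.weightSq X₀ (fun r => w (S.node 0) r - W₀ r) = 0 := by
        rw [Partition.weightSq, Partition.nodalSum]
        refine Finset.sum_eq_zero fun j _ => ?_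
        simp only [S.first, hW₀.left, hW₀.right]
        ring
      simp only [en, i1, i2]
      ring
    rw [e1, S.first]
    simp [φ]
  have hAE : ∀ n u, A n u → en (S.node n) u.1 u.2.1 + c * u.2.2 ≤ B * h ^ 2 := fun n u hu =>
    hu.2.2.2.trans (hφT _ (S.node_mem n))
  have hAδ : ∀ n u, A n u → en (S.node n) u.1 u.2.1 ≤ δ * h := fun n u hu => by
    have h1 := hAE n u hu
    have h2 : 0 ≤ c * u.2.2 := mul_nonneg hc.le hu.2.2.1
    linarith
  have hchain : ∀ n u, A n.castSucc u → ∃ v, A n.succ v ∧ R n u v := by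
    rintro n ⟨X, W, D⟩ hu
    have hsmall := hAδ _ _ hu
    obtain ⟨hXfe, hWfe, hD, hE⟩ := hu
    have hlt : S.node n.castSucc < S.node n.succ := S.left_lt_right n
    have hs0 := S.node_mem n.castSucc
    have hk : S.node n.succ - S.node n.castSucc ≤ Ct * h := (S.step_le_maxStep n).trans htime
    obtain ⟨Y, V, ⟨hY, hYs, hYu⟩, ⟨hV, hVs, hVu⟩, est⟩ := hstep hs0
      ⟨hs0.1.trans_lt hlt, (S.node_mem n.succ).2⟩ hlt hk hXfe hWfe hsmall
    refine ⟨(Y, V, D + dis n X Y V), ⟨hY, hV, ?_, ?_⟩, hYs, hYu, hVs, hVu, by simp⟩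
    · have := S.step_pos n
      have := P.massSq_nonneg (diffQuot (S.step n) (fun r => x (S.node n.castSucc) r - X r)
        fun r => x (S.node n.succ) r - Y r)
      have := P.gradSq_nonneg (fun r => w (S.node n.succ) r - V r)
      simp only [dis]
      positivity
    · have hg0 : 0 ≤ G (S.node n.succ) - G (S.node n.castSucc) := sub_nonneg.2 (hR.mono hlt.le)
      have hk0 : 0 ≤ S.node n.succ - S.node n.castSucc := sub_nonneg.2 hlt.le
      have hrate : C * (S.node n.succ - S.node n.castSucc) * (h ^ 2
          + (S.node n.succ - S.node n.castSucc) * (G (S.node n.succ) - G (S.node n.castSucc))) ≤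
          φ (S.node n.succ) - φ (S.node n.castSucc) := by
        have e1 : (S.node n.succ - S.node n.castSucc) ^ 2 ≤ (Ct * h) ^ 2 :=
          pow_le_pow_left₀ hk0 hk 2
        have e2 := mul_le_mul_of_nonneg_left (mul_le_mul_of_nonneg_right e1 hg0) hC
        simp only [φ]
        linarith
      have hφ0 : φ (S.node n.castSucc) ≤ φ (S.node n.succ) := by
        have : 0 ≤ C * (S.node n.succ - S.node n.castSucc) * (h ^ 2
          + (S.node n.succ - S.node n.castSucc) * (G (S.node n.succ) - G (S.node n.castSucc))) := by
          positivity
        linarith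
      refine gronwall_step hC hs0.1 hlt.le (hen _ X W) (mul_nonneg hc.le hD) hE hφ0 ?_
      exact est.trans (add_le_add le_rfl hrate)
  obtain ⟨u, hu0, huA, huR⟩ := exists_chain hA0 hchain
  have hBc : B * h ^ 2 ≤ (B + B / c) * h ^ 2 := by
    have : 0 ≤ B / c * h ^ 2 := by positivity
    linarith
  refine ⟨fun n => (u n).1, fun n => (u n).2.1, ⟨fun n => (huA n).1, fun n => (huA n).2.1,
    by rw [hu0]; exact hX₀, by rw [hu0]; exact hW₀, fun n => (huR n).1, fun n => (huR n).2.2.1⟩,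
    fun n => ⟨(huR n).2.1, (huR n).2.2.2.1⟩,
    fun n => hnd _ (S.node_mem n) _ _ (hAδ n _ (huA n)), fun n => ?_, ?_⟩
  · have h1 := hAE n _ (huA n)
    have h2 := le_mul_of_one_le_left (P.gradSq_nonneg fun r => x (S.node n) r - (u n).1 r) hΛ
    have h3 : 0 ≤ c * (u n).2.2 := mul_nonneg hc.le (huA n).2.2.1
    simp only [en] at h1
    linarith
  · have h1 : ∑ n : Fin S.count, dis n (u n.castSucc).1 (u n.succ).1 (u n.succ).2.1 =
        (u (Fin.last _)).2.2 := by
      have e1 := sum_succ_sub_castSucc S.count (fun n => (u n).2.2)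
      rw [hu0, sub_zero] at e1
      rw [← e1]
      exact Finset.sum_congr rfl fun n _ => (huR n).2.2.2.2.symm
    have h2 := hAE _ _ (huA (Fin.last _))
    have h3 := hen (S.node (Fin.last _)) (u (Fin.last _)).1 (u (Fin.last _)).2.1
    have h4 : (u (Fin.last _)).2.2 ≤ B / c * h ^ 2 := by
      rw [div_mul_eq_mul_div, le_div_iff₀ hc]
      linarith
    have h5 : 0 ≤ B * h ^ 2 := by positivity
    refine h1.le.trans ?_
    linarith

/-- Uniqueness of the discrete solution follows from that of each of its steps. -/
lemma IsDiscreteSolution.unique {ρ₀ : ℝ} {P : Partition ρ₀ (ρ₀ + 1)} {S : Partition 0 T}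
    {x₀ : ℝ → Plane} {w₀ : ℝ → ℝ} {X X' : Fin (S.count + 1) → ℝ → Plane}
    {W W' : Fin (S.count + 1) → ℝ → ℝ} (h : IsDiscreteSolution P S α d f g x₀ w₀ X W)
    (h' : IsDiscreteSolution P S α d f g x₀ w₀ X' W')
    (hu : ∀ n : Fin S.count,
      (∀ Y : ℝ → Plane, IsFE P Y →
        CurveStep P α f (S.step n) (X n.castSucc) (W n.castSucc) Y → Y = X n.succ) ∧
      (∀ Z : ℝ → ℝ, IsFE P Z →
        ScalarStep P d g (S.step n) (X n.castSucc) (X n.succ) (W n.castSucc) Z →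
          Z = W n.succ)) : X' = X ∧ W' = W := by
  have key : ∀ n, X' n = X n ∧ W' n = W n := fun n => by
    induction n using Fin.induction with
    | zero =>
      exact ⟨(h'.fe_X 0).ext (h.fe_X 0) fun j => by rw [h'.init_X.right, h.init_X.right],
        (h'.fe_W 0).ext (h.fe_W 0) fun j => by rw [h'.init_W.right, h.init_W.right]⟩
    | succ n ih =>
      have h1 := h'.curve n
      have h2 := h'.scalar n
      rw [ih.1, ih.2] at h1 h2
      have h3 := (hu n).1 _ (h'.fe_X _) h1
      rw [h3] at h2
      exact ⟨h3, (hu n).2 _ (h'.fe_W _) h2⟩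
  exact ⟨funext fun n => (key n).1, funext fun n => (key n).2⟩

variable {ρ₀ : ℝ} {P : Partition ρ₀ (ρ₀ + 1)}

/-- Two first order terms are added to the nodal errors: the interpolation error of x_ρ and the
oscillation of w on an element. Nondegeneracy converts the weighted norm of z into the unweighted
one. -/
lemma Reg.position_error_le (hR : Reg T α d f g x w K G) {t : ℝ} (ht : t ∈ Icc 0 T)
    {X : ℝ → Plane} {W : ℝ → ℝ} (hX : IsFE P X) (hW : IsFE P W)
    (hnd : ∀ j, (2 * K)⁻¹ ≤ ‖P.grad X j‖) :
    seminormSq (fun ρ => x t ρ - X ρ) + normSq (fun ρ => w t ρ - W ρ) ≤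
      4 * (K * P.maxStep) ^ 2 + (2 + 8 * K) * (P.gradSq (fun r => x t r - X r)
        + P.weightSq X (fun r => w t r - W r)) := by
  have hK := hR.K_pos
  have h1 := seminormSq_sub_le (hR.x_per t) (hR.x_deriv t ht) hX
    fun j ρ hρ => hR.grad_x_sub_le P ht j hρ
  have h2 := normSq_sub_le (z := fun r => w t r - W r) (A := K * P.maxStep) (hR.w_per t) hW
    fun j ρ hρ => by
      have aux : ∀ σ ∈ Icc (P.left j) (P.right j),
          ‖w t ρ - W σ‖ ≤ K * P.maxStep + ‖w t σ - W σ‖ := fun σ hσ => by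
        have e1 : w t ρ - W σ = (w t ρ - w t σ) + (w t σ - W σ) := by ring
        rw [e1]
        refine (norm_add_le _ _).trans (add_le_add ?_ le_rfl)
        refine (hR.w_lip ht σ ρ).trans (mul_le_mul_of_nonneg_left ?_ hK.le)
        exact P.abs_sub_le_maxStep j (Ioo_subset_Icc_self hρ) hσ
      exact ⟨aux _ (P.left_mem_elem j), aux _ (P.right_mem_elem j)⟩
  have h3 := P.massSq_le_weightSq hK hnd (fun r => w t r - W r)
  have h4 := P.weightSq_nonneg X (fun r => w t r - W r)
  have h5 := mul_nonneg hK.le (P.gradSq_nonneg (fun r => x t r - X r))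
  linarith

lemma Reg.rate_error_le (hR : Reg T α d f g x w K G) {s t : ℝ} (hs : s ∈ Icc 0 T)
    (ht : t ∈ Ioc 0 T) (hst : s < t) {X₀ X : ℝ → Plane} {W : ℝ → ℝ} (hX₀ : IsFE P X₀)
    (hX : IsFE P X) (hW : IsFE P W) :
    normSq (fun ρ => timeDeriv T x t ρ - diffQuot (t - s) X₀ X ρ)
        + seminormSq (fun ρ => w t ρ - W ρ) ≤
      6 * (K * P.maxStep) ^ 2 + 4 * ((t - s) * (G t - G s))
        + 4 * (P.massSq (diffQuot (t - s) (fun r => x s r - X₀ r) fun r => x t r - X r)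
          + P.gradSq (fun r => w t r - W r)) := by
  have hK := hR.K_pos
  have ht' := Ioc_subset_Icc_self ht
  have h1 := seminormSq_sub_le (hR.w_per t) (hR.w_deriv t ht') hW
    fun j ρ hρ => hR.grad_w_sub_le P ht j hρ
  have hper : Function.Periodic (timeDeriv T x t) 1 := fun ρ => by
    simp only [timeDeriv, fun r => hR.x_per r ρ]
  have h2 := normSq_sub_le (z := diffQuot (t - s) (fun r => x s r - X₀ r) fun r => x t r - X r)
    (A := K * P.maxStep + √((t - s) * (G t - G s))) hper (hX₀.diffQuot hX (t - s))
    fun j ρ hρ => by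
      have aux : ∀ σ ∈ Icc (P.left j) (P.right j),
          ‖timeDeriv T x t ρ - diffQuot (t - s) X₀ X σ‖ ≤
            K * P.maxStep + √((t - s) * (G t - G s))
              + ‖diffQuot (t - s) (fun r => x s r - X₀ r) (fun r => x t r - X r) σ‖ :=
        fun σ hσ => by
          have e1 : timeDeriv T x t ρ - diffQuot (t - s) X₀ X σ =
              (timeDeriv T x t ρ - timeDeriv T x t σ)
              + (timeDeriv T x t σ - diffQuot (t - s) (x s) (x t) σ)
              + diffQuot (t - s) (fun r => x s r - X₀ r) (fun r => x t r - X r) σ := by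
            rw [diffQuot_sub]
            abel
          rw [e1]
          refine (norm_add_le _ _).trans (add_le_add ((norm_add_le _ _).trans
            (add_le_add ?_ (hR.xt_sub_le hs ht' hst σ))) le_rfl)
          refine (hR.xt_lip t ht' σ ρ).trans (mul_le_mul_of_nonneg_left ?_ hK.le)
          exact P.abs_sub_le_maxStep j (Ioo_subset_Icc_self hρ) hσ
      exact ⟨aux _ (P.left_mem_elem j), aux _ (P.right_mem_elem j)⟩
  have h3 := add_sq_le (a := K * P.maxStep) (b := √((t - s) * (G t - G s)))
  rw [hR.sq_sqrt_rate hst] at h3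
  have h4 := P.gradSq_nonneg (fun r => w t r - W r)
  linarith

/-- Each summand is a squared step length times an increment of G, and the increments telescope. The
time error is thus of second order in squares without a pointwise bound on second time derivatives.
-/
lemma Reg.sum_rate_le (hR : Reg T α d f g x w K G) (S : Partition 0 T) {τ : ℝ}
    (hτ : S.maxStep ≤ τ) :
    ∑ n : Fin S.count, S.step n * (S.step n * (G (S.node n.succ) - G (S.node n.castSucc))) ≤
      τ ^ 2 * K := by
  have h1 : ∑ n : Fin S.count, S.step n * (S.step n * (G (S.node n.succ) - G (S.node n.castSucc)))
      ≤ ∑ n : Fin S.count, τ ^ 2 * (G (S.right n) - G (S.left n)) :=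
    Finset.sum_le_sum fun n _ => by
      rw [← mul_assoc, ← sq]
      exact mul_le_mul_of_nonneg_right
        (pow_le_pow_left₀ (S.step_pos n).le ((S.step_le_maxStep n).trans hτ) 2)
        (sub_nonneg.2 (hR.mono (S.left_lt_right n).le))
  rw [← Finset.mul_sum, S.sum_telescope] at h1
  exact h1.trans (mul_le_mul_of_nonneg_left hR.G_le (sq_nonneg τ))

end Convergence

end CurveRD

end

/-! ### The convergence theorem. -/

open CurveRD in
theorem theorem2p1
    (T α d m M : ℝ) (hT : 0 < T) (hα : α ∈ Set.Ioc (0 : ℝ) 1) (hd : 0 < d) (hm : 0 < m)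
    (f : ℝ → ℝ) (g : ℝ → ℝ → ℝ)
    (hf : ContDiff ℝ 1 f) (hg : ContDiff ℝ 1 (fun p : ℝ × ℝ => g p.1 p.2))
    (hg_lip : ∀ L > 0, ∃ CL ≥ 0, ∀ v₁ v₂ z : ℝ, |z| ≤ L → |g v₁ z - g v₂ z| ≤ CL * |v₁ - v₂|)
    (x : ℝ → ℝ → Plane) (w : ℝ → ℝ → ℝ)
    (hx_per : ∀ t, Function.Periodic (x t) 1) (hw_per : ∀ t, Function.Periodic (w t) 1)
    -- `x` and `w` are the continuous representatives
    (hx_cont : ContinuousOn (fun q : ℝ × ℝ => x q.1 q.2) (Set.Icc 0 T ×ˢ Set.univ))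
    (hw_cont : ContinuousOn (fun q : ℝ × ℝ => w q.1 q.2) (Set.Icc 0 T ×ˢ Set.univ))
    -- regularity of `x`
    (hx₁ : MemWH T 1 ⊤ 2 x) (hx₂ : MemWH T 2 2 1 x) (hx₃ : MemWH T 2 ⊤ 0 x)
    -- regularity of `w`
    (hw₁ : MemCH T 2 w) (hw₂ : MemWH T 1 ⊤ 1 w) (hw₃ : MemWH T 2 2 0 w)
    -- non-degeneracy
    (hx_nondeg : ∀ t ∈ Set.Icc 0 T, ∀ ρ, m ≤ ‖deriv (x t) ρ‖ ∧ ‖deriv (x t) ρ‖ ≤ M)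
    -- the system
    (hx_eq : SolvesCurveEq T α f x w) (hw_eq : SolvesScalarEq T d g x w)
    -- the constants in `h ≤ C h_j` and `Δt ≤ C h`
    (Cmesh Ctime : ℝ) :
    ∃ hstar > 0, ∃ C : ℝ, ∀ (ρ₀ : ℝ) (P : Partition ρ₀ (ρ₀ + 1)) (S : Partition 0 T),
      (∀ j, P.maxStep ≤ Cmesh * P.step j) → P.maxStep ≤ hstar →
      S.maxStep ≤ Ctime * P.maxStep →
      ∃ (X : Fin (S.count + 1) → ℝ → Plane) (W : Fin (S.count + 1) → ℝ → ℝ),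
        IsDiscreteSolution P S α d f g (x 0) (w 0) X W ∧
        -- the sequence of discrete solutions is unique
        (∀ X' W', IsDiscreteSolution P S α d f g (x 0) (w 0) X' W' → X' = X ∧ W' = W) ∧
        -- each of the linear systems is uniquely solvable
        (∀ n : Fin S.count,
          (∀ Y : ℝ → Plane, IsFE P Y →
            CurveStep P α f (S.step n) (X n.castSucc) (W n.castSucc) Y → Y = X n.succ) ∧
          (∀ Z : ℝ → ℝ, IsFE P Z →
            ScalarStep P d g (S.step n) (X n.castSucc) (X n.succ) (W n.castSucc) Z →
              Z = W n.succ)) ∧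
        -- the discrete tangents and normals are well defined
        (∀ n j, P.grad (X n) j ≠ 0) ∧
        -- the error bound
        (⨆ n : Fin (S.count + 1),
            (seminormSq (fun ρ => x (S.node n) ρ - X n ρ)
              + normSq (fun ρ => w (S.node n) ρ - W n ρ)))
          + ∑ n : Fin S.count, S.step n *
              (normSq (fun ρ => timeDeriv T x (S.node n.succ) ρ
                  - diffQuot (S.step n) (X n.castSucc) (X n.succ) ρ)
                + seminormSq (fun ρ => w (S.node n.succ) ρ - W n.succ ρ))
          ≤ C * P.maxStep ^ 2 := by
  obtain ⟨K, G, hR⟩ := exists_reg T α d m M hT hd hm f g hf hg x w hx_per hw_per hx_cont hw_cont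
    hx₁ hx₂ hw₁ hw₂ hw₃ hx_nondeg hx_eq hw_eq
  have hK := hR.K_pos
  -- The given constants are arbitrary reals. Enlarging them to a nonnegative time constant and a
  -- positive mesh constant only weakens the restrictions on the partitions.
  set Ct := max Ctime 0 with hCt
  obtain ⟨hs, hs0, B, hB, H⟩ := exists_discrete_solution hT hR hα hd hf hg hg_lip
    (le_max_right Ctime 0) (lt_max_of_lt_right one_pos : 0 < max Cmesh 1)
  refine ⟨hs, hs0, (4 * K ^ 2 + (2 + 8 * K) * B) + (6 * K ^ 2 * T + 4 * (Ct ^ 2 * K) + 4 * B), ?_⟩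
  intro ρ₀ P S hqu hmesh htime
  have hh0 := P.maxStep_pos
  have htime' : S.maxStep ≤ Ct * P.maxStep :=
    htime.trans (mul_le_mul_of_nonneg_right (le_max_left _ _) hh0.le)
  obtain ⟨X, W, hsol, huniq, hnd, herr, hsum⟩ := H P S
    (fun j => (hqu j).trans (mul_le_mul_of_nonneg_right (le_max_left _ _) (P.step_pos j).le))
    hmesh htime'
  refine ⟨X, W, hsol, fun X' W' h' => hsol.unique h' huniq, huniq, fun n j h0 => ?_, ?_⟩
  · have := hnd n j
    rw [h0, norm_zero] at this
    exact absurd this (not_le.2 (by positivity))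
  -- The two parts of the constant belong to the supremum, through `Reg.position_error_le`, and to
  -- the sum over the time steps, through `Reg.rate_error_le`.
  rw [add_mul]
  refine add_le_add (ciSup_le fun n => ?_) ?_
  · refine (hR.position_error_le (S.node_mem n) (hsol.fe_X n) (hsol.fe_W n) (hnd n)).trans ?_
    have := mul_le_mul_of_nonneg_left (herr n) (by positivity : 0 ≤ 2 + 8 * K)
    linarith
  · have h1 : ∀ n : Fin S.count, S.step n *
        (normSq (fun ρ => timeDeriv T x (S.node n.succ) ρ
            - diffQuot (S.step n) (X n.castSucc) (X n.succ) ρ)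
          + seminormSq (fun ρ => w (S.node n.succ) ρ - W n.succ ρ)) ≤
        S.step n * (6 * (K * P.maxStep) ^ 2)
          + 4 * (S.step n * (S.step n * (G (S.node n.succ) - G (S.node n.castSucc))))
          + 4 * (S.step n * (P.massSq (diffQuot (S.step n)
              (fun r => x (S.node n.castSucc) r - X n.castSucc r)
              fun r => x (S.node n.succ) r - X n.succ r)
            + P.gradSq (fun r => w (S.node n.succ) r - W n.succ r))) := fun n => by
      have hlt : S.node n.castSucc < S.node n.succ := S.left_lt_right n
      have h2 := hR.rate_error_le (S.node_mem n.castSucc)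
        ⟨(S.node_mem n.castSucc).1.trans_lt hlt, (S.node_mem n.succ).2⟩ hlt
        (hsol.fe_X n.castSucc) (hsol.fe_X n.succ) (hsol.fe_W n.succ)
      refine (mul_le_mul_of_nonneg_left h2 (S.step_pos n).le).trans_eq ?_
      simp only [Partition.step, Partition.left, Partition.right]
      ring
    refine (Finset.sum_le_sum fun n _ => h1 n).trans ?_
    rw [Finset.sum_add_distrib, Finset.sum_add_distrib, ← Finset.sum_mul, ← Finset.mul_sum,
      ← Finset.mul_sum, S.sum_step]
    have h2 := hR.sum_rate_le S htime'
    linarith
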